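/- **Setting.** Consider special relativistic ideal magnetohydrodynamics (speed of light $1$) with density $\rho$, specific entropy $S$, specific internal energy $e(\rho,S)$, pressure $p=\rho^2\partial_\rho e$, enthalpy $h=1+e+p/\rho$, $a^2=p_\rho(\rho,S)$, $c_s^2=a^2/h$, velocity $v$, $\Gamma=(1-|v|^2)^{-1/2}$, $u=\Gamma v$, magnetic field $H$, $B^2=|H|^2/\Gamma^2+(v,H)^2$, $b=H/\Gamma+(u,H)v$, $q=p+\frac12B^2$. For a state $U=(p,u,H,S)$ let $A_0(U),\dots,A_3(U)$ be the symmetric matrices $$A_0=\begin{pmatrix}\frac{\Gamma}{\rho a^2}&v^{\sf T}&0&0\\ v&\mathcal A&0&0\\ 0&0&\mathcal M&0\\ 0&0&0&1\end{pmatrix},\qquad A_j=\begin{pmatrix}\frac{u_j}{\rho a^2}&e_j^{\sf T}&0&0\\ e_j&\mathcal A_j&\mathcal N_j^{\sf T}&0\\ 0&\mathcal N_j&v_j\mathcal M&0\\ 0&0&0&v_j\end{pmatrix},$$ where $\mathcal M=\frac1\Gamma(I+u\otimes u)$, $\mathcal N_j=\frac1\Gamma b\otimes e_j-\frac{v_j}{\Gamma}b\otimes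 v-\frac{H_j}{\Gamma^2}I$, $$\mathcal A=\Bigl(\rho h\Gamma+\tfrac{|H|^2}{\Gamma}\Bigr)I-\Bigl(\rho h\Gamma+\tfrac{|H|^2+B^2}{\Gamma}\Bigr)v\otimes v-\tfrac1\Gamma H\otimes H+\tfrac{(v,H)}{\Gamma}(v\otimes H+H\otimes v),$$ $$\mathcal A_j=v_j\Bigl\{\Bigl(\rho h\Gamma+\tfrac{|H|^2}{\Gamma}\Bigr)I-\Bigl(\rho h\Gamma+\tfrac{|H|^2-B^2}{\Gamma}\Bigr)v\otimes v-\tfrac1\Gamma H\otimes H\Bigr\}+\tfrac{H_j}{\Gamma}\Bigl\{\tfrac1{\Gamma^2}(v\otimes H+H\otimes v)-2(v,H)(I-v\otimes v)\Bigr\}$$ $$+\tfrac{(v,H)}{\Gamma}(H\otimes e_j+e_j\otimes H)-\tfrac{B^2}{\Gamma}(v\otimes e_j+e_j\otimes v);$$ for smooth solutions with ${\rm div}\,H=0$ the equations of motion are $A_0(U)\partial_tU+\sum_jA_j(U)\partial_jU=0$. Let $\widehat U^+$ (in $x^1>0$) and $\widehat U^-$ (in $x^1<0$) be constant states forming a planar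 current-vortex sheet with front $x^1=0$, that is, $\hat v_1^\pm=\widehat H_1^\pm=0$ and $\hat q^+=\hat q^-$. Assume that $e$ is smooth near both states and that $\rho>0$, $p_\rho>0$, $0<c_s^2<1$ at both of them. The linearized free-boundary problem for perturbations $(U^+,U^-,\varphi)$ of $(\widehat U^+,\widehat U^-,0)$ is $$A_0(\widehat U^\pm)\partial_tU^\pm+\sum_{j=1}^3A_j(\widehat U^\pm)\partial_jU^\pm=0\quad(\pm x^1>0),$$ $$\partial_t\varphi=v_1^\pm-\hat v_2^\pm\partial_2\varphi-\hat v_3^\pm\partial_3\varphi,\qquad [q]=0\quad(x^1=0),$$ with given initial data $(U_0^+,U_0^-,\varphi_0)$ satisfying the constraints ${\rm div}\,H_0^\pm=0$ in $\pm x^1>0$ and $H^\pm_{0,1}=\widehat H_2^\pm\partial_2\varphi_0+\widehat H_3^\pm\partial_3\varphi_0$ on $x^1=0$. Here $v_1^\pm=u_1^\pm/\widehat\Gamma^\pm$, $q^\pm=p^\pm+\frac1{\widehat\Gamma^\pm}\bigl((\hat b^\pm,H^\pm)+(\hat v^\pm,\widehat H^\pm)(\widehat H^\pm,u^\pm)-(\widehat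 B^\pm)^2(\hat v^\pm,u^\pm)\bigr)$ are the perturbations of $v_1$ and of the total pressure, and $[g]=g^+-g^-$. Let $v^{\|\pm}=(\hat v_2^\pm,\hat v_3^\pm)$, $H^{\|\pm}=(\widehat H_2^\pm,\widehat H_3^\pm)$, let $\varphi^\pm$ be the oriented angle from $[v^\|]$ to $H^{\|\pm}$ (from an arbitrary fixed direction if $[v^\|]=0$), and (all quantities taken at $\widehat U^\pm$) $$\gamma^\pm=\frac{|H^{\|\pm}|\,c_s^\pm\,(1-|v^\pm|^2)}{\sqrt{\rho^\pm(a^\pm)^2+(B^\pm)^2}+c_s^\pm|(v^\pm,H^\pm)|},$$ $$G(\widehat U^+,\widehat U^-)=|\sin(\varphi^+-\varphi^-)|\min\Bigl\{\frac{\gamma^+}{|\sin\varphi^-|},\frac{\gamma^-}{|\sin\varphi^+|}\Bigr\}-|[v^\|]|,$$ a quotient with denominator $0$ being read as $+\infty$. **Theorem.** Suppose that the tangential magnetic fields on the two sides are nonzero and nonparallel, $\widehat H_2^+\widehat H_3^--\widehat H_3^+\widehat H_2^-\ne0$, and that $G(\widehat U^+,\widehat U^-)>0$. Then the planar current-vortex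 sheet is linearly (neutrally) stable, that is: 1. The linearized problem is well posed in $L^2$. There is a constant $C>0$ depending only on $e$ and $\widehat U^\pm$, and for every $T>0$ a constant $C_T>0$, such that for all data $(U_0^+,U_0^-,\varphi_0)\in L^2(\mathbb R^3_+)\times L^2(\mathbb R^3_-)\times L^2(\mathbb R^2)$ satisfying the constraints (in the weak sense) there is exactly one weak solution $(U^+,U^-,\varphi)$ on $[0,T]$ in $C([0,T];L^2(\mathbb R^3_+)\times L^2(\mathbb R^3_-)\times L^2(\mathbb R^2))$, and for $0\le t\le T$ $$\|U^+(t)\|^2+\|U^-(t)\|^2\le C\bigl(\|U_0^+\|^2+\|U_0^-\|^2\bigr),\qquad\|\varphi(t)\|\le C_T\bigl(\|\varphi_0\|+\|U_0^+\|+\|U_0^-\|\bigr).$$ Weak solution means: for all smooth compactly supported $\Psi^\pm$ on $\mathbb R^3$ with $\Psi^+_{u_1}=\Psi^-_{u_1}$ on $x^1=0$, with $q^\pm(\Psi^\pm)$ the above functional applied to $\Psi^\pm$, $$\frac{d}{dt}\Bigl\{\sum_\pm\int_{\mathbb R^3_\pm}(A_0^\pm U^\pm,\Psi^\pm)\,dx-\int_{\mathbb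 R^2}\varphi\,[\widehat\Gamma q(\Psi)]\,dx'\Bigr\}=\sum_\pm\int_{\mathbb R^3_\pm}\Bigl(U^\pm,\sum_jA_j^\pm\partial_j\Psi^\pm\Bigr)dx-\int_{\mathbb R^2}\varphi\,\bigl[\widehat\Gamma(\hat v_2\partial_2+\hat v_3\partial_3)q(\Psi)\bigr]dx',$$ which is the linearized problem multiplied by $\Psi^\pm$ and integrated by parts in space. 2. The (weak) Kreiss–Lopatinski condition holds: the linearized problem has no nonzero solution of the form $e^{\tau t+i(k_2x^2+k_3x^3)}(V^+(x^1),V^-(x^1),\varphi)$ with ${\rm Re}\,\tau>0$, $(k_2,k_3)\in\mathbb R^2$ and $V^\pm$ square integrable on $\pm x^1>0$. -/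

import Mathlib

open MeasureTheory Matrix

namespace RMHD

noncomputable section

/-! ## States and the equation of state -/

/-- A state of the plasma: rest-mass density `rho`, specific entropy `S`, spatial part `u = Γ v` of
the 4-velocity, magnetic 3-vector `H`. The pressure is `p = p(rho, S)`; since `p_rho > 0` is imposed
below, `(rho, u, H, S)` and `(p, u, H, S)` are equivalent coordinates. -/
structure State where
  rho : ℝ
  S : ℝ
  u : Fin 3 → ℝ
  H : Fin 3 → ℝ

/-- The pressure `p(rho, S) = rho ^ 2 * ∂e/∂rho` of the fluid with specific internal energy
`e(rho, S)` (Gibbs relation). -/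
def pressure (e : ℝ → ℝ → ℝ) (rho S : ℝ) : ℝ := rho ^ 2 * deriv (fun r => e r S) rho

/-- `a² = p_rho(rho, S)`. -/
def aSq (e : ℝ → ℝ → ℝ) (U : State) : ℝ := deriv (fun r => pressure e r U.S) U.rho

/-- The relativistic specific enthalpy `h = 1 + e + p / rho`. -/
def enthalpy (e : ℝ → ℝ → ℝ) (U : State) : ℝ :=
  1 + e U.rho U.S + pressure e U.rho U.S / U.rho

/-- `c_s² = a² / h`. -/
def csSq (e : ℝ → ℝ → ℝ) (U : State) : ℝ := aSq e U / enthalpy e U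

/-- The equation of state is smooth near `U`, and `rho > 0`, `p_rho > 0`, `0 < c_s² < 1` at `U`. -/
structure Hyperbolic (e : ℝ → ℝ → ℝ) (U : State) : Prop where
  smooth : ContDiffAt ℝ (⊤ : ℕ∞) (fun r : ℝ × ℝ => e r.1 r.2) (U.rho, U.S)
  rho_pos : 0 < U.rho
  aSq_pos : 0 < aSq e U
  csSq_pos : 0 < csSq e U
  csSq_lt_one : csSq e U < 1

namespace State

/-- The Lorentz factor. -/
def Gam (U : State) : ℝ := Real.sqrt (1 + U.u ⬝ᵥ U.u)

/-- The 3-velocity `v = u / Γ`. -/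
def v (U : State) : Fin 3 → ℝ := fun i => U.u i / U.Gam

/-- `(v, H)`. -/
def vH (U : State) : ℝ := U.v ⬝ᵥ U.H

/-- `|H|²`. -/
def HSq (U : State) : ℝ := U.H ⬝ᵥ U.H

/-- `B² = |H|² / Γ² + (v, H)²`. -/
def BSq (U : State) : ℝ := U.HSq / U.Gam ^ 2 + U.vH ^ 2

/-- The spatial part `b = H / Γ + (u, H) v` of the magnetic 4-vector. -/
def b (U : State) : Fin 3 → ℝ := fun i => U.H i / U.Gam + (U.u ⬝ᵥ U.H) * U.v i

/-- The tangential velocity `(v₂, v₃)` as a complex number. -/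
def vTan (U : State) : ℂ := ⟨U.v 1, U.v 2⟩

/-- The tangential magnetic field `(H₂, H₃)` as a complex number. -/
def HTan (U : State) : ℂ := ⟨U.H 1, U.H 2⟩

end State

/-- The total pressure `q = p + B² / 2`. -/
def totalPressure (e : ℝ → ℝ → ℝ) (U : State) : ℝ := pressure e U.rho U.S + U.BSq / 2

/-- The constant states `Up` (in `x¹ > 0`) and `Um` (in `x¹ < 0`) form a planar current-vortex sheet
with front `x¹ = 0`. Coordinates `1, 2, 3` are numbered `0, 1, 2`. -/
structure IsCurrentVortexSheet (e : ℝ → ℝ → ℝ) (Up Um : State) : Prop where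
  u_p : Up.u 0 = 0
  u_m : Um.u 0 = 0
  H_p : Up.H 0 = 0
  H_m : Um.H 0 = 0
  q_eq : totalPressure e Up = totalPressure e Um

/-! ## The stability condition `G(U⁺, U⁻) > 0` -/

/-- `γ = |H∥| c_s (1 - |v|²) / (√(rho a² + B²) + c_s |(v, H)|)`. -/
def gam (e : ℝ → ℝ → ℝ) (U : State) : ℝ :=
  ‖U.HTan‖ * Real.sqrt (csSq e U) * (1 - U.v ⬝ᵥ U.v) /
    (Real.sqrt (U.rho * aSq e U + U.BSq) + Real.sqrt (csSq e U) * |U.vH|)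

/-- The jump `[v∥]` of the tangential velocity. -/
def vJump (Up Um : State) : ℂ := Up.vTan - Um.vTan

/-- The oriented angle `φ` from the jump `[v∥]` to the tangential magnetic field `w` (if `[v∥] = 0`,
the angle from a fixed direction). -/
def angleTo (Up Um : State) (w : ℂ) : ℝ := w.arg - (vJump Up Um).arg

/-- `G = |sin (φ⁺ - φ⁻)| min {γ⁺ / |sin φ⁻|, γ⁻ / |sin φ⁺|} - |[v∥]|`, where a quotient with
denominator `0` counts as `+∞` (both denominators vanish only for parallel magnetic fields). -/
def G (e : ℝ → ℝ → ℝ) (Up Um : State) : ℝ :=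
  |Real.sin (angleTo Up Um Up.HTan - angleTo Up Um Um.HTan)| *
    (min
      (ENNReal.ofReal (gam e Up) / ENNReal.ofReal |Real.sin (angleTo Up Um Um.HTan)|)
      (ENNReal.ofReal (gam e Um) / ENNReal.ofReal |Real.sin (angleTo Up Um Up.HTan)|)).toReal
    - ‖vJump Up Um‖

/-! ## The symmetric matrices of the linearized equations -/

/-- Indices of the eight components of a perturbation `(p, u, H, S)`. -/
abbrev Idx := Unit ⊕ (Fin 3 ⊕ (Fin 3 ⊕ Unit))

def iP : Idx := Sum.inl ()
def iU (k : Fin 3) : Idx := Sum.inr (Sum.inl k)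
def iH (k : Fin 3) : Idx := Sum.inr (Sum.inr (Sum.inl k))
def iS : Idx := Sum.inr (Sum.inr (Sum.inr ()))

/-- The symmetric block matrix with rows `(s, rᵀ, 0, 0)`, `(r, X, Yᵀ, 0)`, `(0, Y, Z, 0)`,
`(0, 0, 0, w)`. -/
def block (s : ℝ) (r : Fin 3 → ℝ) (X Y Z : Matrix (Fin 3) (Fin 3) ℝ) (w : ℝ) :
    Matrix Idx Idx ℝ := fun i j =>
  match i, j with
  | .inl _, .inl _ => s
  | .inl _, .inr (.inl l) => r l
  | .inr (.inl k), .inl _ => r k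
  | .inr (.inl k), .inr (.inl l) => X k l
  | .inr (.inl k), .inr (.inr (.inl l)) => Y l k
  | .inr (.inr (.inl k)), .inr (.inl l) => Y k l
  | .inr (.inr (.inl k)), .inr (.inr (.inl l)) => Z k l
  | .inr (.inr (.inr _)), .inr (.inr (.inr _)) => w
  | _, _ => 0

/-- The unit column `e_j`. -/
def ej (j : Fin 3) : Fin 3 → ℝ := Pi.single j 1

/-- `M = (I + u ⊗ u) / Γ`. -/
def calM (U : State) : Matrix (Fin 3) (Fin 3) ℝ := (1 / U.Gam) • (1 + vecMulVec U.u U.u)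

/-- `N_j = b ⊗ e_j / Γ - (v_j / Γ) b ⊗ v - (H_j / Γ²) I`. -/
def calN (U : State) (j : Fin 3) : Matrix (Fin 3) (Fin 3) ℝ :=
  (1 / U.Gam) • vecMulVec U.b (ej j) - (U.v j / U.Gam) • vecMulVec U.b U.v
    - (U.H j / U.Gam ^ 2) • (1 : Matrix (Fin 3) (Fin 3) ℝ)

/-- The velocity block of `A₀`. -/
def calA (e : ℝ → ℝ → ℝ) (U : State) : Matrix (Fin 3) (Fin 3) ℝ :=
  (U.rho * enthalpy e U * U.Gam + U.HSq / U.Gam) • (1 : Matrix (Fin 3) (Fin 3) ℝ)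
    - (U.rho * enthalpy e U * U.Gam + (U.HSq + U.BSq) / U.Gam) • vecMulVec U.v U.v
    - (1 / U.Gam) • vecMulVec U.H U.H
    + (U.vH / U.Gam) • (vecMulVec U.v U.H + vecMulVec U.H U.v)

/-- The velocity block of `A_j`. -/
def calAj (e : ℝ → ℝ → ℝ) (U : State) (j : Fin 3) : Matrix (Fin 3) (Fin 3) ℝ :=
  U.v j • ((U.rho * enthalpy e U * U.Gam + U.HSq / U.Gam) • (1 : Matrix (Fin 3) (Fin 3) ℝ)
      - (U.rho * enthalpy e U * U.Gam + (U.HSq - U.BSq) / U.Gam) • vecMulVec U.v U.v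
      - (1 / U.Gam) • vecMulVec U.H U.H)
    + (U.H j / U.Gam) • ((1 / U.Gam ^ 2) • (vecMulVec U.v U.H + vecMulVec U.H U.v)
      - (2 * U.vH) • (1 - vecMulVec U.v U.v))
    + (U.vH / U.Gam) • (vecMulVec U.H (ej j) + vecMulVec (ej j) U.H)
    - (U.BSq / U.Gam) • (vecMulVec U.v (ej j) + vecMulVec (ej j) U.v)

/-- The matrix `A₀(U)`. -/
def A0 (e : ℝ → ℝ → ℝ) (U : State) : Matrix Idx Idx ℝ :=
  block (U.Gam / (U.rho * aSq e U)) U.v (calA e U) 0 (calM U) 1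

/-- The matrices `A_j(U)`. -/
def A (e : ℝ → ℝ → ℝ) (U : State) (j : Fin 3) : Matrix Idx Idx ℝ :=
  block (U.u j / (U.rho * aSq e U)) (ej j) (calAj e U j) (calN U j) (U.v j • calM U) (U.v j)

/-- The coefficients of the perturbation of the total pressure at the state `U`:
`q = p + ((b, δH) + (v, H) (H, δu) - B² (v, δu)) / Γ`. -/
def qVec (U : State) : Idx → ℝ
  | .inl _ => 1
  | .inr (.inl k) => (U.vH * U.H k - U.BSq * U.v k) / U.Gam
  | .inr (.inr (.inl k)) => U.b k / U.Gam
  | .inr (.inr (.inr _)) => 0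

/-- At a state with `u₁ = H₁ = 0` the boundary form is
`(A₁ X, Y) = q(X) Y_{u₁} + X_{u₁} q(Y)`. -/
theorem boundary_form (e : ℝ → ℝ → ℝ) (U : State) (hu : U.u 0 = 0) (hH : U.H 0 = 0)
    (X Y : Idx → ℝ) :
    (A e U 0 *ᵥ X) ⬝ᵥ Y = (qVec U ⬝ᵥ X) * Y (iU 0) + X (iU 0) * (qVec U ⬝ᵥ Y) := by
  have hv : U.v 0 = 0 := by simp [State.v, hu]
  have hb : U.b 0 = 0 := by simp [State.b, hH, hv]
  simp [dotProduct, mulVec, A, block, calAj, calN, calM, ej, qVec, iU, Fin.sum_univ_three,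
    vecMulVec_apply, hu, hH, hv, hb, Matrix.one_apply]
  ring

/-! ## The linearized problem in `L²` -/

/-- Physical space. -/
abbrev Space := Fin 3 → ℝ

/-- `{x¹ > 0}`. -/
def Rpos : Set Space := {x | 0 < x 0}

/-- `{x¹ < 0}`. -/
def Rneg : Set Space := {x | x 0 < 0}

/-- The boundary point `(0, x')`. -/
def bd (y : Fin 2 → ℝ) : Space := ![0, y 0, y 1]

/-- Square integrable perturbations `(p, u, H, S)` in the domain `D`. -/
abbrev L2 (D : Set Space) := Lp (EuclideanSpace ℝ Idx) 2 ((volume : Measure Space).restrict D)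

/-- Square integrable front perturbations. -/
abbrev L2Front := Lp ℝ 2 (volume : Measure (Fin 2 → ℝ))

/-- The pairing `∫_D (f, Ψ) dx`. -/
def pair {D : Set Space} (f : L2 D) (Ψ : Space → Idx → ℝ) : ℝ :=
  ∫ x in D, WithLp.ofLp (f x) ⬝ᵥ Ψ x

/-- The partial derivative `∂_j`. -/
def pd {E : Type*} [NormedAddCommGroup E] [NormedSpace ℝ E] (j : Fin 3) (g : Space → E)
    (x : Space) : E := fderiv ℝ g x (Pi.single j 1)

/-- `∑_j A_j ∂_j Ψ`. -/
def spatialOp (e : ℝ → ℝ → ℝ) (U : State) (Ψ : Space → Idx → ℝ) : Space → Idx → ℝ :=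
  fun x => ∑ j, A e U j *ᵥ pd j Ψ x

/-- Test functions: restrictions to the closed half-spaces of smooth compactly supported functions
with `Ψ⁺_{u₁} = Ψ⁻_{u₁}` on `x¹ = 0`. -/
structure IsTest (Ψp Ψm : Space → Idx → ℝ) : Prop where
  smooth_p : ContDiff ℝ (⊤ : ℕ∞) Ψp
  smooth_m : ContDiff ℝ (⊤ : ℕ∞) Ψm
  supp_p : HasCompactSupport Ψp
  supp_m : HasCompactSupport Ψm
  match_bd : ∀ y, Ψp (bd y) (iU 0) = Ψm (bd y) (iU 0)

/-- `∫ (A₀⁺ U⁺, Ψ⁺) + ∫ (A₀⁻ U⁻, Ψ⁻) - ∫ φ [Γ q(Ψ)] dx'`. -/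
def momentum (e : ℝ → ℝ → ℝ) (Bp Bm : State) (Ψp Ψm : Space → Idx → ℝ)
    (Up : L2 Rpos) (Um : L2 Rneg) (φ : L2Front) : ℝ :=
  pair Up (fun x => A0 e Bp *ᵥ Ψp x) + pair Um (fun x => A0 e Bm *ᵥ Ψm x)
    - ∫ y, φ y * (Bp.Gam * (qVec Bp ⬝ᵥ Ψp (bd y)) - Bm.Gam * (qVec Bm ⬝ᵥ Ψm (bd y)))

/-- `∫ (U⁺, ∑ A_j⁺ ∂_j Ψ⁺) + ∫ (U⁻, ∑ A_j⁻ ∂_j Ψ⁻) - ∫ φ [Γ (v₂ ∂₂ + v₃ ∂₃) q(Ψ)] dx'`. -/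
def flux (e : ℝ → ℝ → ℝ) (Bp Bm : State) (Ψp Ψm : Space → Idx → ℝ)
    (Up : L2 Rpos) (Um : L2 Rneg) (φ : L2Front) : ℝ :=
  pair Up (spatialOp e Bp Ψp) + pair Um (spatialOp e Bm Ψm)
    - ∫ y, φ y *
        (Bp.Gam * (qVec Bp ⬝ᵥ (Bp.v 1 • pd 1 Ψp (bd y) + Bp.v 2 • pd 2 Ψp (bd y)))
          - Bm.Gam * (qVec Bm ⬝ᵥ (Bm.v 1 • pd 1 Ψm (bd y) + Bm.v 2 • pd 2 Ψm (bd y))))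

/-- `(U⁺, U⁻, φ)` is, on the time interval `[0, T]`, an `L²` (weak) solution with initial data
`(U0⁺, U0⁻, φ0)` of the problem linearized about the sheet `(Bp, Bm)`:
`A₀^± ∂_t U^± + ∑_j A_j^± ∂_j U^± = 0` in `± x¹ > 0`, and
`∂_t φ = v₁^± - v̂₂^± ∂₂ φ - v̂₃^± ∂₃ φ`, `[q] = 0` on `x¹ = 0`.

The weak form arises by multiplying the equations by `Ψ^±` and integrating by parts in space. By
`boundary_form`, the boundary terms are the jump of `q(U) Ψ_{u₁} + U_{u₁} q(Ψ)`. The first summand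
drops out by `[q(U)] = 0` and `[Ψ_{u₁}] = 0`; in the second one
`U_{u₁}^± = Γ^± v₁^± = Γ^± (∂_t + v̂₂^± ∂₂ + v̂₃^± ∂₃) φ`, and the derivatives along the front are
moved to `Ψ`. -/
structure IsSolution (e : ℝ → ℝ → ℝ) (Bp Bm : State) (T : ℝ)
    (U0p : L2 Rpos) (U0m : L2 Rneg) (φ0 : L2Front)
    (Up : ℝ → L2 Rpos) (Um : ℝ → L2 Rneg) (φ : ℝ → L2Front) : Prop where
  cont_p : ContinuousOn Up (Set.Icc 0 T)
  cont_m : ContinuousOn Um (Set.Icc 0 T)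
  cont_front : ContinuousOn φ (Set.Icc 0 T)
  init_p : Up 0 = U0p
  init_m : Um 0 = U0m
  init_front : φ 0 = φ0
  weak_eq : ∀ Ψp Ψm, IsTest Ψp Ψm → ∀ t ∈ Set.Icc 0 T,
    HasDerivWithinAt (fun s => momentum e Bp Bm Ψp Ψm (Up s) (Um s) (φ s))
      (flux e Bp Bm Ψp Ψm (Up t) (Um t) (φ t)) (Set.Icc 0 T) t

/-- `∫_D (H, ∇χ) dx` for the magnetic part `H` of `f`. -/
def divPair {D : Set Space} (f : L2 D) (χ : Space → ℝ) : ℝ :=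
  ∫ x in D, ∑ j, f x (iH j) * pd j χ x

/-- `∫ φ (Ĥ₂ ∂₂ χ + Ĥ₃ ∂₃ χ)(0, x') dx'`. -/
def frontPair (B : State) (φ : L2Front) (χ : Space → ℝ) : ℝ :=
  ∫ y, φ y * (B.H 1 * pd 1 χ (bd y) + B.H 2 * pd 2 χ (bd y))

/-- The constraints on the initial data, in weak form: `div H^± = 0` in `± x¹ > 0` and
`H₁^± = Ĥ₂^± ∂₂ φ + Ĥ₃^± ∂₃ φ` on `x¹ = 0`. -/
def Admissible (Bp Bm : State) (U0p : L2 Rpos) (U0m : L2 Rneg) (φ0 : L2Front) : Prop :=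
  ∀ χ : Space → ℝ, ContDiff ℝ (⊤ : ℕ∞) χ → HasCompactSupport χ →
    divPair U0p χ = frontPair Bp φ0 χ ∧ divPair U0m χ = - frontPair Bm φ0 χ

/-- Well-posedness of the linearized problem in `L²`: for all admissible data and all `T > 0` there
is a unique solution on `[0, T]`; it depends continuously on the data, and the `L²` norm of
`(U⁺, U⁻)` is bounded by that of the data with a constant that does not depend on time. -/
def WellPosed (e : ℝ → ℝ → ℝ) (Bp Bm : State) : Prop :=
  ∃ C : ℝ, 0 < C ∧ ∀ T : ℝ, 0 < T → ∃ CT : ℝ, 0 < CT ∧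
    ∀ (U0p : L2 Rpos) (U0m : L2 Rneg) (φ0 : L2Front), Admissible Bp Bm U0p U0m φ0 →
      ∃ (Up : ℝ → L2 Rpos) (Um : ℝ → L2 Rneg) (φ : ℝ → L2Front),
        IsSolution e Bp Bm T U0p U0m φ0 Up Um φ ∧
        (∀ Up' Um' φ', IsSolution e Bp Bm T U0p U0m φ0 Up' Um' φ' →
          ∀ t ∈ Set.Icc 0 T, Up' t = Up t ∧ Um' t = Um t ∧ φ' t = φ t) ∧
        ∀ t ∈ Set.Icc 0 T,
          ‖Up t‖ ^ 2 + ‖Um t‖ ^ 2 ≤ C * (‖U0p‖ ^ 2 + ‖U0m‖ ^ 2) ∧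
          ‖φ t‖ ≤ CT * (‖φ0‖ + ‖U0p‖ + ‖U0m‖)

/-! ## Normal modes -/

/-- A real matrix with complex entries. -/
def toC (M : Matrix Idx Idx ℝ) : Matrix Idx Idx ℂ := M.map Complex.ofReal

/-- The perturbation of the total pressure for complex amplitudes. -/
def qC (B : State) (X : Idx → ℂ) : ℂ := (fun i => (qVec B i : ℂ)) ⬝ᵥ X

/-- `V` solves on `I` the interior equation for `e^{τ t + i (k₂ x² + k₃ x³)} V(x¹)`, that is,
`τ A₀ V + A₁ V' + i (k₂ A₂ + k₃ A₃) V = 0`. -/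
def ModeEq (e : ℝ → ℝ → ℝ) (B : State) (τ : ℂ) (k : Fin 2 → ℝ) (I : Set ℝ) (V : ℝ → Idx → ℂ) :
    Prop :=
  DifferentiableOn ℝ V I ∧ ∀ s ∈ I,
    τ • (toC (A0 e B) *ᵥ V s) + toC (A e B 0) *ᵥ derivWithin V I s
      + Complex.I • ((k 0 : ℂ) • (toC (A e B 1) *ᵥ V s) + (k 1 : ℂ) • (toC (A e B 2) *ᵥ V s)) = 0

/-- The front condition `∂_t φ = v₁ - v̂₂ ∂₂ φ - v̂₃ ∂₃ φ` for the amplitudes of a mode, with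
`v₁ = u₁ / Γ`. -/
def ModeFront (B : State) (τ : ℂ) (k : Fin 2 → ℝ) (X : Idx → ℂ) (φ : ℂ) : Prop :=
  τ * φ = X (iU 0) / (B.Gam : ℂ) - Complex.I * ((B.v 1 * k 0 + B.v 2 * k 1 : ℝ) : ℂ) * φ

/-- The (weak) Kreiss-Lopatinski condition: the linearized problem has no nonzero normal mode
`(U^±, φ) = e^{τ t + i (k₂ x² + k₃ x³)} (V^±(x¹), φ)` with `Re τ > 0` and `V^±` square integrable. -/
def NoUnstableModes (e : ℝ → ℝ → ℝ) (Bp Bm : State) : Prop :=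
  ∀ (τ : ℂ) (k : Fin 2 → ℝ) (Vp Vm : ℝ → Idx → ℂ) (φ : ℂ), 0 < τ.re →
    ModeEq e Bp τ k (Set.Ici 0) Vp → ModeEq e Bm τ k (Set.Iic 0) Vm →
    MemLp Vp 2 (volume.restrict (Set.Ici 0)) → MemLp Vm 2 (volume.restrict (Set.Iic 0)) →
    ModeFront Bp τ k (Vp 0) φ → ModeFront Bm τ k (Vm 0) φ → qC Bp (Vp 0) = qC Bm (Vm 0) →
    (∀ s, 0 ≤ s → Vp s = 0) ∧ (∀ s, s ≤ 0 → Vm s = 0) ∧ φ = 0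

/-- Linear (neutral) stability of the planar current-vortex sheet `(Bp, Bm)`. -/
def LinearlyStable (e : ℝ → ℝ → ℝ) (Bp Bm : State) : Prop :=
  WellPosed e Bp Bm ∧ NoUnstableModes e Bp Bm

end

end RMHD

/-! The obstruction to an energy estimate is the boundary term. For the given symmetric system the
boundary form is q(X)Y_{u₁} + X_{u₁}q(Y), and u₁/Γ jumps across the front by a derivative of φ. The
remedy is a second symmetrization, a one-parameter family that exists because of div H = 0. The
matrices A₀K and A_jK - λ(q in the row H_j), with K = `symK`, are symmetric (`B0_symm`, `Bj_symm`),
and on fields satisfying the constraints they describe the same evolution. The new boundary form is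
q ⊗ w + w ⊗ q with w = u₁/Γ - λH₁ (`B_zero_form`). At the front v₁ = ∂_tφ + v·∇φ and H₁ = H·∇φ,
hence w = ∂_tφ + (v - λH)·∇φ. If λ⁺ and λ⁻ satisfy v⁺ - λ⁺H⁺ = v⁻ - λ⁻H⁻, then w and q are both
continuous, the boundary terms of the two sides cancel, and the energy (B₀U, U) is conserved.

As the magnetic fields are not parallel, this pair λ^± exists and is unique. The energy is positive
when |λ|(1 + s|(v,H)|) < s(1 - |v|²) with s = c_s/√(ρa² + B²) (`B0_pos`). In rest frame variables
the energy density is affine in the speed of the frame, so that only the light-like case has to be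
examined (`lightlike_form_pos`). The condition G > 0 expresses exactly that the required λ^± obey
these bounds (`exists_lam`).

Absence of unstable modes: for a mode the flux q·w through x¹ = const is monotone and integrable,
hence has a definite sign on each side; the two signs are opposite and the boundary values agree, so
that the flux vanishes and with it the mode (`noUnstableModes`).

Well-posedness: testing with functions for which both q and w match removes φ altogether. What
remains is a skew-symmetric operator in L² of the whole space (`SymSys.inner_op_self`). In a frame
where q and w are coordinates its normal matrix is the same constant on both sides, so averaging by
translations shows that 1 + εL has dense range (`eq_zero_of_orthogonal_range`,
`SymSys.isSkewGraph`). A skew operator of this kind generates isometries, and its weak solutions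
conserve the norm (`IsSkewGraph.exists_weak_solution`, `IsSkewGraph.norm_eq_of_weak_solution`). This
settles (U⁺, U⁻), with a bound independent of time.

The front is recovered afterwards. The constraints H₁ = H^±·∇φ with two independent directions H^±
control the fine scales of φ by U, with half a derivative to spare (`exists_front_norm_le`). The
coarse scales follow from a transport equation with the common velocity v - λH
(`Symmetrizable.RedSol.transportEq`). Existence of φ is obtained by tangential averaging and passage
to the limit (`Symmetrizable.exists_redSol`). Constraints propagate in both formulations, so that
the two problems have the same solutions for admissible data (`Symmetrizable.origSol_iff`). -/

open MeasureTheory Matrix Filter Topology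

/-! ### Skew operators given by their graphs: resolvents. -/

section SkewGraph

variable {H : Type*} [NormedAddCommGroup H] [InnerProductSpace ℝ H]

/-- The graph of a densely defined skew-symmetric operator `L` such that `1 + ε L` has dense range
for every `ε ≠ 0`. -/
structure IsSkewGraph (Γ : Submodule ℝ (H × H)) : Prop where
  skew : ∀ p ∈ Γ, inner ℝ p.2 p.1 = 0
  dense_fst : Dense (Prod.fst '' (Γ : Set (H × H)))
  dense_range : ∀ ε : ℝ, ε ≠ 0 → Dense ((fun p : H × H => p.1 + ε • p.2) '' (Γ : Set (H × H)))

namespace IsSkewGraph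

variable {Γ : Submodule ℝ (H × H)}

theorem skew_closure (h : IsSkewGraph Γ) {p : H × H} (hp : p ∈ Γ.topologicalClosure) :
    inner ℝ p.2 p.1 = 0 := by
  have hcl : IsClosed {p : H × H | inner ℝ p.2 p.1 = 0} :=
    isClosed_eq (by fun_prop) continuous_const
  exact closure_minimal (fun p hp => h.skew p hp) hcl hp

theorem skew_closure₂ (h : IsSkewGraph Γ) {p q : H × H} (hp : p ∈ Γ.topologicalClosure)
    (hq : q ∈ Γ.topologicalClosure) : inner ℝ p.2 q.1 = - inner ℝ p.1 q.2 := by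
  have h1 := h.skew_closure (add_mem hp hq)
  have h2 := h.skew_closure hp
  have h3 := h.skew_closure hq
  simp only [Prod.fst_add, Prod.snd_add, inner_add_left, inner_add_right] at h1
  rw [real_inner_comm q.2 p.1]
  linarith

/-- Skewness kills the cross term. This identity yields injectivity of 1 + εL, closedness of its
range and the contraction property of its inverse. -/
theorem norm_sq_add (h : IsSkewGraph Γ) {p : H × H} (hp : p ∈ Γ.topologicalClosure) (ε : ℝ) :
    ‖p.1 + ε • p.2‖ ^ 2 = ‖p.1‖ ^ 2 + ε ^ 2 * ‖p.2‖ ^ 2 := by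
  have h2 := h.skew_closure hp
  rw [norm_add_sq_real, inner_smul_right, real_inner_comm, h2, norm_smul, mul_pow,
    Real.norm_eq_abs, sq_abs]
  ring

theorem norm_fst_le (h : IsSkewGraph Γ) {p : H × H} (hp : p ∈ Γ.topologicalClosure) (ε : ℝ) :
    ‖p.1‖ ≤ ‖p.1 + ε • p.2‖ := by
  have := h.norm_sq_add hp ε
  refine le_of_sq_le_sq ?_ (norm_nonneg _)
  rw [this]; nlinarith [sq_nonneg (ε * ‖p.2‖)]

/-- On the closed graph `norm_sq_add` bounds both components of p by the image of p, so the map is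
antilipschitz and has closed range; the range is dense by assumption. -/
theorem exists_add_smul [CompleteSpace H] (h : IsSkewGraph Γ) {ε : ℝ} (hε : ε ≠ 0) (x : H) :
    ∃ p ∈ Γ.topologicalClosure, p.1 + ε • p.2 = x := by
  let f : Γ.topologicalClosure → H := fun p => p.1.1 + ε • p.1.2
  have : CompleteSpace Γ.topologicalClosure :=
    (Submodule.isClosed_topologicalClosure Γ).completeSpace_coe
  have hlin : ∀ p q : Γ.topologicalClosure, f p - f q = f (p - q) := by
    intro p q; simp [f, smul_sub]; abel
  have hanti : AntilipschitzWith (Real.toNNReal (1 + |ε|⁻¹)) f := by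
    refine AntilipschitzWith.of_le_mul_dist fun p q => ?_
    rw [dist_eq_norm, dist_eq_norm, hlin]
    set r := p - q
    have h1 := h.norm_fst_le r.2 ε
    have h2 := h.norm_sq_add r.2 ε
    have h3 : |ε| * ‖(r : H × H).2‖ ≤ ‖f r‖ := by
      refine le_of_sq_le_sq ?_ (norm_nonneg _)
      rw [mul_pow, sq_abs]
      change _ ≤ ‖(r : H × H).1 + ε • (r : H × H).2‖ ^ 2
      rw [h2]; nlinarith [sq_nonneg ‖(r : H × H).1‖]
    have hpos : 0 < |ε| := abs_pos.2 hε
    rw [Real.coe_toNNReal _ (by positivity)]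
    change ‖(r : H × H)‖ ≤ _
    rw [Prod.norm_def]
    have h4 : ‖(r : H × H).2‖ ≤ |ε|⁻¹ * ‖f r‖ := by
      rw [inv_mul_eq_div, le_div_iff₀ hpos]; linarith
    have h5 : 0 ≤ |ε|⁻¹ * ‖f r‖ := by positivity
    have h6 : ‖(r : H × H).1‖ ≤ ‖f r‖ := h1
    have h7 := norm_nonneg (f r)
    refine max_le ?_ ?_ <;> nlinarith
  have hunif : UniformContinuous f := by
    have : UniformContinuous (fun p : H × H => p.1 + ε • p.2) :=
      ((ContinuousLinearMap.fst ℝ H H) + ε • (ContinuousLinearMap.snd ℝ H H)).uniformContinuous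
    exact this.comp uniformContinuous_subtype_val
  have hclosed : IsClosed (Set.range f) := hanti.isClosed_range hunif
  have hdense : Dense (Set.range f) := by
    refine (h.dense_range ε hε).mono ?_
    rintro _ ⟨p, hp, rfl⟩
    exact ⟨⟨p, Γ.le_topologicalClosure hp⟩, rfl⟩
  have hx : x ∈ Set.range f := by
    have := hdense x
    rwa [hclosed.closure_eq] at this
  obtain ⟨p, hp⟩ := hx
  exact ⟨p, p.2, hp⟩

theorem eq_of_add_smul_eq (h : IsSkewGraph Γ) {ε : ℝ} {p q : H × H}
    (hp : p ∈ Γ.topologicalClosure) (hq : q ∈ Γ.topologicalClosure)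
    (hpq : p.1 + ε • p.2 = q.1 + ε • q.2) : p.1 = q.1 := by
  have := h.norm_fst_le (sub_mem hp hq) ε
  have h0 : (p - q).1 + ε • (p - q).2 = 0 := by
    simp only [Prod.fst_sub, Prod.snd_sub, smul_sub]
    rw [sub_add_sub_comm, hpq, sub_self]
  rw [h0, norm_zero] at this
  exact sub_eq_zero.1 (norm_le_zero_iff.1 this)

/-- The resolvents `J ε = (1 + ε L)⁻¹`. -/
theorem exists_resolvent [CompleteSpace H] (h : IsSkewGraph Γ) :
    ∃ J : ℝ → H →L[ℝ] H,
      (∀ ε, ε ≠ 0 → ∀ p ∈ Γ.topologicalClosure, J ε (p.1 + ε • p.2) = p.1) ∧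
      (∀ ε, ε ≠ 0 → ∀ x, (J ε x, ε⁻¹ • (x - J ε x)) ∈ Γ.topologicalClosure) := by
  have key : ∀ ε : ℝ, ∃ J : H →L[ℝ] H, ε ≠ 0 →
      (∀ p ∈ Γ.topologicalClosure, J (p.1 + ε • p.2) = p.1) ∧
      (∀ x, (J x, ε⁻¹ • (x - J x)) ∈ Γ.topologicalClosure) := by
    intro ε
    by_cases hε : ε = 0
    · exact ⟨0, fun h => absurd hε h⟩
    choose g hg hgx using fun x => h.exists_add_smul hε x
    have huniq : ∀ p ∈ Γ.topologicalClosure, (g (p.1 + ε • p.2)).1 = p.1 := fun p hp =>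
      h.eq_of_add_smul_eq (hg _) hp (hgx _)
    let J0 : H →ₗ[ℝ] H :=
      { toFun := fun x => (g x).1
        map_add' := fun x y => by
          have := huniq _ (add_mem (hg x) (hg y))
          simp only [Prod.fst_add, Prod.snd_add, smul_add] at this
          rw [add_add_add_comm, hgx, hgx] at this
          exact this
        map_smul' := fun c x => by
          have := huniq _ (Submodule.smul_mem _ c (hg x))
          simp only [Prod.smul_fst, Prod.smul_snd] at this
          rw [smul_comm ε c, ← smul_add, hgx] at this
          exact this }
    refine ⟨J0.mkContinuous 1 fun x => ?_, fun _ => ⟨huniq, fun x => ?_⟩⟩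
    · have := h.norm_fst_le (hg x) ε
      rw [hgx] at this
      rw [one_mul]; exact this
    · have h2 : ε⁻¹ • (x - (g x).1) = (g x).2 := by
        conv_lhs => rw [← hgx x]
        have : (g ((g x).1 + ε • (g x).2)).1 = (g x).1 := by rw [hgx]
        rw [this, add_sub_cancel_left, smul_smul, inv_mul_cancel₀ hε, one_smul]
      change ((g x).1, ε⁻¹ • (x - (g x).1)) ∈ _
      rw [h2]; exact hg x
  choose J hJ using key
  exact ⟨J, fun ε hε => (hJ ε hε).1, fun ε hε => (hJ ε hε).2⟩

section Resolvent

variable {J : ℝ → H →L[ℝ] H}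

theorem resolvent_norm_le (h : IsSkewGraph Γ)
    (hJ : ∀ ε, ε ≠ 0 → ∀ x, (J ε x, ε⁻¹ • (x - J ε x)) ∈ Γ.topologicalClosure)
    {ε : ℝ} (hε : ε ≠ 0) (x : H) : ‖J ε x‖ ≤ ‖x‖ := by
  have := h.norm_fst_le (hJ ε hε x) ε
  simpa [smul_smul, mul_inv_cancel₀ hε] using this

/-- Formally (1 + εL)* = 1 - εL; this is skewness applied to the graph elements over `J ε x` and `J
(-ε) y`. -/
theorem resolvent_adjoint (h : IsSkewGraph Γ)
    (hJ : ∀ ε, ε ≠ 0 → ∀ x, (J ε x, ε⁻¹ • (x - J ε x)) ∈ Γ.topologicalClosure)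
    {ε : ℝ} (hε : ε ≠ 0) (x y : H) : inner ℝ (J ε x) y = inner ℝ x (J (-ε) y) := by
  have h1 := h.skew_closure₂ (hJ ε hε x) (hJ (-ε) (neg_ne_zero.2 hε) y)
  simp only [inner_smul_left, inner_smul_right, inner_sub_left, inner_sub_right, inv_neg,
    neg_mul, RCLike.conj_to_real] at h1
  field_simp at h1
  linarith

/-- On the domain J p - p = -ε J L p, which has norm at most |ε| ‖L p‖; as the resolvents are
contractions, convergence extends from the dense domain to every x. -/
theorem resolvent_tendsto (h : IsSkewGraph Γ)
    (hJ1 : ∀ ε, ε ≠ 0 → ∀ p ∈ Γ.topologicalClosure, J ε (p.1 + ε • p.2) = p.1)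
    (hJ : ∀ ε, ε ≠ 0 → ∀ x, (J ε x, ε⁻¹ • (x - J ε x)) ∈ Γ.topologicalClosure)
    {u : ℕ → ℝ} (hu : ∀ n, u n ≠ 0) (hlim : Tendsto u atTop (𝓝 0)) (x : H) :
    Tendsto (fun n => J (u n) x) atTop (𝓝 x) := by
  rw [Metric.tendsto_atTop]
  intro δ hδ
  obtain ⟨_, hpx, ⟨p, hp, rfl⟩⟩ := Metric.dense_iff.1 h.dense_fst x (δ / 3) (by positivity)
  rw [Metric.mem_ball] at hpx
  have h0 : Tendsto (fun n => |u n| * ‖p.2‖) atTop (𝓝 0) := by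
    have := (hlim.abs).mul_const ‖p.2‖
    simpa using this
  obtain ⟨N, hN⟩ := Metric.tendsto_atTop.1 h0 (δ / 3) (by positivity)
  refine ⟨N, fun n hn => ?_⟩
  have hN' := hN n hn
  rw [Real.dist_eq, sub_zero, abs_of_nonneg (by positivity)] at hN'
  have h1 : J (u n) p.1 - p.1 = - (u n • J (u n) p.2) := by
    have := hJ1 (u n) (hu n) p (Γ.le_topologicalClosure hp)
    rw [map_add, map_smul] at this
    rw [eq_neg_iff_add_eq_zero, sub_add_eq_add_sub, this, sub_self]
  have h2 : ‖J (u n) p.1 - p.1‖ < δ / 3 := by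
    rw [h1, norm_neg, norm_smul, Real.norm_eq_abs]
    refine lt_of_le_of_lt ?_ hN'
    gcongr
    exact h.resolvent_norm_le hJ (hu n) _
  have h3 : ‖J (u n) (x - p.1)‖ < δ / 3 := by
    refine lt_of_le_of_lt (h.resolvent_norm_le hJ (hu n) _) ?_
    rwa [← dist_eq_norm, dist_comm]
  calc dist (J (u n) x) x = ‖J (u n) (x - p.1) + (J (u n) p.1 - p.1) + (p.1 - x)‖ := by
        rw [dist_eq_norm, map_sub]; congr 1; abel
    _ ≤ ‖J (u n) (x - p.1)‖ + ‖J (u n) p.1 - p.1‖ + ‖p.1 - x‖ := norm_add₃_le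
    _ < δ / 3 + δ / 3 + δ / 3 := by
        rw [dist_eq_norm] at hpx; linarith
    _ = δ := by ring

theorem resolvent_identity (h : IsSkewGraph Γ)
    (hJ1 : ∀ ε, ε ≠ 0 → ∀ p ∈ Γ.topologicalClosure, J ε (p.1 + ε • p.2) = p.1)
    (hJ : ∀ ε, ε ≠ 0 → ∀ x, (J ε x, ε⁻¹ • (x - J ε x)) ∈ Γ.topologicalClosure)
    {ε δ : ℝ} (hε : ε ≠ 0) (hδ : δ ≠ 0) (x : H) :
    δ • J δ x = ε • J ε x + (δ - ε) • J ε (J δ x) := by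
  have h1 := hJ1 ε hε _ (hJ δ hδ x)
  simp only [map_add, map_smul, map_sub] at h1
  have h2 := congrArg (fun z => δ • z) h1
  simp only [smul_add, smul_smul, smul_sub] at h2
  have e1 : δ * (ε * δ⁻¹) = ε := by field_simp
  rw [e1] at h2
  rw [← h2]
  module

/-- For ε ≠ δ the resolvent identity, read in both orders, determines both products by the same
expression. -/
theorem resolvent_comm (h : IsSkewGraph Γ)
    (hJ1 : ∀ ε, ε ≠ 0 → ∀ p ∈ Γ.topologicalClosure, J ε (p.1 + ε • p.2) = p.1)
    (hJ : ∀ ε, ε ≠ 0 → ∀ x, (J ε x, ε⁻¹ • (x - J ε x)) ∈ Γ.topologicalClosure)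
    {ε δ : ℝ} (hε : ε ≠ 0) (hδ : δ ≠ 0) (x : H) : J ε (J δ x) = J δ (J ε x) := by
  by_cases hne : δ = ε
  · rw [hne]
  have h1 := h.resolvent_identity hJ1 hJ hε hδ x
  have h2 := h.resolvent_identity hJ1 hJ hδ hε x
  have h3 : (δ - ε) • (J ε (J δ x) - J δ (J ε x)) = 0 := by
    have : (δ - ε) • (J ε (J δ x)) = δ • J δ x - ε • J ε x := by rw [h1]; abel
    have h4 : (δ - ε) • (J δ (J ε x)) = δ • J δ x - ε • J ε x := by
      rw [h2]; module
    rw [smul_sub, this, h4, sub_self]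
  exact sub_eq_zero.1 ((smul_eq_zero.1 h3).resolve_left (sub_ne_zero.2 hne))

end Resolvent

end IsSkewGraph

/-! ### Exponentials of bounded skew operators. -/

section SkewExp

variable [CompleteSpace H]

theorem hasDerivAt_exp_smul_apply (A : H →L[ℝ] H) (x : H) (t : ℝ) :
    HasDerivAt (fun s : ℝ => NormedSpace.exp (s • A) x) (A (NormedSpace.exp (t • A) x)) t :=
  by
  simpa using (hasDerivAt_exp_smul_const' (𝕂 := ℝ) A t).clm_apply (hasDerivAt_const t x)

theorem norm_exp_smul_apply {A : H →L[ℝ] H} (hA : ∀ x, inner ℝ (A x) x = 0) (t : ℝ) (x : H) :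
    ‖NormedSpace.exp (t • A) x‖ = ‖x‖ := by
  have hd : ∀ s : ℝ, HasDerivAt (fun s : ℝ => inner ℝ (NormedSpace.exp (s • A) x)
      (NormedSpace.exp (s • A) x)) 0 s := by
    intro s
    have h := (hasDerivAt_exp_smul_apply A x s).inner ℝ (hasDerivAt_exp_smul_apply A x s)
    have h0 := hA (NormedSpace.exp (s • A) x)
    rw [real_inner_comm (A _), h0, add_zero] at h
    exact h
  have hc := is_const_of_deriv_eq_zero (𝕜 := ℝ) (fun s => (hd s).differentiableAt)
    (fun s => (hd s).deriv) t 0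
  simp only [real_inner_self_eq_norm_sq, zero_smul, NormedSpace.exp_zero,
    one_apply_eq_self] at hc
  exact (sq_eq_sq₀ (norm_nonneg _) (norm_nonneg _)).1 hc

/-- Duhamel: e^{(t-s)A} e^{sB} x interpolates between the two vectors, and since A and B commute its
derivative is an isometric image of the fixed vector Bx - Ax. -/
theorem norm_exp_sub_exp_le {A B : H →L[ℝ] H} (hA : ∀ x, inner ℝ (A x) x = 0)
    (hB : ∀ x, inner ℝ (B x) x = 0) (hAB : Commute A B) (t : ℝ) (x : H) :
    ‖NormedSpace.exp (t • B) x - NormedSpace.exp (t • A) x‖ ≤ ‖B x - A x‖ * |t| := by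
  have hd : ∀ s : ℝ, HasDerivAt
      (fun s : ℝ => NormedSpace.exp ((t - s) • A) (NormedSpace.exp (s • B) x))
      (NormedSpace.exp ((t - s) • A) (NormedSpace.exp (s • B) (B x - A x))) s := by
    intro s
    have h1 := (hasDerivAt_exp_smul_const (𝕂 := ℝ) A (t - s)).comp_const_sub t s
    have h2 := h1.clm_apply (hasDerivAt_exp_smul_apply B x s)
    refine h2.congr_deriv ?_
    have e1 : B (NormedSpace.exp (s • B) x) = NormedSpace.exp (s • B) (B x) := by
      have hc : Commute B (NormedSpace.exp (s • B)) :=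
        ((Commute.refl B).smul_right s).exp_right
      exact congrArg (fun T : H →L[ℝ] H => T x) hc
    have e2 : A (NormedSpace.exp (s • B) x) = NormedSpace.exp (s • B) (A x) := by
      have hc : Commute A (NormedSpace.exp (s • B)) := (hAB.smul_right s).exp_right
      exact congrArg (fun T : H →L[ℝ] H => T x) hc
    simp only [_root_.neg_apply, mul_apply_eq_comp, map_sub]
    rw [e1, e2]; abel
  have h := Convex.norm_image_sub_le_of_norm_hasDerivWithin_le (𝕜 := ℝ) (s := Set.univ)
    (x := 0) (y := t) (C := ‖B x - A x‖) (fun s _ => (hd s).hasDerivWithinAt)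
    (fun s _ => by rw [norm_exp_smul_apply hA, norm_exp_smul_apply hB]) convex_univ
    (Set.mem_univ _) (Set.mem_univ _)
  simpa using h

end SkewExp

/-! ### Existence and norm conservation for weak solutions. -/

namespace IsSkewGraph

variable {Γ : Submodule ℝ (H × H)} [CompleteSpace H]

/-- Commuting bounded skew-symmetric approximations of the operator. -/
theorem exists_approx (h : IsSkewGraph Γ) :
    ∃ A : ℕ → H →L[ℝ] H, (∀ n x, inner ℝ (A n x) x = 0) ∧ (∀ n m, Commute (A n) (A m)) ∧
      ∀ p ∈ Γ.topologicalClosure, Tendsto (fun n => A n p.1) atTop (𝓝 p.2) := by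
  obtain ⟨J, hJ1, hJ⟩ := h.exists_resolvent
  let u : ℕ → ℝ := fun n => 1 / ((n : ℝ) + 1)
  have hu : ∀ n, u n ≠ 0 := fun n => by simp only [u]; positivity
  have hlim : Tendsto u atTop (𝓝 0) := tendsto_one_div_add_atTop_nhds_zero_nat
  have hu' : ∀ n, -u n ≠ 0 := fun n => neg_ne_zero.2 (hu n)
  have hlim' : Tendsto (fun n => -u n) atTop (𝓝 0) := by simpa using hlim.neg
  -- Formally this is L(1 - u²L²)⁻¹. The symmetric combination of the resolvents at u and -u is
  -- exactly skew, because these two are adjoint to each other.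
  refine ⟨fun n => (2 * u n)⁻¹ • (J (-u n) - J (u n)), fun n x => ?_, fun n m => ?_, ?_⟩
  · have h1 := h.resolvent_adjoint hJ (hu n) x x
    simp only [_root_.smul_apply, _root_.sub_apply, inner_smul_left,
      inner_sub_left]
    rw [h1, real_inner_comm, sub_self, mul_zero]
  · have hc : ∀ a b : ℝ, a ≠ 0 → b ≠ 0 → Commute (J a) (J b) := fun a b ha hb => by
      ext x; exact h.resolvent_comm hJ1 hJ ha hb x
    refine Commute.smul_left (Commute.smul_right ?_ _) _
    exact ((hc _ _ (hu' n) (hu' m)).sub_right (hc _ _ (hu' n) (hu m))).sub_left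
      ((hc _ _ (hu n) (hu' m)).sub_right (hc _ _ (hu n) (hu m)))
  · intro p hp
    have e : ∀ n, ((2 * u n)⁻¹ • (J (-u n) - J (u n))) p.1
        = (2 : ℝ)⁻¹ • (J (-u n) p.2 + J (u n) p.2) := by
      intro n
      have h1 := hJ1 (u n) (hu n) p hp
      have h2 := hJ1 (-u n) (hu' n) p hp
      rw [map_add, map_smul] at h1 h2
      have h3 : (J (-u n) - J (u n)) p.1 = u n • (J (-u n) p.2 + J (u n) p.2) := by
        rw [_root_.sub_apply]
        have h1' : J (u n) p.1 = p.1 - u n • J (u n) p.2 := eq_sub_of_add_eq h1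
        have h2' : J (-u n) p.1 = p.1 - (-u n) • J (-u n) p.2 := eq_sub_of_add_eq h2
        rw [h1', h2']; module
      rw [_root_.smul_apply, h3, smul_smul]
      congr 1
      have := hu n
      field_simp
    simp only [e]
    have := ((h.resolvent_tendsto hJ1 hJ hu' hlim' p.2).add
      (h.resolvent_tendsto hJ1 hJ hu hlim p.2)).const_smul (2 : ℝ)⁻¹
    convert this using 2
    module

/-- The isometries generated by the bounded approximations converge locally uniformly in time: on
the domain by the Duhamel bound, elsewhere by density. The weak equation passes to the limit because
A_n p.1 → p.2. -/
theorem exists_weak_solution (h : IsSkewGraph Γ) (x : H) :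
    ∃ F : ℝ → H, Continuous F ∧ F 0 = x ∧ ∀ p ∈ Γ.topologicalClosure, ∀ t,
      HasDerivAt (fun s => inner ℝ (F s) p.1) (inner ℝ (F t) p.2) t := by
  obtain ⟨A, hA, hcomm, hlim⟩ := h.exists_approx
  have hB : ∀ n y, inner ℝ ((-A n) y) y = 0 := fun n y => by simp [hA]
  -- The sign is that of F' = -LF: in the weak form L acts on the test vector, and its formal
  -- adjoint is -L.
  let E : ℕ → ℝ → H → H := fun n t y => NormedSpace.exp (t • (-A n)) y
  have hEsub : ∀ n t y z, E n t (y - z) = E n t y - E n t z := fun n t y z => map_sub _ _ _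
  have hEn : ∀ n t y, ‖E n t y‖ = ‖y‖ := fun n t y => norm_exp_smul_apply (hB n) t y
  have hcau : ∀ T δ : ℝ, 0 < δ → ∃ N, ∀ n ≥ N, ∀ m ≥ N, ∀ t, |t| ≤ T →
      ‖E n t x - E m t x‖ < δ := by
    intro T δ hδ
    obtain ⟨_, hpx, ⟨p, hp, rfl⟩⟩ := Metric.dense_iff.1 h.dense_fst x (δ / 4) (by positivity)
    rw [Metric.mem_ball, dist_comm, dist_eq_norm] at hpx
    have hc : CauchySeq fun n => A n p.1 :=
      (hlim p (Γ.le_topologicalClosure hp)).cauchySeq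
    obtain ⟨N, hN⟩ := Metric.cauchySeq_iff.1 hc (δ / (4 * (|T| + 1))) (by positivity)
    refine ⟨N, fun n hn m hm t ht => ?_⟩
    have h1 : ‖E n t p.1 - E m t p.1‖ ≤ δ / 4 := by
      refine (norm_exp_sub_exp_le (hB m) (hB n) ((hcomm m n).neg_left.neg_right) t p.1).trans ?_
      have h2 := hN n hn m hm
      have h3 : ‖(-A n) p.1 - (-A m) p.1‖ = dist (A n p.1) (A m p.1) := by
        rw [dist_eq_norm, ← norm_neg]; congr 1; simp; abel
      rw [h3]
      calc dist (A n p.1) (A m p.1) * |t| ≤ δ / (4 * (|T| + 1)) * (|T| + 1) := by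
            gcongr
            exact ht.trans ((le_abs_self T).trans (by linarith))
        _ = δ / 4 := by field_simp
    calc ‖E n t x - E m t x‖
        = ‖E n t (x - p.1) + (E n t p.1 - E m t p.1) - E m t (x - p.1)‖ := by
          rw [hEsub, hEsub]; congr 1; abel
      _ ≤ ‖E n t (x - p.1)‖ + ‖E n t p.1 - E m t p.1‖ + ‖E m t (x - p.1)‖ :=
          (norm_sub_le _ _).trans (by gcongr; exact norm_add_le _ _)
      _ < δ := by rw [hEn, hEn]; linarith
  have hpt : ∀ t, ∃ y, Tendsto (fun n => E n t x) atTop (𝓝 y) := by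
    intro t
    refine cauchySeq_tendsto_of_complete (Metric.cauchySeq_iff.2 fun δ hδ => ?_)
    obtain ⟨N, hN⟩ := hcau |t| δ hδ
    exact ⟨N, fun n hn m hm => by rw [dist_eq_norm]; exact hN n hn m hm t le_rfl⟩
  choose F hF using hpt
  have hunif : ∀ T : ℝ, TendstoUniformlyOn (fun n t => E n t x) F atTop {t | |t| < T} := by
    intro T
    refine UniformCauchySeqOn.tendstoUniformlyOn_of_tendsto ?_ fun t _ => hF t
    refine Metric.uniformCauchySeqOn_iff.2 fun δ hδ => ?_
    obtain ⟨N, hN⟩ := hcau T δ hδ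
    exact ⟨N, fun n hn m hm t ht => by rw [dist_eq_norm]; exact hN n hn m hm t (le_of_lt ht)⟩
  have hopen : ∀ T : ℝ, IsOpen {t : ℝ | |t| < T} := fun T =>
    isOpen_lt continuous_abs continuous_const
  have hmem : ∀ t : ℝ, t ∈ {s : ℝ | |s| < |t| + 1} := fun t => by
    simp only [Set.mem_ofPred_eq]; linarith
  have hEder : ∀ n t, HasDerivAt (fun s => E n s x) ((-A n) (E n t x)) t := fun n t =>
    hasDerivAt_exp_smul_apply (-A n) x t
  have hFx : ∀ t, ‖F t‖ = ‖x‖ := fun t =>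
    tendsto_nhds_unique (hF t).norm (by simp only [hEn]; exact tendsto_const_nhds)
  refine ⟨F, ?_, ?_, fun p hp t => ?_⟩
  · rw [continuous_iff_continuousAt]
    intro t
    have hc : ContinuousOn F {s | |s| < |t| + 1} :=
      (hunif _).continuousOn (Filter.Frequently.of_forall fun n s _ =>
        (hEder n s).continuousAt.continuousWithinAt)
    exact hc.continuousAt ((hopen _).mem_nhds (hmem t))
  · refine tendsto_nhds_unique (hF 0) ?_
    simp [E, NormedSpace.exp_zero]
  · refine hasDerivAt_of_tendstoLocallyUniformlyOn (l := atTop)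
      (f := fun n s => inner ℝ (E n s x) p.1) (f' := fun n s => inner ℝ (E n s x) (A n p.1))
      (g' := fun s => inner ℝ (F s) p.2) (hopen (|t| + 1)) ?_ ?_ ?_ (hmem t)
    · refine TendstoUniformlyOn.tendstoLocallyUniformlyOn ?_
      refine Metric.tendstoUniformlyOn_iff.2 fun δ hδ => ?_
      have h1 := Metric.tendstoUniformlyOn_iff.1 (hunif (|t| + 1)) (δ / (2 * (‖p.2‖ + 1)))
        (by positivity)
      have h2 := Metric.tendsto_nhds.1 (hlim p hp) (δ / (2 * (‖x‖ + 1))) (by positivity)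
      filter_upwards [h1, h2] with n hn1 hn2 s hs
      have hn1' := hn1 s hs
      rw [dist_eq_norm] at hn1' hn2
      rw [Real.dist_eq]
      have e : inner ℝ (F s) p.2 - inner ℝ (E n s x) (A n p.1)
          = inner ℝ (F s - E n s x) p.2 - inner ℝ (E n s x) (A n p.1 - p.2) := by
        rw [inner_sub_left, inner_sub_right]; ring
      rw [e]
      have b1 : |inner ℝ (F s - E n s x) p.2| ≤ δ / (2 * (‖p.2‖ + 1)) * ‖p.2‖ :=
        (abs_real_inner_le_norm _ _).trans (by gcongr)
      have b2 : |inner ℝ (E n s x) (A n p.1 - p.2)| ≤ ‖x‖ * (δ / (2 * (‖x‖ + 1))) := by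
        refine (abs_real_inner_le_norm _ _).trans ?_
        rw [hEn]; gcongr
      have c1 : δ / (2 * (‖p.2‖ + 1)) * ‖p.2‖ < δ / 2 := by
        rw [div_mul_eq_mul_div, div_lt_div_iff₀ (by positivity) (by positivity)]
        nlinarith [norm_nonneg p.2]
      have c2 : ‖x‖ * (δ / (2 * (‖x‖ + 1))) < δ / 2 := by
        rw [mul_div_assoc', div_lt_div_iff₀ (by positivity) (by positivity)]
        nlinarith [norm_nonneg x]
      calc |inner ℝ (F s - E n s x) p.2 - inner ℝ (E n s x) (A n p.1 - p.2)|
          ≤ |inner ℝ (F s - E n s x) p.2| + |inner ℝ (E n s x) (A n p.1 - p.2)| := abs_sub _ _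
        _ < δ := by linarith
    · refine Filter.Eventually.of_forall fun n s _ => ?_
      have h1 := (hEder n s).inner ℝ (hasDerivAt_const s p.1)
      have h2 := hA n (E n s x + p.1)
      simp only [map_add, inner_add_left, inner_add_right, hA] at h2
      refine h1.congr_deriv ?_
      rw [inner_zero_right, zero_add, _root_.neg_apply, inner_neg_left,
        real_inner_comm (A n p.1)]
      linarith
    · exact fun s _ => (hF s).inner tendsto_const_nhds

/-- A weak solution need not lie in the domain, so its norm cannot be differentiated directly. The
regularization `J ε` carries it into the domain, where it satisfies the equation in the strong sense
and has constant norm; then ε → 0. Uniqueness rests on this. -/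
theorem norm_eq_of_weak_solution (h : IsSkewGraph Γ) {F : ℝ → H} {T : ℝ}
    (hc : ContinuousOn F (Set.Icc 0 T))
    (hF : ∀ p ∈ Γ, ∀ t ∈ Set.Icc 0 T,
      HasDerivWithinAt (fun s => inner ℝ (F s) p.1) (inner ℝ (F t) p.2) (Set.Icc 0 T) t) :
    ∀ t ∈ Set.Icc 0 T, ‖F t‖ = ‖F 0‖ := by
  obtain ⟨J, hJ1, hJ⟩ := h.exists_resolvent
  have hsub : ∀ t ∈ Set.Icc 0 T, Set.Icc 0 t ⊆ Set.Icc 0 T := fun t ht =>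
    Set.Icc_subset_Icc le_rfl ht.2
  have hFint : ∀ t ∈ Set.Icc 0 T, IntervalIntegrable F volume 0 t := fun t ht =>
    (hc.mono (by rw [Set.uIcc_of_le ht.1]; exact hsub t ht)).intervalIntegrable
  -- In integrated form the weak equation is a closed condition on p and extends to the closure of
  -- the graph, where the resolvents take their values.
  have hint : ∀ p ∈ Γ.topologicalClosure, ∀ t ∈ Set.Icc 0 T,
      inner ℝ (F t) p.1 - inner ℝ (F 0) p.1 = inner ℝ (∫ s in (0 : ℝ)..t, F s) p.2 := by
    intro p hp t ht
    have hcl : IsClosed {p : H × H | inner ℝ (F t) p.1 - inner ℝ (F 0) p.1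
        = inner ℝ (∫ s in (0 : ℝ)..t, F s) p.2} :=
      isClosed_eq (by fun_prop) (by fun_prop)
    refine closure_minimal (fun p hp => ?_) hcl hp
    have hco : ContinuousOn (fun s => inner ℝ (F s) p.1) (Set.Icc 0 t) :=
      (hc.mono (hsub t ht)).inner continuousOn_const
    have h1 := intervalIntegral.integral_eq_sub_of_hasDeriv_right_of_le ht.1 hco
      (f' := fun s => inner ℝ (F s) p.2) (fun s hs => by
        have h2 := hF p hp s (hsub t ht (Set.Ioo_subset_Icc_self hs))
        exact (h2.hasDerivAt (Icc_mem_nhds hs.1 (hs.2.trans_le ht.2))).hasDerivWithinAt)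
      ((((hc.mono (hsub t ht)).inner continuousOn_const).mono
        (by rw [Set.uIcc_of_le ht.1])).intervalIntegrable)
    simp only [Set.mem_ofPred_eq]
    rw [← h1]
    have h3 := ContinuousLinearMap.intervalIntegral_comp_comm (innerSL ℝ p.2) (hFint t ht)
    simp only [innerSL_apply_apply] at h3
    rw [real_inner_comm, ← h3]
    exact intervalIntegral.integral_congr fun s _ => real_inner_comm _ _
  have hJn : ∀ ε : ℝ, ε ≠ 0 → ∀ t ∈ Set.Icc 0 T, ‖J ε (F t)‖ = ‖J ε (F 0)‖ := by
    intro ε hε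
    have hε' : -ε ≠ 0 := neg_ne_zero.2 hε
    -- D is L composed with `J ε`, a bounded operator.
    let D : H →L[ℝ] H := ε⁻¹ • (1 - J ε)
    have hYint : ∀ t ∈ Set.Icc 0 T,
        J ε (F t) - J ε (F 0) = -D (∫ s in (0 : ℝ)..t, F s) := by
      intro t ht
      refine ext_inner_right ℝ fun z => ?_
      have h1 := hint _ (hJ (-ε) hε' z) t ht
      simp only at h1
      rw [inner_sub_left, h.resolvent_adjoint hJ hε, h.resolvent_adjoint hJ hε, h1]
      simp only [D, _root_.smul_apply, _root_.sub_apply,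
        one_apply_eq_self, inner_neg_left, inner_smul_left, inner_smul_right,
        inner_sub_left, inner_sub_right, h.resolvent_adjoint hJ hε, inv_neg, RCLike.conj_to_real]
      ring
    have hYd : ∀ t ∈ Set.Icc 0 T,
        HasDerivWithinAt (fun s => J ε (F s)) (-D (F t)) (Set.Icc 0 T) t := by
      intro t ht
      have h1 : HasDerivWithinAt (fun u => ∫ s in (0 : ℝ)..u, F s) (F t) (Set.Icc 0 T) t := by
        have : Fact (t ∈ Set.Icc 0 T) := ⟨ht⟩
        exact intervalIntegral.integral_hasDerivWithinAt_right (hFint t ht)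
          (hc.stronglyMeasurableAtFilter_nhdsWithin measurableSet_Icc t) (hc t ht)
      have h2 := ((D.hasFDerivAt.comp_hasDerivWithinAt t h1).neg).add_const (J ε (F 0))
      refine h2.congr (fun s hs => ?_) ?_
      · rw [← sub_eq_iff_eq_add]; exact hYint s hs
      · rw [← sub_eq_iff_eq_add]; exact hYint t ht
    have hsq : ∀ t ∈ Set.Icc 0 T, inner ℝ (J ε (F t)) (J ε (F t))
        = inner ℝ (J ε (F 0)) (J ε (F 0)) := by
      have hd : ∀ t ∈ Set.Icc 0 T, HasDerivWithinAt
          (fun s => inner ℝ (J ε (F s)) (J ε (F s))) 0 (Set.Icc 0 T) t := by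
        intro t ht
        have h1 := (hYd t ht).inner ℝ (hYd t ht)
        have h2 := h.skew_closure (hJ ε hε (F t))
        simp only at h2
        refine h1.congr_deriv ?_
        simp only [D, inner_neg_left, inner_neg_right, _root_.smul_apply,
          _root_.sub_apply, one_apply_eq_self]
        rw [real_inner_comm, h2]; simp
      refine constant_of_has_deriv_right_zero (fun t ht => (hd t ht).continuousWithinAt)
        fun t ht => ?_
      exact (hd t (Set.Ico_subset_Icc_self ht)).mono_of_mem_nhdsWithin
        (Icc_mem_nhdsGE_of_mem ht)
    intro t ht
    have := hsq t ht
    simp only [real_inner_self_eq_norm_sq] at this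
    exact (sq_eq_sq₀ (norm_nonneg _) (norm_nonneg _)).1 this
  intro t ht
  let u : ℕ → ℝ := fun n => 1 / ((n : ℝ) + 1)
  have hu : ∀ n, u n ≠ 0 := fun n => by simp only [u]; positivity
  have hlim : Tendsto u atTop (𝓝 0) := tendsto_one_div_add_atTop_nhds_zero_nat
  refine tendsto_nhds_unique (h.resolvent_tendsto hJ1 hJ hu hlim (F t)).norm ?_
  simp only [hJn _ (hu _) t ht]
  exact (h.resolvent_tendsto hJ1 hJ hu hlim (F 0)).norm

end IsSkewGraph

end SkewGraph

/-! ### Averages and difference quotients along isometric flows. -/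

/-- A strongly continuous one-parameter group of isometries. -/
structure IsometryFlow (H : Type*) [NormedAddCommGroup H] [InnerProductSpace ℝ H] where
  τ : ℝ → H →ₗᵢ[ℝ] H
  map_zero' : ∀ x, τ 0 x = x
  map_add' : ∀ s t x, τ (s + t) x = τ s (τ t x)
  continuous' : ∀ x, Continuous fun s => τ s x

namespace IsometryFlow

variable {H : Type*} [NormedAddCommGroup H] [InnerProductSpace ℝ H]
variable (G : IsometryFlow H)

theorem inner_τ (s : ℝ) (x y : H) : inner ℝ (G.τ s x) y = inner ℝ x (G.τ (-s) y) := by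
  rw [← (G.τ s).inner_map_map x, ← G.map_add', add_neg_cancel, G.map_zero']

theorem hasDerivAt_of_zero {y y' : H} (h : HasDerivAt (fun s => G.τ s y) y' 0) (t : ℝ) :
    HasDerivAt (fun s => G.τ s y) (G.τ t y') t := by
  have h1 : HasDerivAt (fun s => G.τ (s - t) y) y' t := by
    have h2 : HasDerivAt (fun s => G.τ s y) y' (t - t) := by rwa [sub_self]
    simpa using h2.comp_sub_const t t
  have h3 := ((G.τ t).toContinuousLinearMap.hasFDerivAt).comp_hasDerivAt t h1
  refine h3.congr_of_eventuallyEq (Eventually.of_forall fun s => ?_)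
  simp only [Function.comp, LinearIsometry.coe_toContinuousLinearMap]
  rw [← G.map_add']; congr 2; ring

theorem intervalIntegrable (x : H) (a b : ℝ) :
    IntervalIntegrable (fun s => G.τ s x) volume a b :=
  (G.continuous' x).intervalIntegrable a b

/-- The symmetric difference quotient. -/
noncomputable def diff (δ : ℝ) : H →L[ℝ] H :=
  (2 * δ)⁻¹ • ((G.τ δ).toContinuousLinearMap - (G.τ (-δ)).toContinuousLinearMap)

theorem diff_apply (δ : ℝ) (x : H) : G.diff δ x = (2 * δ)⁻¹ • (G.τ δ x - G.τ (-δ) x) := rfl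

theorem norm_diff_le {δ : ℝ} (hδ : 0 < δ) (x : H) : ‖G.diff δ x‖ ≤ δ⁻¹ * ‖x‖ := by
  rw [diff_apply, norm_smul, Real.norm_eq_abs, abs_of_pos (by positivity)]
  have : ‖G.τ δ x - G.τ (-δ) x‖ ≤ 2 * ‖x‖ := by
    refine (norm_sub_le _ _).trans ?_
    rw [LinearIsometry.norm_map, LinearIsometry.norm_map]; linarith
  calc (2 * δ)⁻¹ * ‖G.τ δ x - G.τ (-δ) x‖ ≤ (2 * δ)⁻¹ * (2 * ‖x‖) := by gcongr
    _ = δ⁻¹ * ‖x‖ := by field_simp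

theorem inner_diff (δ : ℝ) (x y : H) :
    inner ℝ (G.diff δ x) y = - inner ℝ x (G.diff δ y) := by
  simp only [diff_apply, inner_smul_left, inner_smul_right, inner_sub_left, inner_sub_right,
    G.inner_τ, neg_neg, RCLike.conj_to_real]
  ring

/-- The average over `[-δ, δ]` along the flow. -/
noncomputable def avg (δ : ℝ) : H →L[ℝ] H :=
  LinearMap.mkContinuous
    { toFun := fun x => (2 * δ)⁻¹ • ∫ s in -δ..δ, G.τ s x
      map_add' := fun x y => by
        simp only [map_add]
        rw [intervalIntegral.integral_add (G.intervalIntegrable _ _ _)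
          (G.intervalIntegrable _ _ _), smul_add]
      map_smul' := fun c x => by
        simp only [map_smul, intervalIntegral.integral_smul, RingHom.id_apply]
        rw [smul_comm] } 1 (fun x => by
      simp only [LinearMap.coe_mk, AddHom.coe_mk, norm_smul]
      have h := intervalIntegral.norm_integral_le_of_norm_le_const (a := -δ) (b := δ)
        (f := fun s => G.τ s x) (C := ‖x‖) (fun s _ => by rw [LinearIsometry.norm_map])
      have e : δ - -δ = 2 * δ := by ring
      rw [e] at h
      refine (mul_le_mul_of_nonneg_left h (norm_nonneg _)).trans ?_
      rw [norm_inv, Real.norm_eq_abs]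
      by_cases hd : |2 * δ| = 0
      · rw [hd]; simp
      · rw [one_mul]
        exact le_of_eq (by field_simp))

theorem avg_apply (δ : ℝ) (x : H) : G.avg δ x = (2 * δ)⁻¹ • ∫ s in -δ..δ, G.τ s x := rfl

theorem norm_avg_le (δ : ℝ) (x : H) : ‖G.avg δ x‖ ≤ ‖x‖ := by
  have h : ‖G.avg δ‖ ≤ 1 := LinearMap.mkContinuous_norm_le _ zero_le_one _
  simpa using (G.avg δ).le_of_opNorm_le h x

variable {G}

theorem diff_comm {M : H →L[ℝ] H} (hM : ∀ s x, M (G.τ s x) = G.τ s (M x)) (δ : ℝ) (x : H) :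
    M (G.diff δ x) = G.diff δ (M x) := by
  simp only [diff_apply, map_smul, map_sub, hM]

variable [CompleteSpace H]

theorem clm_avg {E : Type*} [NormedAddCommGroup E] [NormedSpace ℝ E] [CompleteSpace E]
    (L : H →L[ℝ] E) (δ : ℝ) (x : H) :
    L (G.avg δ x) = (2 * δ)⁻¹ • ∫ s in -δ..δ, L (G.τ s x) := by
  rw [avg_apply, map_smul,
    ContinuousLinearMap.intervalIntegral_comp_comm L (G.intervalIntegrable x _ _)]

theorem avg_comm {M : H →L[ℝ] H} (hM : ∀ s x, M (G.τ s x) = G.τ s (M x)) (δ : ℝ) (x : H) :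
    M (G.avg δ x) = G.avg δ (M x) := by
  rw [clm_avg, avg_apply]; simp only [hM]

theorem inner_avg_right (δ : ℝ) (x y : H) :
    inner ℝ x (G.avg δ y) = (2 * δ)⁻¹ * ∫ s in -δ..δ, inner ℝ x (G.τ s y) := by
  exact clm_avg (G := G) (innerSL ℝ x) δ y

theorem inner_avg (δ : ℝ) (x y : H) : inner ℝ (G.avg δ x) y = inner ℝ x (G.avg δ y) := by
  rw [real_inner_comm, inner_avg_right, inner_avg_right]
  congr 1
  have h := intervalIntegral.integral_comp_neg (a := -δ) (b := δ)
    (fun s => inner ℝ x (G.τ s y))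
  rw [neg_neg] at h
  rw [← h]
  refine intervalIntegral.integral_congr fun s _ => ?_
  rw [real_inner_comm, G.inner_τ]

/-- The fundamental theorem of calculus along the flow: averaging exchanges a derivative for a
bounded difference quotient. This replaces mollification throughout. -/
theorem avg_deriv {δ : ℝ} {y y' : H} (h : HasDerivAt (fun s => G.τ s y) y' 0) :
    G.avg δ y' = G.diff δ y := by
  rw [avg_apply, diff_apply]
  congr 1
  exact intervalIntegral.integral_eq_sub_of_hasDerivAt
    (fun s _ => G.hasDerivAt_of_zero h s) (G.intervalIntegrable _ _ _)

theorem avg_tendsto {δ : ℕ → ℝ} (hδ : ∀ n, 0 < δ n) (hlim : Tendsto δ atTop (𝓝 0)) (x : H) :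
    Tendsto (fun n => G.avg (δ n) x) atTop (𝓝 x) := by
  rw [Metric.tendsto_atTop]
  intro ε hε
  have hc : ContinuousAt (fun s => G.τ s x) 0 := (G.continuous' x).continuousAt
  obtain ⟨η, hη, hηx⟩ := Metric.continuousAt_iff.1 hc (ε / 2) (by positivity)
  obtain ⟨N, hN⟩ := Metric.tendsto_atTop.1 hlim η hη
  refine ⟨N, fun n hn => ?_⟩
  have hn' := hN n hn
  rw [Real.dist_eq, sub_zero, abs_of_pos (hδ n)] at hn'
  have hδn := hδ n
  have e : G.avg (δ n) x - x = (2 * δ n)⁻¹ • ∫ s in -(δ n)..(δ n), (G.τ s x - x) := by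
    rw [intervalIntegral.integral_sub (G.intervalIntegrable _ _ _)
      intervalIntegrable_const, intervalIntegral.integral_const, smul_sub, smul_smul, avg_apply]
    have : (2 * δ n)⁻¹ * (δ n - -δ n) = 1 := by field_simp; ring
    rw [this, one_smul]
  have hb : ‖∫ s in -(δ n)..(δ n), (G.τ s x - x)‖ ≤ ε / 2 * |δ n - -δ n| := by
    refine intervalIntegral.norm_integral_le_of_norm_le_const fun s hs => ?_
    rw [Set.uIoc_of_le (by linarith)] at hs
    have := @hηx s (by
      rw [Real.dist_eq, sub_zero, abs_lt]; constructor <;> linarith [hs.1, hs.2])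
    rw [G.map_zero', dist_eq_norm] at this
    exact this.le
  rw [dist_eq_norm, e, norm_smul, Real.norm_eq_abs, abs_of_pos (by positivity)]
  rw [abs_of_pos (by linarith)] at hb
  calc (2 * δ n)⁻¹ * ‖∫ s in -(δ n)..(δ n), (G.τ s x - x)‖
      ≤ (2 * δ n)⁻¹ * (ε / 2 * (δ n - -δ n)) := by gcongr
    _ = ε / 2 := by field_simp; ring
    _ < ε := by linarith

theorem avg_avg_tendsto {δ : ℕ → ℝ} (hδ : ∀ n, 0 < δ n) (hlim : Tendsto δ atTop (𝓝 0)) (x : H) :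
    Tendsto (fun n => G.avg (δ n) (G.avg (δ n) x)) atTop (𝓝 x) := by
  have h := avg_tendsto (G := G) hδ hlim x
  have h0 : Tendsto (fun n => G.avg (δ n) (G.avg (δ n) x - x)) atTop (𝓝 0) := by
    refine squeeze_zero_norm (fun n => G.norm_avg_le (δ n) _) ?_
    have := (h.sub_const x).norm
    simpa using this
  have := h0.add h
  simpa using this

theorem inner_sum_avg {ι : Type*} (s : Finset ι) {a y : H} {b z : ι → H}
    (h : ∀ r, inner ℝ a (G.τ r y) + ∑ j ∈ s, inner ℝ (b j) (G.τ r (z j)) = 0) (δ : ℝ) :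
    inner ℝ a (G.avg δ y) + ∑ j ∈ s, inner ℝ (b j) (G.avg δ (z j)) = 0 := by
  have hint : ∀ u w : H, IntervalIntegrable (fun r => inner ℝ u (G.τ r w)) volume (-δ) δ :=
    fun u w => (continuous_const.inner (G.continuous' w)).intervalIntegrable _ _
  simp only [inner_avg_right]
  have h2 := intervalIntegral.integral_add (hint a y)
    (IntervalIntegrable.sum s fun j _ => hint (b j) (z j))
  simp only [Finset.sum_apply] at h2
  rw [← Finset.mul_sum, ← intervalIntegral.integral_finsetSum fun j _ => hint _ _, ← mul_add,
    ← h2]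
  simp [h]

/-- A substitute for ∫ (f, M ∂f) = 0 when f is merely in L²: averages are self-adjoint, difference
quotients are antisymmetric, and all commute with M, so the form equals its negative. -/
theorem inner_diff_avg_eq_zero {M : H →L[ℝ] H} (hM : ∀ s x, M (G.τ s x) = G.τ s (M x))
    (hs : ∀ x y, inner ℝ (M x) y = inner ℝ x (M y)) (δ : ℝ) (x : H) :
    inner ℝ x (M (G.diff δ (G.avg δ x))) = 0 := by
  have hc : G.diff δ (G.avg δ x) = G.avg δ (G.diff δ x) := by
    refine avg_comm (M := G.diff δ) (fun s y => ?_) δ x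
    simp only [diff_apply, map_smul, map_sub, ← G.map_add', add_comm]
  have h1 : inner ℝ x (M (G.diff δ (G.avg δ x))) = - inner ℝ x (M (G.diff δ (G.avg δ x))) := by
    conv_lhs => rw [← hs, ← neg_neg (inner ℝ (M x) _), ← G.inner_diff, ← inner_avg,
      ← diff_comm hM, ← avg_comm hM, ← hc]
    rw [real_inner_comm]
  linarith

end IsometryFlow

/-! ### Density of the range by anisotropic averaging. -/

section DenseRange

open IsometryFlow

variable {H : Type*} [NormedAddCommGroup H] [InnerProductSpace ℝ H] [CompleteSpace H]

/-- Uniqueness for the weak form of `M y + ε ∑ N_j ∂_j y = 0`, where `N₀` commutes with all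
translations and `M`, `N_j` commute with those along the directions `1` and `2`. -/
theorem eq_zero_of_orthogonal_range (G : Fin 3 → IsometryFlow H)
    (hG : ∀ i j s t x, (G i).τ s ((G j).τ t x) = (G j).τ t ((G i).τ s x))
    (M : H →L[ℝ] H) (N : Fin 3 → H →L[ℝ] H)
    (hN : ∀ j x y, inner ℝ (N j x) y = inner ℝ x (N j y))
    (hM0 : ∀ x, inner ℝ x (M x) = 0 → x = 0)
    (hMs : ∀ x y, inner ℝ (M x) y = inner ℝ x (M y))
    (hMτ : ∀ i, i ≠ 0 → ∀ s x, M ((G i).τ s x) = (G i).τ s (M x))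
    (hNτ : ∀ i j, i ≠ 0 ∨ j = 0 → ∀ s x, N j ((G i).τ s x) = (G i).τ s (N j x))
    {S : Set H} (hS : Dense S) (D : Fin 3 → H → H)
    (hD : ∀ j, ∀ y ∈ S, HasDerivAt (fun s => (G j).τ s y) (D j y) 0)
    (ε : ℝ) {f : H}
    (hf : ∀ y ∈ S, ∀ r : Fin 3 → ℝ,
      inner ℝ f (M ((G 0).τ (r 0) ((G 1).τ (r 1) ((G 2).τ (r 2) y)))) + ∑ j, ε *
        inner ℝ f (N j ((G 0).τ (r 0) ((G 1).τ (r 1) ((G 2).τ (r 2) (D j y))))) = 0) :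
    f = 0 := by
  have aa : ∀ i j δ η x, (G i).avg δ ((G j).avg η x) = (G j).avg η ((G i).avg δ x) := by
    intro i j δ η x
    refine avg_comm (G := G j) (M := (G i).avg δ) (fun s y => ?_) η x
    exact ((avg_comm (G := G i) (M := ((G j).τ s).toContinuousLinearMap)
      (fun t z => hG j i s t z) δ y)).symm
  have ad : ∀ i j δ η x, (G i).avg δ ((G j).diff η x) = (G j).diff η ((G i).avg δ x) := by
    intro i j δ η x
    refine diff_comm (G := G j) (M := (G i).avg δ) (fun s y => ?_) η x
    exact ((avg_comm (G := G i) (M := ((G j).τ s).toContinuousLinearMap)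
      (fun t z => hG j i s t z) δ y)).symm
  -- The orthogonality relations are integrated over the shifts, one direction at a time.
  have havg : ∀ y ∈ S, ∀ δ : Fin 3 → ℝ,
      inner ℝ f (M ((G 0).avg (δ 0) ((G 1).avg (δ 1) ((G 2).avg (δ 2) y)))) + ∑ j, ε *
        inner ℝ f (N j ((G 0).avg (δ 0) ((G 1).avg (δ 1) ((G 2).avg (δ 2) (D j y))))) = 0 := by
    intro y hy δ
    have e : ∀ w : H → H,
        (inner ℝ f (M (w y)) + ∑ j, ε * inner ℝ f (N j (w (D j y))) = 0) ↔
        (inner ℝ (M f) (w y) + ∑ j, inner ℝ (ε • N j f) (w (D j y)) = 0) := by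
      intro w
      simp only [hMs, inner_smul_left, hN, RCLike.conj_to_real]
    rw [e (fun x => (G 0).avg (δ 0) ((G 1).avg (δ 1) ((G 2).avg (δ 2) x)))]
    refine inner_sum_avg _ (fun r0 => ?_) _
    have e0 := e (fun x => (G 0).τ r0 ((G 1).avg (δ 1) ((G 2).avg (δ 2) x)))
    have c1 : ∀ x, (G 0).τ r0 ((G 1).avg (δ 1) x) = (G 1).avg (δ 1) ((G 0).τ r0 x) := fun x =>
      avg_comm (M := ((G 0).τ r0).toContinuousLinearMap) (fun t z => hG 0 1 r0 t z) (δ 1) x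
    have c2 : ∀ x, (G 0).τ r0 ((G 2).avg (δ 2) x) = (G 2).avg (δ 2) ((G 0).τ r0 x) := fun x =>
      avg_comm (M := ((G 0).τ r0).toContinuousLinearMap) (fun t z => hG 0 2 r0 t z) (δ 2) x
    simp only [c1, c2]
    refine inner_sum_avg _ (fun r1 => ?_) _
    have c3 : ∀ x, (G 1).τ r1 ((G 2).avg (δ 2) x) = (G 2).avg (δ 2) ((G 1).τ r1 x) := fun x =>
      avg_comm (M := ((G 1).τ r1).toContinuousLinearMap) (fun t z => hG 1 2 r1 t z) (δ 2) x
    simp only [c3]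
    refine inner_sum_avg _ (fun r2 => ?_) _
    have h := (e (fun x => (G 0).τ r0 ((G 1).τ r1 ((G 2).τ r2 x)))).1 (hf y hy ![r0, r1, r2])
    rw [← h]
    simp only [hG 2 1 r2 r1, hG 2 0 r2 r0, hG 1 0 r1 r0]
  -- All derivatives have become bounded difference quotients. The relation is therefore continuous
  -- in y and holds on the whole space, so that y may be built from f itself.
  have hall : ∀ δ : Fin 3 → ℝ, ∀ y,
      inner ℝ f (M ((G 0).avg (δ 0) ((G 1).avg (δ 1) ((G 2).avg (δ 2) y))))
      + ε * (inner ℝ f (N 0 ((G 0).diff (δ 0) ((G 1).avg (δ 1) ((G 2).avg (δ 2) y))))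
      + inner ℝ f (N 1 ((G 0).avg (δ 0) ((G 1).diff (δ 1) ((G 2).avg (δ 2) y))))
      + inner ℝ f (N 2 ((G 0).avg (δ 0) ((G 1).avg (δ 1) ((G 2).diff (δ 2) y))))) = 0 := by
    intro δ y
    refine hS.induction (P := fun y => inner ℝ f (M ((G 0).avg (δ 0) ((G 1).avg (δ 1)
      ((G 2).avg (δ 2) y))))
      + ε * (inner ℝ f (N 0 ((G 0).diff (δ 0) ((G 1).avg (δ 1) ((G 2).avg (δ 2) y))))
      + inner ℝ f (N 1 ((G 0).avg (δ 0) ((G 1).diff (δ 1) ((G 2).avg (δ 2) y))))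
      + inner ℝ f (N 2 ((G 0).avg (δ 0) ((G 1).avg (δ 1) ((G 2).diff (δ 2) y))))) = 0)
      (fun y hy => ?_) (isClosed_eq (by fun_prop) continuous_const) y
    have h := havg y hy δ
    rw [Fin.sum_univ_three] at h
    have d0 : (G 0).avg (δ 0) ((G 1).avg (δ 1) ((G 2).avg (δ 2) (D 0 y)))
        = (G 0).diff (δ 0) ((G 1).avg (δ 1) ((G 2).avg (δ 2) y)) := by
      rw [aa 0 1, aa 0 2, avg_deriv (hD 0 y hy), ad 2 0, ad 1 0]
    have d1 : (G 0).avg (δ 0) ((G 1).avg (δ 1) ((G 2).avg (δ 2) (D 1 y)))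
        = (G 0).avg (δ 0) ((G 1).diff (δ 1) ((G 2).avg (δ 2) y)) := by
      rw [aa 1 2, avg_deriv (hD 1 y hy), ad 2 1]
    have d2 : (G 0).avg (δ 0) ((G 1).avg (δ 1) ((G 2).avg (δ 2) (D 2 y)))
        = (G 0).avg (δ 0) ((G 1).avg (δ 1) ((G 2).diff (δ 2) y)) := by
      rw [avg_deriv (hD 2 y hy)]
    rw [d0, d1, d2] at h
    linarith
  let u : ℕ → ℝ := fun n => 1 / ((n : ℝ) + 1)
  have hu : ∀ n, 0 < u n := fun n => by simp only [u]; positivity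
  have hlim : Tendsto u atTop (𝓝 0) := tendsto_one_div_add_atTop_nhds_zero_nat
  -- The tangential scale δ stays fixed while the normal scale tends to 0. The operators M, N 1, N 2
  -- need not commute with normal translations, but no normal derivative goes with them, so the
  -- normal averages simply disappear in the limit.
  have hzero : ∀ δ : ℝ, (G 1).avg δ ((G 2).avg δ f) = 0 := by
    intro δ
    set g := (G 1).avg δ ((G 2).avg δ f) with hg
    refine hM0 g ?_
    have t0 : Tendsto (fun n => inner ℝ g (M ((G 0).avg (u n) ((G 0).avg (u n) g)))) atTop
        (𝓝 (inner ℝ g (M g))) :=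
      tendsto_const_nhds.inner ((M.continuous.tendsto _).comp (avg_avg_tendsto hu hlim g))
    have t1 : Tendsto (fun n => inner ℝ f (N 1 ((G 0).avg (u n) ((G 0).avg (u n)
        ((G 1).diff δ ((G 2).avg δ g)))))) atTop
        (𝓝 (inner ℝ f (N 1 ((G 1).diff δ ((G 2).avg δ g))))) :=
      tendsto_const_nhds.inner (((N 1).continuous.tendsto _).comp (avg_avg_tendsto hu hlim _))
    have t2 : Tendsto (fun n => inner ℝ f (N 2 ((G 0).avg (u n) ((G 0).avg (u n)
        ((G 1).avg δ ((G 2).diff δ g)))))) atTop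
        (𝓝 (inner ℝ f (N 2 ((G 1).avg δ ((G 2).diff δ g))))) :=
      tendsto_const_nhds.inner (((N 2).continuous.tendsto _).comp (avg_avg_tendsto hu hlim _))
    have z1 : inner ℝ f (N 1 ((G 1).diff δ ((G 2).avg δ g))) = 0 := by
      have e : N 1 ((G 1).diff δ ((G 2).avg δ g))
          = (G 2).avg δ (N 1 ((G 1).diff δ ((G 1).avg δ ((G 2).avg δ f)))) := by
        rw [← ad 2 1, avg_comm (G := G 2) (hNτ 2 1 (by simp))]
      rw [e, ← inner_avg]
      exact inner_diff_avg_eq_zero (hNτ 1 1 (by simp)) (hN 1) δ _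
    have z2 : inner ℝ f (N 2 ((G 1).avg δ ((G 2).diff δ g))) = 0 := by
      have e : N 2 ((G 1).avg δ ((G 2).diff δ g))
          = (G 1).avg δ (N 2 ((G 2).diff δ ((G 2).avg δ ((G 1).avg δ f)))) := by
        rw [avg_comm (G := G 1) (hNτ 1 2 (by simp)), hg, aa 1 2]
      rw [e, ← inner_avg]
      exact inner_diff_avg_eq_zero (hNτ 2 2 (by simp)) (hN 2) δ _
    rw [z1] at t1
    rw [z2] at t2
    have hsum := t0.add ((t1.add t2).const_mul ε)
    have hval : ∀ n, inner ℝ g (M ((G 0).avg (u n) ((G 0).avg (u n) g)))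
        + ε * (inner ℝ f (N 1 ((G 0).avg (u n) ((G 0).avg (u n)
        ((G 1).diff δ ((G 2).avg δ g)))))
        + inner ℝ f (N 2 ((G 0).avg (u n) ((G 0).avg (u n)
        ((G 1).avg δ ((G 2).diff δ g)))))) = 0 := by
      intro n
      have h := hall ![u n, δ, δ] ((G 0).avg (u n) g)
      simp only [Matrix.cons_val_zero, Matrix.cons_val_one, Matrix.cons_val] at h
      have e0 : inner ℝ f (M ((G 0).avg (u n) ((G 1).avg δ ((G 2).avg δ ((G 0).avg (u n) g)))))
          = inner ℝ g (M ((G 0).avg (u n) ((G 0).avg (u n) g))) := by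
        rw [aa 0 1, aa 0 2, avg_comm (G := G 1) (hMτ 1 (by simp)),
          avg_comm (G := G 2) (hMτ 2 (by simp)), ← inner_avg, ← inner_avg, aa 2 1]
      -- The only term with a normal difference quotient is unbounded as the scale shrinks; it
      -- vanishes for every n because N 0 commutes with all translations.
      have e1 : inner ℝ f (N 0 ((G 0).diff (u n) ((G 1).avg δ ((G 2).avg δ
          ((G 0).avg (u n) g))))) = 0 := by
        rw [← ad 1 0, ← ad 2 0, avg_comm (G := G 1) (hNτ 1 0 (by simp)),
          avg_comm (G := G 2) (hNτ 2 0 (by simp)), ← inner_avg, ← inner_avg, aa 2 1]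
        exact inner_diff_avg_eq_zero (hNτ 0 0 (by simp)) (hN 0) (u n) _
      have e2 : (G 1).diff δ ((G 2).avg δ ((G 0).avg (u n) g))
          = (G 0).avg (u n) ((G 1).diff δ ((G 2).avg δ g)) := by
        rw [ad 0 1, aa 0 2]
      have e3 : (G 1).avg δ ((G 2).diff δ ((G 0).avg (u n) g))
          = (G 0).avg (u n) ((G 1).avg δ ((G 2).diff δ g)) := by
        rw [aa 0 1 (u n) δ ((G 2).diff δ g), ad 0 2 (u n) δ g]
      rw [e0, e1, e2, e3] at h
      linarith
    have := tendsto_nhds_unique hsum (by simp only [hval]; exact tendsto_const_nhds)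
    simpa using this
  have h1 := avg_tendsto (G := G 1) hu hlim f
  have h2 := avg_tendsto (G := G 2) hu hlim f
  have h3 : Tendsto (fun n => (G 1).avg (u n) ((G 2).avg (u n) f - f)) atTop (𝓝 0) := by
    refine squeeze_zero_norm (fun n => (G 1).norm_avg_le (u n) _) ?_
    simpa using (h2.sub_const f).norm
  have h4 := h3.add h1
  simp only [map_sub, hzero, zero_sub, neg_add_cancel, zero_add] at h4
  exact tendsto_nhds_unique h4 tendsto_const_nhds

end DenseRange

/-! ### Translations in L². -/

section TranslationFlow

variable {n : ℕ} {E : Type*} [NormedAddCommGroup E] [InnerProductSpace ℝ E]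

/-- The isometries `f ↦ f (· + s w)` of `L²(ℝⁿ)`. -/
noncomputable def transFlow (w : Fin n → ℝ) :
    IsometryFlow (Lp E 2 (volume : Measure (Fin n → ℝ))) where
  τ s := Lp.compMeasurePreservingₗᵢ ℝ (fun x => x + s • w)
    (measurePreserving_add_right volume (s • w))
  map_zero' f := by
    refine Lp.ext ?_
    filter_upwards [Lp.coeFn_compMeasurePreserving f
      (measurePreserving_add_right volume ((0 : ℝ) • w))] with x hx
    refine hx.trans ?_
    simp
  map_add' s t f := by
    refine Lp.ext ?_
    have h1 := Lp.coeFn_compMeasurePreserving f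
      (measurePreserving_add_right volume ((s + t) • w))
    have h2 := Lp.coeFn_compMeasurePreserving f (measurePreserving_add_right volume (t • w))
    have h3 := Lp.coeFn_compMeasurePreserving
      (Lp.compMeasurePreserving _ (measurePreserving_add_right volume (t • w)) f)
      (measurePreserving_add_right volume (s • w))
    have h4 := (measurePreserving_add_right volume (s • w)).quasiMeasurePreserving.ae h2
    filter_upwards [h1, h3, h4] with x e1 e3 e4
    refine e1.trans (Eq.trans ?_ e3.symm)
    refine Eq.trans ?_ e4.symm
    simp only [Function.comp, add_smul, add_assoc]
  continuous' f := by
    refine Continuous.compMeasurePreservingLp (X := Fin n → ℝ) (Y := Fin n → ℝ)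
      (g := fun s : ℝ => (⟨fun x => x + s • w, by fun_prop⟩ : C(Fin n → ℝ, Fin n → ℝ)))
      (f := fun _ => f) continuous_const ?_
      (fun s => measurePreserving_add_right volume (s • w)) (by simp)
    exact ContinuousMap.continuous_of_continuous_uncurry _ (by dsimp [Function.uncurry]; fun_prop)

theorem transFlow_coeFn (w : Fin n → ℝ) (s : ℝ) (f : Lp E 2 (volume : Measure (Fin n → ℝ))) :
    (transFlow w).τ s f =ᵐ[volume] fun x => f (x + s • w) :=
  Lp.coeFn_compMeasurePreserving f (measurePreserving_add_right volume (s • w))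

theorem transFlow_comm (v w : Fin n → ℝ) (s t : ℝ) (f : Lp E 2 (volume : Measure (Fin n → ℝ))) :
    (transFlow v).τ s ((transFlow w).τ t f) = (transFlow w).τ t ((transFlow v).τ s f) := by
  refine Lp.ext ?_
  have h1 := transFlow_coeFn v s ((transFlow w).τ t f)
  have h2 := transFlow_coeFn w t ((transFlow v).τ s f)
  have h3 := (measurePreserving_add_right volume (s • v)).quasiMeasurePreserving.ae
    (transFlow_coeFn w t f)
  have h4 := (measurePreserving_add_right volume (t • w)).quasiMeasurePreserving.ae
    (transFlow_coeFn v s f)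
  filter_upwards [h1, h2, h3, h4] with x e1 e2 e3 e4
  rw [e1, e2, e3, e4]
  congr 1; abel

theorem transFlow_toLp (w : Fin n → ℝ) (s : ℝ) {g : (Fin n → ℝ) → E} (hg : MemLp g 2 volume) :
    (transFlow w).τ s (hg.toLp g) = (hg.comp_measurePreserving
      (measurePreserving_add_right volume (s • w))).toLp (fun x => g (x + s • w)) := by
  exact Lp.toLp_compMeasurePreserving hg (measurePreserving_add_right volume (s • w))

/-- A compactly supported function that is Lipschitz in the direction `w` and differentiable in
this direction almost everywhere is differentiable along the translations of `L²`. -/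
theorem hasDerivAt_transFlow {w : Fin n → ℝ} {g g' : (Fin n → ℝ) → E}
    (hg : MemLp g 2 volume) (hg' : MemLp g' 2 volume) {K : Set (Fin n → ℝ)} (hK : IsCompact K)
    (hsupp : ∀ x, x ∉ K → g x = 0) {C : ℝ} (hLip : ∀ x s, ‖g (x + s • w) - g x‖ ≤ C * |s|)
    (hd : ∀ᵐ x, HasDerivAt (fun s : ℝ => g (x + s • w)) (g' x) 0) :
    HasDerivAt (fun s => (transFlow w).τ s (hg.toLp g)) (hg'.toLp g') 0 := by
  rw [hasDerivAt_iff_tendsto_slope_zero]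
  have hC : 0 ≤ C := by
    have := (norm_nonneg _).trans (hLip 0 1)
    simpa using this
  have hmem : ∀ s : ℝ, MemLp (fun x => s⁻¹ • (g (x + s • w) - g x) - g' x) 2 volume := fun s =>
    (((hg.comp_measurePreserving (measurePreserving_add_right volume (s • w))).sub hg).const_smul
      s⁻¹).sub hg'
  have heq : ∀ s : ℝ, s⁻¹ • ((transFlow w).τ (0 + s) (hg.toLp g) - (transFlow w).τ 0 (hg.toLp g))
      - hg'.toLp g' = (hmem s).toLp _ := by
    intro s
    rw [zero_add, (transFlow w).map_zero', transFlow_toLp, ← MemLp.toLp_sub,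
      ← MemLp.toLp_const_smul, ← MemLp.toLp_sub]
    rfl
  rw [tendsto_iff_norm_sub_tendsto_zero]
  simp only [heq, Lp.norm_toLp]
  suffices key : Tendsto (fun s : ℝ => eLpNorm (fun x => s⁻¹ • (g (x + s • w) - g x) - g' x) 2
      volume) (𝓝[≠] 0) (𝓝 0) by
    simpa [Function.comp_def] using (ENNReal.tendsto_toReal ENNReal.zero_ne_top).comp key
  -- The thickening contains the supports of all shifts with |s| ≤ 1.
  let K' := Metric.cthickening ‖w‖ K
  have hK' : IsCompact K' := hK.cthickening
  have hb : ∀ s : ℝ, |s| ≤ 1 → ∀ x, x ∉ K' → g (x + s • w) = 0 := by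
    intro s hs x hx
    refine hsupp _ fun hmem => hx ?_
    refine Metric.mem_cthickening_of_dist_le x (x + s • w) _ _ hmem ?_
    rw [dist_eq_norm, sub_add_cancel_left, norm_neg, norm_smul, Real.norm_eq_abs]
    exact mul_le_of_le_one_left (norm_nonneg _) hs
  have hlim : ∀ᵐ x, Tendsto (fun s : ℝ => s⁻¹ • (g (x + s • w) - g x)) (𝓝[≠] 0) (𝓝 (g' x)) := by
    filter_upwards [hd] with x hx
    rw [hasDerivAt_iff_tendsto_slope_zero] at hx
    simpa using hx
  have hnear : ∀ᶠ s : ℝ in 𝓝[≠] 0, |s| ≤ 1 ∧ s ≠ 0 := by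
    refine Filter.Eventually.and ?_ self_mem_nhdsWithin
    have : ∀ᶠ s : ℝ in 𝓝 0, |s| < 1 := by
      have := (continuous_abs (G := ℝ)).continuousAt.tendsto.eventually
        (gt_mem_nhds (show |(0 : ℝ)| < 1 by simp))
      exact this
    exact (this.filter_mono nhdsWithin_le_nhds).mono fun s hs => hs.le
  have hbound : ∀ s : ℝ, |s| ≤ 1 ∧ s ≠ 0 → ∀ x,
      ‖s⁻¹ • (g (x + s • w) - g x)‖ ≤ K'.indicator (fun _ => C) x := by
    rintro s ⟨hs, hs0⟩ x
    by_cases hx : x ∈ K'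
    · rw [Set.indicator_of_mem hx, norm_smul, norm_inv, Real.norm_eq_abs,
        inv_mul_le_iff₀ (abs_pos.2 hs0), mul_comm]
      exact hLip x s
    · have h0 := hb 0 (by simp) x hx
      rw [zero_smul, add_zero] at h0
      rw [Set.indicator_of_notMem hx, hb s hs x hx, h0]; simp
  have hbound' : ∀ᵐ x, ‖g' x‖ ≤ K'.indicator (fun _ => C) x := by
    filter_upwards [hlim] with x hx
    exact le_of_tendsto hx.norm (hnear.mono fun s hs => hbound s hs x)
  -- The majorant: difference quotient and derivative are each at most C on K' and vanish outside.
  have hfin : MemLp (K'.indicator (fun _ => 2 * C)) 2 (volume : Measure (Fin n → ℝ)) :=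
    memLp_indicator_const 2 hK'.measurableSet (2 * C) (Or.inr hK'.measure_lt_top.ne)
  simp only [eLpNorm_eq_lintegral_rpow_enorm_toReal (two_ne_zero) ENNReal.ofNat_ne_top]
  simp only [ENNReal.toReal_ofNat]
  suffices key : Tendsto (fun s : ℝ => ∫⁻ x, ‖s⁻¹ • (g (x + s • w) - g x) - g' x‖ₑ ^ (2 : ℝ))
      (𝓝[≠] 0) (𝓝 (∫⁻ _ : Fin n → ℝ, 0)) by
    have h1 := ((ENNReal.continuous_rpow_const (y := 1 / (2 : ℝ))).tendsto _).comp key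
    simpa [Function.comp_def] using h1
  refine tendsto_lintegral_filter_of_dominated_convergence'
    (fun x => ‖K'.indicator (fun _ => 2 * C) x‖ₑ ^ (2 : ℝ)) ?_ ?_ ?_ ?_
  · exact Eventually.of_forall fun s => ((hmem s).1.enorm.pow_const _)
  · filter_upwards [hnear] with s hs
    filter_upwards [hbound'] with x hx
    refine ENNReal.rpow_le_rpow ?_ (by norm_num)
    rw [← ofReal_norm, ← ofReal_norm]
    refine ENNReal.ofReal_le_ofReal ?_
    refine (norm_sub_le _ _).trans ?_
    have h1 := hbound s hs x
    by_cases hxK : x ∈ K'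
    · rw [Set.indicator_of_mem hxK] at *
      rw [Real.norm_eq_abs, abs_of_nonneg (by positivity)]
      linarith
    · rw [Set.indicator_of_notMem hxK] at *
      simp only [norm_zero]; linarith
  · have := (lintegral_rpow_enorm_lt_top_of_eLpNorm_lt_top two_ne_zero ENNReal.ofNat_ne_top
      hfin.2).ne
    simpa using this
  · filter_upwards [hlim] with x hx
    have h1 : Tendsto (fun s : ℝ => s⁻¹ • (g (x + s • w) - g x) - g' x) (𝓝[≠] 0) (𝓝 0) := by
      simpa using hx.sub_const (g' x)
    have h2 := ((ENNReal.continuous_rpow_const (y := (2 : ℝ))).tendsto _).comp h1.enorm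
    simpa [Function.comp_def, ENNReal.zero_rpow_of_pos] using h2

end TranslationFlow

/-! ### Algebra of the secondary symmetrization. -/

namespace RMHD
noncomputable section

/-- The secondary symmetrization: multiplying the test functions by
`(1 / Γ + λ Γ (v, H)) I - λ Γ kC` adds the conserved cross-helicity form. -/
def kC (e : ℝ → ℝ → ℝ) (U : State) : Matrix Idx Idx ℝ := fun i j =>
  match i, j with
  | .inl _, .inr (.inl l) => -(U.rho * enthalpy e U / U.Gam) * U.H l
  | .inr (.inl k), .inl _ => -(1 / (U.rho * aSq e U)) * U.b k
  | .inr (.inl k), .inr (.inl l) =>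
      U.vH * (1 : Matrix (Fin 3) (Fin 3) ℝ) k l - U.vH * U.v k * U.v l - 1 / U.Gam ^ 2 * U.H k * U.v l
  | .inr (.inl k), .inr (.inr (.inl l)) => calM U k l
  | .inr (.inr (.inl k)), .inl _ => U.v k
  | .inr (.inr (.inl k)), .inr (.inl l) => calA e U k l
  | .inr (.inr (.inl k)), .inr (.inr (.inl l)) =>
      -U.vH * (1 : Matrix (Fin 3) (Fin 3) ℝ) k l + U.vH * U.v k * U.v l
        + 1 / U.Gam ^ 2 * U.v k * U.H l + U.H k * U.v l
  | _, _ => 0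

theorem Gam_pos (U : State) : 0 < U.Gam := by
  unfold State.Gam
  refine Real.sqrt_pos.2 ?_
  have : 0 ≤ U.u ⬝ᵥ U.u := by
    simp only [dotProduct]; exact Finset.sum_nonneg fun i _ => mul_self_nonneg _
  linarith

theorem Gam_sq (U : State) : U.Gam ^ 2 * (1 - U.v ⬝ᵥ U.v) = 1 := by
  have h0 : 0 ≤ U.u ⬝ᵥ U.u := by
    simp only [dotProduct]; exact Finset.sum_nonneg fun i _ => mul_self_nonneg _
  have h1 : U.Gam ^ 2 = 1 + U.u ⬝ᵥ U.u := Real.sq_sqrt (by linarith)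
  have hG := (Gam_pos U).ne'
  have h2 : U.v ⬝ᵥ U.v = (U.u ⬝ᵥ U.u) / U.Gam ^ 2 := by
    simp only [State.v, dotProduct, Finset.sum_div]
    refine Finset.sum_congr rfl fun i _ => ?_
    rw [div_mul_div_comm, sq]
  rw [h2, mul_sub, mul_div_cancel₀ _ (pow_ne_zero 2 hG), h1]; ring

theorem u_eq (U : State) (i : Fin 3) : U.u i = U.Gam * U.v i := by
  have hG := (Gam_pos U).ne'
  simp only [State.v]; field_simp

theorem symm_of_blocks {M : Matrix Idx Idx ℝ}
    (hpu : ∀ k, M iP (iU k) = M (iU k) iP) (hph : ∀ k, M iP (iH k) = M (iH k) iP)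
    (hps : M iP iS = M iS iP)
    (huu : ∀ k l, k < l → M (iU k) (iU l) = M (iU l) (iU k))
    (huh : ∀ k l, M (iU k) (iH l) = M (iH l) (iU k))
    (hus : ∀ k, M (iU k) iS = M iS (iU k))
    (hhh : ∀ k l, k < l → M (iH k) (iH l) = M (iH l) (iH k))
    (hhs : ∀ k, M (iH k) iS = M iS (iH k)) : M.IsSymm := by
  have lift : ∀ f : Fin 3 → Fin 3 → ℝ, (∀ k l, k < l → f k l = f l k) → ∀ k l, f k l = f l k :=
    fun f hf k l => by
      rcases lt_trichotomy k l with h | h | h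
      · exact hf k l h
      · rw [h]
      · exact (hf l k h).symm
  replace huu := lift _ huu
  replace hhh := lift _ hhh
  refine Matrix.IsSymm.ext ?_
  rintro (⟨⟩ | k | k | ⟨⟩) (⟨⟩ | l | l | ⟨⟩)
  exacts [rfl, (hpu l).symm, (hph l).symm, hps.symm, hpu k, huu l k, (huh k l).symm, (hus k).symm,
    hph k, huh l k, hhh l k, (hhs k).symm, hps, hus l, hhs l, rfl]

section BlockMul

variable (s : ℝ) (r : Fin 3 → ℝ) (X Y Z : Matrix (Fin 3) (Fin 3) ℝ) (w : ℝ)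
  (N : Matrix Idx Idx ℝ) (j : Idx) (k : Fin 3)

theorem block_mul_p : (block s r X Y Z w * N) iP j = s * N iP j
    + (r 0 * N (iU 0) j + r 1 * N (iU 1) j + r 2 * N (iU 2) j) := by
  simp [Matrix.mul_apply, block, iP, iU, Fin.sum_univ_three]

theorem block_mul_u : (block s r X Y Z w * N) (iU k) j = r k * N iP j
    + (X k 0 * N (iU 0) j + X k 1 * N (iU 1) j + X k 2 * N (iU 2) j)
    + (Y 0 k * N (iH 0) j + Y 1 k * N (iH 1) j + Y 2 k * N (iH 2) j) := by
  simp [Matrix.mul_apply, block, iP, iU, iH, Fin.sum_univ_three]; ring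

theorem block_mul_h : (block s r X Y Z w * N) (iH k) j =
    (Y k 0 * N (iU 0) j + Y k 1 * N (iU 1) j + Y k 2 * N (iU 2) j)
    + (Z k 0 * N (iH 0) j + Z k 1 * N (iH 1) j + Z k 2 * N (iH 2) j) := by
  simp [Matrix.mul_apply, block, iU, iH, Fin.sum_univ_three]

theorem block_mul_s : (block s r X Y Z w * N) iS j = w * N iS j := by
  simp [Matrix.mul_apply, block, iS]

end BlockMul

section Coordinates

variable (e : ℝ → ℝ → ℝ) (U : State) (k l : Fin 3)

theorem kC_pp : kC e U iP iP = 0 := rfl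
theorem kC_pu : kC e U iP (iU l) = -(U.rho * enthalpy e U / U.Gam) * U.H l := rfl
theorem kC_ph : kC e U iP (iH l) = 0 := rfl
theorem kC_ps : kC e U iP iS = 0 := rfl
theorem kC_up : kC e U (iU k) iP = -(1 / (U.rho * aSq e U)) * U.b k := rfl
theorem kC_uu : kC e U (iU k) (iU l) = U.vH * (1 : Matrix (Fin 3) (Fin 3) ℝ) k l
    - U.vH * U.v k * U.v l - 1 / U.Gam ^ 2 * U.H k * U.v l := rfl
theorem kC_uh : kC e U (iU k) (iH l) = calM U k l := rfl
theorem kC_us : kC e U (iU k) iS = 0 := rfl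
theorem kC_hp : kC e U (iH k) iP = U.v k := rfl
theorem kC_hu : kC e U (iH k) (iU l) = calA e U k l := rfl
theorem kC_hh : kC e U (iH k) (iH l) = -U.vH * (1 : Matrix (Fin 3) (Fin 3) ℝ) k l
    + U.vH * U.v k * U.v l + 1 / U.Gam ^ 2 * U.v k * U.H l + U.H k * U.v l := rfl
theorem kC_hs : kC e U (iH k) iS = 0 := rfl
theorem kC_sp : kC e U iS iP = 0 := rfl
theorem kC_su : kC e U iS (iU l) = 0 := rfl
theorem kC_sh : kC e U iS (iH l) = 0 := rfl

variable {e U k l}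

theorem calA_symm : calA e U k l = calA e U l k := by
  simp [calA, vecMulVec_apply, Matrix.one_apply, eq_comm]; ring

theorem calM_symm : calM U k l = calM U l k := by
  simp [calM, vecMulVec_apply, Matrix.one_apply, eq_comm]; left; ring

/-- The blocks coupling velocity and magnetic field are the products of `calA` and `calM` in the two
orders, hence transposes of each other. The other blocks are polynomial identities modulo Γ²(1 -
|v|²) = 1. -/
theorem A0_kC_symm (hu : U.u 0 = 0) (hH : U.H 0 = 0) : (A0 e U * kC e U).IsSymm := by
  have hv : U.v 0 = 0 := by simp [State.v, hu]
  have hG := Gam_sq U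
  have hG0 := (Gam_pos U).ne'
  unfold A0
  simp only [dotProduct, Fin.sum_univ_three, hv] at hG
  refine symm_of_blocks (fun k => ?_) (fun k => ?_) ?_ (fun k l hkl => ?_) (fun k l => ?_)
    (fun k => ?_) (fun k l hkl => ?_) (fun k => ?_) <;>
  simp only [block_mul_p, block_mul_u, block_mul_h, block_mul_s, kC_pp, kC_pu, kC_ph, kC_ps,
    kC_up, kC_uu, kC_uh, kC_us, kC_hp, kC_hu, kC_hh, kC_hs, kC_sp, kC_su, kC_sh]
  · simp only [State.b, u_eq, State.vH, dotProduct, Fin.sum_univ_three, hv, hH]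
    fin_cases k <;>
    simp [calA, State.BSq, State.HSq, State.vH, dotProduct, Fin.sum_univ_three,
      Matrix.one_apply, vecMulVec_apply, hv, hH] <;>
    field_simp <;> grind
  · rw [calM_symm (k := 0), calM_symm (k := 1), calM_symm (k := 2)]; simp; ring
  · simp
  · fin_cases k <;> fin_cases l <;> first | exact absurd hkl (by decide) | clear hkl
    all_goals simp [calA, State.BSq, State.HSq, State.vH, dotProduct, Fin.sum_univ_three,
      Matrix.one_apply, vecMulVec_apply, hv, hH]
    · field_simp; grind
  · rw [calM_symm (k := 0), calM_symm (k := 1), calM_symm (k := 2), calA_symm (k := k),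
      calA_symm (k := k), calA_symm (k := k)]; simp; ring
  · simp
  · fin_cases k <;> fin_cases l <;> first | exact absurd hkl (by decide) | clear hkl
    all_goals simp [calM, State.vH, dotProduct, Fin.sum_univ_three, u_eq,
      Matrix.one_apply, vecMulVec_apply, hv, hH]
    · field_simp; grind
  · simp

-- The product of `A e U j` and `kC e U` is corrected by the row q placed at H_j. Summed over j, the
-- correction becomes the gradient of q(Θ) paired with H, that is, a multiple of the divergence
-- constraint; this is where div H = 0 enters the symmetrization.
set_option maxHeartbeats 4000000 in
theorem A_kC_symm (hu : U.u 0 = 0) (hH : U.H 0 = 0) (j : Fin 3) :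
    (A e U j * kC e U
      + (1 / U.Gam) • Matrix.of fun a b => if a = iH j then qVec U b else 0).IsSymm := by
  have hv : U.v 0 = 0 := by simp [State.v, hu]
  have hG := Gam_sq U
  have hG0 := (Gam_pos U).ne'
  have n1 : ∀ a, (iP = iH a) = False := fun _ => by simp [iP, iH]
  have n2 : ∀ b a, (iU b = iH a) = False := fun _ _ => by simp [iU, iH]
  have n3 : ∀ b a, (iH b = iH a) = (b = a) := fun _ _ => by simp [iH]
  have n4 : ∀ a, (iS = iH a) = False := fun _ => by simp [iS, iH]
  have q1 : qVec U iP = 1 := rfl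
  have q2 : ∀ k, qVec U (iU k) = (U.vH * U.H k - U.BSq * U.v k) / U.Gam := fun _ => rfl
  have q3 : ∀ k, qVec U (iH k) = U.b k / U.Gam := fun _ => rfl
  have q4 : qVec U iS = 0 := rfl
  unfold A
  simp only [dotProduct, Fin.sum_univ_three, hv] at hG
  refine symm_of_blocks (fun k => ?_) (fun k => ?_) ?_ (fun k l hkl => ?_) (fun k l => ?_)
    (fun k => ?_) (fun k l hkl => ?_) (fun k => ?_) <;>
  simp only [Matrix.add_apply, Matrix.smul_apply, Matrix.of_apply, n1, n2, n3, n4, q1, q2, q3, q4,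
    block_mul_p, block_mul_u, block_mul_h, block_mul_s, kC_pp, kC_pu, kC_ph, kC_ps,
    kC_up, kC_uu, kC_uh, kC_us, kC_hp, kC_hu, kC_hh, kC_hs, kC_sp, kC_su, kC_sh, if_false] <;>
  clear n1 n2 n3 n4 q1 q2 q3 q4
  · fin_cases j <;> fin_cases k <;>
    simp [calA, calAj, calN, ej, State.b, u_eq, State.BSq, State.HSq, State.vH, dotProduct,
      Fin.sum_univ_three, Matrix.one_apply, vecMulVec_apply, hv, hH] <;>
    field_simp <;> try grind
  · fin_cases j <;> fin_cases k <;>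
    simp [calM, calN, ej, State.b, u_eq, dotProduct,
      Fin.sum_univ_three, vecMulVec_apply, hv, hH] <;>
    field_simp <;> try grind
  · simp
  · fin_cases j <;> fin_cases k <;> fin_cases l <;> first | exact absurd hkl (by decide) | clear hkl
    all_goals
      simp [calA, calAj, calN, ej, State.b, u_eq, State.BSq, State.HSq, State.vH, dotProduct,
      Fin.sum_univ_three, Matrix.one_apply, vecMulVec_apply, hv, hH] <;>
    field_simp <;> try grind
  · fin_cases j <;> fin_cases k <;> fin_cases l <;>
    simp [calA, calAj, calM, calN, ej, State.b, u_eq, State.BSq, State.HSq, State.vH, dotProduct,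
      Fin.sum_univ_three, Matrix.one_apply, vecMulVec_apply, hv, hH] <;>
    field_simp <;> try grind
  · simp
  · fin_cases j <;> fin_cases k <;> fin_cases l <;> first | exact absurd hkl (by decide) | clear hkl
    all_goals
      simp [calM, calN, ej, State.b, u_eq, State.vH, dotProduct,
      Fin.sum_univ_three, Matrix.one_apply, vecMulVec_apply, hv, hH] <;>
    field_simp <;> try grind
  · simp

end Coordinates
end
end RMHD

/-! ### Positivity of the energy density in rest frame variables. -/

namespace RMHD
noncomputable section

section Positivity

variable {m κ k μ b1 b2 : ℝ}

/-- Positivity of the energy flux through a light-like direction, in the rest frame. -/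
theorem lightlike_form_pos (hm : 0 < m) (hk : k = κ * m) (hk1 : 1 < k)
    (hμ : μ ^ 2 * (m + k * (b1 ^ 2 + b2 ^ 2)) < 1) (p xn xt en et : ℝ) :
    let Q := (1 + b1 * μ) * (κ * p ^ 2 + m * (xn ^ 2 + xt ^ 2) + (b1 * xt - b2 * xn) ^ 2
        + en ^ 2 + et ^ 2)
      - 2 * μ * (m * (xn * en + xt * et) + (b1 * xt - b2 * xn) * (b1 * et - b2 * en))
      + 2 * μ * κ * m * p * (b1 * xn + b2 * xt) - 2 * b1 * (xn * en + xt * et)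
      + 2 * (p + b1 * en + b2 * et) * (xn - μ * en)
    0 ≤ Q ∧ (Q = 0 → p = 0 ∧ xn = 0 ∧ xt = 0 ∧ en = 0 ∧ et = 0) := by
  intro Q
  have hκ : κ = k / m := by rw [hk]; field_simp
  have hb1 : μ ^ 2 * b1 ^ 2 < 1 := by
    nlinarith [mul_nonneg (sq_nonneg μ) hm.le, mul_nonneg (sq_nonneg μ) (sq_nonneg b2),
      mul_nonneg (sq_nonneg μ) (sq_nonneg b1), mul_nonneg (mul_nonneg (sq_nonneg μ) (sq_nonneg b1))
        (sub_nonneg.2 hk1.le), mul_nonneg (mul_nonneg (sq_nonneg μ) (sq_nonneg b2))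
        (sub_nonneg.2 hk1.le)]
  have ha : 0 < 1 + b1 * μ := by nlinarith
  have hD' : 0 < 1 - μ ^ 2 * (m + k * (b1 ^ 2 + b2 ^ 2)) := by linarith
  set D := 1 - μ ^ 2 * (b1 ^ 2 + b2 ^ 2) - μ ^ 2 * m with hDdef
  have hD : 0 < D := by
    have : 0 ≤ (k - 1) * (μ ^ 2 * (b1 ^ 2 + b2 ^ 2)) :=
      mul_nonneg (by linarith) (by positivity)
    nlinarith
  have hR : 0 < (1 - μ ^ 2 * (m + k * (b1 ^ 2 + b2 ^ 2))) * (1 - μ ^ 2 * b1 ^ 2) :=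
    mul_pos hD' (by linarith)
  -- Completion of squares, with the denominators cleared: first et, then xn, then en and xt,
  -- finally p. The coefficient left for p carries the factors k - 1 and 1 - μ²(m + k(b1² + b2²)),
  -- positive by the hypotheses on k and μ.
  have key : (1 + b1 * μ) * D * m ^ 2 * Q =
      m ^ 2 * D * ((1 + b1 * μ) * et + ((1 + b1 * μ) * b2 * xn - ((1 + b1 * μ) * b1 + μ * m) * xt
        - μ * b2 * en)) ^ 2
      + D * m * (m * (1 + b1 * μ) * xn + m * μ * b2 * xt - m * μ * en
        + (1 + μ * k * b1) * p) ^ 2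
      + m ^ 2 * (D * en + μ ^ 2 * b1 * (k - 1) * p) ^ 2
      + m * (m * D * xt + μ * b2 * (k - 1) * p) ^ 2
      + m * (k - 1) * ((1 - μ ^ 2 * (m + k * (b1 ^ 2 + b2 ^ 2))) * (1 - μ ^ 2 * b1 ^ 2)) * p ^ 2 := by
    simp only [Q, hDdef, hκ]
    field_simp
    ring
  have hpos : 0 < (1 + b1 * μ) * D * m ^ 2 := by positivity
  have t1 : 0 ≤ m ^ 2 * D * ((1 + b1 * μ) * et + ((1 + b1 * μ) * b2 * xn
      - ((1 + b1 * μ) * b1 + μ * m) * xt - μ * b2 * en)) ^ 2 := by positivity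
  have t2 : 0 ≤ D * m * (m * (1 + b1 * μ) * xn + m * μ * b2 * xt - m * μ * en
        + (1 + μ * k * b1) * p) ^ 2 := by positivity
  have t3 : 0 ≤ m ^ 2 * (D * en + μ ^ 2 * b1 * (k - 1) * p) ^ 2 := by positivity
  have t4 : 0 ≤ m * (m * D * xt + μ * b2 * (k - 1) * p) ^ 2 := by positivity
  have hk2 : 0 < k - 1 := by linarith
  have t5 : 0 ≤ m * (k - 1) * ((1 - μ ^ 2 * (m + k * (b1 ^ 2 + b2 ^ 2)))
      * (1 - μ ^ 2 * b1 ^ 2)) * p ^ 2 := by positivity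
  refine ⟨?_, fun h0 => ?_⟩
  · have : 0 ≤ (1 + b1 * μ) * D * m ^ 2 * Q := by rw [key]; positivity
    exact nonneg_of_mul_nonneg_right this hpos
  · rw [h0, mul_zero] at key
    have z5 : m * (k - 1) * ((1 - μ ^ 2 * (m + k * (b1 ^ 2 + b2 ^ 2)))
      * (1 - μ ^ 2 * b1 ^ 2)) * p ^ 2 = 0 := by linarith
    have hp : p = 0 := by
      have := (mul_eq_zero.1 z5).resolve_left (by positivity)
      exact pow_eq_zero_iff (two_ne_zero) |>.1 this
    have z3 : m ^ 2 * (D * en + μ ^ 2 * b1 * (k - 1) * p) ^ 2 = 0 := by linarith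
    have z4 : m * (m * D * xt + μ * b2 * (k - 1) * p) ^ 2 = 0 := by linarith
    rw [hp, mul_zero, add_zero] at z3 z4
    have hen : en = 0 := by
      have := pow_eq_zero_iff (two_ne_zero) |>.1 ((mul_eq_zero.1 z3).resolve_left (by positivity))
      exact (mul_eq_zero.1 this).resolve_left hD.ne'
    have hxt : xt = 0 := by
      have := pow_eq_zero_iff (two_ne_zero) |>.1 ((mul_eq_zero.1 z4).resolve_left (by positivity))
      exact (mul_eq_zero.1 this).resolve_left (by positivity)
    have z2 : D * m * (m * (1 + b1 * μ) * xn + m * μ * b2 * xt - m * μ * en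
        + (1 + μ * k * b1) * p) ^ 2 = 0 := by linarith
    rw [hp, hen, hxt] at z2
    have hxn : xn = 0 := by
      have := pow_eq_zero_iff (two_ne_zero) |>.1 ((mul_eq_zero.1 z2).resolve_left (by positivity))
      simp only [mul_zero, add_zero, sub_zero] at this
      exact (mul_eq_zero.1 this).resolve_left (by positivity)
    have z1 : m ^ 2 * D * ((1 + b1 * μ) * et + ((1 + b1 * μ) * b2 * xn
      - ((1 + b1 * μ) * b1 + μ * m) * xt - μ * b2 * en)) ^ 2 = 0 := by linarith
    rw [hen, hxt, hxn] at z1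
    have het : et = 0 := by
      have := pow_eq_zero_iff (two_ne_zero) |>.1 ((mul_eq_zero.1 z1).resolve_left (by positivity))
      simp only [mul_zero, add_zero, sub_zero] at this
      exact (mul_eq_zero.1 this).resolve_left (by positivity)
    exact ⟨hp, hxn, hxt, hen, het⟩

/-- The energy density of the secondary symmetrization, in the variables of the rest frame, for a
frame moving with velocity `V`: components in the plane of the boundary. -/
def planeForm (m κ μ b1 b2 V p xn xt en et : ℝ) : ℝ :=
  (1 + V * b1 * μ) * (κ * p ^ 2 + m * (xn ^ 2 + xt ^ 2) + (b1 * xt - b2 * xn) ^ 2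
      + en ^ 2 + et ^ 2)
    - 2 * μ * (m * (xn * en + xt * et) + (b1 * xt - b2 * xn) * (b1 * et - b2 * en))
    + 2 * μ * κ * m * p * (b1 * xn + b2 * xt) - 2 * V * b1 * (xn * en + xt * et)
    + 2 * V * (p + b1 * en + b2 * et) * (xn - μ * en)

/-- The components normal to the boundary. -/
def normalForm (m μ b1 b2 V xz ez : ℝ) : ℝ :=
  (1 + V * b1 * μ) * ((m + (b1 ^ 2 + b2 ^ 2)) * xz ^ 2 + ez ^ 2)
    - 2 * (μ * (m + (b1 ^ 2 + b2 ^ 2)) + V * b1) * xz * ez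

/-- The form is affine in V, hence a convex combination of its values at V = 1 and V = -1; the
second is the first reflected in the direction n. Definiteness can be read off the V = 1 part alone,
since its weight (1 + V)/2 is positive. -/
theorem planeForm_pos (hm : 0 < m) (hk : k = κ * m) (hk1 : 1 < k)
    (hμ : μ ^ 2 * (m + k * (b1 ^ 2 + b2 ^ 2)) < 1) {V : ℝ} (hV : |V| < 1) (p xn xt en et : ℝ) :
    0 ≤ planeForm m κ μ b1 b2 V p xn xt en et ∧ (planeForm m κ μ b1 b2 V p xn xt en et = 0 →
      p = 0 ∧ xn = 0 ∧ xt = 0 ∧ en = 0 ∧ et = 0) := by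
  have h1 := lightlike_form_pos hm hk hk1 hμ p xn xt en et
  have h2 := lightlike_form_pos (b1 := -b1) hm hk hk1 (by simpa using hμ) p (-xn) xt (-en) et
  simp only at h1 h2
  obtain ⟨hV1, hV2⟩ := abs_lt.1 hV
  have e : planeForm m κ μ b1 b2 V p xn xt en et = (1 + V) / 2 * ((1 + b1 * μ) * (κ * p ^ 2
        + m * (xn ^ 2 + xt ^ 2) + (b1 * xt - b2 * xn) ^ 2 + en ^ 2 + et ^ 2)
      - 2 * μ * (m * (xn * en + xt * et) + (b1 * xt - b2 * xn) * (b1 * et - b2 * en))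
      + 2 * μ * κ * m * p * (b1 * xn + b2 * xt) - 2 * b1 * (xn * en + xt * et)
      + 2 * (p + b1 * en + b2 * et) * (xn - μ * en))
      + (1 - V) / 2 * ((1 + -b1 * μ) * (κ * p ^ 2
        + m * ((-xn) ^ 2 + xt ^ 2) + (-b1 * xt - b2 * -xn) ^ 2 + (-en) ^ 2 + et ^ 2)
      - 2 * μ * (m * (-xn * -en + xt * et) + (-b1 * xt - b2 * -xn) * (-b1 * et - b2 * -en))
      + 2 * μ * κ * m * p * (-b1 * -xn + b2 * xt) - 2 * -b1 * (-xn * -en + xt * et)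
      + 2 * (p + -b1 * -en + b2 * et) * (-xn - μ * -en)) := by
    unfold planeForm; ring
  rw [e]
  have c1 : 0 < (1 + V) / 2 := by linarith
  have c2 : 0 < (1 - V) / 2 := by linarith
  have p1 := mul_nonneg c1.le h1.1
  have p2 := mul_nonneg c2.le h2.1
  refine ⟨add_nonneg p1 p2, fun h0 => h1.2 ?_⟩
  have := (add_eq_zero_iff_of_nonneg p1 p2).1 h0
  exact (mul_eq_zero.1 this.1).resolve_left c1.ne'

/-- A binary form: completing the square in ez leaves its determinant (N - (V b1)²)(1 - μ²N) with N
= m + b1² + b2². Both factors are positive because |V| < 1 and because k > 1 makes N smaller than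
the quantity bounded in the hypothesis on μ. -/
theorem normalForm_pos (hm : 0 < m) (hk1 : 1 < k)
    (hμ : μ ^ 2 * (m + k * (b1 ^ 2 + b2 ^ 2)) < 1) {V : ℝ} (hV : |V| < 1) (xz ez : ℝ) :
    0 ≤ normalForm m μ b1 b2 V xz ez ∧ (normalForm m μ b1 b2 V xz ez = 0 → xz = 0 ∧ ez = 0) := by
  have hV2 : V ^ 2 < 1 := by rw [← sq_abs]; nlinarith [abs_nonneg V]
  have h0 : 0 ≤ (k - 1) * (μ ^ 2 * (b1 ^ 2 + b2 ^ 2)) := mul_nonneg (by linarith) (by positivity)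
  have hN : μ ^ 2 * (m + (b1 ^ 2 + b2 ^ 2)) < 1 := by nlinarith
  set N := m + (b1 ^ 2 + b2 ^ 2) with hNdef
  have hN0 : 0 < N := by positivity
  have hβ : (V * b1) ^ 2 < N := by
    have : V ^ 2 * b1 ^ 2 ≤ 1 * b1 ^ 2 := by gcongr
    rw [mul_pow, hNdef]; nlinarith [sq_nonneg b2]
  have hβμ : (V * b1 * μ) ^ 2 < 1 := by
    rw [mul_pow]
    calc (V * b1) ^ 2 * μ ^ 2 ≤ N * μ ^ 2 := by gcongr
      _ < 1 := by linarith
  have ha : 0 < 1 + V * b1 * μ := by nlinarith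
  have key : (1 + V * b1 * μ) * normalForm m μ b1 b2 V xz ez =
      ((1 + V * b1 * μ) * ez - (μ * N + V * b1) * xz) ^ 2
        + (N - (V * b1) ^ 2) * (1 - μ ^ 2 * N) * xz ^ 2 := by
    unfold normalForm; rw [← hNdef]; ring
  have hc : 0 < (N - (V * b1) ^ 2) * (1 - μ ^ 2 * N) := mul_pos (by linarith) (by linarith)
  have t1 : 0 ≤ (N - (V * b1) ^ 2) * (1 - μ ^ 2 * N) * xz ^ 2 := by positivity
  refine ⟨?_, fun hz => ?_⟩
  · have : 0 ≤ (1 + V * b1 * μ) * normalForm m μ b1 b2 V xz ez := by rw [key]; positivity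
    exact nonneg_of_mul_nonneg_right this ha
  · rw [hz, mul_zero] at key
    have t2 := sq_nonneg ((1 + V * b1 * μ) * ez - (μ * N + V * b1) * xz)
    have z1 : (N - (V * b1) ^ 2) * (1 - μ ^ 2 * N) * xz ^ 2 = 0 := by linarith
    have hx : xz = 0 := pow_eq_zero_iff two_ne_zero |>.1 ((mul_eq_zero.1 z1).resolve_left hc.ne')
    rw [hx] at key
    have z2 : (1 + V * b1 * μ) * ez = 0 := by
      have : ((1 + V * b1 * μ) * ez) ^ 2 = 0 := by nlinarith
      exact pow_eq_zero_iff two_ne_zero |>.1 this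
    exact ⟨hx, (mul_eq_zero.1 z2).resolve_left ha.ne'⟩

end Positivity

end
end RMHD

/-! ### The quadratic form of the symmetrized system. -/

namespace RMHD
noncomputable section

section QuadraticForm

variable {e : ℝ → ℝ → ℝ} {U : State}

/-- The form of `calA` in terms of scalar products with `v` and `H`. -/
def formA (e : ℝ → ℝ → ℝ) (U : State) (uw vu vw Hu Hw : ℝ) : ℝ :=
  (U.rho * enthalpy e U * U.Gam + U.HSq / U.Gam) * uw
    - (U.rho * enthalpy e U * U.Gam + (U.HSq + U.BSq) / U.Gam) * (vu * vw)
    - 1 / U.Gam * (Hu * Hw) + U.vH / U.Gam * (vu * Hw + Hu * vw)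

def formM (U : State) (hw vh vw : ℝ) : ℝ := 1 / U.Gam * (hw + U.Gam ^ 2 * (vh * vw))

def pu (X : Idx → ℝ) : Fin 3 → ℝ := fun k => X (iU k)
def ph (X : Idx → ℝ) : Fin 3 → ℝ := fun k => X (iH k)

theorem calA_form (x y : Fin 3 → ℝ) : x ⬝ᵥ (calA e U *ᵥ y)
    = formA e U (x ⬝ᵥ y) (U.v ⬝ᵥ x) (U.v ⬝ᵥ y) (U.H ⬝ᵥ x) (U.H ⬝ᵥ y) := by
  simp only [calA, add_mulVec, sub_mulVec, smul_mulVec, one_mulVec, vecMulVec_mulVec, dotProduct_add,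
    dotProduct_sub, dotProduct_smul, formA, smul_eq_mul, op_smul_eq_smul, dotProduct_comm x U.v, dotProduct_comm x U.H]
  ring

theorem calM_form (x y : Fin 3 → ℝ) : x ⬝ᵥ (calM U *ᵥ y)
    = formM U (x ⬝ᵥ y) (U.v ⬝ᵥ x) (U.v ⬝ᵥ y) := by
  have hu : U.u = U.Gam • U.v := funext fun i => u_eq U i
  simp only [calM, add_mulVec, smul_mulVec, one_mulVec, vecMulVec_mulVec, dotProduct_add,
    dotProduct_smul, formM, smul_eq_mul, hu, op_smul_eq_smul, smul_dotProduct,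
    dotProduct_comm x U.v]
  ring

theorem dotProduct_idx (X Y : Idx → ℝ) :
    X ⬝ᵥ Y = X iP * Y iP + pu X ⬝ᵥ pu Y + ph X ⬝ᵥ ph Y + X iS * Y iS := by
  simp only [dotProduct, Fintype.sum_sum_type, Finset.univ_unique, Finset.sum_singleton, pu, ph,
    iP, iU, iH, iS]
  rw [add_assoc, add_assoc]

theorem A0_mulVec (X : Idx → ℝ) :
    (A0 e U *ᵥ X) iP = U.Gam / (U.rho * aSq e U) * X iP + U.v ⬝ᵥ pu X ∧
    pu (A0 e U *ᵥ X) = X iP • U.v + calA e U *ᵥ pu X ∧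
    ph (A0 e U *ᵥ X) = calM U *ᵥ ph X ∧ (A0 e U *ᵥ X) iS = X iS := by
  refine ⟨?_, ?_, ?_, ?_⟩
  · simp [mulVec, dotProduct, A0, block, iP, pu, iU]
  · funext k
    simp [mulVec, dotProduct, A0, block, iP, pu, iU, mul_comm]
  · funext k
    simp [mulVec, dotProduct, A0, block, ph, iH]
  · simp [mulVec, dotProduct, A0, block, iS]

theorem kC_mulVec (X : Idx → ℝ) :
    (kC e U *ᵥ X) iP = -(U.rho * enthalpy e U / U.Gam) * (U.H ⬝ᵥ pu X) ∧
    pu (kC e U *ᵥ X) = (-(1 / (U.rho * aSq e U)) * X iP) • U.b + U.vH • pu X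
      - (U.vH * (U.v ⬝ᵥ pu X)) • U.v - (1 / U.Gam ^ 2 * (U.v ⬝ᵥ pu X)) • U.H
      + calM U *ᵥ ph X ∧
    ph (kC e U *ᵥ X) = X iP • U.v + calA e U *ᵥ pu X - U.vH • ph X
      + (U.vH * (U.v ⬝ᵥ ph X)) • U.v + (1 / U.Gam ^ 2 * (U.H ⬝ᵥ ph X)) • U.v
      + (U.v ⬝ᵥ ph X) • U.H ∧ (kC e U *ᵥ X) iS = 0 := by
  refine ⟨?_, ?_, ?_, ?_⟩
  · simp [mulVec, dotProduct, kC, iP, pu, iU, Finset.mul_sum, mul_assoc]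
  · funext k
    simp only [mulVec, dotProduct, kC, pu, ph, iU, iH, iP, Fintype.sum_sum_type,
      Finset.univ_unique, Finset.sum_singleton, Pi.add_apply, Pi.sub_apply, Pi.smul_apply,
      smul_eq_mul, Fin.sum_univ_three, zero_mul, add_zero]
    fin_cases k <;> simp [Matrix.one_apply] <;> ring
  · funext k
    simp only [mulVec, dotProduct, kC, pu, ph, iU, iH, iP, Fintype.sum_sum_type,
      Finset.univ_unique, Finset.sum_singleton, Pi.add_apply, Pi.sub_apply, Pi.smul_apply,
      smul_eq_mul, Fin.sum_univ_three, zero_mul, add_zero]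
    fin_cases k <;> simp [Matrix.one_apply] <;> ring
  · simp [mulVec, dotProduct, kC, iS]

theorem A0_form (X : Idx → ℝ) : X ⬝ᵥ (A0 e U *ᵥ X) =
    U.Gam / (U.rho * aSq e U) * X iP ^ 2 + 2 * X iP * (U.v ⬝ᵥ pu X)
    + formA e U (pu X ⬝ᵥ pu X) (U.v ⬝ᵥ pu X) (U.v ⬝ᵥ pu X) (U.H ⬝ᵥ pu X) (U.H ⬝ᵥ pu X)
    + formM U (ph X ⬝ᵥ ph X) (U.v ⬝ᵥ ph X) (U.v ⬝ᵥ ph X) + X iS ^ 2 := by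
  obtain ⟨h1, h2, h3, h4⟩ := A0_mulVec (e := e) (U := U) X
  rw [dotProduct_idx, h1, h2, h3, h4, dotProduct_add, dotProduct_smul, calA_form, calM_form,
    dotProduct_comm (pu X) U.v, smul_eq_mul]
  ring

theorem b_eq : U.b = (1 / U.Gam) • U.H + (U.Gam * U.vH) • U.v := by
  funext k
  simp only [State.b, Pi.add_apply, Pi.smul_apply, smul_eq_mul, State.vH, dotProduct, u_eq,
    Finset.mul_sum, mul_assoc]
  ring

theorem calA_symm' (x y : Fin 3 → ℝ) : (calA e U *ᵥ x) ⬝ᵥ y = x ⬝ᵥ (calA e U *ᵥ y) := by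
  have : (calA e U)ᵀ = calA e U := by ext; exact calA_symm
  rw [dotProduct_mulVec, ← mulVec_transpose, this]

theorem calM_symm' (x y : Fin 3 → ℝ) : (calM U *ᵥ x) ⬝ᵥ y = x ⬝ᵥ (calM U *ᵥ y) := by
  have : (calM U)ᵀ = calM U := by ext; exact calM_symm
  rw [dotProduct_mulVec, ← mulVec_transpose, this]

theorem calM_mulVec (x : Fin 3 → ℝ) :
    calM U *ᵥ x = (1 / U.Gam) • x + (U.Gam * (U.v ⬝ᵥ x)) • U.v := by
  have hu : U.u = U.Gam • U.v := funext fun i => u_eq U i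
  have hG := (Gam_pos U).ne'
  simp only [calM, add_mulVec, smul_mulVec, one_mulVec, vecMulVec_mulVec, hu, op_smul_eq_smul,
    smul_dotProduct, smul_add, smul_smul, smul_eq_mul]
  congr 2
  field_simp

/-- Since A₀ is symmetric, the form is the scalar product of A₀X with `kC` X. Only scalar products
among v, H and the two vector parts of X remain, so the passage to rest frame variables becomes a
substitution of scalars. -/
theorem A0_kC_form (X : Idx → ℝ) : X ⬝ᵥ ((A0 e U * kC e U) *ᵥ X) =
    (U.Gam / (U.rho * aSq e U) * X iP + U.v ⬝ᵥ pu X)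
      * (-(U.rho * enthalpy e U / U.Gam) * (U.H ⬝ᵥ pu X))
    + X iP * (-(1 / (U.rho * aSq e U)) * X iP * (1 / U.Gam * U.vH + U.Gam * U.vH * (U.v ⬝ᵥ U.v))
      + U.vH * (U.v ⬝ᵥ pu X) - U.vH * (U.v ⬝ᵥ pu X) * (U.v ⬝ᵥ U.v)
      - 1 / U.Gam ^ 2 * (U.v ⬝ᵥ pu X) * U.vH
      + formM U (U.v ⬝ᵥ ph X) (U.v ⬝ᵥ U.v) (U.v ⬝ᵥ ph X))
    + (-(1 / (U.rho * aSq e U)) * X iP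
        * formA e U (1 / U.Gam * (U.H ⬝ᵥ pu X) + U.Gam * U.vH * (U.v ⬝ᵥ pu X)) (U.v ⬝ᵥ pu X)
          (1 / U.Gam * U.vH + U.Gam * U.vH * (U.v ⬝ᵥ U.v)) (U.H ⬝ᵥ pu X)
          (1 / U.Gam * U.HSq + U.Gam * U.vH * U.vH)
      + U.vH * formA e U (pu X ⬝ᵥ pu X) (U.v ⬝ᵥ pu X) (U.v ⬝ᵥ pu X) (U.H ⬝ᵥ pu X) (U.H ⬝ᵥ pu X)
      - U.vH * (U.v ⬝ᵥ pu X)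
        * formA e U (U.v ⬝ᵥ pu X) (U.v ⬝ᵥ pu X) (U.v ⬝ᵥ U.v) (U.H ⬝ᵥ pu X) U.vH
      - 1 / U.Gam ^ 2 * (U.v ⬝ᵥ pu X)
        * formA e U (U.H ⬝ᵥ pu X) (U.v ⬝ᵥ pu X) U.vH (U.H ⬝ᵥ pu X) U.HSq
      + 2 * (1 / U.Gam
        * formA e U (pu X ⬝ᵥ ph X) (U.v ⬝ᵥ pu X) (U.v ⬝ᵥ ph X) (U.H ⬝ᵥ pu X) (U.H ⬝ᵥ ph X)
        + U.Gam * (U.v ⬝ᵥ ph X)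
        * formA e U (U.v ⬝ᵥ pu X) (U.v ⬝ᵥ pu X) (U.v ⬝ᵥ U.v) (U.H ⬝ᵥ pu X) U.vH))
    + (X iP * formM U (U.v ⬝ᵥ ph X) (U.v ⬝ᵥ ph X) (U.v ⬝ᵥ U.v)
      - U.vH * formM U (ph X ⬝ᵥ ph X) (U.v ⬝ᵥ ph X) (U.v ⬝ᵥ ph X)
      + (U.vH * (U.v ⬝ᵥ ph X) + 1 / U.Gam ^ 2 * (U.H ⬝ᵥ ph X))
        * formM U (U.v ⬝ᵥ ph X) (U.v ⬝ᵥ ph X) (U.v ⬝ᵥ U.v)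
      + (U.v ⬝ᵥ ph X) * formM U (U.H ⬝ᵥ ph X) (U.v ⬝ᵥ ph X) U.vH) := by
  obtain ⟨h1, h2, h3, h4⟩ := A0_mulVec (e := e) (U := U) X
  obtain ⟨k1, k2, k3, k4⟩ := kC_mulVec (e := e) (U := U) X
  have hA0 : (A0 e U)ᵀ = A0 e U := by
    refine symm_of_blocks (fun k => rfl) (fun k => rfl) rfl (fun k l _ => calA_symm) (fun k l => rfl)
      (fun k => rfl) (fun k l _ => calM_symm) (fun k => rfl)
  have hsym : X ⬝ᵥ ((A0 e U * kC e U) *ᵥ X) = (A0 e U *ᵥ X) ⬝ᵥ (kC e U *ᵥ X) := by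
    rw [← mulVec_mulVec, dotProduct_mulVec, ← mulVec_transpose, hA0]
  have hHv : U.H ⬝ᵥ U.v = U.vH := dotProduct_comm _ _
  have hvH : U.v ⬝ᵥ U.H = U.vH := rfl
  have hHH : U.H ⬝ᵥ U.H = U.HSq := rfl
  have cu : ∀ x, x ⬝ᵥ U.v = U.v ⬝ᵥ x := fun x => dotProduct_comm _ _
  have cH : ∀ x, x ⬝ᵥ U.H = U.H ⬝ᵥ x := fun x => dotProduct_comm _ _
  rw [hsym, dotProduct_idx, h1, h2, h3, h4, k1, k2, k3, k4]
  simp only [add_dotProduct, smul_dotProduct, calA_symm', calM_symm',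
    dotProduct_add, dotProduct_sub, dotProduct_smul, calA_form, calM_form, b_eq,
    hvH, hHv, hHH, cu (pu X), cu (ph X), cH (pu X), cH (ph X),
    dotProduct_comm (ph X) (pu X), smul_eq_mul]
  have hG := (Gam_pos U).ne'
  simp only [formA, formM]
  field_simp
  ring

end QuadraticForm

section Frame

variable {e : ℝ → ℝ → ℝ} {U : State}

/-- The secondary symmetrizer. -/
def symK (e : ℝ → ℝ → ℝ) (U : State) (lam : ℝ) : Matrix Idx Idx ℝ :=
  (1 / U.Gam + lam * U.Gam * U.vH) • 1 - (lam * U.Gam) • kC e U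

/-- The quadratic form of `A₀ K` in rest frame variables. -/
theorem A0_symK_form (hu : U.u 0 = 0) (hH : U.H 0 = 0) (X : Idx → ℝ) {c μ lam V n1 n2 : ℝ}
    (hc : c = 1 / U.Gam + lam * U.Gam * U.vH) (hμ : c * μ = lam * U.Gam)
    (hn : n1 ^ 2 + n2 ^ 2 = 1) (hv1 : U.v 1 = V * n1) (hv2 : U.v 2 = V * n2)
    {κ m b1 b2 xn xt xz en et ez : ℝ} (hκ : κ = 1 / (U.rho * aSq e U))
    (hm : m = U.rho * enthalpy e U)
    (hb1 : b1 = U.H 1 * n1 + U.H 2 * n2) (hb2 : b2 = (-(U.H 1 * n2) + U.H 2 * n1) / U.Gam)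
    (hxn : xn = (X (iU 1) * n1 + X (iU 2) * n2) / U.Gam)
    (hxt : xt = -(X (iU 1) * n2) + X (iU 2) * n1) (hxz : xz = X (iU 0))
    (hen : en = X (iH 1) * n1 + X (iH 2) * n2)
    (het : et = (-(X (iH 1) * n2) + X (iH 2) * n1) / U.Gam - V * (b2 * xn - b1 * xt))
    (hez : ez = X (iH 0) / U.Gam + V * b1 * xz) :
    X ⬝ᵥ ((A0 e U * symK e U lam) *ᵥ X) = c * (U.Gam * (planeForm m κ μ b1 b2 V (X iP) xn xt en et
      + normalForm m μ b1 b2 V xz ez) + X iS ^ 2) := by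
  have hv : U.v 0 = 0 := by simp [State.v, hu]
  have hG0 := (Gam_pos U).ne'
  have hGs := Gam_sq U
  have e1 : X ⬝ᵥ ((A0 e U * symK e U lam) *ᵥ X)
      = c * (X ⬝ᵥ (A0 e U *ᵥ X)) - c * μ * (X ⬝ᵥ ((A0 e U * kC e U) *ᵥ X)) := by
    rw [hc, ← hc, hμ, hc]
    simp only [symK, Matrix.mul_sub, Matrix.mul_smul, Matrix.mul_one, sub_mulVec, smul_mulVec,
      dotProduct_sub, dotProduct_smul, smul_eq_mul]
  have hn2 : n2 ^ 2 = 1 - n1 ^ 2 := by linarith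
  have d1 : U.v ⬝ᵥ U.v = V ^ 2 := by
    simp only [dotProduct, Fin.sum_univ_three, hv, hv1, hv2]
    linear_combination V ^ 2 * hn
  have d2 : U.vH = V * b1 := by
    simp only [State.vH, dotProduct, Fin.sum_univ_three, hv, hv1, hv2, hb1]
    ring
  have b2' : -(U.H 1 * n2) + U.H 2 * n1 = U.Gam * b2 := by rw [hb2]; field_simp
  have xn' : X (iU 1) * n1 + X (iU 2) * n2 = U.Gam * xn := by rw [hxn]; field_simp
  have et' : -(X (iH 1) * n2) + X (iH 2) * n1 = U.Gam * (et + V * (b2 * xn - b1 * xt)) := by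
    rw [het]; field_simp; ring
  have ez' : X (iH 0) = U.Gam * (ez - V * b1 * xz) := by rw [hez]; field_simp; ring
  -- Scalar products in the boundary plane, in the orthonormal basis along and across the velocity.
  have rot : ∀ p1 p2 q1 q2 : ℝ, p1 * q1 + p2 * q2 = (p1 * n1 + p2 * n2) * (q1 * n1 + q2 * n2)
      + (-(p1 * n2) + p2 * n1) * (-(q1 * n2) + q2 * n1) := by
    intro p1 p2 q1 q2
    linear_combination (-(p1 * q1) - p2 * q2) * hn
  have d3 : U.HSq = b1 ^ 2 + U.Gam ^ 2 * b2 ^ 2 := by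
    simp only [State.HSq, dotProduct, Fin.sum_univ_three, hH]
    rw [mul_zero, zero_add, rot, b2', ← hb1]; ring
  have d4 : U.v ⬝ᵥ pu X = V * (U.Gam * xn) := by
    simp only [dotProduct, Fin.sum_univ_three, hv, hv1, hv2, pu, ← xn']; ring
  have d5 : U.H ⬝ᵥ pu X = b1 * (U.Gam * xn) + U.Gam * b2 * xt := by
    simp only [dotProduct, Fin.sum_univ_three, hH, pu]
    rw [zero_mul, zero_add, rot, b2', xn', ← hxt, ← hb1]
  have d6 : pu X ⬝ᵥ pu X = xz ^ 2 + (U.Gam * xn) ^ 2 + xt ^ 2 := by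
    simp only [dotProduct, Fin.sum_univ_three, pu]
    rw [add_assoc, rot, xn', ← hxt, ← hxz]; ring
  have d7 : U.v ⬝ᵥ ph X = V * en := by
    simp only [dotProduct, Fin.sum_univ_three, hv, hv1, hv2, ph, hen]; ring
  have d8 : U.H ⬝ᵥ ph X = b1 * en + U.Gam * b2 * (U.Gam * (et + V * (b2 * xn - b1 * xt))) := by
    simp only [dotProduct, Fin.sum_univ_three, hH, ph]
    rw [zero_mul, zero_add, rot, b2', et', ← hen, ← hb1]
  have d9 : ph X ⬝ᵥ ph X = (U.Gam * (ez - V * b1 * xz)) ^ 2 + en ^ 2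
      + (U.Gam * (et + V * (b2 * xn - b1 * xt))) ^ 2 := by
    simp only [dotProduct, Fin.sum_univ_three, ph]
    rw [add_assoc, rot, et', ← hen, ez']; ring
  have d10 : pu X ⬝ᵥ ph X = xz * (U.Gam * (ez - V * b1 * xz)) + U.Gam * xn * en
      + xt * (U.Gam * (et + V * (b2 * xn - b1 * xt))) := by
    simp only [dotProduct, Fin.sum_univ_three, pu, ph]
    rw [add_assoc, rot, et', xn', ← hen, ← hxt, ez', ← hxz]; ring
  have hV : U.Gam ^ 2 * (1 - V ^ 2) = 1 := by rw [← d1]; exact hGs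
  have hB : U.BSq = b1 ^ 2 + b2 ^ 2 := by
    rw [State.BSq, d2, d3]
    field_simp
    linear_combination (-b1 ^ 2) * hV
  have hG1 : U.Gam⁻¹ = U.Gam * (1 - V ^ 2) := by field_simp; linarith
  have hG2 : (U.Gam ^ 2)⁻¹ = 1 - V ^ 2 := by field_simp; linarith
  have hκ' : (U.rho * aSq e U)⁻¹ = κ := by rw [hκ, one_div]
  -- The target form is affine in μ. So it suffices to identify its value at μ = 0 with the form of
  -- A₀, and the difference of its values at μ = 0 and μ = 1 with the form of A₀ times `kC`. The
  -- long coefficients are the cofactors of Γ²(1 - V²) = 1.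
  have e2 : X ⬝ᵥ (A0 e U *ᵥ X) = U.Gam * (planeForm m κ 0 b1 b2 V (X iP) xn xt en et
      + normalForm m 0 b1 b2 V xz ez) + X iS ^ 2 := by
    rw [A0_form, d4, d5, d6, d7, d9, formA, formM, d2, d3, hB, ← hm, div_eq_mul_inv, hκ']
    simp only [planeForm, normalForm, div_eq_mul_inv, hG1, hG2]
    generalize U.Gam = G at *
    linear_combination (G * ez^2 + G * et^2 + G * m * xn^2 + G * b2^2 * xz^2 + G * b2^2 * xn^2 - 2 * G * b1 * b2 * xn * xt +
        2 * G * V * b2 * xn * et - 2 * G * V * b1 * xz * ez - 2 * G * V * b1 * xt * et + G * V^2 * en^2 + G * V^2 * b1^2 * xz^2 +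
        G * V^2 * b1^2 * xt^2 + G^3 * b2^2 * xn^2 - G^3 * V^2 * b2^2 * xn^2) * hV
  have e3 : X ⬝ᵥ ((A0 e U * kC e U) *ᵥ X) = U.Gam * ((planeForm m κ 0 b1 b2 V (X iP) xn xt en et
      + normalForm m 0 b1 b2 V xz ez) - (planeForm m κ 1 b1 b2 V (X iP) xn xt en et
      + normalForm m 1 b1 b2 V xz ez)) := by
    rw [A0_kC_form]
    simp only [formA, formM, d1, d2, d3, hB, d4, d5, d6, d7, d8, d9, d10, ← hm,
      div_eq_mul_inv, hκ', hG1, hG2, one_mul]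
    simp only [planeForm, normalForm]
    generalize U.Gam = G at *
    linear_combination (2 * G * m * xz * ez + 2 * G * m * xt * et + 2 * G * m * xn * en - 2 * G * b2 * m * κ * X iP * xt + 2 * G * b2^2 * xz * ez +
        2 * G * b2^2 * xn * en - 2 * G * b1 * m * κ * X iP * xn - 2 * G * b1 * b2 * xt * en - 2 * G * b1 * b2 * xn * et +
        2 * G * b1^2 * xz * ez + 2 * G * b1^2 * xt * et + 2 * G * V * b2 * en * et - G * V * b1 * ez^2 - G * V * b1 * et^2 -
        2 * G * V * b1 * m * xz^2 - 2 * G * V * b1 * m * xt^2 - G * V * b1 * m * xn^2 - G * V * b1 * b2^2 * xz^2 -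
        G * V * b1 * b2^2 * xn^2 + 2 * G * V * b1^2 * b2 * xn * xt - 2 * G * V * b1^3 * xz^2 - 2 * G * V * b1^3 * xt^2 + 2 * G * V^3 * X
        iP * en + G * V^3 * b1 * en^2 + G * V^3 * b1^3 * xz^2 + G * V^3 * b1^3 * xt^2 + 2 * G^3 * b2^2 * xz * ez +
        2 * G^3 * b2^2 * xn * en - 2 * G^3 * b1 * b2 * xn * et - 2 * G^3 * V * b1 * b2^2 * xz^2 - G^3 * V * b1 * b2^2 * xn^2 +
        2 * G^3 * V * b1^2 * b2 * xn * xt - 2 * G^3 * V^2 * b2^2 * xz * ez - 2 * G^3 * V^2 * b2^2 * xn * en +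
        4 * G^3 * V^2 * b1 * b2 * xn * et - G^3 * V^2 * b1 * b2^2 * κ * X iP * xn + G^3 * V^3 * b2 * en * et +
        2 * G^3 * V^3 * b1 * b2^2 * xz^2 + 2 * G^3 * V^3 * b1 * b2^2 * xn^2 - 4 * G^3 * V^3 * b1^2 * b2 * xn * xt +
        G^3 * V^4 * b2^2 * xn * en - G^3 * V^4 * b1 * b2 * xt * en - 2 * G^3 * V^4 * b1 * b2 * xn * et + G^3 * V^4 * b1 * b2^2 * κ * X
        iP * xn - G^3 * V^5 * b2 * en * et - G^3 * V^5 * b1 * b2^2 * xn^2 + 2 * G^3 * V^5 * b1^2 * b2 * xn * xt -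
        G^3 * V^6 * b2^2 * xn * en + G^3 * V^6 * b1 * b2 * xt * en) * hV
  rw [e1, e2, e3]
  simp only [planeForm, normalForm]
  ring

end Frame
end
end RMHD

/-! ### The symmetrized coefficients and their boundary form. -/

namespace RMHD
noncomputable section

section Symmetrizer

/-- `w(X) = X_{u₁} / Γ - λ X_{H₁}`. -/
def wVec (U : State) (lam : ℝ) : Idx → ℝ
  | .inl _ => 0
  | .inr (.inl k) => if k = 0 then 1 / U.Gam else 0
  | .inr (.inr (.inl k)) => if k = 0 then -lam else 0
  | .inr (.inr (.inr _)) => 0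

/-- The matrix of `X ↦ q(X) e_{H_j}`. -/
def magQ (U : State) (j : Fin 3) : Matrix Idx Idx ℝ :=
  Matrix.of fun a b => if a = iH j then qVec U b else 0

/-- The coefficient of the time derivative in the secondary symmetrization. -/
def B0 (e : ℝ → ℝ → ℝ) (U : State) (lam : ℝ) : Matrix Idx Idx ℝ := A0 e U * symK e U lam

/-- The spatial coefficients of the secondary symmetrization. -/
def Bj (e : ℝ → ℝ → ℝ) (U : State) (lam : ℝ) (j : Fin 3) : Matrix Idx Idx ℝ :=
  A e U j * symK e U lam - lam • magQ U j

variable {e : ℝ → ℝ → ℝ} {U : State} {lam : ℝ}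

theorem wVec_dot (X : Idx → ℝ) : wVec U lam ⬝ᵥ X = X (iU 0) / U.Gam - lam * X (iH 0) := by
  simp [dotProduct, wVec, iU, iH, Fin.sum_univ_three]; ring

theorem qVec_dot (X : Idx → ℝ) : qVec U ⬝ᵥ X = X iP + (U.vH * (U.H ⬝ᵥ pu X)
    - U.BSq * (U.v ⬝ᵥ pu X) + U.b ⬝ᵥ ph X) / U.Gam := by
  simp only [dotProduct, qVec, pu, ph, iU, iH, iP, Fintype.sum_sum_type,
      Finset.univ_unique, Finset.sum_singleton, Fin.sum_univ_three]
  ring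

theorem magQ_mulVec (j : Fin 3) (X : Idx → ℝ) (a : Idx) :
    (magQ U j *ᵥ X) a = if a = iH j then qVec U ⬝ᵥ X else 0 := by
  simp only [magQ, mulVec, dotProduct, of_apply]
  split_ifs <;> simp

theorem symK_mulVec (X : Idx → ℝ) : symK e U lam *ᵥ X
    = (1 / U.Gam + lam * U.Gam * U.vH) • X - (lam * U.Gam) • (kC e U *ᵥ X) := by
  simp only [symK, sub_mulVec, smul_mulVec, one_mulVec]

/-- For test functions Ψ = `symK` Θ this turns the matching condition on Ψ_{u₁} into continuity of
w(Θ). -/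
theorem symK_u_zero (hu : U.u 0 = 0) (hH : U.H 0 = 0) (X : Idx → ℝ) :
    (symK e U lam *ᵥ X) (iU 0) = wVec U lam ⬝ᵥ X := by
  have hv : U.v 0 = 0 := by simp [State.v, hu]
  have hb : U.b 0 = 0 := by simp [State.b, hH, hv]
  have hG := (Gam_pos U).ne'
  have h := congrFun (kC_mulVec (e := e) (U := U) X).2.1 0
  rw [calM_mulVec] at h
  simp only [pu, ph, Pi.add_apply, Pi.sub_apply, Pi.smul_apply, smul_eq_mul, hv, hb, hH, mul_zero,
    add_zero, sub_zero, zero_add] at h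
  rw [symK_mulVec, wVec_dot]
  simp only [Pi.sub_apply, Pi.smul_apply, smul_eq_mul, h]
  field_simp
  ring

/-- The total pressure is a left eigenvector of `kC`, and its eigenvalue (v,H) cancels the
λ-dependent part of the scalar term of `symK`. So q changes under `symK` only by the factor 1/Γ,
whatever λ is. -/
theorem q_kC (X : Idx → ℝ) :
    qVec U ⬝ᵥ (kC e U *ᵥ X) = U.vH * (qVec U ⬝ᵥ X) := by
  have hG0 := (Gam_pos U).ne'
  have hG := Gam_sq U
  obtain ⟨k1, k2, k3, k4⟩ := kC_mulVec (e := e) (U := U) X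
  have hHv : U.H ⬝ᵥ U.v = U.vH := dotProduct_comm _ _
  have hvH : U.v ⬝ᵥ U.H = U.vH := rfl
  have hHH : U.H ⬝ᵥ U.H = U.HSq := rfl
  have cu : ∀ x, x ⬝ᵥ U.v = U.v ⬝ᵥ x := fun x => dotProduct_comm _ _
  have cH : ∀ x, x ⬝ᵥ U.H = U.H ⬝ᵥ x := fun x => dotProduct_comm _ _
  rw [qVec_dot, qVec_dot, k1, k2, k3, calM_mulVec, b_eq]
  simp only [add_dotProduct, smul_dotProduct, dotProduct_add, dotProduct_sub, dotProduct_smul,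
    calA_form, formA, hvH, hHv, hHH, smul_eq_mul, State.BSq, div_eq_mul_inv]
  have hG1 : U.Gam⁻¹ = U.Gam * (1 - U.v ⬝ᵥ U.v) := by field_simp; linarith
  have hG2 : (U.Gam ^ 2)⁻¹ = 1 - U.v ⬝ᵥ U.v := by field_simp; linarith
  rw [hG1, hG2]
  grind

theorem q_symK (hu : U.u 0 = 0) (hH : U.H 0 = 0) (X : Idx → ℝ) :
    qVec U ⬝ᵥ (symK e U lam *ᵥ X) = (qVec U ⬝ᵥ X) / U.Gam := by
  rw [symK_mulVec, dotProduct_sub, dotProduct_smul, dotProduct_smul, q_kC]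
  simp only [smul_eq_mul]
  ring

theorem A_transpose (j : Fin 3) : (A e U j)ᵀ = A e U j := by
  have hj : ∀ k l, calAj e U j k l = calAj e U j l k := by
    intro k l
    have h1 : (1 : Matrix (Fin 3) (Fin 3) ℝ) k l = (1 : Matrix (Fin 3) (Fin 3) ℝ) l k := by
      simp [Matrix.one_apply, eq_comm]
    simp only [calAj, vecMulVec_apply, Matrix.add_apply, Matrix.sub_apply, Matrix.smul_apply,
      smul_eq_mul, h1]
    ring
  refine symm_of_blocks (fun k => rfl) (fun k => rfl) rfl (fun k l _ => hj k l) (fun k l => rfl)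
      (fun k => rfl) (fun k l _ => ?_) (fun k => rfl)
  change U.v j * calM U k l = U.v j * calM U l k
  rw [calM_symm]

theorem A0_transpose : (A0 e U)ᵀ = A0 e U :=
  symm_of_blocks (fun k => rfl) (fun k => rfl) rfl (fun k l _ => calA_symm) (fun k l => rfl)
      (fun k => rfl) (fun k l _ => calM_symm) (fun k => rfl)

theorem B0_symm (hu : U.u 0 = 0) (hH : U.H 0 = 0) : (B0 e U lam)ᵀ = B0 e U lam := by
  have h : (A0 e U * kC e U)ᵀ = A0 e U * kC e U := A0_kC_symm hu hH
  simp only [B0, symK, Matrix.mul_sub, Matrix.mul_smul, Matrix.mul_one, transpose_sub,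
    transpose_smul, h, A0_transpose]

theorem Bj_symm (hu : U.u 0 = 0) (hH : U.H 0 = 0) (j : Fin 3) :
    (Bj e U lam j)ᵀ = Bj e U lam j := by
  have h : (A e U j * kC e U + (1 / U.Gam) • magQ U j)ᵀ
      = A e U j * kC e U + (1 / U.Gam) • magQ U j := A_kC_symm hu hH j
  have hG := (Gam_pos U).ne'
  have : Bj e U lam j = (1 / U.Gam + lam * U.Gam * U.vH) • A e U j
      - (lam * U.Gam) • (A e U j * kC e U + (1 / U.Gam) • magQ U j) := by
    simp only [Bj, symK, Matrix.mul_sub, Matrix.mul_smul, smul_add, smul_smul,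
      mul_assoc, mul_one_div_cancel hG, mul_one]
    abel
  rw [this, transpose_sub, transpose_smul, transpose_smul, h, A_transpose]

/-- The normal matrix involves only q and w. Once both are continuous across the front, the boundary
terms of the two sides cancel. -/
theorem B_zero_form (hu : U.u 0 = 0) (hH : U.H 0 = 0) (X Y : Idx → ℝ) :
    X ⬝ᵥ (Bj e U lam 0 *ᵥ Y) = (qVec U ⬝ᵥ X) * (wVec U lam ⬝ᵥ Y)
      + (wVec U lam ⬝ᵥ X) * (qVec U ⬝ᵥ Y) := by
  have h1 : X ⬝ᵥ (magQ U 0 *ᵥ Y) = X (iH 0) * (qVec U ⬝ᵥ Y) := by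
    simp only [dotProduct, magQ_mulVec, mul_ite, mul_zero, Finset.sum_ite_eq', Finset.mem_univ,
      if_true]
  rw [Bj, sub_mulVec, smul_mulVec, dotProduct_sub, dotProduct_smul, h1, ← mulVec_mulVec,
    dotProduct_comm, boundary_form e U hu hH, symK_u_zero hu hH, q_symK hu hH, wVec_dot X]
  simp only [smul_eq_mul]
  ring

end Symmetrizer

/-! ### Admissible λ and the condition G > 0. -/

section Positivity

variable {e : ℝ → ℝ → ℝ} {U : State} {lam : ℝ}

theorem frame_exists (hu : U.u 0 = 0) :
    ∃ n1 n2 V : ℝ, n1 ^ 2 + n2 ^ 2 = 1 ∧ U.v 1 = V * n1 ∧ U.v 2 = V * n2 ∧ U.v ⬝ᵥ U.v = V ^ 2 := by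
  have hv : U.v 0 = 0 := by simp [State.v, hu]
  have hd : U.v ⬝ᵥ U.v = U.v 1 ^ 2 + U.v 2 ^ 2 := by
    simp only [dotProduct, Fin.sum_univ_three, hv]; ring
  by_cases h : U.v ⬝ᵥ U.v = 0
  · refine ⟨1, 0, 0, by norm_num, ?_, ?_, by simpa using h⟩ <;> nlinarith
  · have hp : 0 < U.v ⬝ᵥ U.v := lt_of_le_of_ne (by rw [hd]; positivity) (Ne.symm h)
    have hs := Real.sqrt_pos.2 hp
    have hsq := Real.sq_sqrt hp.le
    refine ⟨U.v 1 / √(U.v ⬝ᵥ U.v), U.v 2 / √(U.v ⬝ᵥ U.v), √(U.v ⬝ᵥ U.v), ?_, ?_, ?_, hsq.symm⟩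
    · rw [div_pow, div_pow, ← add_div, ← hd, hsq, div_self h]
    · field_simp
    · field_simp

/-- `c_s / √(ρ a² + B²)`. -/
def slow (e : ℝ → ℝ → ℝ) (U : State) : ℝ :=
  Real.sqrt (csSq e U) / Real.sqrt (U.rho * aSq e U + U.BSq)

theorem enthalpy_pos (hyp : Hyperbolic e U) : 0 < enthalpy e U := by
  have h := hyp.csSq_pos
  rw [csSq] at h
  exact (div_pos_iff_of_pos_left hyp.aSq_pos).1 h

theorem BSq_nonneg : 0 ≤ U.BSq := by
  have : 0 ≤ U.HSq := by
    simp only [State.HSq, dotProduct]; exact Finset.sum_nonneg fun i _ => mul_self_nonneg _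
  unfold State.BSq; positivity

theorem slow_pos (hyp : Hyperbolic e U) : 0 < slow e U := by
  have := mul_pos hyp.rho_pos hyp.aSq_pos
  have := BSq_nonneg (U := U)
  exact div_pos (Real.sqrt_pos.2 hyp.csSq_pos) (Real.sqrt_pos.2 (by linarith))

/-- With m = ρh and k = 1/c_s² the second factor is m + kB², so that |μ| < `slow` is the bound on μ
required by `planeForm_pos`. -/
theorem slow_sq (hyp : Hyperbolic e U) : slow e U ^ 2
    * (U.rho * enthalpy e U + 1 / (U.rho * aSq e U) * (U.rho * enthalpy e U) * U.BSq) = 1 := by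
  have h1 := mul_pos hyp.rho_pos hyp.aSq_pos
  have h2 := BSq_nonneg (U := U)
  have h3 := enthalpy_pos hyp
  have h4 : U.rho * aSq e U + U.BSq ≠ 0 := by linarith
  have h5 := hyp.rho_pos.ne'
  have h6 := hyp.aSq_pos.ne'
  rw [slow, div_pow, Real.sq_sqrt hyp.csSq_pos.le, Real.sq_sqrt (by linarith), csSq]
  field_simp
  exact div_self (by rwa [mul_comm] at h4)

/-- Put d = 1 - |v|² + λ(v,H). The scalar part of the symmetrizer is Γd and the parameter of the
rest frame forms is μ = λ/d. The bound on λ makes d positive and |μ| < `slow`, after which the two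
forms are positive definite. -/
theorem B0_pos (hyp : Hyperbolic e U) (hu : U.u 0 = 0) (hH : U.H 0 = 0)
    (hlam : |lam| * (1 + slow e U * |U.vH|) < slow e U * (1 - U.v ⬝ᵥ U.v)) (X : Idx → ℝ)
    (hX : X ≠ 0) : 0 < X ⬝ᵥ (B0 e U lam *ᵥ X) := by
  have hG := Gam_pos U
  have hGs := Gam_sq U
  have hs := slow_pos hyp
  have hh := enthalpy_pos hyp
  obtain ⟨n1, n2, V, hn, hv1, hv2, hVV⟩ := frame_exists hu
  have hv : U.v 0 = 0 := by simp [State.v, hu]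
  have hlv : |lam * U.vH| < 1 - U.v ⬝ᵥ U.v := by
    rw [abs_mul]
    have : slow e U * (|lam| * |U.vH|) < slow e U * (1 - U.v ⬝ᵥ U.v) := by
      nlinarith [abs_nonneg lam]
    exact lt_of_mul_lt_mul_left this hs.le
  have hd : 0 < 1 - U.v ⬝ᵥ U.v + lam * U.vH := by linarith [(abs_lt.1 hlv).1]
  set d := 1 - U.v ⬝ᵥ U.v + lam * U.vH with hddef
  have hc : 1 / U.Gam + lam * U.Gam * U.vH = U.Gam * d := by
    rw [hddef]; field_simp; linear_combination (-1) * hGs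
  have hμ : (lam / d) ^ 2 * slow e U ^ 2 ≤ (slow e U ^ 2) ^ 2 ∧ (lam / d) ^ 2 < slow e U ^ 2 := by
    -- The hypothesis gives |λ| < s(1 - |v|² - |λ(v,H)|), and d is at least the bracket.
    have h1 : |lam| < slow e U * d := by
      have := neg_abs_le (lam * U.vH)
      rw [abs_mul] at this
      rw [hddef]
      nlinarith
    have h2 : |lam / d| < slow e U := by
      rw [abs_div, abs_of_pos hd, div_lt_iff₀ hd]; exact h1
    have h3 : (lam / d) ^ 2 < slow e U ^ 2 := by
      rw [← sq_abs (lam / d)]; exact pow_lt_pow_left₀ h2 (abs_nonneg _) two_ne_zero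
    exact ⟨by nlinarith [sq_nonneg (slow e U)], h3⟩
  have hm : 0 < U.rho * enthalpy e U := mul_pos hyp.rho_pos hh
  -- This quantity is 1/c_s²: the speed of sound is below that of light.
  have hk1 : 1 < 1 / (U.rho * aSq e U) * (U.rho * enthalpy e U) := by
    have := hyp.csSq_lt_one
    rw [csSq, div_lt_one hh] at this
    have h1 := hyp.rho_pos
    have h2 := hyp.aSq_pos
    rw [one_div_mul_eq_div, lt_div_iff₀ (mul_pos h1 h2)]
    nlinarith
  have hVlt : |V| < 1 := by
    have : 0 < 1 - V ^ 2 := by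
      rw [← hVV]
      by_contra h
      nlinarith [sq_nonneg U.Gam]
    exact (sq_lt_one_iff_abs_lt_one V).1 (by linarith)
  set b1 := U.H 1 * n1 + U.H 2 * n2 with hb1
  set b2 := (-(U.H 1 * n2) + U.H 2 * n1) / U.Gam with hb2
  have hvH : U.vH = V * b1 := by
    simp only [State.vH, dotProduct, Fin.sum_univ_three, hv, hv1, hv2, hb1]; ring
  have hB : U.BSq = b1 ^ 2 + b2 ^ 2 := by
    have h1 : U.HSq = b1 ^ 2 + U.Gam ^ 2 * b2 ^ 2 := by
      have : U.Gam ^ 2 * b2 ^ 2 = (-(U.H 1 * n2) + U.H 2 * n1) ^ 2 := by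
        rw [hb2]; field_simp
      rw [this, hb1]
      simp only [State.HSq, dotProduct, Fin.sum_univ_three, hH]
      linear_combination (-(U.H 1 ^ 2) - U.H 2 ^ 2) * hn
    rw [State.BSq, h1, hvH]
    rw [hVV] at hGs
    field_simp
    linear_combination (-b1 ^ 2) * hGs
  have hμ2 : (lam / d) ^ 2 * (U.rho * enthalpy e U
      + 1 / (U.rho * aSq e U) * (U.rho * enthalpy e U) * (b1 ^ 2 + b2 ^ 2)) < 1 := by
    have h1 := slow_sq hyp
    rw [hB] at h1
    have h2 : 0 < U.rho * enthalpy e U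
        + 1 / (U.rho * aSq e U) * (U.rho * enthalpy e U) * (b1 ^ 2 + b2 ^ 2) := by
      have : 0 ≤ 1 / (U.rho * aSq e U) * (U.rho * enthalpy e U) * (b1 ^ 2 + b2 ^ 2) := by
        have := hk1.le
        positivity
      linarith
    nlinarith [hμ.2]
  have key := A0_symK_form (e := e) (lam := lam) hu hH X (μ := lam / d) hc.symm
    (by field_simp) hn hv1 hv2 rfl rfl hb1 hb2 rfl rfl rfl rfl rfl rfl
  rw [B0, key]
  have p1 := planeForm_pos hm rfl hk1 hμ2 hVlt (X iP) ((X (iU 1) * n1 + X (iU 2) * n2) / U.Gam)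
    (-(X (iU 1) * n2) + X (iU 2) * n1) (X (iH 1) * n1 + X (iH 2) * n2)
    ((-(X (iH 1) * n2) + X (iH 2) * n1) / U.Gam - V * (b2 * ((X (iU 1) * n1 + X (iU 2) * n2)
      / U.Gam) - b1 * (-(X (iU 1) * n2) + X (iU 2) * n1)))
  have p2 := normalForm_pos hm hk1 hμ2 hVlt (X (iU 0)) (X (iH 0) / U.Gam + V * b1 * X (iU 0))
  refine mul_pos (mul_pos hG hd) (lt_of_le_of_ne (add_nonneg (mul_nonneg hG.le
    (add_nonneg p1.1 p2.1)) (sq_nonneg _)) fun h0 => hX ?_)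
  have z := (add_eq_zero_iff_of_nonneg (mul_nonneg hG.le (add_nonneg p1.1 p2.1))
    (sq_nonneg _)).1 h0.symm
  have z2 := (add_eq_zero_iff_of_nonneg p1.1 p2.1).1 ((mul_eq_zero.1 z.1).resolve_left hG.ne')
  obtain ⟨q1, q2, q3, q4, q5⟩ := p1.2 z2.1
  obtain ⟨r1, r2⟩ := p2.2 z2.2
  have zS : X iS = 0 := pow_eq_zero_iff two_ne_zero |>.1 z.2
  rw [r1, mul_zero, add_zero, div_eq_zero_iff, or_iff_left hG.ne'] at r2
  rw [q2, q3, mul_zero, mul_zero, sub_zero, mul_zero, sub_zero, div_eq_zero_iff,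
    or_iff_left hG.ne'] at q5
  rw [div_eq_zero_iff, or_iff_left hG.ne'] at q2
  have u1 : X (iU 1) = 0 := by linear_combination n1 * q2 - n2 * q3 - X (iU 1) * hn
  have u2 : X (iU 2) = 0 := by linear_combination n2 * q2 + n1 * q3 - X (iU 2) * hn
  have h1 : X (iH 1) = 0 := by linear_combination n1 * q4 - n2 * q5 - X (iH 1) * hn
  have h2 : X (iH 2) = 0 := by linear_combination n2 * q4 + n1 * q5 - X (iH 2) * hn
  funext i
  rcases i with ⟨⟩ | k | k | ⟨⟩
  · exact q1
  · fin_cases k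
    exacts [r1, u1, u2]
  · fin_cases k
    exacts [r2, h1, h2]
  · exact zS

theorem cross_eq (z w : ℂ) :
    z.re * w.im - z.im * w.re = ‖z‖ * ‖w‖ * Real.sin (w.arg - z.arg) := by
  rw [Real.sin_sub]
  linear_combination (-(z.re)) * Complex.norm_mul_sin_arg w
    + z.im * Complex.norm_mul_cos_arg w - ‖w‖ * Real.sin w.arg * Complex.norm_mul_cos_arg z
    + ‖w‖ * Real.cos w.arg * Complex.norm_mul_sin_arg z

/-- By definition γ = |H| s(1 - |v|²)/(1 + s|(v,H)|), so the claim amounts to |λ||H| < γ. If the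
sine vanishes then λ = 0 and no condition is needed, in agreement with the value +∞ of the quotient.
The factor N is the norm of the other magnetic field and cancels. -/
theorem lam_bound (hyp : Hyperbolic e U) {D s J N : ℝ} (hD : 0 < |D|)
    (hN : N ≠ 0) (hU : 0 < ‖U.HTan‖)
    (h : J < (|D| * (ENNReal.ofReal (gam e U) / ENNReal.ofReal |s|).toReal) ∨ s = 0)
    (hl : |lam| * (‖U.HTan‖ * N * |D|) = J * N * |s|) :
    |lam| * (1 + slow e U * |U.vH|) < slow e U * (1 - U.v ⬝ᵥ U.v) := by
  have hs := slow_pos hyp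
  have hv : 0 < 1 - U.v ⬝ᵥ U.v := by
    by_contra h
    nlinarith [Gam_sq U, sq_nonneg U.Gam]
  have hr : 0 < Real.sqrt (U.rho * aSq e U + U.BSq) := by
    have := mul_pos hyp.rho_pos hyp.aSq_pos
    have := BSq_nonneg (U := U)
    exact Real.sqrt_pos.2 (by linarith)
  have h1 : 0 < 1 + slow e U * |U.vH| := by positivity
  have hgam : gam e U * (1 + slow e U * |U.vH|) = ‖U.HTan‖ * (slow e U * (1 - U.v ⬝ᵥ U.v)) := by
    have h2 : Real.sqrt (U.rho * aSq e U + U.BSq) + Real.sqrt (csSq e U) * |U.vH|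
        = Real.sqrt (U.rho * aSq e U + U.BSq) * (1 + slow e U * |U.vH|) := by
      rw [slow]; field_simp
    rw [gam, h2, slow]
    rw [slow] at h1
    field_simp
  have hg : 0 < gam e U := by
    have : 0 < gam e U * (1 + slow e U * |U.vH|) := by rw [hgam]; positivity
    exact pos_of_mul_pos_left this h1.le
  have hl' : |lam| * (‖U.HTan‖ * |D|) = J * |s| :=
    mul_right_cancel₀ hN (by linear_combination hl)
  have key : |lam| * ‖U.HTan‖ < gam e U := by
    by_cases hs0 : s = 0
    · rw [hs0, abs_zero, mul_zero, ← mul_assoc] at hl'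
      rw [(mul_eq_zero.1 hl').resolve_right hD.ne']
      exact hg
    · have hs1 : 0 < |s| := abs_pos.2 hs0
      have h3 := h.resolve_right hs0
      rw [← ENNReal.ofReal_div_of_pos hs1, ENNReal.toReal_ofReal (by positivity),
        ← mul_div_assoc, lt_div_iff₀ hs1] at h3
      have : |lam| * ‖U.HTan‖ * |D| < gam e U * |D| := by nlinarith
      exact lt_of_mul_lt_mul_right this hD.le
  have : ‖U.HTan‖ * (|lam| * (1 + slow e U * |U.vH|))
      < ‖U.HTan‖ * (slow e U * (1 - U.v ⬝ᵥ U.v)) := by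
    rw [← hgam]; nlinarith
  exact lt_of_mul_lt_mul_left this hU.le

/-- The equation [v] = λ⁺H⁺ - λ⁻H⁻ is solved by Cramer's rule. Writing the determinants through
angles gives |λ⁺||H⁺||sin(φ⁺ - φ⁻)| = |[v]||sin φ⁻| and the analogous formula for λ⁻; G > 0 then
says |λ^±||H^±| < γ^±. -/
theorem exists_lam {Up Um : State} (hp : Hyperbolic e Up) (hm : Hyperbolic e Um)
    (hH : Up.H 1 * Um.H 2 - Up.H 2 * Um.H 1 ≠ 0) (hG : 0 < G e Up Um) :
    ∃ lp lm : ℝ, |lp| * (1 + slow e Up * |Up.vH|) < slow e Up * (1 - Up.v ⬝ᵥ Up.v) ∧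
      |lm| * (1 + slow e Um * |Um.vH|) < slow e Um * (1 - Um.v ⬝ᵥ Um.v) ∧
      Up.v 1 - lp * Up.H 1 = Um.v 1 - lm * Um.H 1 ∧
      Up.v 2 - lp * Up.H 2 = Um.v 2 - lm * Um.H 2 := by
  set d := Up.H 1 * Um.H 2 - Up.H 2 * Um.H 1 with hd
  set J := vJump Up Um with hJ
  have hJre : J.re = Up.v 1 - Um.v 1 := rfl
  have hJim : J.im = Up.v 2 - Um.v 2 := rfl
  have c1 : d = ‖Up.HTan‖ * ‖Um.HTan‖ * Real.sin (Um.HTan.arg - Up.HTan.arg) :=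
    cross_eq Up.HTan Um.HTan
  have c2 : J.re * Um.H 2 - J.im * Um.H 1
      = ‖J‖ * ‖Um.HTan‖ * Real.sin (angleTo Up Um Um.HTan) := cross_eq J Um.HTan
  have c3 : J.re * Up.H 2 - J.im * Up.H 1
      = ‖J‖ * ‖Up.HTan‖ * Real.sin (angleTo Up Um Up.HTan) := cross_eq J Up.HTan
  have np : ‖Up.HTan‖ ≠ 0 := fun h => hH (by rw [c1, h]; ring)
  have nm : ‖Um.HTan‖ ≠ 0 := fun h => hH (by rw [c1, h]; ring)
  have hsin : |Real.sin (angleTo Up Um Up.HTan - angleTo Up Um Um.HTan)|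
      = |Real.sin (Um.HTan.arg - Up.HTan.arg)| := by
    rw [angleTo, angleTo, sub_sub_sub_cancel_right, ← abs_neg, ← Real.sin_neg, neg_sub]
  have hD : 0 < |Real.sin (Um.HTan.arg - Up.HTan.arg)| :=
    abs_pos.2 fun h => hH (by rw [c1, h]; ring)
  have hG' := hG
  rw [G, hsin, ← hJ, sub_pos] at hG'
  -- Monotonicity of `ENNReal.toReal` needs a finite upper bound; where a sine vanishes the
  -- corresponding quotient imposes no bound.
  have fin : ∀ {x s : ℝ}, s ≠ 0 → ENNReal.ofReal x / ENNReal.ofReal |s| ≠ ⊤ := fun hs =>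
    ENNReal.div_ne_top ENNReal.ofReal_ne_top (by simpa using hs)
  refine ⟨(J.re * Um.H 2 - J.im * Um.H 1) / d, (J.re * Up.H 2 - J.im * Up.H 1) / d, ?_, ?_, ?_, ?_⟩
  · refine lam_bound (J := ‖J‖) hp hD nm ((norm_nonneg _).lt_of_ne' np)
      (s := Real.sin (angleTo Up Um Um.HTan)) ?_ ?_
    · by_cases h0 : Real.sin (angleTo Up Um Um.HTan) = 0
      · exact Or.inr h0
      · exact Or.inl (hG'.trans_le (mul_le_mul_of_nonneg_left
          (ENNReal.toReal_mono (fin h0) (min_le_left _ _)) hD.le))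
    · have : |d| = ‖Up.HTan‖ * ‖Um.HTan‖ * |Real.sin (Um.HTan.arg - Up.HTan.arg)| := by
        rw [c1, abs_mul, abs_mul, abs_norm, abs_norm]
      rw [← this, abs_div, div_mul_cancel₀ _ (abs_ne_zero.2 hH), c2, abs_mul, abs_mul, abs_norm,
        abs_norm]
  · refine lam_bound (J := ‖J‖) hm hD np ((norm_nonneg _).lt_of_ne' nm)
      (s := Real.sin (angleTo Up Um Up.HTan)) ?_ ?_
    · by_cases h0 : Real.sin (angleTo Up Um Up.HTan) = 0
      · exact Or.inr h0
      · exact Or.inl (hG'.trans_le (mul_le_mul_of_nonneg_left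
          (ENNReal.toReal_mono (fin h0) (min_le_right _ _)) hD.le))
    · have : |d| = ‖Um.HTan‖ * ‖Up.HTan‖ * |Real.sin (Um.HTan.arg - Up.HTan.arg)| := by
        rw [c1, abs_mul, abs_mul, abs_norm, abs_norm, mul_comm ‖Up.HTan‖]
      rw [← this, abs_div, div_mul_cancel₀ _ (abs_ne_zero.2 hH), c3, abs_mul, abs_mul, abs_norm,
        abs_norm]
  · rw [hJre, hJim]; field_simp; rw [hd]; ring
  · rw [hJre, hJim]; field_simp; rw [hd]; ring

end Positivity
end
end RMHD

namespace RMHD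
noncomputable section

/-! ### The induction equation inside the symmetric system. -/

section Induction

variable {e : ℝ → ℝ → ℝ} {U : State}

/-- The row that extracts the induction equation in the direction `x`. -/
def indVec (U : State) (x : Fin 3 → ℝ) : Idx → ℝ
  | .inr (.inr (.inl k)) => U.Gam * (x k - (U.v ⬝ᵥ x) * U.v k)
  | _ => 0

theorem ph_indVec (x : Fin 3 → ℝ) : ph (indVec U x) = U.Gam • (x - (U.v ⬝ᵥ x) • U.v) := rfl
theorem pu_indVec (x : Fin 3 → ℝ) : pu (indVec U x) = 0 := rfl

theorem b_indVec (x : Fin 3 → ℝ) : U.b ⬝ᵥ ph (indVec U x) = U.H ⬝ᵥ x := by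
  have hHv : U.H ⬝ᵥ U.v = U.vH := dotProduct_comm _ _
  have hG := Gam_sq U
  have hG0 := (Gam_pos U).ne'
  rw [ph_indVec, b_eq]
  simp only [add_dotProduct, smul_dotProduct, dotProduct_sub, dotProduct_smul, smul_eq_mul, hHv]
  field_simp
  linear_combination (U.v ⬝ᵥ x) * U.vH * hG

theorem q_indVec (x : Fin 3 → ℝ) : qVec U ⬝ᵥ indVec U x = (U.H ⬝ᵥ x) / U.Gam := by
  rw [qVec_dot, b_indVec, pu_indVec]
  simp [indVec, iP]

/-- The inverse of `calM` is Γ(I - v ⊗ v); so `indVec` is the test vector whose momentum is the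
purely magnetic vector x. -/
theorem A0_indVec (x : Fin 3 → ℝ) (a : Idx) : (A0 e U *ᵥ indVec U x) a
    = match a with
      | .inr (.inr (.inl k)) => x k
      | _ => 0 := by
  obtain ⟨h1, h2, h3, h4⟩ := A0_mulVec (e := e) (indVec U x)
  have hG := Gam_sq U
  have hG0 := (Gam_pos U).ne'
  rcases a with ⟨⟩ | k | k | ⟨⟩
  · exact h1.trans (by rw [pu_indVec]; simp [indVec, iP])
  · refine (congrFun h2 k).trans ?_
    rw [pu_indVec]; simp [indVec, iP]
  · refine (congrFun h3 k).trans ?_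
    rw [calM_mulVec, ph_indVec]
    simp only [Pi.add_apply, Pi.smul_apply, Pi.sub_apply, smul_eq_mul, dotProduct_smul,
      dotProduct_sub]
    field_simp
    linear_combination (U.v ⬝ᵥ x) * U.v k * hG
  · exact h4

theorem A_indVec (j : Fin 3) (x : Fin 3 → ℝ) (a : Idx) : (A e U j *ᵥ indVec U x) a
    = match a with
      | .inr (.inl k) => ((U.H ⬝ᵥ x) * (ej j k - U.v j * U.v k)
          - U.H j * (x k - (U.v ⬝ᵥ x) * U.v k)) / U.Gam
      | .inr (.inr (.inl k)) => U.v j * x k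
      | _ => 0 := by
  have hG0 := (Gam_pos U).ne'
  rcases a with ⟨⟩ | k | k | ⟨⟩
  · simp [mulVec, dotProduct, A, block, indVec]
  · have hb := b_indVec (U := U) x
    simp only [dotProduct, Fin.sum_univ_three, ph_indVec, Pi.smul_apply, Pi.sub_apply,
      smul_eq_mul] at hb
    have h1 : ∀ l, (1 : Matrix (Fin 3) (Fin 3) ℝ) l k = if l = k then 1 else 0 :=
      fun l => Matrix.one_apply
    have : (A e U j *ᵥ indVec U x) (iU k) = ∑ l, calN U j l k * (ph (indVec U x)) l := by
      simp [mulVec, dotProduct, A, block, indVec, ph, iU, iH]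
    refine this.trans ?_
    simp only [dotProduct, Fin.sum_univ_three, calN, ph_indVec, Pi.smul_apply, Pi.sub_apply,
      smul_eq_mul, Matrix.sub_apply, Matrix.smul_apply, vecMulVec_apply, ← hb, h1]
    fin_cases k <;> simp <;> field_simp <;> ring
  · have h := A0_indVec (e := e) (U := U) x (iH k)
    have h2 : (A0 e U *ᵥ indVec U x) (iH k) = ∑ l, calM U k l * (ph (indVec U x)) l := by
      simp [mulVec, dotProduct, A0, block, indVec, ph, iH]
    have h3 : (A e U j *ᵥ indVec U x) (iH k) = ∑ l, U.v j * calM U k l * (ph (indVec U x)) l := by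
      simp [mulVec, dotProduct, A, block, indVec, ph, iH]
    refine h3.trans ?_
    simp only [mul_assoc]
    rw [← Finset.mul_sum, ← h2, h]; rfl
  · simp [mulVec, dotProduct, A, block, indVec]

end Induction

/-! ### Absence of unstable normal modes. -/

section Modes

variable {e : ℝ → ℝ → ℝ} {U : State} {lam : ℝ}

theorem row_toC (r : Idx → ℝ) (M : Matrix Idx Idx ℝ) (hM : Mᵀ = M) (X : Idx → ℂ) :
    (fun i => (r i : ℂ)) ⬝ᵥ (toC M *ᵥ X) = (fun i => ((M *ᵥ r) i : ℂ)) ⬝ᵥ X := by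
  rw [dotProduct_mulVec]
  congr 1
  funext i
  have : (M *ᵥ r) i = (r ᵥ* M) i := by rw [← vecMul_transpose, hM]
  rw [this]
  simp [vecMul, dotProduct, toC]

theorem mode_induction {τ : ℂ} {k : Fin 2 → ℝ} {X X' : Idx → ℂ}
    (h : τ • (toC (A0 e U) *ᵥ X) + toC (A e U 0) *ᵥ X'
      + Complex.I • ((k 0 : ℂ) • (toC (A e U 1) *ᵥ X) + (k 1 : ℂ) • (toC (A e U 2) *ᵥ X)) = 0)
    (x : Fin 3 → ℝ) :
    τ * ((fun i => ((A0 e U *ᵥ indVec U x) i : ℂ)) ⬝ᵥ X)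
      + (fun i => ((A e U 0 *ᵥ indVec U x) i : ℂ)) ⬝ᵥ X'
      + Complex.I * (k 0 * ((fun i => ((A e U 1 *ᵥ indVec U x) i : ℂ)) ⬝ᵥ X)
        + k 1 * ((fun i => ((A e U 2 *ᵥ indVec U x) i : ℂ)) ⬝ᵥ X)) = 0 := by
  have := congrArg (fun Y => (fun i => (indVec U x i : ℂ)) ⬝ᵥ Y) h
  simpa only [dotProduct_add, dotProduct_smul, row_toC _ _ A0_transpose,
    row_toC _ _ (A_transpose _), smul_eq_mul, dotProduct_zero] using this

/-- The normal component of the induction equation and the divergence constraint for a mode. -/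
theorem mode_constraint (hu : U.u 0 = 0) (hH : U.H 0 = 0) {τ : ℂ} {k : Fin 2 → ℝ}
    {X X' : Idx → ℂ}
    (h : τ • (toC (A0 e U) *ᵥ X) + toC (A e U 0) *ᵥ X'
      + Complex.I • ((k 0 : ℂ) • (toC (A e U 1) *ᵥ X) + (k 1 : ℂ) • (toC (A e U 2) *ᵥ X)) = 0) :
    (τ + Complex.I * (U.v 1 * k 0 + U.v 2 * k 1 : ℝ)) * X (iH 0)
      = Complex.I * (U.H 1 * k 0 + U.H 2 * k 1 : ℝ) * X (iU 0) / U.Gam ∧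
    (τ + Complex.I * (U.v 1 * k 0 + U.v 2 * k 1 : ℝ)) * (k 0 * X (iH 1) + k 1 * X (iH 2))
      = - ((U.H 1 * k 0 + U.H 2 * k 1 : ℝ) * X' (iU 0) / U.Gam) := by
  have hv : U.v 0 = 0 := by simp [State.v, hu]
  have hG : (U.Gam : ℂ) ≠ 0 := by exact_mod_cast (Gam_pos U).ne'
  -- The direction e₁ gives the normal component of the induction equation; the direction of the
  -- wave vector gives the tangential part of its divergence.
  have h1 := mode_induction h ![1, 0, 0]
  have h2 := mode_induction h ![0, k 0, k 1]
  simp only [A0_indVec, A_indVec] at h1 h2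
  simp only [dotProduct, Fintype.sum_sum_type, Finset.univ_unique, Finset.sum_singleton,
    Fin.sum_univ_three, hv, hH, ej] at h1 h2
  simp [← iH.eq_def, ← iU.eq_def] at h1 h2
  change _ * X (iH 0) = _ * X (iU 0) / _ ∧ _
  constructor
  · field_simp at h1 ⊢
    push_cast
    linear_combination h1
  · push_cast
    linear_combination h2

theorem symK_transpose_A0 (hu : U.u 0 = 0) (hH : U.H 0 = 0) :
    (symK e U lam)ᵀ * A0 e U = B0 e U lam := by
  have := congrArg transpose (show B0 e U lam = A0 e U * symK e U lam from rfl)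
  rw [transpose_mul, A0_transpose, B0_symm hu hH] at this
  exact this.symm

theorem symK_transpose_A (hu : U.u 0 = 0) (hH : U.H 0 = 0) (j : Fin 3) :
    (symK e U lam)ᵀ * A e U j = Bj e U lam j + lam • (magQ U j)ᵀ := by
  have : A e U j * symK e U lam = Bj e U lam j + lam • magQ U j := by rw [Bj]; abel
  have := congrArg transpose this
  rwa [transpose_mul, A_transpose, transpose_add, transpose_smul, Bj_symm hu hH] at this

theorem toC_mul (M N : Matrix Idx Idx ℝ) (X : Idx → ℂ) :
    toC M *ᵥ (toC N *ᵥ X) = toC (M * N) *ᵥ X := by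
  have : toC (M * N) = toC M * toC N := Matrix.map_mul (f := Complex.ofRealHom)
  rw [mulVec_mulVec, this]

theorem magQ_transpose_toC (j : Fin 3) (X : Idx → ℂ) :
    toC (lam • (magQ U j)ᵀ) *ᵥ X = fun a => lam * X (iH j) * qVec U a := by
  funext a
  simp only [toC, magQ, mulVec, dotProduct, map_apply, Matrix.smul_apply, transpose_apply, of_apply,
    smul_eq_mul, Complex.ofReal_mul]
  rw [Finset.sum_eq_single (iH j) (fun b _ hb => by simp [hb]) (by simp)]
  simp
  ring

theorem toC_add (M N : Matrix Idx Idx ℝ) (X : Idx → ℂ) :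
    toC (M + N) *ᵥ X = toC M *ᵥ X + toC N *ᵥ X := by
  have : toC (M + N) = toC M + toC N := by ext; simp [toC]
  rw [this, add_mulVec]

/-- The symmetrized equation for a mode. -/
theorem mode_symmetrized (hu : U.u 0 = 0) (hH : U.H 0 = 0) {τ : ℂ} {k : Fin 2 → ℝ}
    {X X' : Idx → ℂ}
    (h : τ • (toC (A0 e U) *ᵥ X) + toC (A e U 0) *ᵥ X'
      + Complex.I • ((k 0 : ℂ) • (toC (A e U 1) *ᵥ X) + (k 1 : ℂ) • (toC (A e U 2) *ᵥ X)) = 0)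
    (hdiv : X' (iH 0) + Complex.I * (k 0 * X (iH 1) + k 1 * X (iH 2)) = 0) :
    τ • (toC (B0 e U lam) *ᵥ X) + toC (Bj e U lam 0) *ᵥ X'
      + Complex.I • (toC (k 0 • Bj e U lam 1 + k 1 • Bj e U lam 2) *ᵥ X) = 0 := by
  have h1 := congrArg (fun Y => toC (symK e U lam)ᵀ *ᵥ Y) h
  simp only [mulVec_add, mulVec_smul, toC_mul, symK_transpose_A0 hu hH, symK_transpose_A hu hH,
    toC_add, magQ_transpose_toC, mulVec_zero] at h1
  have hs : ∀ (r : ℝ) M, toC (r • M) *ᵥ X = (r : ℂ) • (toC M *ᵥ X) := by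
    intro r M
    have : toC (r • M) = (r : ℂ) • toC M := by ext; simp [toC]
    rw [this, smul_mulVec]
  rw [toC_add, hs, hs]
  funext a
  have h2 := congrFun h1 a
  simp only [Pi.add_apply, Pi.smul_apply, smul_eq_mul, Pi.zero_apply] at h2 ⊢
  linear_combination h2 - lam * qVec U a * hdiv

theorem re_toC (M : Matrix Idx Idx ℝ) (X : Idx → ℂ) :
    (fun a => ((toC M *ᵥ X) a).re) = M *ᵥ fun a => (X a).re := by
  funext a; simp [toC, mulVec, dotProduct]

theorem im_toC (M : Matrix Idx Idx ℝ) (X : Idx → ℂ) :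
    (fun a => ((toC M *ᵥ X) a).im) = M *ᵥ fun a => (X a).im := by
  funext a; simp [toC, mulVec, dotProduct]

theorem dot_symm {M : Matrix Idx Idx ℝ} (hM : Mᵀ = M) (X Y : Idx → ℝ) :
    X ⬝ᵥ (M *ᵥ Y) = Y ⬝ᵥ (M *ᵥ X) := by
  rw [dotProduct_mulVec, ← mulVec_transpose, hM, dotProduct_comm]

/-- The real part of the equation paired with the conjugate of X: the symmetric P contributes a
purely imaginary term, and only Re τ survives from the M term. -/
theorem energy_identity {M N P : Matrix Idx Idx ℝ} (hM : Mᵀ = M) (hP : Pᵀ = P) {τ : ℂ}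
    {X X' : Idx → ℂ}
    (h : τ • (toC M *ᵥ X) + toC N *ᵥ X' + Complex.I • (toC P *ᵥ X) = 0) :
    (fun a => (X a).re) ⬝ᵥ (N *ᵥ fun a => (X' a).re)
      + (fun a => (X a).im) ⬝ᵥ (N *ᵥ fun a => (X' a).im)
      = -(τ.re * ((fun a => (X a).re) ⬝ᵥ (M *ᵥ fun a => (X a).re)
        + (fun a => (X a).im) ⬝ᵥ (M *ᵥ fun a => (X a).im))) := by
  have h1 : N *ᵥ (fun a => (X' a).re) = -(τ.re • (M *ᵥ fun a => (X a).re)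
      - τ.im • (M *ᵥ fun a => (X a).im) - P *ᵥ fun a => (X a).im) := by
    rw [← re_toC, ← re_toC, ← im_toC, ← im_toC]
    funext a
    have := congrArg Complex.re (congrFun h a)
    simp at this ⊢
    linarith
  have h2 : N *ᵥ (fun a => (X' a).im) = -(τ.re • (M *ᵥ fun a => (X a).im)
      + τ.im • (M *ᵥ fun a => (X a).re) + P *ᵥ fun a => (X a).re) := by
    rw [← re_toC, ← re_toC, ← im_toC, ← im_toC]
    funext a
    have := congrArg Complex.im (congrFun h a)
    simp at this ⊢
    linarith
  rw [h1, h2]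
  simp only [dotProduct_neg, dotProduct_sub, dotProduct_add, dotProduct_smul, smul_eq_mul]
  rw [dot_symm hM (fun a => (X a).im) (fun a => (X a).re),
    dot_symm hP (fun a => (X a).im) (fun a => (X a).re)]
  ring

theorem hasDerivWithinAt_form {M : Matrix Idx Idx ℝ} (hM : Mᵀ = M) {I : Set ℝ} {s : ℝ}
    {X : ℝ → Idx → ℝ} {X' : Idx → ℝ} (hX : HasDerivWithinAt X X' I s) :
    HasDerivWithinAt (fun r => X r ⬝ᵥ (M *ᵥ X r)) (2 * (X s ⬝ᵥ (M *ᵥ X'))) I s := by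
  have hc := hasDerivWithinAt_pi.1 hX
  have h1 : HasDerivWithinAt (fun r => ∑ a, X r a * ∑ b, M a b * X r b)
      (∑ a, (X' a * ∑ b, M a b * X s b + X s a * ∑ b, M a b * X' b)) I s :=
    HasDerivWithinAt.fun_sum fun a _ => (hc a).mul (HasDerivWithinAt.fun_sum fun b _ =>
      (hc b).const_mul _)
  refine h1.congr_deriv ?_
  rw [Finset.sum_add_distrib]
  change X' ⬝ᵥ (M *ᵥ X s) + X s ⬝ᵥ (M *ᵥ X') = _
  rw [dot_symm hM]; ring

theorem not_integrableOn_of_le {S : Set ℝ} (hS : MeasurableSet S) (hinf : volume S = ⊤)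
    {f : ℝ → ℝ} {c : ℝ} (hc : 0 < c) (hf : ∀ x ∈ S, c ≤ |f x|) : ¬ IntegrableOn f S := by
  intro h
  have h1 : IntegrableOn (fun _ : ℝ => c) S := by
    refine Integrable.mono h aestronglyMeasurable_const ((ae_restrict_iff' hS).2 (.of_forall ?_))
    intro x hx
    rw [Real.norm_eq_abs, Real.norm_eq_abs, abs_of_pos hc]
    exact hf x hx
  rw [integrableOn_const_iff] at h1
  simp [hc.ne', hinf] at h1

theorem memLp_form {I : Set ℝ} {V : ℝ → Idx → ℂ} (hV : MemLp V 2 (volume.restrict I))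
    (M : Matrix Idx Idx ℝ) :
    IntegrableOn (fun s => (fun a => (V s a).re) ⬝ᵥ (M *ᵥ fun a => (V s a).re)
      + (fun a => (V s a).im) ⬝ᵥ (M *ᵥ fun a => (V s a).im)) I := by
  have hc : ∀ a, MemLp (fun s => V s a) 2 (volume.restrict I) := fun a =>
    (ContinuousLinearMap.proj (R := ℝ) (φ := fun _ : Idx => ℂ) a).comp_memLp' hV
  have hre : ∀ a, MemLp (fun s => (V s a).re) 2 (volume.restrict I) := fun a =>
    Complex.reCLM.comp_memLp' (hc a)
  have him : ∀ a, MemLp (fun s => (V s a).im) 2 (volume.restrict I) := fun a =>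
    Complex.imCLM.comp_memLp' (hc a)
  have key : ∀ f : ℝ → Idx → ℝ, (∀ a, MemLp (fun s => f s a) 2 (volume.restrict I)) →
      IntegrableOn (fun s => f s ⬝ᵥ (M *ᵥ f s)) I := by
    intro f hf
    simp only [dotProduct, mulVec]
    refine integrable_finsetSum _ fun a _ => ?_
    simp only [Finset.mul_sum]
    refine integrable_finsetSum _ fun b _ => ?_
    have := ((hf a).integrable_mul (hf b)).const_mul (M a b)
    refine this.congr (.of_forall fun s => ?_)
    simp only [Pi.mul_apply]; ring
  exact (key _ hre).add (key _ him)

/-- The quadratic form of a real matrix at a complex vector. -/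
def cForm (M : Matrix Idx Idx ℝ) (X : Idx → ℂ) : ℝ :=
  (fun a => (X a).re) ⬝ᵥ (M *ᵥ fun a => (X a).re) + (fun a => (X a).im) ⬝ᵥ (M *ᵥ fun a => (X a).im)

theorem cForm_B0 (hB : ∀ X : Idx → ℝ, X ≠ 0 → 0 < X ⬝ᵥ (B0 e U lam *ᵥ X)) (X : Idx → ℂ) :
    0 ≤ cForm (B0 e U lam) X ∧ (cForm (B0 e U lam) X = 0 → X = 0) := by
  have h0 : ∀ Y : Idx → ℝ, 0 ≤ Y ⬝ᵥ (B0 e U lam *ᵥ Y) := fun Y => by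
    by_cases h : Y = 0
    · simp [h]
    · exact (hB Y h).le
  refine ⟨add_nonneg (h0 _) (h0 _), fun h => ?_⟩
  have h1 := (add_eq_zero_iff_of_nonneg (h0 _) (h0 _)).1 h
  have h2 : (fun a => (X a).re) = 0 := by
    by_contra hne
    exact (hB _ hne).ne' h1.1
  have h3 : (fun a => (X a).im) = 0 := by
    by_contra hne
    exact (hB _ hne).ne' h1.2
  funext a
  exact Complex.ext (congrFun h2 a) (congrFun h3 a)

variable {τ : ℂ} {k : Fin 2 → ℝ} {I : Set ℝ} {V : ℝ → Idx → ℂ}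

theorem tau_shift_ne_zero (hτ : 0 < τ.re) (r : ℝ) : τ + Complex.I * (r : ℂ) ≠ 0 := by
  intro h
  have := congrArg Complex.re h
  simp at this
  linarith

/-- The divergence constraint is not imposed on modes; it follows. The induction equation gives (τ +
i v·k) div H = 0, and the factor has positive real part. -/
theorem mode_div (hu : U.u 0 = 0) (hH : U.H 0 = 0) (hI : UniqueDiffOn ℝ I) (hτ : 0 < τ.re)
    (hV : ModeEq e U τ k I V) {s : ℝ} (hs : s ∈ I) :
    derivWithin V I s (iH 0) + Complex.I * (k 0 * V s (iH 1) + k 1 * V s (iH 2)) = 0 := by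
  have hd := (hV.1 s hs).hasDerivWithinAt
  have hc := hasDerivWithinAt_pi.1 hd
  have h1 := (hc (iH 0)).const_mul (τ + Complex.I * ((U.v 1 * k 0 + U.v 2 * k 1 : ℝ) : ℂ))
  have h2 := ((hc (iU 0)).const_mul
    (Complex.I * ((U.H 1 * k 0 + U.H 2 * k 1 : ℝ) : ℂ))).div_const (U.Gam : ℂ)
  have h3 := h2.congr (fun r hr => (mode_constraint hu hH (hV.2 r hr)).1)
      (mode_constraint hu hH (hV.2 s hs)).1
  have h4 := (hI s hs).eq_deriv _ h1 h3
  have h5 := (mode_constraint hu hH (hV.2 s hs)).2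
  have h6 := tau_shift_ne_zero hτ (U.v 1 * k 0 + U.v 2 * k 1)
  refine (mul_eq_zero.1 ?_).resolve_left h6
  linear_combination h4 + Complex.I * h5

theorem mode_energy (hu : U.u 0 = 0) (hH : U.H 0 = 0) (hI : UniqueDiffOn ℝ I) (hτ : 0 < τ.re)
    (hV : ModeEq e U τ k I V) {s : ℝ} (hs : s ∈ I) :
    HasDerivWithinAt (fun r => cForm (Bj e U lam 0) (V r))
      (-(2 * τ.re * cForm (B0 e U lam) (V s))) I s := by
  have hc := hasDerivWithinAt_pi.1 (hV.1 s hs).hasDerivWithinAt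
  have hre : HasDerivWithinAt (fun r a => (V r a).re) (fun a => (derivWithin V I s a).re) I s :=
    hasDerivWithinAt_pi.2 fun a => by
      simpa [Function.comp_def] using
        (Complex.reCLM.hasFDerivAt (x := V s a)).comp_hasDerivWithinAt s (hc a)
  have him : HasDerivWithinAt (fun r a => (V r a).im) (fun a => (derivWithin V I s a).im) I s :=
    hasDerivWithinAt_pi.2 fun a => by
      simpa [Function.comp_def] using
        (Complex.imCLM.hasFDerivAt (x := V s a)).comp_hasDerivWithinAt s (hc a)
  have hsym := Bj_symm (e := e) (lam := lam) hu hH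
  refine ((hasDerivWithinAt_form (hsym 0) hre).add
    (hasDerivWithinAt_form (hsym 0) him)).congr_deriv ?_
  have := energy_identity (B0_symm (lam := lam) hu hH)
    (P := k 0 • Bj e U lam 1 + k 1 • Bj e U lam 2)
    (by rw [transpose_add, transpose_smul, transpose_smul, hsym, hsym])
    (mode_symmetrized hu hH (hV.2 s hs) (mode_div hu hH hI hτ hV hs))
  unfold cForm
  linear_combination 2 * this

theorem mode_zero (hu : U.u 0 = 0) (hH : U.H 0 = 0) (hI : UniqueDiffOn ℝ I) (hτ : 0 < τ.re)
    (hB : ∀ X : Idx → ℝ, X ≠ 0 → 0 < X ⬝ᵥ (B0 e U lam *ᵥ X))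
    (hV : ModeEq e U τ k I V) (h0 : ∀ s ∈ I, cForm (Bj e U lam 0) (V s) = 0) :
    ∀ s ∈ I, V s = 0 := by
  intro s hs
  have h1 := mode_energy (lam := lam) hu hH hI hτ hV hs
  have h2 := (hI s hs).eq_deriv _ h1
    ((hasDerivWithinAt_const s I (0 : ℝ)).congr h0 (h0 s hs))
  refine (cForm_B0 hB (V s)).2 ?_
  have : 2 * τ.re ≠ 0 := by positivity
  exact (mul_eq_zero.1 (neg_eq_zero.1 h2)).resolve_left this

theorem mode_antitone (hu : U.u 0 = 0) (hH : U.H 0 = 0) (hI : UniqueDiffOn ℝ I)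
    (hIc : Convex ℝ I) (hτ : 0 < τ.re)
    (hB : ∀ X : Idx → ℝ, X ≠ 0 → 0 < X ⬝ᵥ (B0 e U lam *ᵥ X))
    (hV : ModeEq e U τ k I V) : AntitoneOn (fun r => cForm (Bj e U lam 0) (V r)) I := by
  have h := fun s (hs : s ∈ I) => mode_energy (lam := lam) hu hH hI hτ hV hs
  refine antitoneOn_of_deriv_nonpos hIc (fun s hs => (h s hs).continuousWithinAt)
    (fun s hs => ((h s (interior_subset hs)).hasDerivAt
      (mem_interior_iff_mem_nhds.1 hs)).differentiableAt.differentiableWithinAt) fun s hs => ?_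
  rw [((h s (interior_subset hs)).hasDerivAt (mem_interior_iff_mem_nhds.1 hs)).deriv]
  have := mul_nonneg hτ.le (cForm_B0 hB (V s)).1
  linarith

theorem cForm_Bzero (hu : U.u 0 = 0) (hH : U.H 0 = 0) (X : Idx → ℂ) :
    cForm (Bj e U lam 0) X
      = 2 * (qC U X * starRingEnd ℂ (X (iU 0) / U.Gam - lam * X (iH 0))).re := by
  have hq1 : (qC U X).re = qVec U ⬝ᵥ fun a => (X a).re := by simp [qC, dotProduct]
  have hq2 : (qC U X).im = qVec U ⬝ᵥ fun a => (X a).im := by simp [qC, dotProduct]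
  rw [cForm, B_zero_form hu hH, B_zero_form hu hH, wVec_dot, wVec_dot, Complex.mul_re, hq1, hq2]
  simp only [Complex.conj_re, Complex.conj_im, Complex.sub_re, Complex.sub_im,
    Complex.div_ofReal_re, Complex.div_ofReal_im, Complex.re_ofReal_mul, Complex.im_ofReal_mul]
  ring

/-- The boundary relation H₁ = i(H·k)φ is likewise a consequence of the induction equation and the
front condition. The velocity and the field then enter only through v - λH, which is common to both
sides. -/
theorem mode_w (hu : U.u 0 = 0) (hH : U.H 0 = 0) (hτ : 0 < τ.re) {φ : ℂ}
    (hV : ModeEq e U τ k I V) (h0 : (0 : ℝ) ∈ I) (hφ : ModeFront U τ k (V 0) φ) :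
    V 0 (iU 0) / U.Gam - lam * V 0 (iH 0)
      = (τ + Complex.I * (((U.v 1 - lam * U.H 1) * k 0 + (U.v 2 - lam * U.H 2) * k 1 : ℝ) : ℂ))
        * φ := by
  have h1 := (mode_constraint hu hH (hV.2 0 h0)).1
  have h6 := tau_shift_ne_zero hτ (U.v 1 * k 0 + U.v 2 * k 1)
  rw [ModeFront] at hφ
  have h2 : V 0 (iU 0) / U.Gam
      = (τ + Complex.I * ((U.v 1 * k 0 + U.v 2 * k 1 : ℝ) : ℂ)) * φ := by linear_combination -hφ
  have h3 : V 0 (iH 0) = Complex.I * ((U.H 1 * k 0 + U.H 2 * k 1 : ℝ) : ℂ) * φ := by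
    refine mul_left_cancel₀ h6 ?_
    rw [h1, mul_div_assoc, h2]; ring
  rw [h2, h3]
  push_cast
  ring

/-- The flux is decreasing in x¹ and integrable on each half-line, hence nonnegative on the right
and nonpositive on the left. At the front the two fluxes agree, since q and w do; so both are 0
there and, by monotonicity, everywhere. A vanishing derivative of the flux makes the positive form
of B₀ vanish. -/
theorem noUnstableModes {Up Um : State} {lp lm : ℝ} (hs : IsCurrentVortexSheet e Up Um)
    (hBp : ∀ X : Idx → ℝ, X ≠ 0 → 0 < X ⬝ᵥ (B0 e Up lp *ᵥ X))
    (hBm : ∀ X : Idx → ℝ, X ≠ 0 → 0 < X ⬝ᵥ (B0 e Um lm *ᵥ X))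
    (h1 : Up.v 1 - lp * Up.H 1 = Um.v 1 - lm * Um.H 1)
    (h2 : Up.v 2 - lp * Up.H 2 = Um.v 2 - lm * Um.H 2) : NoUnstableModes e Up Um := by
  intro τ k Vp Vm φ hτ hVp hVm hLp hLm hfp hfm hq
  have ap := mode_antitone hs.u_p hs.H_p (uniqueDiffOn_Ici 0) (convex_Ici 0) hτ hBp hVp
  have am := mode_antitone hs.u_m hs.H_m (uniqueDiffOn_Iic 0) (convex_Iic 0) hτ hBm hVm
  have ip := memLp_form hLp (Bj e Up lp 0)
  have im := memLp_form hLm (Bj e Um lm 0)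
  have hp0 : ∀ s ∈ Set.Ici (0 : ℝ), 0 ≤ cForm (Bj e Up lp 0) (Vp s) := by
    intro s hs0
    by_contra hneg
    push Not at hneg
    refine not_integrableOn_of_le (S := Set.Ici s) measurableSet_Ici Real.volume_Ici
      (neg_pos.2 hneg) (fun x hx => ?_) (ip.mono_set (Set.Ici_subset_Ici.2 hs0))
    have hx0 : (0 : ℝ) ≤ x := le_trans hs0 hx
    exact (neg_le_neg (ap hs0 hx0 hx)).trans (neg_le_abs _)
  have hm0 : ∀ s ∈ Set.Iic (0 : ℝ), cForm (Bj e Um lm 0) (Vm s) ≤ 0 := by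
    intro s hs0
    by_contra hpos
    push Not at hpos
    refine not_integrableOn_of_le (S := Set.Iic s) measurableSet_Iic Real.volume_Iic
      hpos (fun x hx => ?_) (im.mono_set (Set.Iic_subset_Iic.2 hs0))
    have hx0 : x ≤ (0 : ℝ) := le_trans hx hs0
    exact (am hx0 hs0 hx).trans (le_abs_self _)
  have hmp : (0 : ℝ) ∈ Set.Ici (0 : ℝ) := Set.self_mem_Ici
  have hmm : (0 : ℝ) ∈ Set.Iic (0 : ℝ) := Set.self_mem_Iic
  have heq : cForm (Bj e Up lp 0) (Vp 0) = cForm (Bj e Um lm 0) (Vm 0) := by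
    rw [cForm_Bzero hs.u_p hs.H_p, cForm_Bzero hs.u_m hs.H_m,
      mode_w hs.u_p hs.H_p hτ hVp hmp hfp, mode_w hs.u_m hs.H_m hτ hVm hmm hfm, hq, h1, h2]
  have z0 : cForm (Bj e Up lp 0) (Vp 0) = 0 :=
    le_antisymm (heq ▸ hm0 0 hmm) (hp0 0 hmp)
  have zp := mode_zero hs.u_p hs.H_p (uniqueDiffOn_Ici 0) hτ hBp hVp fun s hs0 =>
    le_antisymm (z0 ▸ ap hmp hs0 hs0) (hp0 s hs0)
  have zm := mode_zero hs.u_m hs.H_m (uniqueDiffOn_Iic 0) hτ hBm hVm fun s hs0 =>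
    le_antisymm (hm0 s hs0) ((z0.symm.trans heq) ▸ am hs0 hmm hs0)
  refine ⟨zp, zm, ?_⟩
  have h6 := tau_shift_ne_zero hτ (Up.v 1 * k 0 + Up.v 2 * k 1)
  rw [ModeFront, zp 0 hmp] at hfp
  simp only [Pi.zero_apply, zero_div, zero_sub] at hfp
  exact (mul_eq_zero.1 (show (τ + Complex.I * ((Up.v 1 * k 0 + Up.v 2 * k 1 : ℝ) : ℂ)) * φ = 0 by
    linear_combination hfp)).resolve_left h6

end Modes
end
end RMHD

/-! ### Smooth compactly supported functions and their classes in L². -/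

namespace RMHD
noncomputable section

section Nice

variable {n : ℕ} {E F : Type*} [NormedAddCommGroup E] [NormedSpace ℝ E]
  [NormedAddCommGroup F] [NormedSpace ℝ F]

/-- Smooth compactly supported functions. -/
def Nice (f : (Fin n → ℝ) → E) : Prop := ContDiff ℝ (⊤ : ℕ∞) f ∧ HasCompactSupport f

/-- The derivative in the direction `w`. -/
def dir (w : Fin n → ℝ) (f : (Fin n → ℝ) → E) (x : Fin n → ℝ) : E := fderiv ℝ f x w

variable {f g : (Fin n → ℝ) → E}

theorem Nice.zero : Nice (fun _ : Fin n → ℝ => (0 : E)) :=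
  ⟨contDiff_const, HasCompactSupport.zero⟩

theorem Nice.continuous (hf : Nice f) : Continuous f := hf.1.continuous

theorem Nice.differentiable (hf : Nice f) : Differentiable ℝ f := hf.1.differentiable (by simp)

theorem Nice.add (hf : Nice f) (hg : Nice g) : Nice (fun x => f x + g x) :=
  ⟨hf.1.add hg.1, hf.2.add hg.2⟩

theorem Nice.sub (hf : Nice f) (hg : Nice g) : Nice (fun x => f x - g x) :=
  ⟨hf.1.sub hg.1, hf.2.sub hg.2⟩

theorem Nice.clm (hf : Nice f) (L : E →L[ℝ] F) : Nice (fun x => L (f x)) :=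
  ⟨L.contDiff.comp hf.1, hf.2.comp_left (map_zero L)⟩

theorem Nice.smul (hf : Nice f) (c : ℝ) : Nice (fun x => c • f x) :=
  ⟨hf.1.const_smul c, hf.2.comp_left (g := fun y => c • y) (smul_zero c)⟩

theorem Nice.dir (hf : Nice f) (w : Fin n → ℝ) : Nice (dir w f) := by
  refine ⟨?_, ?_⟩
  · exact (hf.1.fderiv_right (m := (⊤ : ℕ∞)) (by simp)).clm_apply contDiff_const
  · exact (hf.2.fderiv ℝ).comp_left (g := fun L : (Fin n → ℝ) →L[ℝ] E => L w) rfl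

theorem Nice.translate (hf : Nice f) (c : Fin n → ℝ) : Nice (fun x => f (x + c)) :=
  ⟨hf.1.comp (contDiff_id.add contDiff_const), hf.2.comp_homeomorph (Homeomorph.addRight c)⟩

theorem Nice.sum {ι : Type*} (s : Finset ι) {f : ι → (Fin n → ℝ) → E} (hf : ∀ i, Nice (f i)) :
    Nice (fun x => ∑ i ∈ s, f i x) := by
  classical
  induction s using Finset.induction_on with
  | empty => simpa using Nice.zero
  | insert i s hi ih => simpa [Finset.sum_insert hi] using (hf i).add ih

theorem dir_clm (hf : Nice f) (L : E →L[ℝ] F) (w x : Fin n → ℝ) :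
    dir w (fun y => L (f y)) x = L (dir w f x) := by
  have := L.hasFDerivAt.comp x (hf.differentiable x).hasFDerivAt
  simp only [dir]
  rw [show (fun y => L (f y)) = L ∘ f from rfl, this.fderiv]
  rfl

theorem dir_translate (w c x : Fin n → ℝ) :
    dir w (fun y => f (y + c)) x = dir w f (x + c) := by
  simp only [dir]
  rw [fderiv_comp_add_right]

theorem dir_add (hf : Nice f) (hg : Nice g) (w x : Fin n → ℝ) :
    dir w (fun y => f y + g y) x = dir w f x + dir w g x := by
  simp only [dir]
  rw [fderiv_fun_add (hf.differentiable x) (hg.differentiable x)]; rfl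

theorem Nice.hasDerivAt (hf : Nice f) (w x : Fin n → ℝ) :
    HasDerivAt (fun s : ℝ => f (x + s • w)) (RMHD.dir w f x) 0 := by
  have h1 : HasDerivAt (fun s : ℝ => x + s • w) w 0 := by
    simpa using ((hasDerivAt_id (0 : ℝ)).smul_const w).const_add x
  have h2 := (hf.differentiable (x + (0 : ℝ) • w)).hasFDerivAt.comp_hasDerivAt 0 h1
  simpa [RMHD.dir, Function.comp_def] using h2

theorem Nice.lipschitz (hf : Nice f) : ∃ C : ℝ, 0 ≤ C ∧ ∀ x y, ‖f x - f y‖ ≤ C * ‖x - y‖ := by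
  obtain ⟨C, hC⟩ := hf.1.lipschitzWith_of_hasCompactSupport hf.2 (by simp)
  exact ⟨C, C.2, fun x y => by simpa [dist_eq_norm] using hC.dist_le_mul x y⟩

theorem Nice.memLp (hf : Nice f) : MemLp f 2 (volume : Measure (Fin n → ℝ)) :=
  hf.continuous.memLp_of_hasCompactSupport hf.2

open Classical in
/-- The class in `L²` of a square integrable function. -/
def toL (f : (Fin n → ℝ) → E) : Lp E 2 (volume : Measure (Fin n → ℝ)) :=
  if h : MemLp f 2 volume then h.toLp f else 0

theorem toL_eq (h : MemLp f 2 (volume : Measure (Fin n → ℝ))) : toL f = h.toLp f := dif_pos h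

theorem toL_coeFn (h : MemLp f 2 (volume : Measure (Fin n → ℝ))) : toL f =ᵐ[volume] f := by
  rw [toL_eq h]; exact h.coeFn_toLp

theorem toL_add (hf : MemLp f 2 (volume : Measure (Fin n → ℝ))) (hg : MemLp g 2 volume) :
    toL (fun x => f x + g x) = toL f + toL g := by
  rw [toL_eq hf, toL_eq hg, ← MemLp.toLp_add]; exact toL_eq (hf.add hg)

theorem toL_sub (hf : MemLp f 2 (volume : Measure (Fin n → ℝ))) (hg : MemLp g 2 volume) :
    toL (fun x => f x - g x) = toL f - toL g := by
  rw [toL_eq hf, toL_eq hg, ← MemLp.toLp_sub]; exact toL_eq (hf.sub hg)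

theorem toL_smul (hf : MemLp f 2 (volume : Measure (Fin n → ℝ))) (c : ℝ) :
    toL (fun x => c • f x) = c • toL f := by
  rw [toL_eq hf, ← MemLp.toLp_const_smul]; exact toL_eq (hf.const_smul c)

end Nice

section NiceTranslation

variable {n : ℕ} {E : Type*} [NormedAddCommGroup E] [InnerProductSpace ℝ E]

theorem transFlow_toL {g : (Fin n → ℝ) → E} (hg : MemLp g 2 volume) (w : Fin n → ℝ) (s : ℝ) :
    (transFlow w).τ s (toL g) = toL (fun x => g (x + s • w)) := by
  rw [toL_eq hg, transFlow_toLp, toL_eq]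

theorem Nice.hasDerivAt_transFlow {g : (Fin n → ℝ) → E} (hg : Nice g) (w : Fin n → ℝ) :
    HasDerivAt (fun s => (transFlow w).τ s (toL g)) (toL (RMHD.dir w g)) 0 := by
  obtain ⟨C, hC, hL⟩ := hg.lipschitz
  rw [toL_eq hg.memLp, toL_eq (hg.dir w).memLp]
  refine _root_.hasDerivAt_transFlow hg.memLp (hg.dir w).memLp (K := tsupport g) hg.2
    (fun x hx => image_eq_zero_of_notMem_tsupport hx) (C := C * ‖w‖) (fun x s => ?_)
    (.of_forall fun x => hg.hasDerivAt w x)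
  refine (hL _ _).trans (le_of_eq ?_)
  rw [add_sub_cancel_left, norm_smul, Real.norm_eq_abs]; ring

theorem dense_nice : Dense {f : Lp E 2 (volume : Measure (Fin n → ℝ)) | ∃ g, Nice g ∧ f = toL g} := by
  refine (Lp.dense_hasCompactSupport_contDiff (F := E) (μ := (volume : Measure (Fin n → ℝ)))
    (p := 2) (by simp)).mono ?_
  rintro f ⟨g, h1, h2, h3⟩
  have hn : Nice g := ⟨h3, h2⟩
  exact ⟨g, hn, Lp.ext (h1.trans (toL_coeFn hn.memLp).symm)⟩

end NiceTranslation

/-! ### Piecewise data in the two half-spaces. -/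

section Sides

/-- The half-space that contains `x`. -/
def side (x : Space) : Bool := decide (0 < x 0)

variable {E F G : Type*} [NormedAddCommGroup E] [NormedAddCommGroup F] [NormedAddCommGroup G]

/-- The function that equals `Ψ true` in `x¹ > 0` and `Ψ false` in `x¹ ≤ 0`. -/
def glue {E : Type*} (Ψ : Bool → Space → E) (x : Space) : E := Ψ (side x) x

theorem measurableSet_Rpos : MeasurableSet Rpos :=
  measurableSet_lt measurable_const (measurable_pi_apply 0)

theorem measurableSet_Rneg : MeasurableSet Rneg :=
  measurableSet_lt (measurable_pi_apply 0) measurable_const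

theorem side_of_pos {x : Space} (h : 0 < x 0) : side x = true := by simp [side, h]
theorem side_of_neg {x : Space} (h : x 0 < 0) : side x = false := by simp [side, h.le]

theorem side_add {x w : Space} (hw : w 0 = 0) (s : ℝ) : side (x + s • w) = side x := by
  simp [side, hw]

theorem glue_eq (Ψ : Bool → Space → E) :
    glue Ψ = fun x => Rpos.indicator (Ψ true) x + (Rposᶜ).indicator (Ψ false) x := by
  funext x
  by_cases hx : 0 < x 0
  · have h1 : x ∈ Rpos := hx
    have h2 : x ∉ Rposᶜ := fun h => h hx
    simp [glue, side, hx, h1, h2]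
  · have h1 : x ∉ Rpos := hx
    have h2 : x ∈ Rposᶜ := hx
    simp only [glue, side, hx, decide_false, Set.indicator_of_notMem h1, Set.indicator_of_mem h2,
      zero_add]

theorem memLp_glue {Ψ : Bool → Space → E} (h : ∀ σ, MemLp (Ψ σ) 2 volume) :
    MemLp (glue Ψ) 2 volume := by
  rw [glue_eq]
  exact ((h true).indicator measurableSet_Rpos).add
    ((h false).indicator measurableSet_Rpos.compl)

theorem ae_ne_zero : ∀ᵐ x : Space, x 0 ≠ 0 := by
  have := Measure.pi_hyperplane (fun _ : Fin 3 => (volume : Measure ℝ)) 0 0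
  rw [ae_iff]
  simpa [volume_pi] using this

variable [NormedSpace ℝ E] [NormedSpace ℝ F] [NormedSpace ℝ G]

theorem memLp_side (L : Bool → E →L[ℝ] F) {f : Space → E} (hf : MemLp f 2 volume) :
    MemLp (fun x => L (side x) (f x)) 2 volume :=
  memLp_glue (Ψ := fun σ x => L σ (f x)) fun σ => (L σ).comp_memLp' hf

/-- Multiplication by a piecewise constant operator. -/
def mulSide (L : Bool → E →L[ℝ] F) :
    Lp E 2 (volume : Measure Space) →L[ℝ] Lp F 2 (volume : Measure Space) :=
  LinearMap.mkContinuous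
    { toFun := fun f => (memLp_side L (Lp.memLp f)).toLp _
      map_add' := fun f g => by
        refine Lp.ext ?_
        filter_upwards [(memLp_side L (Lp.memLp (f + g))).coeFn_toLp, Lp.coeFn_add f g,
          Lp.coeFn_add ((memLp_side L (Lp.memLp f)).toLp _) ((memLp_side L (Lp.memLp g)).toLp _),
          (memLp_side L (Lp.memLp f)).coeFn_toLp, (memLp_side L (Lp.memLp g)).coeFn_toLp]
          with x h1 h2 h3 h4 h5
        rw [h1, h3, Pi.add_apply, h4, h5, h2, Pi.add_apply, map_add]
      map_smul' := fun c f => by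
        refine Lp.ext ?_
        filter_upwards [(memLp_side L (Lp.memLp (c • f))).coeFn_toLp, Lp.coeFn_smul c f,
          Lp.coeFn_smul c ((memLp_side L (Lp.memLp f)).toLp _),
          (memLp_side L (Lp.memLp f)).coeFn_toLp] with x h1 h2 h3 h4
        rw [h1, RingHom.id_apply, h3, Pi.smul_apply, h4, h2, Pi.smul_apply, map_smul] }
    (max ‖L true‖ ‖L false‖) fun f => by
      refine Lp.norm_le_mul_norm_of_ae_le_mul ?_
      filter_upwards [(memLp_side L (Lp.memLp f)).coeFn_toLp] with x h1
      simp only [LinearMap.coe_mk, AddHom.coe_mk]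
      rw [h1]
      refine ((L (side x)).le_opNorm _).trans ?_
      gcongr
      rcases side x
      · exact le_max_right _ _
      · exact le_max_left _ _

theorem mulSide_coeFn (L : Bool → E →L[ℝ] F) (f : Lp E 2 (volume : Measure Space)) :
    mulSide L f =ᵐ[volume] fun x => L (side x) (f x) :=
  (memLp_side L (Lp.memLp f)).coeFn_toLp

theorem mulSide_comp (L : Bool → E →L[ℝ] F) (M : Bool → F →L[ℝ] G)
    (f : Lp E 2 (volume : Measure Space)) :
    mulSide M (mulSide L f) = mulSide (fun σ => (M σ).comp (L σ)) f := by
  refine Lp.ext ?_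
  filter_upwards [mulSide_coeFn M (mulSide L f), mulSide_coeFn L f,
    mulSide_coeFn (fun σ => (M σ).comp (L σ)) f] with x h1 h2 h3
  rw [h1, h2, h3]; rfl

theorem mulSide_toL_glue (L : Bool → E →L[ℝ] F) {Ψ : Bool → Space → E}
    (h : ∀ σ, MemLp (Ψ σ) 2 volume) :
    mulSide L (toL (glue Ψ)) = toL (glue fun σ x => L σ (Ψ σ x)) := by
  refine Lp.ext ?_
  filter_upwards [mulSide_coeFn L (toL (glue Ψ)), toL_coeFn (memLp_glue h),
    toL_coeFn (memLp_glue (Ψ := fun σ x => L σ (Ψ σ x)) fun σ => (L σ).comp_memLp' (h σ))]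
    with x h1 h2 h3
  rw [h1, h2, h3]; rfl

end Sides

section SidesHilbert

variable {E F : Type*} [NormedAddCommGroup E] [InnerProductSpace ℝ E]
  [NormedAddCommGroup F] [InnerProductSpace ℝ F]

theorem mulSide_transFlow (L : Bool → E →L[ℝ] F) {w : Space} (hw : w 0 = 0 ∨ L true = L false)
    (s : ℝ) (f : Lp E 2 (volume : Measure Space)) :
    mulSide L ((transFlow w).τ s f) = (transFlow w).τ s (mulSide L f) := by
  refine Lp.ext ?_
  filter_upwards [mulSide_coeFn L ((transFlow w).τ s f), transFlow_coeFn w s f,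
    transFlow_coeFn w s (mulSide L f), (measurePreserving_add_right volume
      (s • w)).quasiMeasurePreserving.ae (mulSide_coeFn L f)] with x h1 h2 h3 h4
  rw [h1, h2, h3, h4]
  rcases hw with hw | hw
  · rw [side_add hw]
  · have : ∀ σ, L σ = L false := fun σ => by rcases σ <;> simp [hw]
    rw [this (side x), this (side _)]

theorem inner_mulSide {L : Bool → E →L[ℝ] F} {M : Bool → F →L[ℝ] E}
    (h : ∀ σ x y, inner ℝ (L σ x) y = inner ℝ x (M σ y))
    (f : Lp E 2 (volume : Measure Space)) (g : Lp F 2 (volume : Measure Space)) :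
    inner ℝ (mulSide L f) g = inner ℝ f (mulSide M g) := by
  rw [L2.inner_def, L2.inner_def]
  refine integral_congr_ae ?_
  filter_upwards [mulSide_coeFn L f, mulSide_coeFn M g] with x h1 h2
  rw [h1, h2, h]

/-- If the traces match, the glued function is Lipschitz across x¹ = 0 and no surface term appears
in its derivative. In tangential directions the hyperplane is never crossed, and matching is not
needed. -/
theorem hasDerivAt_glue {Ψ : Bool → Space → E} (hΨ : ∀ σ, Nice (Ψ σ)) {w : Space}
    (hw : w 0 = 0 ∨ ∀ y, Ψ true (bd y) = Ψ false (bd y)) :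
    HasDerivAt (fun s => (transFlow w).τ s (toL (glue Ψ))) (toL (glue fun σ => dir w (Ψ σ))) 0 := by
  have hm := memLp_glue fun σ => (hΨ σ).memLp
  have hm' := memLp_glue (Ψ := fun σ => dir w (Ψ σ)) fun σ => ((hΨ σ).dir w).memLp
  obtain ⟨C1, hC1, hL1⟩ := (hΨ true).lipschitz
  obtain ⟨C2, hC2, hL2⟩ := (hΨ false).lipschitz
  rw [toL_eq hm, toL_eq hm']
  refine _root_.hasDerivAt_transFlow hm hm' (K := tsupport (Ψ true) ∪ tsupport (Ψ false))
    ((hΨ true).2.isCompact.union (hΨ false).2.isCompact) (fun x hx => ?_)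
    (C := 2 * (C1 + C2) * ‖w‖) (fun x s => ?_) ?_
  · simp only [Set.mem_union, not_or] at hx
    simp only [glue]
    rcases side x
    · exact image_eq_zero_of_notMem_tsupport hx.2
    · exact image_eq_zero_of_notMem_tsupport hx.1
  · have cross : (∀ y, Ψ true (bd y) = Ψ false (bd y)) → ∀ y z : Space, 0 < y 0 → z 0 ≤ 0 →
        ‖Ψ true y - Ψ false z‖ ≤ 2 * (C1 + C2) * ‖y - z‖ := by
      intro hbd y z hy hz
      -- The projection of y to the boundary: in the maximum norm it is no farther from y than any
      -- point of the other side.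
      let p : Space := bd ![y 1, y 2]
      have hp : ‖y - p‖ ≤ ‖y - z‖ := by
        have h0 : ‖y 0 - z 0‖ ≤ ‖y - z‖ := norm_le_pi_norm (y - z) 0
        rw [Real.norm_eq_abs, abs_of_pos (by linarith)] at h0
        refine (pi_norm_le_iff_of_nonneg (norm_nonneg _)).2 fun i => ?_
        fin_cases i
        · simp only [p, bd, Pi.sub_apply, Fin.zero_eta, Matrix.cons_val_zero, sub_zero,
            Real.norm_eq_abs, abs_of_pos hy]
          linarith
        · simp [p, bd]
        · simp [p, bd]
      have hpz : ‖p - z‖ ≤ 2 * ‖y - z‖ := by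
        have : p - z = (y - z) - (y - p) := by abel
        rw [this]
        exact (norm_sub_le _ _).trans (by linarith)
      have e : Ψ true y - Ψ false z = (Ψ true y - Ψ true p) + (Ψ false p - Ψ false z) := by
        rw [show Ψ false p = Ψ true p from (hbd _).symm]; abel
      rw [e]
      calc _ ≤ ‖Ψ true y - Ψ true p‖ + ‖Ψ false p - Ψ false z‖ := norm_add_le _ _
        _ ≤ C1 * ‖y - p‖ + C2 * ‖p - z‖ := add_le_add (hL1 _ _) (hL2 _ _)
        _ ≤ C1 * ‖y - z‖ + C2 * (2 * ‖y - z‖) := by gcongr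
        _ ≤ 2 * (C1 + C2) * ‖y - z‖ := by nlinarith [mul_nonneg hC1 (norm_nonneg (y - z))]
    have key : ∀ y z : Space, (side y = side z ∨ ∀ y, Ψ true (bd y) = Ψ false (bd y)) →
        ‖glue Ψ y - glue Ψ z‖ ≤ 2 * (C1 + C2) * ‖y - z‖ := by
      intro y z h
      have hN : 0 ≤ ‖y - z‖ := norm_nonneg _
      have same : ∀ σ, ‖Ψ σ y - Ψ σ z‖ ≤ 2 * (C1 + C2) * ‖y - z‖ := by
        intro σ
        rcases σ
        · exact (hL2 y z).trans (by gcongr; linarith)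
        · exact (hL1 y z).trans (by gcongr; linarith)
      by_cases hs : side y = side z
      · simp only [glue, hs]; exact same _
      · have hbd := h.resolve_left hs
        by_cases hy : 0 < y 0
        · by_cases hz : 0 < z 0
          · exact absurd ((side_of_pos hy).trans (side_of_pos hz).symm) hs
          · simp only [glue, side, hy, hz, decide_true, decide_false]
            exact cross hbd y z hy (not_lt.1 hz)
        · by_cases hz : 0 < z 0
          · simp only [glue, side, hy, hz, decide_true, decide_false]
            rw [norm_sub_rev, norm_sub_rev y z]
            exact cross hbd z y hz (not_lt.1 hy)
          · exact absurd (by simp [side, hy, hz]) hs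
    have h1 := key (x + s • w) x (hw.imp (fun h => side_add h s) id)
    refine h1.trans (le_of_eq ?_)
    rw [add_sub_cancel_left, norm_smul, Real.norm_eq_abs]; ring
  · filter_upwards [ae_ne_zero] with x hx
    refine ((hΨ (side x)).hasDerivAt w x).congr_of_eventuallyEq ?_
    have hc : ContinuousAt (fun s : ℝ => x 0 + s * w 0) 0 := by fun_prop
    rcases lt_or_gt_of_ne hx with h | h
    · have : ∀ᶠ s : ℝ in 𝓝 0, x 0 + s * w 0 < 0 :=
        hc.eventually_lt continuousAt_const (by simpa using h)
      filter_upwards [this] with s hs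
      have e : side (x + s • w) = side x := by
        rw [side_of_neg h]; exact side_of_neg (by simpa using hs)
      simp only [glue, e]
    · have : ∀ᶠ s : ℝ in 𝓝 0, 0 < x 0 + s * w 0 :=
        continuousAt_const.eventually_lt hc (by simpa using h)
      filter_upwards [this] with s hs
      have e : side (x + s • w) = side x := by
        rw [side_of_pos h]; exact side_of_pos (by simpa using hs)
      simp only [glue, e]

end SidesHilbert
end
end RMHD

/-! ### The bulk Hilbert space and multiplication by piecewise constant matrices. -/

namespace RMHD
noncomputable section

section Bulk

/-- Amplitudes with the Euclidean norm. -/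
abbrev E8 := EuclideanSpace ℝ Idx

/-- Square integrable perturbations in the whole space. -/
abbrev HS := Lp E8 2 (volume : Measure Space)

/-- The passage to the Euclidean norm. -/
def eu : (Idx → ℝ) →L[ℝ] E8 := (EuclideanSpace.equiv Idx ℝ).symm.toContinuousLinearMap

theorem ofLp_eu (X : Idx → ℝ) : WithLp.ofLp (eu X) = X := rfl

theorem inner_E8 (x y : E8) : inner ℝ x y = WithLp.ofLp x ⬝ᵥ WithLp.ofLp y := by
  rw [EuclideanSpace.inner_eq_star_dotProduct, star_trivial, dotProduct_comm]

/-- The element of `L²` defined by a pair of functions in the two half-spaces. -/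
def glueH (Ψ : Bool → Space → Idx → ℝ) : HS := toL (glue fun σ x => eu (Ψ σ x))

/-- Multiplication by a piecewise constant matrix. -/
def mul (A : Bool → Matrix Idx Idx ℝ) : HS →L[ℝ] HS :=
  mulSide fun σ => toEuclideanCLM (n := Idx) (𝕜 := ℝ) (A σ)

variable {A M : Bool → Matrix Idx Idx ℝ} {Ψ Φ : Bool → Space → Idx → ℝ}

theorem Nice.mulVec {n : ℕ} {f : (Fin n → ℝ) → Idx → ℝ} (hf : Nice f) (N : Matrix Idx Idx ℝ) :
    Nice (fun x => N *ᵥ f x) := hf.clm N.mulVecLin.toContinuousLinearMap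

theorem dir_mulVec {n : ℕ} {f : (Fin n → ℝ) → Idx → ℝ} (hf : Nice f) (N : Matrix Idx Idx ℝ)
    (w x : Fin n → ℝ) : dir w (fun y => N *ᵥ f y) x = N *ᵥ dir w f x :=
  dir_clm hf N.mulVecLin.toContinuousLinearMap w x

/-- The functional `X ↦ r ⬝ᵥ X`. -/
def dotCLM (r : Idx → ℝ) : (Idx → ℝ) →L[ℝ] ℝ :=
  LinearMap.toContinuousLinearMap
    { toFun := fun X => r ⬝ᵥ X
      map_add' := dotProduct_add r
      map_smul' := fun c X => dotProduct_smul c r X }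

theorem Nice.dot {n : ℕ} {f : (Fin n → ℝ) → Idx → ℝ} (hf : Nice f) (r : Idx → ℝ) :
    Nice (fun x => r ⬝ᵥ f x) := hf.clm (dotCLM r)

theorem dir_dot {n : ℕ} {f : (Fin n → ℝ) → Idx → ℝ} (hf : Nice f) (r : Idx → ℝ)
    (w x : Fin n → ℝ) : dir w (fun y => r ⬝ᵥ f y) x = r ⬝ᵥ dir w f x :=
  dir_clm hf (dotCLM r) w x

theorem memLp_eu (hΨ : ∀ σ, Nice (Ψ σ)) (σ : Bool) : MemLp (fun x => eu (Ψ σ x)) 2 volume :=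
  ((hΨ σ).clm eu).memLp

theorem glueH_coeFn (hΨ : ∀ σ, Nice (Ψ σ)) :
    glueH Ψ =ᵐ[volume] fun x => eu (Ψ (side x) x) := toL_coeFn (memLp_glue (memLp_eu hΨ))

theorem mul_glueH (A : Bool → Matrix Idx Idx ℝ) (hΨ : ∀ σ, Nice (Ψ σ)) :
    mul A (glueH Ψ) = glueH fun σ x => A σ *ᵥ Ψ σ x :=
  mulSide_toL_glue _ (memLp_eu hΨ)

theorem mul_coeFn (A : Bool → Matrix Idx Idx ℝ) (f : HS) :
    mul A f =ᵐ[volume] fun x => toEuclideanCLM (n := Idx) (𝕜 := ℝ) (A (side x)) (f x) :=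
  mulSide_coeFn _ f

theorem mul_mul (A M : Bool → Matrix Idx Idx ℝ) (f : HS) :
    mul A (mul M f) = mul (fun σ => A σ * M σ) f := by
  refine (mulSide_comp _ _ f).trans ?_
  simp only [mul, map_mul]; rfl

theorem mul_one' (f : HS) : mul (fun _ => 1) f = f := by
  refine Lp.ext ?_
  filter_upwards [mul_coeFn (fun _ => 1) f] with x h1
  rw [h1, map_one]; rfl

theorem inner_mul (A : Bool → Matrix Idx Idx ℝ) (f g : HS) :
    inner ℝ (mul A f) g = inner ℝ f (mul (fun σ => (A σ)ᵀ) g) := by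
  refine inner_mulSide (fun σ x y => ?_) f g
  rw [inner_E8, inner_E8, ofLp_toEuclideanCLM, ofLp_toEuclideanCLM, dotProduct_mulVec,
    vecMul_transpose]

theorem inner_mul_symm (hA : ∀ σ, (A σ)ᵀ = A σ) (f g : HS) :
    inner ℝ (mul A f) g = inner ℝ f (mul A g) := by
  rw [inner_mul]; simp only [hA]

theorem mul_transFlow (A : Bool → Matrix Idx Idx ℝ) {w : Space} (hw : w 0 = 0 ∨ A true = A false)
    (s : ℝ) (f : HS) : mul A ((transFlow w).τ s f) = (transFlow w).τ s (mul A f) :=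
  mulSide_transFlow _ (hw.imp id fun h => by rw [h]) s f

theorem eq_zero_of_inner_mul (hA : ∀ σ X, X ≠ 0 → 0 < X ⬝ᵥ (A σ *ᵥ X)) (f : HS)
    (h : inner ℝ f (mul A f) = 0) : f = 0 := by
  have hnn : ∀ σ (X : Idx → ℝ), 0 ≤ X ⬝ᵥ (A σ *ᵥ X) := fun σ X => by
    by_cases hX : X = 0
    · simp [hX]
    · exact (hA σ X hX).le
  have hae := mul_coeFn A f
  have hin : ∀ᵐ x : Space, inner ℝ (f x) (mul A f x)
      = WithLp.ofLp (f x) ⬝ᵥ (A (side x) *ᵥ WithLp.ofLp (f x)) := by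
    filter_upwards [hae] with x hx
    rw [hx, inner_E8]; rfl
  rw [L2.inner_def, integral_eq_zero_iff_of_nonneg_ae
    (by filter_upwards [hin] with x hx; rw [hx]; exact hnn _ _) (L2.integrable_inner f _)] at h
  refine Lp.ext ?_
  filter_upwards [h, hin, Lp.coeFn_zero E8 2 (volume : Measure Space)] with x h1 h2 h3
  rw [h3]
  by_contra hne
  have : WithLp.ofLp (f x) ≠ 0 := fun h0 => hne (by
    ext i; exact congrFun h0 i)
  exact (hA (side x) _ this).ne' (h2.symm.trans h1)

theorem glueH_hasDerivAt (hΨ : ∀ σ, Nice (Ψ σ)) {w : Space}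
    (hw : w 0 = 0 ∨ ∀ y, Ψ true (bd y) = Ψ false (bd y)) :
    HasDerivAt (fun s => (transFlow w).τ s (glueH Ψ)) (glueH fun σ => dir w (Ψ σ)) 0 := by
  have := hasDerivAt_glue (Ψ := fun σ x => eu (Ψ σ x)) (fun σ => (hΨ σ).clm eu)
    (hw.imp id fun h y => by rw [h])
  have e : (fun σ => dir w fun x => eu (Ψ σ x)) = fun σ x => eu (dir w (Ψ σ) x) := by
    funext σ x; exact dir_clm (hΨ σ) eu w x
  rw [e] at this
  exact this

theorem transFlow_glueH (hΨ : ∀ σ, Nice (Ψ σ)) {w : Space} (hw : w 0 = 0) (s : ℝ) :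
    (transFlow w).τ s (glueH Ψ) = glueH fun σ x => Ψ σ (x + s • w) := by
  rw [glueH, transFlow_toL (memLp_glue (memLp_eu hΨ))]
  congr 1
  funext x
  simp only [glue, side_add hw]

theorem transFlow_glueH_const {f : Space → Idx → ℝ} (hf : Nice f) (w : Space) (s : ℝ) :
    (transFlow w).τ s (glueH fun _ => f) = glueH fun _ x => f (x + s • w) := by
  rw [glueH, transFlow_toL (memLp_glue (memLp_eu fun _ => hf))]
  rfl

theorem glueH_add (hΨ : ∀ σ, Nice (Ψ σ)) (hΦ : ∀ σ, Nice (Φ σ)) :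
    glueH (fun σ x => Ψ σ x + Φ σ x) = glueH Ψ + glueH Φ := by
  rw [glueH, glueH, glueH, ← toL_add (memLp_glue (memLp_eu hΨ)) (memLp_glue (memLp_eu hΦ))]
  rfl

theorem glueH_smul (hΨ : ∀ σ, Nice (Ψ σ)) (c : ℝ) :
    glueH (fun σ x => c • Ψ σ x) = c • glueH Ψ := by
  rw [glueH, glueH, ← toL_smul (memLp_glue (memLp_eu hΨ))]
  rfl

theorem glueH_zero : glueH (fun _ _ => 0) = 0 := by
  have := glueH_smul (Ψ := fun _ _ => 0) (fun _ => Nice.zero) 0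
  simpa using this

theorem glueH_sum {ι : Type*} (s : Finset ι) {Ψ : ι → Bool → Space → Idx → ℝ}
    (hΨ : ∀ i σ, Nice (Ψ i σ)) :
    glueH (fun σ x => ∑ i ∈ s, Ψ i σ x) = ∑ i ∈ s, glueH (Ψ i) := by
  classical
  induction s using Finset.induction_on with
  | empty => simpa using glueH_zero
  | insert i s hi ih =>
    simp only [Finset.sum_insert hi]
    rw [glueH_add (hΨ i) (fun σ => Nice.sum s fun i => hΨ i σ), ih]

theorem dense_glueH : Dense {f : HS | ∃ g : Space → Idx → ℝ, Nice g ∧ f = glueH fun _ => g} := by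
  refine dense_nice.mono ?_
  rintro f ⟨g, hg, rfl⟩
  let L : E8 →L[ℝ] (Idx → ℝ) := (EuclideanSpace.equiv Idx ℝ).toContinuousLinearMap
  exact ⟨fun x => L (g x), hg.clm L, rfl⟩

end Bulk

/-! ### Splitting of the bulk space into the two half-spaces. -/

section Join

variable {D : Set Space}

/-- Extension by zero. -/
def ext (hD : MeasurableSet D) : L2 D →ₗᵢ[ℝ] HS where
  toFun f := toL (D.indicator f)
  map_add' f g := by
    have h := fun f : L2 D => (memLp_indicator_iff_restrict hD).2 (Lp.memLp f)
    rw [← toL_add (h f) (h g), toL_eq (h (f + g))]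
    refine Eq.trans (Lp.ext ?_) (toL_eq ((h f).add (h g))).symm
    filter_upwards [(h (f + g)).coeFn_toLp, ((h f).add (h g)).coeFn_toLp,
      (ae_restrict_iff' hD).1 (Lp.coeFn_add f g)] with x h1 h2 h3
    rw [h1, h2]
    by_cases hx : x ∈ D
    · rw [Pi.add_apply, Set.indicator_of_mem hx, Set.indicator_of_mem hx,
        Set.indicator_of_mem hx]
      exact h3 hx
    · simp [hx]
  map_smul' c f := by
    have h := fun f : L2 D => (memLp_indicator_iff_restrict hD).2 (Lp.memLp f)
    rw [RingHom.id_apply, ← toL_smul (h f), toL_eq (h (c • f))]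
    refine Eq.trans (Lp.ext ?_) (toL_eq ((h f).const_smul c)).symm
    filter_upwards [(h (c • f)).coeFn_toLp, ((h f).const_smul c).coeFn_toLp,
      (ae_restrict_iff' hD).1 (Lp.coeFn_smul c f)] with x h1 h2 h3
    rw [h1, h2]
    by_cases hx : x ∈ D
    · simp [hx, h3 hx]
    · simp [hx]
  norm_map' f := by
    have h := (memLp_indicator_iff_restrict hD).2 (Lp.memLp f)
    change ‖toL (D.indicator f)‖ = ‖f‖
    rw [toL_eq h, Lp.norm_toLp, eLpNorm_indicator_eq_eLpNorm_restrict hD, ← Lp.norm_def]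

theorem ext_coeFn (hD : MeasurableSet D) (f : L2 D) : ext hD f =ᵐ[volume] D.indicator f :=
  toL_coeFn ((memLp_indicator_iff_restrict hD).2 (Lp.memLp f))

/-- Restriction to `D`. -/
def rest (D : Set Space) : HS →L[ℝ] L2 D := LpToLpRestrictCLM Space E8 ℝ volume 2 D

theorem rest_coeFn (f : HS) : ∀ᵐ x : Space, x ∈ D → MeasurableSet D → rest D f x = f x := by
  by_cases hD : MeasurableSet D
  · have := (ae_restrict_iff' hD).1 (LpToLpRestrictCLM_coeFn ℝ D f (μ := volume) (p := 2))
    filter_upwards [this] with x hx h _ using hx h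
  · exact .of_forall fun x _ h => absurd h hD

theorem inner_ext (hD : MeasurableSet D) (f : L2 D) (g : HS) :
    inner ℝ (ext hD f) g = ∫ x in D, inner ℝ (f x) (g x) := by
  rw [L2.inner_def, ← integral_indicator hD]
  refine integral_congr_ae ?_
  filter_upwards [ext_coeFn hD f] with x h1
  rw [h1]
  by_cases hx : x ∈ D
  · simp [hx]
  · simp [hx]

theorem disjoint_sides : Disjoint Rpos Rneg :=
  Set.disjoint_left.2 fun x (h1 : 0 < x 0) (h2 : x 0 < 0) => absurd h1 (not_lt.2 h2.le)

theorem inner_ext_ext (f : L2 Rpos) (g : L2 Rneg) :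
    inner ℝ (ext measurableSet_Rpos f) (ext measurableSet_Rneg g) = 0 := by
  rw [L2.inner_def, integral_eq_zero_of_ae]
  filter_upwards [ext_coeFn measurableSet_Rpos f, ext_coeFn measurableSet_Rneg g] with x h1 h2
  rw [h1, h2]
  by_cases hx : x ∈ Rpos
  · simp [Set.disjoint_left.1 disjoint_sides hx]
  · simp [hx]

/-- The perturbation in the whole space with given restrictions to the half-spaces. -/
def join (f : L2 Rpos) (g : L2 Rneg) : HS := ext measurableSet_Rpos f + ext measurableSet_Rneg g

theorem norm_join (f : L2 Rpos) (g : L2 Rneg) : ‖join f g‖ ^ 2 = ‖f‖ ^ 2 + ‖g‖ ^ 2 := by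
  rw [join, norm_add_sq_real, inner_ext_ext, LinearIsometry.norm_map, LinearIsometry.norm_map]
  ring

theorem join_rest (f : HS) : join (rest Rpos f) (rest Rneg f) = f := by
  refine Lp.ext ?_
  filter_upwards [Lp.coeFn_add (ext measurableSet_Rpos (rest Rpos f))
    (ext measurableSet_Rneg (rest Rneg f)), ext_coeFn measurableSet_Rpos (rest Rpos f),
    ext_coeFn measurableSet_Rneg (rest Rneg f), rest_coeFn (D := Rpos) f,
    rest_coeFn (D := Rneg) f, ae_ne_zero] with x h1 h2 h3 h4 h5 h6
  rw [join, h1, Pi.add_apply, h2, h3]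
  rcases lt_or_gt_of_ne h6 with h | h
  · have hx : x ∈ Rneg := h
    have hx' : x ∉ Rpos := fun hp => Set.disjoint_left.1 disjoint_sides hp hx
    simp [hx, hx', h5 hx measurableSet_Rneg]
  · have hx : x ∈ Rpos := h
    have hx' : x ∉ Rneg := Set.disjoint_left.1 disjoint_sides hx
    simp [hx, hx', h4 hx measurableSet_Rpos]

theorem join_sub (f f' : L2 Rpos) (g g' : L2 Rneg) :
    join (f - f') (g - g') = join f g - join f' g' := by
  simp only [join, map_sub]; abel

theorem join_eq_iff {f f' : L2 Rpos} {g g' : L2 Rneg} :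
    join f g = join f' g' ↔ f = f' ∧ g = g' := by
  refine ⟨fun h => ?_, fun h => by rw [h.1, h.2]⟩
  have h0 : ‖join (f - f') (g - g')‖ ^ 2 = 0 := by rw [join_sub, h, sub_self]; simp
  rw [norm_join] at h0
  have := (add_eq_zero_iff_of_nonneg (sq_nonneg _) (sq_nonneg _)).1 h0
  simpa [sub_eq_zero] using this

theorem continuousOn_join {I : Set ℝ} {f : ℝ → L2 Rpos} {g : ℝ → L2 Rneg}
    (hf : ContinuousOn f I) (hg : ContinuousOn g I) :
    ContinuousOn (fun t => join (f t) (g t)) I :=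
  ((ext measurableSet_Rpos).continuous.comp_continuousOn hf).add
    ((ext measurableSet_Rneg).continuous.comp_continuousOn hg)

theorem pair_eq_inner (hD : MeasurableSet D) (f : L2 D) {g : HS} {ψ : Space → Idx → ℝ}
    (h : ∀ᵐ x : Space, x ∈ D → g x = eu (ψ x)) : pair f ψ = inner ℝ (ext hD f) g := by
  rw [inner_ext hD, pair]
  refine integral_congr_ae ((ae_restrict_iff' hD).2 ?_)
  filter_upwards [h] with x hx hxD
  rw [hx hxD, inner_E8, ofLp_eu]

theorem pair_add_pair (f : L2 Rpos) (g : L2 Rneg) {Ψ : Bool → Space → Idx → ℝ}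
    (hΨ : ∀ σ, Nice (Ψ σ)) :
    pair f (Ψ true) + pair g (Ψ false) = inner ℝ (join f g) (glueH Ψ) := by
  have hc := glueH_coeFn hΨ
  rw [join, inner_add_left]
  rw [pair_eq_inner (g := glueH Ψ) measurableSet_Rpos f, pair_eq_inner (g := glueH Ψ)
    measurableSet_Rneg g]
  · filter_upwards [hc] with x h1 hx
    rw [h1, side_of_neg hx]
  · filter_upwards [hc] with x h1 hx
    rw [h1, side_of_pos hx]

end Join
end
end RMHD

/-! ### Products of tangential and normal functions. -/

namespace RMHD
noncomputable section

section Tensor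

/-- The tangential coordinates. -/
def tl (x : Space) : Fin 2 → ℝ := ![x 1, x 2]

theorem tl_bd (y : Fin 2 → ℝ) : tl (bd y) = y := by
  funext i; fin_cases i <;> rfl

theorem tl_add (x : Space) (s : ℝ) (w : Fin 2 → ℝ) : tl (x + s • bd w) = tl x + s • w := by
  funext i; fin_cases i <;> simp [tl, bd]

theorem bd_zero_apply (w : Fin 2 → ℝ) : bd w 0 = 0 := rfl

/-- The splitting of space into the normal and the tangential coordinates. -/
def splitEquiv : Space ≃ᵐ ℝ × (Fin 2 → ℝ) := MeasurableEquiv.piFinSuccAbove (fun _ : Fin 3 => ℝ) 0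

theorem splitEquiv_apply (x : Space) : splitEquiv x = (x 0, tl x) := by
  refine Prod.ext rfl ?_
  funext i; fin_cases i <;> rfl

theorem splitEquiv_mp : MeasurePreserving splitEquiv volume (volume.prod volume) :=
  volume_preserving_piFinSuccAbove (fun _ : Fin 3 => ℝ) 0

theorem tl_qmp : Measure.QuasiMeasurePreserving tl (volume : Measure Space)
    (volume : Measure (Fin 2 → ℝ)) := by
  have h : tl = Prod.snd ∘ splitEquiv := by funext x; simp [splitEquiv_apply]
  rw [h]
  exact Measure.quasiMeasurePreserving_snd.comp splitEquiv_mp.quasiMeasurePreserving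

variable {z : ℝ → ℝ}

theorem tensor_aux (hz : MemLp z 2 volume) {f : (Fin 2 → ℝ) → ℝ} (hf : MemLp f 2 volume) :
    MemLp (fun x : Space => f (tl x) * z (x 0)) 2 volume ∧
    ∫ x : Space, (f (tl x) * z (x 0)) ^ 2 = (∫ y, f y ^ 2) * ∫ t, z t ^ 2 := by
  have hz2 := hz.integrable_sq
  have hf2 := hf.integrable_sq
  have hprod := hz2.mul_prod hf2
  have hmeas : AEStronglyMeasurable (fun p : ℝ × (Fin 2 → ℝ) => f p.2 * z p.1)
      (volume.prod volume) := hf.1.comp_snd.mul hz.1.comp_fst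
  have hm2 : MemLp (fun p : ℝ × (Fin 2 → ℝ) => f p.2 * z p.1) 2 (volume.prod volume) := by
    rw [memLp_two_iff_integrable_sq hmeas]
    refine hprod.congr (.of_forall fun p => ?_)
    simp only; ring
  have hcomp := hm2.comp_measurePreserving splitEquiv_mp
  have e : (fun p : ℝ × (Fin 2 → ℝ) => f p.2 * z p.1) ∘ splitEquiv
      = fun x : Space => f (tl x) * z (x 0) := by
    funext x; simp [splitEquiv_apply]
  refine ⟨e ▸ hcomp, ?_⟩
  have h1 := splitEquiv_mp.integral_comp splitEquiv.measurableEmbedding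
    (fun p : ℝ × (Fin 2 → ℝ) => (f p.2 * z p.1) ^ 2)
  simp only [splitEquiv_apply] at h1
  rw [h1]
  have h2 := integral_prod_mul (μ := (volume : Measure ℝ)) (ν := (volume : Measure (Fin 2 → ℝ)))
    (fun t => z t ^ 2) (fun y => f y ^ 2)
  rw [mul_comm, ← h2]
  refine integral_congr_ae (.of_forall fun p => ?_)
  simp only; ring

theorem norm_toL_sq {n : ℕ} {f : (Fin n → ℝ) → ℝ} (hf : MemLp f 2 volume) :
    ‖toL f‖ ^ 2 = ∫ x, f x ^ 2 := by
  rw [← real_inner_self_eq_norm_sq, L2.inner_def]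
  refine integral_congr_ae ?_
  filter_upwards [toL_coeFn hf] with x hx
  rw [hx]; simp [sq]

/-- The operator `f ↦ f(x') z(x¹)`. -/
def tens (hz : MemLp z 2 volume) : L2Front →L[ℝ] Lp ℝ 2 (volume : Measure Space) :=
  LinearMap.mkContinuous
    { toFun := fun f => toL fun x => f (tl x) * z (x 0)
      map_add' := fun f g => by
        rw [← toL_add (tensor_aux hz (Lp.memLp f)).1 (tensor_aux hz (Lp.memLp g)).1]
        have h := (tensor_aux hz (Lp.memLp (f + g))).1
        refine Lp.ext ((toL_coeFn h).trans (EventuallyEq.trans ?_ (toL_coeFn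
          ((tensor_aux hz (Lp.memLp f)).1.add (tensor_aux hz (Lp.memLp g)).1)).symm))
        filter_upwards [tl_qmp.ae (Lp.coeFn_add f g)] with x hx
        rw [hx, Pi.add_apply, add_mul]; rfl
      map_smul' := fun c f => by
        rw [RingHom.id_apply, ← toL_smul (tensor_aux hz (Lp.memLp f)).1]
        have h := (tensor_aux hz (Lp.memLp (c • f))).1
        refine Lp.ext ((toL_coeFn h).trans (EventuallyEq.trans ?_ (toL_coeFn
          ((tensor_aux hz (Lp.memLp f)).1.const_smul c)).symm))
        filter_upwards [tl_qmp.ae (Lp.coeFn_smul c f)] with x hx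
        rw [hx, Pi.smul_apply, smul_eq_mul, mul_assoc]; rfl }
    (Real.sqrt (∫ t, z t ^ 2)) fun f => by
      have h := tensor_aux hz (Lp.memLp f)
      refine le_of_sq_le_sq ?_ (by positivity)
      change ‖toL fun x => f (tl x) * z (x 0)‖ ^ 2 ≤ _
      rw [norm_toL_sq h.1, h.2, mul_pow, Real.sq_sqrt (integral_nonneg fun t => sq_nonneg _),
        mul_comm]
      gcongr
      refine le_of_eq ?_
      rw [← real_inner_self_eq_norm_sq, L2.inner_def]
      exact integral_congr_ae (.of_forall fun x => by simp [sq])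

theorem norm_tens_le (hz : MemLp z 2 volume) (f : L2Front) :
    ‖tens hz f‖ ≤ Real.sqrt (∫ t, z t ^ 2) * ‖f‖ :=
  (tens hz).le_of_opNorm_le (LinearMap.mkContinuous_norm_le _ (Real.sqrt_nonneg _) _) f

theorem tens_toL (hz : MemLp z 2 volume) {g : (Fin 2 → ℝ) → ℝ} (hg : MemLp g 2 volume) :
    tens hz (toL g) = toL fun x => g (tl x) * z (x 0) := by
  have h := (tensor_aux hz (Lp.memLp (toL g))).1
  refine Lp.ext ((toL_coeFn h).trans (EventuallyEq.trans ?_ (toL_coeFn (tensor_aux hz hg).1).symm))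
  filter_upwards [tl_qmp.ae (toL_coeFn hg)] with x hx
  rw [hx]

theorem transFlow_tens (hz : MemLp z 2 volume) (w : Fin 2 → ℝ) (s : ℝ) (f : L2Front) :
    tens hz ((transFlow w).τ s f) = (transFlow (bd w)).τ s (tens hz f) := by
  have h1 := toL_coeFn (tensor_aux hz (Lp.memLp ((transFlow w).τ s f))).1
  have h2 := toL_coeFn (tensor_aux hz (Lp.memLp f)).1
  refine Lp.ext (h1.trans (EventuallyEq.trans ?_ (transFlow_coeFn (bd w) s (tens hz f)).symm))
  filter_upwards [tl_qmp.ae (transFlow_coeFn w s f), (measurePreserving_add_right volume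
      (s • bd w)).quasiMeasurePreserving.ae h2] with x h3 h4
  rw [h3]
  refine Eq.trans ?_ h4.symm
  rw [tl_add]
  simp [bd]

/-- The operator `f ↦ f(x') z(x¹) c`. -/
def lift (hz : MemLp z 2 volume) (c : Bool → Idx → ℝ) : L2Front →L[ℝ] HS :=
  (mulSide fun σ => ContinuousLinearMap.toSpanSingleton ℝ (eu (c σ))).comp (tens hz)

theorem transFlow_lift (hz : MemLp z 2 volume) (c : Bool → Idx → ℝ) (w : Fin 2 → ℝ) (s : ℝ)
    (f : L2Front) : lift hz c ((transFlow w).τ s f) = (transFlow (bd w)).τ s (lift hz c f) := by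
  simp only [lift, ContinuousLinearMap.comp_apply, transFlow_tens]
  exact mulSide_transFlow _ (Or.inl rfl) s _

/-- Pairs of smooth functions `g(x') z(x¹) c`. -/
def tensFun (g : (Fin 2 → ℝ) → ℝ) (z : ℝ → ℝ) (c : Idx → ℝ) (x : Space) : Idx → ℝ :=
  (g (tl x) * z (x 0)) • c

theorem lift_toL (hz : MemLp z 2 volume) (c : Bool → Idx → ℝ) {g : (Fin 2 → ℝ) → ℝ}
    (hg : MemLp g 2 volume) : lift hz c (toL g) = glueH fun σ => tensFun g z (c σ) := by
  rw [lift, ContinuousLinearMap.comp_apply, tens_toL hz hg]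
  have := mulSide_toL_glue (fun σ => ContinuousLinearMap.toSpanSingleton ℝ (eu (c σ)))
    (Ψ := fun _ x => g (tl x) * z (x 0)) fun _ => (tensor_aux hz hg).1
  refine Eq.trans this ?_
  rw [glueH]
  congr 1

theorem exists_norm_lift_le (c : Bool → Idx → ℝ) : ∃ C : ℝ, 0 ≤ C ∧ ∀ (z : ℝ → ℝ)
    (hz : MemLp z 2 volume) (f : L2Front),
      ‖lift hz c f‖ ≤ C * Real.sqrt (∫ t, z t ^ 2) * ‖f‖ := by
  refine ⟨‖mulSide fun σ => ContinuousLinearMap.toSpanSingleton ℝ (eu (c σ))‖, norm_nonneg _,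
    fun z hz f => ?_⟩
  rw [mul_assoc, lift, ContinuousLinearMap.comp_apply]
  exact (ContinuousLinearMap.le_opNorm _ _).trans
    (mul_le_mul_of_nonneg_left (norm_tens_le hz f) (norm_nonneg _))

/-- The scalar tensor product of smooth functions. -/
theorem Nice.tensor {g : (Fin 2 → ℝ) → ℝ} (hg : Nice g) (hz : ContDiff ℝ (⊤ : ℕ∞) z)
    (hzs : HasCompactSupport z) : Nice fun x : Space => g (tl x) * z (x 0) := by
  have htl : ContDiff ℝ (⊤ : ℕ∞) tl := by
    refine contDiff_pi.2 fun i => ?_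
    fin_cases i
    · exact contDiff_apply ℝ ℝ (1 : Fin 3)
    · exact contDiff_apply ℝ ℝ (2 : Fin 3)
  refine ⟨(hg.1.comp htl).mul (hz.comp (contDiff_apply ℝ ℝ (0 : Fin 3))), ?_⟩
  have hc : Continuous fun p : ℝ × (Fin 2 → ℝ) => (![p.1, p.2 0, p.2 1] : Space) := by
    refine continuous_pi fun i => ?_
    fin_cases i
    · exact continuous_fst
    · exact (continuous_apply 0).comp continuous_snd
    · exact (continuous_apply 1).comp continuous_snd
  refine HasCompactSupport.intro ((hzs.isCompact.prod hg.2.isCompact).image hc) fun x hx => ?_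
  by_contra hne
  refine hx ⟨(x 0, tl x), ⟨subset_tsupport _ ?_, subset_tsupport _ ?_⟩, ?_⟩
  · exact right_ne_zero_of_mul hne
  · exact left_ne_zero_of_mul hne
  · funext i; fin_cases i <;> rfl

theorem dir_tensor_bd {g : (Fin 2 → ℝ) → ℝ} (hg : Nice g) (hz : ContDiff ℝ (⊤ : ℕ∞) z)
    (hzs : HasCompactSupport z) (w : Fin 2 → ℝ) (x : Space) :
    dir (bd w) (fun x : Space => g (tl x) * z (x 0)) x = dir w g (tl x) * z (x 0) := by
  refine ((hg.tensor hz hzs).hasDerivAt (bd w) x).unique ?_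
  have h := (hg.hasDerivAt w (tl x)).mul_const (z (x 0))
  refine h.congr_of_eventuallyEq (.of_forall fun s => ?_)
  change g (tl (x + s • bd w)) * z ((x + s • bd w) 0) = _
  rw [tl_add]
  simp [bd]

theorem dir_tensor_zero {g : (Fin 2 → ℝ) → ℝ} (hg : Nice g) (hz : ContDiff ℝ (⊤ : ℕ∞) z)
    (hzs : HasCompactSupport z) (x : Space) :
    dir (Pi.single 0 1) (fun x : Space => g (tl x) * z (x 0)) x = g (tl x) * deriv z (x 0) := by
  refine ((hg.tensor hz hzs).hasDerivAt (Pi.single 0 1) x).unique ?_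
  have h0 : HasDerivAt (fun s : ℝ => z (x 0 + s)) (deriv z (x 0)) 0 := by
    have : HasDerivAt z (deriv z (x 0)) (x 0 + 0) := by
      rw [add_zero]; exact (hz.differentiable (by simp) _).hasDerivAt
    exact this.comp_const_add (x 0) 0
  refine (h0.const_mul (g (tl x))).congr_of_eventuallyEq (.of_forall fun s => ?_)
  have : tl (x + s • (Pi.single 0 1 : Space)) = tl x := by
    funext i; fin_cases i <;> simp [tl]
  simp [this]

end Tensor
end
end RMHD

/-! ### The interior problem: skewness, maximality, solutions. -/

namespace IsometryFlow

variable {H : Type*} [NormedAddCommGroup H] [InnerProductSpace ℝ H] {G : IsometryFlow H}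

/-- By symmetry of M and its commutation with the flow, the function s ↦ ⟪M τ_s y, y⟫ is even; so
its derivative at 0 is zero. -/
theorem inner_deriv_eq_zero {M : H →L[ℝ] H} (hM : ∀ s x, M (G.τ s x) = G.τ s (M x))
    (hs : ∀ x y, inner ℝ (M x) y = inner ℝ x (M y)) {y y' : H}
    (h : HasDerivAt (fun s => G.τ s y) y' 0) : inner ℝ (M y') y = 0 := by
  have h1 : HasDerivAt (fun s => inner ℝ (M (G.τ s y)) y) (inner ℝ (M y') y) 0 := by
    have := (M.hasFDerivAt.comp_hasDerivAt 0 h).inner ℝ (hasDerivAt_const (0 : ℝ) y)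
    simpa using this
  have h2 : HasDerivAt (fun s => inner ℝ (M (G.τ (-s) y)) y) (-inner ℝ (M y') y) 0 := by
    have h0 : HasDerivAt (fun s => inner ℝ (M (G.τ s y)) y) (inner ℝ (M y') y) (-0) := by
      rwa [neg_zero]
    exact (HasDerivAt.scomp (0 : ℝ) h0 (hasDerivAt_neg (0 : ℝ))).congr_deriv (by simp)
  have e : (fun s => inner ℝ (M (G.τ (-s) y)) y) = fun s => inner ℝ (M (G.τ s y)) y := by
    funext s
    rw [hM, G.inner_τ, neg_neg, hs, real_inner_comm]
  rw [e] at h2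
  have := h1.unique h2
  linarith

end IsometryFlow

namespace RMHD
noncomputable section

theorem Nice.pd {E : Type*} [NormedAddCommGroup E] [NormedSpace ℝ E] {f : Space → E} (hf : Nice f)
    (j : Fin 3) : Nice (RMHD.pd j f) := hf.dir _

/-- A symmetric hyperbolic system in the two half-spaces with boundary matrix
`q ⊗ w + w ⊗ q`. -/
structure SymSys where
  B : Bool → Matrix Idx Idx ℝ
  D : Fin 3 → Bool → Matrix Idx Idx ℝ
  q : Bool → Idx → ℝ
  w : Bool → Idx → ℝ
  R : Bool → Matrix Idx Idx ℝ
  R' : Bool → Matrix Idx Idx ℝ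
  N : Bool → Matrix Idx Idx ℝ
  N' : Bool → Matrix Idx Idx ℝ
  B_pos : ∀ σ X, X ≠ 0 → 0 < X ⬝ᵥ (B σ *ᵥ X)
  D_symm : ∀ j σ, (D j σ)ᵀ = D j σ
  D_zero : ∀ σ X Y, X ⬝ᵥ (D 0 σ *ᵥ Y) = (q σ ⬝ᵥ X) * (w σ ⬝ᵥ Y) + (w σ ⬝ᵥ X) * (q σ ⬝ᵥ Y)
  RtR : ∀ σ, (R σ)ᵀ * R σ = B σ
  RR' : ∀ σ, R σ * R' σ = 1
  R'R : ∀ σ, R' σ * R σ = 1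
  NN' : ∀ σ, N σ * N' σ = 1
  N'N : ∀ σ, N' σ * N σ = 1
  q_N : ∀ σ X, q σ ⬝ᵥ (N σ *ᵥ X) = X iP
  w_N : ∀ σ X, w σ ⬝ᵥ (N σ *ᵥ X) = X (iU 0)

/-- Test functions for the interior equations with the two boundary conditions `[q] = [w] = 0`. -/
structure CoreTest (S : SymSys) (Θ : Bool → Space → Idx → ℝ) : Prop where
  nice : ∀ σ, Nice (Θ σ)
  q_eq : ∀ y, S.q true ⬝ᵥ Θ true (bd y) = S.q false ⬝ᵥ Θ false (bd y)
  w_eq : ∀ y, S.w true ⬝ᵥ Θ true (bd y) = S.w false ⬝ᵥ Θ false (bd y)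

namespace SymSys

variable (S : SymSys)

theorem B_symm (σ : Bool) : (S.B σ)ᵀ = S.B σ := by
  rw [← S.RtR, transpose_mul, transpose_transpose]

/-- `∑_j D_j ∂_j Θ`. -/
def op (Θ : Bool → Space → Idx → ℝ) : HS := ∑ j, mul (S.D j) (glueH fun σ => pd j (Θ σ))

theorem op_add {Θ Φ : Bool → Space → Idx → ℝ} (hΘ : ∀ σ, Nice (Θ σ)) (hΦ : ∀ σ, Nice (Φ σ)) :
    S.op (fun σ x => Θ σ x + Φ σ x) = S.op Θ + S.op Φ := by
  have : ∀ j, glueH (fun σ => pd j fun x => Θ σ x + Φ σ x)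
      = glueH (fun σ => pd j (Θ σ)) + glueH (fun σ => pd j (Φ σ)) := fun j => by
    rw [← glueH_add (fun σ => (hΘ σ).pd j) (fun σ => (hΦ σ).pd j)]
    congr 1; funext σ x
    exact dir_add (hΘ σ) (hΦ σ) _ x
  simp only [op, this, map_add, Finset.sum_add_distrib]

theorem dir_smul' {n : ℕ} {f : (Fin n → ℝ) → Idx → ℝ} (hf : Nice f) (c : ℝ) (w x : Fin n → ℝ) :
    dir w (fun y => c • f y) x = c • dir w f x := by
  exact dir_clm hf (c • ContinuousLinearMap.id ℝ _) w x

theorem op_smul {Θ : Bool → Space → Idx → ℝ} (hΘ : ∀ σ, Nice (Θ σ)) (c : ℝ) :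
    S.op (fun σ x => c • Θ σ x) = c • S.op Θ := by
  have : ∀ j, glueH (fun σ => pd j fun x => c • Θ σ x)
      = c • glueH (fun σ => pd j (Θ σ)) := fun j => by
    rw [← glueH_smul (fun σ => (hΘ σ).pd j)]
    congr 1; funext σ x
    exact dir_smul' (hΘ σ) c _ x
  simp only [op, this, map_smul, Finset.smul_sum]

/-- The part of the frame that enters the boundary conditions. -/
def bdFrame (σ : Bool) : Matrix Idx Idx ℝ := fun i => if i = iP then S.q σ else
  if i = iU 0 then S.w σ else 0

/-- The boundary matrix in the frame. -/
def bdMat : Matrix Idx Idx ℝ := fun i j => if i = iP ∧ j = iU 0 ∨ i = iU 0 ∧ j = iP then 1 else 0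

theorem bdMat_symm : bdMatᵀ = bdMat := by
  ext i j; simp only [transpose_apply, bdMat]; congr 1; ext; tauto

theorem bdMat_mulVec (X : Idx → ℝ) : bdMat *ᵥ X
    = fun i => if i = iP then X (iU 0) else if i = iU 0 then X iP else 0 := by
  have h : iP ≠ iU 0 := by simp [iP, iU]
  funext i
  simp only [mulVec, dotProduct, bdMat]
  by_cases h1 : i = iP
  · subst h1; simp [h]
  · by_cases h2 : i = iU 0
    · subst h2; simp [h.symm]
    · simp [h1, h2]

theorem bdMat_form (X Y : Idx → ℝ) :
    X ⬝ᵥ (bdMat *ᵥ Y) = X iP * Y (iU 0) + X (iU 0) * Y iP := by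
  have h : iP ≠ iU 0 := by simp [iP, iU]
  have e : ∀ i, X i * (bdMat *ᵥ Y) i = (if i = iP then X iP * Y (iU 0) else 0)
      + if i = iU 0 then X (iU 0) * Y iP else 0 := fun i => by
    rw [bdMat_mulVec]
    by_cases h1 : i = iP
    · subst h1; simp [h]
    · by_cases h2 : i = iU 0
      · subst h2; simp [h.symm]
      · simp [h1, h2]
  rw [dotProduct, Finset.sum_congr rfl fun i _ => e i, Finset.sum_add_distrib]
  simp only [Finset.sum_ite_eq', Finset.mem_univ, if_true]

theorem ext_form {M M' : Matrix Idx Idx ℝ} (h : ∀ X Y, X ⬝ᵥ (M *ᵥ Y) = X ⬝ᵥ (M' *ᵥ Y)) :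
    M = M' := by
  ext i j
  simpa [Matrix.mulVec_single_one, Matrix.col_apply] using h (Pi.single i 1) (Pi.single j 1)

theorem bdFrame_mulVec (σ : Bool) (X : Idx → ℝ) : S.bdFrame σ *ᵥ X
    = fun i => if i = iP then S.q σ ⬝ᵥ X else if i = iU 0 then S.w σ ⬝ᵥ X else 0 := by
  funext i
  simp only [mulVec, bdFrame]
  split_ifs <;> simp

/-- The normal derivative thus acts only on q and w, the quantities that are continuous across the
front, and the middle factor does not depend on the side. -/
theorem D_zero_eq (σ : Bool) : S.D 0 σ = (S.bdFrame σ)ᵀ * bdMat * S.bdFrame σ := by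
  have h : iU 0 ≠ iP := by simp [iP, iU]
  refine ext_form fun X Y => ?_
  rw [S.D_zero, ← mulVec_mulVec, ← mulVec_mulVec, dotProduct_mulVec, vecMul_transpose, bdMat_form,
    bdFrame_mulVec, bdFrame_mulVec]
  simp [h]

/-- In the frame the normal matrix is the same on both sides. Multiplication by it therefore
commutes with translations across the front, as `eq_zero_of_orthogonal_range` demands. -/
theorem N_D_zero_N (σ : Bool) : (S.N σ)ᵀ * S.D 0 σ * S.N σ = bdMat := by
  refine ext_form fun X Y => ?_
  rw [← mulVec_mulVec, ← mulVec_mulVec, dotProduct_mulVec, vecMul_transpose, S.D_zero, S.q_N,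
    S.w_N, S.q_N, S.w_N, bdMat_form]

variable {S} {Θ : Bool → Space → Idx → ℝ}

/-- Integration by parts without boundary terms. Tangential matrices commute with tangential
translations. For the normal direction one passes to the components q, w, whose traces match and
whose matrix is constant in the whole space. -/
theorem inner_op_self (hΘ : CoreTest S Θ) : inner ℝ (S.op Θ) (glueH Θ) = 0 := by
  rw [op, sum_inner]
  refine Finset.sum_eq_zero fun j _ => ?_
  by_cases hj : j = 0
  · subst hj
    let Φ : Bool → Space → Idx → ℝ := fun σ x => S.bdFrame σ *ᵥ Θ σ x
    have hΦ : ∀ σ, Nice (Φ σ) := fun σ => (hΘ.nice σ).mulVec _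
    have hb : ∀ y, Φ true (bd y) = Φ false (bd y) := fun y => by
      simp only [Φ, bdFrame_mulVec, hΘ.q_eq, hΘ.w_eq]
    have hd := glueH_hasDerivAt hΦ (w := Pi.single 0 1) (Or.inr hb)
    have := IsometryFlow.inner_deriv_eq_zero (M := mul fun _ => bdMat)
      (fun s x => mul_transFlow _ (Or.inr rfl) s x)
      (inner_mul_symm fun _ => bdMat_symm) hd
    rw [← this]
    have e1 : (glueH fun σ => dir (Pi.single 0 1) (Φ σ))
        = mul S.bdFrame (glueH fun σ => pd 0 (Θ σ)) := by
      rw [mul_glueH _ fun σ => (hΘ.nice σ).pd 0]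
      congr 1; funext σ x
      exact dir_mulVec (hΘ.nice σ) _ _ x
    have e2 : glueH Φ = mul S.bdFrame (glueH Θ) := (mul_glueH _ hΘ.nice).symm
    have e3 : S.D 0 = fun σ => (S.bdFrame σ)ᵀ * (bdMat * S.bdFrame σ) := by
      funext σ; rw [S.D_zero_eq, Matrix.mul_assoc]
    rw [e1, e2, e3, ← mul_mul (fun σ => (S.bdFrame σ)ᵀ) fun σ => bdMat * S.bdFrame σ,
      inner_mul]
    simp only [transpose_transpose]
    rw [mul_mul (fun _ => bdMat) S.bdFrame]
  · have hw : (Pi.single j 1 : Space) 0 = 0 := by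
      rw [Pi.single_apply, if_neg (Ne.symm hj)]
    exact IsometryFlow.inner_deriv_eq_zero
      (fun s x => mul_transFlow _ (Or.inl hw) s x) (inner_mul_symm (S.D_symm j))
      (glueH_hasDerivAt hΘ.nice (w := Pi.single j 1) (Or.inl hw))

variable (S)

/-- The test function with the components `g` in the frame. -/
def frame (g : Space → Idx → ℝ) : Bool → Space → Idx → ℝ := fun σ x => S.N σ *ᵥ g x

/-- A function smooth in the whole space, read in the frame, satisfies both matching conditions
automatically. This class of test functions is invariant under all translations, including normal
ones. -/
theorem coreTest_frame {g : Space → Idx → ℝ} (hg : Nice g) : CoreTest S (S.frame g) where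
  nice σ := hg.mulVec _
  q_eq y := by simp only [frame, S.q_N]
  w_eq y := by simp only [frame, S.w_N]

theorem glueH_frame {g : Space → Idx → ℝ} (hg : Nice g) :
    glueH (S.frame g) = mul S.N (glueH fun _ => g) := (mul_glueH _ fun _ => hg).symm

theorem op_frame {g : Space → Idx → ℝ} (hg : Nice g) :
    S.op (S.frame g) = ∑ j, mul (S.D j) (mul S.N (glueH fun _ => pd j g)) := by
  refine Finset.sum_congr rfl fun j _ => ?_
  rw [mul_glueH S.N fun _ => hg.pd j]
  congr 2; funext σ x
  exact dir_mulVec hg _ _ x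

/-- The graph of the operator in the variables in which the energy is the norm. -/
def graph : Submodule ℝ (HS × HS) where
  carrier := {p | ∃ Θ, CoreTest S Θ ∧
    p = (mul S.R (glueH Θ), mul (fun σ => (S.R' σ)ᵀ) (S.op Θ))}
  add_mem' := by
    rintro _ _ ⟨Θ, hΘ, rfl⟩ ⟨Φ, hΦ, rfl⟩
    refine ⟨fun σ x => Θ σ x + Φ σ x, ⟨fun σ => (hΘ.nice σ).add (hΦ.nice σ), fun y => ?_,
      fun y => ?_⟩, ?_⟩
    · simp only [dotProduct_add, hΘ.q_eq, hΦ.q_eq]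
    · simp only [dotProduct_add, hΘ.w_eq, hΦ.w_eq]
    · rw [glueH_add hΘ.nice hΦ.nice, S.op_add hΘ.nice hΦ.nice, map_add, map_add]; rfl
  zero_mem' := by
    refine ⟨fun _ _ => 0, ⟨fun σ => Nice.zero, fun y => by simp, fun y => by simp⟩, ?_⟩
    have h := S.op_smul (Θ := fun _ _ => 0) (fun _ => Nice.zero) 0
    simp only [smul_zero, zero_smul] at h
    rw [glueH_zero, h, map_zero, map_zero]; rfl
  smul_mem' := by
    rintro c _ ⟨Θ, hΘ, rfl⟩
    refine ⟨fun σ x => c • Θ σ x, ⟨fun σ => (hΘ.nice σ).smul c, fun y => ?_, fun y => ?_⟩, ?_⟩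
    · simp only [dotProduct_smul, hΘ.q_eq]
    · simp only [dotProduct_smul, hΘ.w_eq]
    · rw [glueH_smul hΘ.nice, S.op_smul hΘ.nice, map_smul, map_smul]; rfl

theorem mem_graph (hΘ : CoreTest S Θ) :
    (mul S.R (glueH Θ), mul (fun σ => (S.R' σ)ᵀ) (S.op Θ)) ∈ S.graph := ⟨Θ, hΘ, rfl⟩

theorem inner_R (f g : HS) : inner ℝ (mul S.R f) (mul S.R g) = inner ℝ f (mul S.B g) := by
  rw [inner_mul, mul_mul]; simp only [S.RtR]

theorem inner_R' (f g : HS) :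
    inner ℝ (mul S.R f) (mul (fun σ => (S.R' σ)ᵀ) g) = inner ℝ f g := by
  rw [inner_mul, mul_mul]
  simp only [← transpose_mul, S.R'R, transpose_one, mul_one']

theorem mul_R'_R (f : HS) : mul S.R' (mul S.R f) = f := by
  rw [mul_mul]; simp only [S.R'R, mul_one']

theorem mul_R_R' (f : HS) : mul S.R (mul S.R' f) = f := by
  rw [mul_mul]; simp only [S.RR', mul_one']

theorem mul_N_N' (f : HS) : mul S.N (mul S.N' f) = f := by
  rw [mul_mul]; simp only [S.NN', mul_one']

/-- Skewness is `inner_op_self`. For dense range it is enough to use the test functions that come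
from the frame; on them the orthogonality relations become those of `eq_zero_of_orthogonal_range`.
-/
theorem isSkewGraph : IsSkewGraph S.graph where
  skew := by
    rintro _ ⟨Θ, hΘ, rfl⟩
    change inner ℝ (mul (fun σ => (S.R' σ)ᵀ) (S.op Θ)) (mul S.R (glueH Θ)) = 0
    rw [real_inner_comm, S.inner_R', real_inner_comm, inner_op_self hΘ]
  dense_fst := by
    have hs : Function.Surjective fun x => mul S.R (mul S.N x) := fun x =>
      ⟨mul S.N' (mul S.R' x), by simp only [S.mul_N_N', S.mul_R_R']⟩
    have h := hs.denseRange.dense_image (by fun_prop) dense_glueH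
    refine h.mono ?_
    rintro _ ⟨_, ⟨g, hg, rfl⟩, rfl⟩
    refine ⟨_, S.mem_graph (S.coreTest_frame hg), ?_⟩
    simp only [S.glueH_frame hg]
  dense_range := by
    intro ε _
    let L : HS × HS →ₗ[ℝ] HS := LinearMap.fst ℝ HS HS + ε • LinearMap.snd ℝ HS HS
    have hset : (fun p : HS × HS => p.1 + ε • p.2) '' (S.graph : Set (HS × HS))
        = (S.graph.map L : Set HS) := rfl
    rw [hset, Submodule.dense_iff_topologicalClosure_eq_top, Submodule.topologicalClosure_eq_top_iff,
      Submodule.eq_bot_iff]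
    intro f hf
    -- Written in the frame, the unknown sees the coefficients NᵀBN and NᵀD_jN, of which the normal
    -- one is constant.
    obtain ⟨f', hff⟩ : ∃ f', f = mul S.R (mul S.N f') :=
      ⟨mul S.N' (mul S.R' f), by simp only [S.mul_N_N', S.mul_R_R']⟩
    have key : ∀ g : Space → Idx → ℝ, Nice g →
        inner ℝ f' (mul (fun σ => (S.N σ)ᵀ * (S.B σ * S.N σ)) (glueH fun _ => g)) + ∑ j, ε *
          inner ℝ f' (mul (fun σ => (S.N σ)ᵀ * S.D j σ * S.N σ) (glueH fun _ => pd j g)) = 0 := by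
      intro g hg
      have h := (Submodule.mem_orthogonal' _ _).1 hf _
        (Submodule.mem_map_of_mem (f := L) (S.mem_graph (S.coreTest_frame hg)))
      have hL : L (mul S.R (glueH (S.frame g)), mul (fun σ => (S.R' σ)ᵀ) (S.op (S.frame g)))
        = mul S.R (glueH (S.frame g)) + ε • mul (fun σ => (S.R' σ)ᵀ) (S.op (S.frame g)) := rfl
      rw [hL, inner_add_right, inner_smul_right, hff, S.inner_R, S.inner_R', S.glueH_frame hg,
        S.op_frame hg, inner_sum] at h
      rw [← h, Finset.mul_sum]
      congr 1
      · rw [inner_mul, mul_mul, mul_mul]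
        simp only [Matrix.mul_assoc]
      · refine Finset.sum_congr rfl fun j _ => ?_
        rw [inner_mul, mul_mul, mul_mul]
    have hz : f' = 0 := by
      refine eq_zero_of_orthogonal_range (fun i => transFlow (Pi.single i 1))
        (fun i j s t x => transFlow_comm _ _ s t x)
        (mul fun σ => (S.N σ)ᵀ * (S.B σ * S.N σ))
        (fun j => mul fun σ => (S.N σ)ᵀ * S.D j σ * S.N σ)
        (fun j => inner_mul_symm fun σ => ?_) (fun x hx => ?_)
        (inner_mul_symm fun σ => ?_) (fun i hi s x => mul_transFlow _ (Or.inl ?_) s x)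
        (fun i j hij s x => mul_transFlow _ ?_ s x) dense_glueH
        -- A total function is required here; only its values on the dense set of smooth functions
        -- matter.
        (fun j y => deriv (fun s => (transFlow (Pi.single j 1)).τ s y) 0) (fun j y hy => ?_) ε
        (fun y hy r => ?_)
      · rw [transpose_mul, transpose_mul, transpose_transpose, S.D_symm, Matrix.mul_assoc]
      · refine eq_zero_of_inner_mul (fun σ X hX => ?_) x hx
        rw [← mulVec_mulVec, ← mulVec_mulVec, dotProduct_mulVec, vecMul_transpose]
        refine S.B_pos σ _ fun h0 => hX ?_
        have := congrArg (fun Y => S.N' σ *ᵥ Y) h0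
        simpa [mulVec_mulVec, S.N'N] using this
      · rw [transpose_mul, transpose_mul, transpose_transpose, S.B_symm, Matrix.mul_assoc]
      · rw [Pi.single_apply, if_neg (Ne.symm hi)]
      · rcases hij with hi | hj
        · left; rw [Pi.single_apply, if_neg (Ne.symm hi)]
        · right; subst hj; rw [S.N_D_zero_N, S.N_D_zero_N]
      · obtain ⟨g, hg, rfl⟩ := hy
        exact (glueH_hasDerivAt (fun _ => hg) (Or.inr fun _ => rfl)).differentiableAt.hasDerivAt
      · obtain ⟨g, hg, rfl⟩ := hy
        have hd : ∀ j : Fin 3, deriv (fun s => (transFlow (Pi.single j 1 : Space)).τ s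
            (glueH fun _ => g)) 0 = glueH fun _ => pd j g := fun j =>
          (glueH_hasDerivAt (fun _ => hg) (w := Pi.single j 1) (Or.inr fun _ => rfl)).deriv
        let c : Space := r 0 • Pi.single 0 1 + r 1 • Pi.single 1 1 + r 2 • Pi.single 2 1
        have ht : ∀ k : Space → Idx → ℝ, Nice k →
            (transFlow (Pi.single 0 1 : Space)).τ (r 0) ((transFlow (Pi.single 1 1 : Space)).τ (r 1)
              ((transFlow (Pi.single 2 1 : Space)).τ (r 2) (glueH fun _ => k)))
            = glueH fun _ x => k (x + c) := by
          intro k hk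
          rw [transFlow_glueH_const hk, transFlow_glueH_const (hk.translate _),
            transFlow_glueH_const ((hk.translate _).translate _)]
          congr 1; funext _ x
          simp only [c, add_assoc]
        simp only [hd]
        have h := key _ (hg.translate c)
        have hpd : ∀ j, (pd j fun x => g (x + c)) = fun x => pd j g (x + c) := fun j => by
          funext x; exact dir_translate _ _ _
        simp only [hpd] at h
        have ht' := fun j => ht (pd j g) (hg.pd j)
        simp only [ht _ hg, ht']
        exact h
    rw [hff, hz, map_zero, map_zero]

/-- `W` satisfies the interior equations and the boundary conditions `[q] = [w] = 0` weakly. -/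
def CoreSol (I : Set ℝ) (W : ℝ → HS) : Prop :=
  ∀ Θ, CoreTest S Θ → ∀ t ∈ I,
    HasDerivWithinAt (fun s => inner ℝ (W s) (mul S.B (glueH Θ))) (inner ℝ (W t) (S.op Θ)) I t

/-- The isometric evolution in the variable R W, in which the energy is the squared norm,
transported back by R⁻¹. -/
theorem exists_coreSol (W₀ : HS) : ∃ W : ℝ → HS, Continuous W ∧ W 0 = W₀ ∧
    S.CoreSol Set.univ W := by
  obtain ⟨F, hF, hF0, hFd⟩ := S.isSkewGraph.exists_weak_solution (mul S.R W₀)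
  refine ⟨fun t => mul S.R' (F t), by fun_prop, by simp only [hF0, S.mul_R'_R],
    fun Θ hΘ t _ => ?_⟩
  have h := (hFd _ (Submodule.le_topologicalClosure _ (S.mem_graph hΘ)) t).hasDerivWithinAt
    (s := Set.univ)
  have e : ∀ s, F s = mul S.R (mul S.R' (F s)) := fun s => (S.mul_R_R' _).symm
  refine (h.congr_deriv ?_).congr_of_eventuallyEq (.of_forall fun s => ?_) ?_
  · dsimp only; rw [e t, S.inner_R', ← e t]
  · dsimp only; rw [e s, S.inner_R, ← e s]
  · dsimp only; rw [e t, S.inner_R, ← e t]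

theorem norm_eq_of_coreSol {W : ℝ → HS} {T : ℝ} (hc : ContinuousOn W (Set.Icc 0 T))
    (h : S.CoreSol (Set.Icc 0 T) W) : ∀ t ∈ Set.Icc 0 T,
      ‖mul S.R (W t)‖ = ‖mul S.R (W 0)‖ := by
  refine S.isSkewGraph.norm_eq_of_weak_solution (F := fun t => mul S.R (W t))
    ((mul S.R).continuous.comp_continuousOn hc) ?_
  rintro _ ⟨Θ, hΘ, rfl⟩ t ht
  simpa only [S.inner_R, S.inner_R'] using h Θ hΘ t ht

theorem exists_norm_le_of_coreSol : ∃ C : ℝ, 1 ≤ C ∧ ∀ (W : ℝ → HS) (T : ℝ),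
    ContinuousOn W (Set.Icc 0 T) → S.CoreSol (Set.Icc 0 T) W → ∀ t ∈ Set.Icc 0 T,
      ‖W t‖ ≤ C * ‖W 0‖ := by
  refine ⟨1 + ‖mul S.R'‖ * ‖mul S.R‖, by simp; positivity, fun W T hc h t ht => ?_⟩
  have h1 := S.norm_eq_of_coreSol hc h t ht
  calc ‖W t‖ = ‖mul S.R' (mul S.R (W t))‖ := by rw [S.mul_R'_R]
    _ ≤ ‖mul S.R'‖ * ‖mul S.R (W 0)‖ := by rw [← h1]; exact (mul S.R').le_opNorm _
    _ ≤ ‖mul S.R'‖ * (‖mul S.R‖ * ‖W 0‖) := by gcongr; exact (mul S.R).le_opNorm _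
    _ ≤ _ := by nlinarith [norm_nonneg (W 0)]

end SymSys
end
end RMHD

/-! ### The symmetrized problem as a symmetric system. -/

namespace RMHD
noncomputable section

section Factorization

theorem exists_inverse {M : Matrix Idx Idx ℝ} (h : ∀ X, M *ᵥ X = 0 → X = 0) :
    ∃ M' : Matrix Idx Idx ℝ, M * M' = 1 ∧ M' * M = 1 := by
  have hi : Function.Injective M.mulVec := fun X Y hXY => by
    have : M *ᵥ (X - Y) = 0 := by rw [mulVec_sub]; exact sub_eq_zero.2 hXY
    exact sub_eq_zero.1 (h _ this)
  obtain ⟨u, rfl⟩ := mulVec_injective_iff_isUnit.1 hi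
  exact ⟨↑u⁻¹, u.mul_inv, u.inv_mul⟩

open scoped MatrixOrder in
theorem exists_factor {M : Matrix Idx Idx ℝ} (hs : Mᵀ = M) (hp : ∀ X, X ≠ 0 → 0 < X ⬝ᵥ (M *ᵥ X)) :
    ∃ R R' : Matrix Idx Idx ℝ, Rᵀ * R = M ∧ R * R' = 1 ∧ R' * R = 1 := by
  have hps : M.PosSemidef := by
    refine .of_dotProduct_mulVec_nonneg (by rw [IsHermitian, conjTranspose_eq_transpose_of_trivial, hs])
      fun X => ?_
    by_cases hX : X = 0
    · simp [hX]
    · simpa using (hp X hX).le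
  obtain ⟨R, hR⟩ := CStarAlgebra.nonneg_iff_eq_star_mul_self.mp hps.nonneg
  rw [star_eq_conjTranspose, conjTranspose_eq_transpose_of_trivial] at hR
  obtain ⟨R', h1, h2⟩ := exists_inverse (M := R) fun X hX => by
    by_contra hne
    have := hp X hne
    rw [hR, ← mulVec_mulVec, hX] at this
    simp at this
  exact ⟨R, R', hR.symm, h1, h2⟩

end Factorization

/-- The secondary symmetrizations on the two sides have a common convective velocity
`v - λ H`, and their matrices at the time derivative are positive. -/
structure Symmetrizable (e : ℝ → ℝ → ℝ) (U : Bool → State) (lam : Bool → ℝ) : Prop where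
  u_zero : ∀ σ, (U σ).u 0 = 0
  H_zero : ∀ σ, (U σ).H 0 = 0
  pos : ∀ σ (X : Idx → ℝ), X ≠ 0 → 0 < X ⬝ᵥ (B0 e (U σ) (lam σ) *ᵥ X)
  vel_one : (U true).v 1 - lam true * (U true).H 1 = (U false).v 1 - lam false * (U false).H 1
  vel_two : (U true).v 2 - lam true * (U true).H 2 = (U false).v 2 - lam false * (U false).H 2

variable {e : ℝ → ℝ → ℝ} {U : Bool → State} {lam : Bool → ℝ}

namespace Symmetrizable

theorem exists_symK_inverse (h : Symmetrizable e U lam) (σ : Bool) : ∃ M' : Matrix Idx Idx ℝ,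
    symK e (U σ) (lam σ) * M' = 1 ∧ M' * symK e (U σ) (lam σ) = 1 :=
  exists_inverse fun X hX => by
    by_contra hne
    have := h.pos σ X hne
    rw [B0, ← mulVec_mulVec, hX] at this
    simp at this

/-- The variables `q`, `w` replace `p`, `u₁`. -/
def frameMat (U : State) (l : ℝ) : Matrix Idx Idx ℝ := fun i =>
  if i = iP then qVec U else if i = iU 0 then wVec U l else Pi.single i 1

/-- The matrix is triangular in effect: p enters q with coefficient 1 and u₁ enters w with
coefficient 1/Γ, while the other coordinates are unchanged. -/
theorem exists_frame_inverse (h : Symmetrizable e U lam) (σ : Bool) : ∃ M' : Matrix Idx Idx ℝ,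
    frameMat (U σ) (lam σ) * M' = 1 ∧ M' * frameMat (U σ) (lam σ) = 1 :=
  exists_inverse fun X hX => by
    have hv : (U σ).v 0 = 0 := by simp [State.v, h.u_zero]
    have h0 : ∀ i, i ≠ iP → i ≠ iU 0 → X i = 0 := fun i h1 h2 => by
      have := congrFun hX i
      simpa [mulVec, frameMat, h1, h2] using this
    have hu : X (iU 0) = 0 := by
      have := congrFun hX (iU 0)
      have hne : iU 0 ≠ iP := by simp [iP, iU]
      have hG := (Gam_pos (U σ)).ne'
      simp only [mulVec, frameMat, hne, if_false, if_true] at this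
      rw [wVec_dot, h0 (iH 0) (by simp [iP, iH]) (by simp [iU, iH])] at this
      simpa [hG] using this
    have hq : X iP = 0 := by
      have := congrFun hX iP
      simp only [mulVec, frameMat, if_true] at this
      have hpu : pu X = 0 := by
        funext k
        by_cases hk : k = 0
        · subst hk; exact hu
        · exact h0 _ (by simp [iP, iU]) (by simpa [iU] using hk)
      have hph : ph X = 0 := by
        funext k
        exact h0 _ (by simp [iP, iH]) (by simp [iU, iH])
      rw [qVec_dot, hpu, hph] at this
      simpa using this
    funext i
    by_cases h1 : i = iP
    · subst h1; exact hq
    · by_cases h2 : i = iU 0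
      · subst h2; exact hu
      · exact h0 i h1 h2

theorem exists_B0_factor (h : Symmetrizable e U lam) (σ : Bool) : ∃ R R' : Matrix Idx Idx ℝ,
    Rᵀ * R = B0 e (U σ) (lam σ) ∧ R * R' = 1 ∧ R' * R = 1 :=
  exists_factor (B0_symm (h.u_zero σ) (h.H_zero σ)) (h.pos σ)

/-- The symmetrized system. -/
def sys (h : Symmetrizable e U lam) : SymSys where
  B σ := B0 e (U σ) (lam σ)
  D j σ := Bj e (U σ) (lam σ) j
  q σ := qVec (U σ)
  w σ := wVec (U σ) (lam σ)
  R σ := (h.exists_B0_factor σ).choose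
  R' σ := (h.exists_B0_factor σ).choose_spec.choose
  N σ := (h.exists_frame_inverse σ).choose
  N' σ := frameMat (U σ) (lam σ)
  B_pos := h.pos
  D_symm j σ := Bj_symm (h.u_zero σ) (h.H_zero σ) j
  D_zero σ := B_zero_form (h.u_zero σ) (h.H_zero σ)
  RtR σ := (h.exists_B0_factor σ).choose_spec.choose_spec.1
  RR' σ := (h.exists_B0_factor σ).choose_spec.choose_spec.2.1
  R'R σ := (h.exists_B0_factor σ).choose_spec.choose_spec.2.2
  NN' σ := (h.exists_frame_inverse σ).choose_spec.2
  N'N σ := (h.exists_frame_inverse σ).choose_spec.1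
  q_N σ X := by
    have := congrFun (congrArg (fun M => M *ᵥ X) (h.exists_frame_inverse σ).choose_spec.1) iP
    simp only [← mulVec_mulVec, one_mulVec] at this
    exact this
  w_N σ X := by
    have := congrFun (congrArg (fun M => M *ᵥ X) (h.exists_frame_inverse σ).choose_spec.1) (iU 0)
    simp only [← mulVec_mulVec, one_mulVec] at this
    exact this

/-- The inverse of the symmetrizer. -/
def invK (h : Symmetrizable e U lam) (σ : Bool) : Matrix Idx Idx ℝ :=
  (h.exists_symK_inverse σ).choose

theorem symK_invK (h : Symmetrizable e U lam) (σ : Bool) (X : Idx → ℝ) :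
    symK e (U σ) (lam σ) *ᵥ (h.invK σ *ᵥ X) = X := by
  rw [mulVec_mulVec, invK, (h.exists_symK_inverse σ).choose_spec.1, one_mulVec]

end Symmetrizable

/-! ### Traces and jumps of test functions. -/

section Boundary

theorem bd_eq (c : Fin 2 → ℝ) : bd c = c 0 • Pi.single 1 1 + c 1 • Pi.single 2 1 := by
  funext i; fin_cases i <;> simp [bd]

theorem dir_bd {E : Type*} [NormedAddCommGroup E] [NormedSpace ℝ E] (c : Fin 2 → ℝ)
    (f : Space → E) (x : Space) : dir (bd c) f x = c 0 • pd 1 f x + c 1 • pd 2 f x := by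
  rw [dir, bd_eq, map_add, map_smul, map_smul]; rfl

theorem bd_linear (y w : Fin 2 → ℝ) (s : ℝ) : bd (y + s • w) = bd y + s • bd w := by
  funext i; fin_cases i <;> simp [bd]

theorem Nice.bd {E : Type*} [NormedAddCommGroup E] [NormedSpace ℝ E] {f : Space → E}
    (hf : Nice f) : Nice fun y => f (RMHD.bd y) := by
  have hbd : ContDiff ℝ (⊤ : ℕ∞) RMHD.bd := by
    refine contDiff_pi.2 fun i => ?_
    fin_cases i
    · exact contDiff_const
    · exact contDiff_apply ℝ ℝ (0 : Fin 2)
    · exact contDiff_apply ℝ ℝ (1 : Fin 2)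
  have hcl : Continuous tl := by
    refine continuous_pi fun i => ?_
    fin_cases i
    · exact continuous_apply 1
    · exact continuous_apply 2
  refine ⟨hf.1.comp hbd, HasCompactSupport.intro (hf.2.isCompact.image hcl) fun y hy => ?_⟩
  by_contra hne
  exact hy ⟨RMHD.bd y, subset_tsupport _ hne, tl_bd y⟩

theorem dir_comp_bd {E : Type*} [NormedAddCommGroup E] [NormedSpace ℝ E] {f : Space → E}
    (hf : Nice f) (w y : Fin 2 → ℝ) : dir w (fun y => f (bd y)) y = dir (bd w) f (bd y) := by
  refine (hf.bd.hasDerivAt w y).unique ?_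
  simp only [bd_linear]
  exact hf.hasDerivAt (bd w) (bd y)

theorem dir_comm {n : ℕ} {E : Type*} [NormedAddCommGroup E] [NormedSpace ℝ E]
    {f : (Fin n → ℝ) → E} (hf : Nice f) (v w x : Fin n → ℝ) :
    dir v (dir w f) x = dir w (dir v f) x := by
  have hd : DifferentiableAt ℝ (fderiv ℝ f) x :=
    ((hf.1.fderiv_right (m := (⊤ : ℕ∞)) (by simp)).differentiable (by simp)) x
  have h : ∀ v w, dir v (dir w f) x = fderiv ℝ (fderiv ℝ f) x v w := fun v w => by
    have := hd.hasFDerivAt.clm_apply (hasFDerivAt_const w x)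
    change fderiv ℝ (fun y => fderiv ℝ f y w) x v = _
    rw [this.fderiv]; simp
  rw [h, h]
  exact second_derivative_symmetric (fun y => (hf.differentiable y).hasFDerivAt) hd.hasFDerivAt v w

/-- The jump of a linear combination of the components at the boundary. -/
def jump (r : Bool → Idx → ℝ) (Θ : Bool → Space → Idx → ℝ) : L2Front :=
  toL fun y => r true ⬝ᵥ Θ true (bd y) - r false ⬝ᵥ Θ false (bd y)

variable {Θ Φ : Bool → Space → Idx → ℝ} {r : Bool → Idx → ℝ}

theorem nice_jump (r : Bool → Idx → ℝ) (hΘ : ∀ σ, Nice (Θ σ)) :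
    Nice fun y => r true ⬝ᵥ Θ true (bd y) - r false ⬝ᵥ Θ false (bd y) :=
  ((hΘ true).bd.dot _).sub ((hΘ false).bd.dot _)

theorem jump_add (hΘ : ∀ σ, Nice (Θ σ)) (hΦ : ∀ σ, Nice (Φ σ)) :
    jump r (fun σ x => Θ σ x + Φ σ x) = jump r Θ + jump r Φ := by
  rw [jump, jump, jump, ← toL_add (nice_jump r hΘ).memLp (nice_jump r hΦ).memLp]
  congr 1; funext y; simp only [dotProduct_add]; ring

theorem jump_dir (hΘ : ∀ σ, Nice (Θ σ)) (w : Fin 2 → ℝ) :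
    jump r (fun σ => dir (bd w) (Θ σ))
      = toL (dir w fun y => r true ⬝ᵥ Θ true (bd y) - r false ⬝ᵥ Θ false (bd y)) := by
  rw [jump]; congr 1; funext y
  have h : ∀ σ, dir (bd w) (Θ σ) (bd y) = dir w (fun y => Θ σ (bd y)) y := fun σ =>
    (dir_comp_bd (hΘ σ) w y).symm
  rw [h, h, ← dir_dot (hΘ true).bd, ← dir_dot (hΘ false).bd]
  simp only [dir]
  rw [fderiv_fun_sub (((hΘ true).bd.dot _).differentiable y) (((hΘ false).bd.dot _).differentiable y)]
  rfl

end Boundary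

/-! ### One-sided test functions and gradient fields. -/

section OneSided

variable {E : Type*} [NormedAddCommGroup E] [NormedSpace ℝ E]

/-- The pair of functions that equals `f` on the side `σ` and `0` on the other one. -/
def onSide (σ : Bool) (f : Space → E) : Bool → Space → E := fun τ => if τ = σ then f else fun _ => 0

theorem Nice.onSide {f : Space → E} (hf : Nice f) (σ τ : Bool) : Nice (onSide σ f τ) := by
  unfold RMHD.onSide; split_ifs
  · exact hf
  · exact Nice.zero

/-- `1` on the side `x¹ > 0` and `-1` on the other one. -/
def sgn (σ : Bool) : ℝ := if σ then 1 else -1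

theorem jump_onSide (r : Bool → Idx → ℝ) (σ : Bool) {f : Space → Idx → ℝ} (hf : Nice f) :
    jump r (RMHD.onSide σ f) = sgn σ • toL fun y => r σ ⬝ᵥ f (bd y) := by
  rw [← toL_smul (hf.bd.dot _).memLp]
  cases σ <;> simp [jump, RMHD.onSide, sgn]

theorem glueH_sides {F : Bool → Space → Idx → ℝ} (hF : ∀ σ, Nice (F σ)) (c : Bool → ℝ) :
    glueH (fun σ x => c σ • F σ x) = ∑ σ, c σ • glueH (RMHD.onSide σ (F σ)) := by
  rw [Fintype.sum_bool, ← glueH_smul fun τ => (hF _).onSide _ τ,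
    ← glueH_smul fun τ => (hF _).onSide _ τ,
    ← glueH_add (fun τ => ((hF _).onSide _ τ).smul _) (fun τ => ((hF _).onSide _ τ).smul _)]
  congr 1; funext τ x
  cases τ <;> simp [RMHD.onSide]

/-- The perturbation with magnetic field `x`. -/
def magVec (x : Fin 3 → ℝ) : Idx → ℝ
  | .inr (.inr (.inl k)) => x k
  | _ => 0

theorem magVec_eq (x : Fin 3 → ℝ) : magVec x = ∑ k, x k • Pi.single (iH k) 1 := by
  funext i
  rw [Finset.sum_apply]
  simp only [Pi.smul_apply, smul_eq_mul, Pi.single_apply, mul_ite, mul_one, mul_zero]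
  rcases i with _ | _ | k | _ <;> simp [magVec, iH]

/-- The perturbation with magnetic field `∇χ`. -/
def gradH (χ : Space → ℝ) (x : Space) : Idx → ℝ := magVec fun k => pd k χ x

variable {χ : Space → ℝ}

theorem gradH_eq (χ : Space → ℝ) : gradH χ = fun x => ∑ k, pd k χ x • (Pi.single (iH k) 1 : Idx → ℝ) := by
  funext x; exact magVec_eq _

theorem Nice.gradH (hχ : Nice χ) : Nice (RMHD.gradH χ) := by
  rw [gradH_eq]
  exact Nice.sum _ fun k => (hχ.pd k).clm (ContinuousLinearMap.toSpanSingleton ℝ _)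

theorem dir_gradH (hχ : Nice χ) (w x : Space) :
    dir w (RMHD.gradH χ) x = RMHD.gradH (dir w χ) x := by
  rw [gradH_eq, gradH_eq]
  have hk : ∀ k, Nice fun x => pd k χ x • (Pi.single (iH k) 1 : Idx → ℝ) := fun k =>
    (hχ.pd k).clm (ContinuousLinearMap.toSpanSingleton ℝ _)
  simp only [dir]
  rw [fderiv_fun_sum fun k _ => (hk k).differentiable x, _root_.sum_apply]
  refine Finset.sum_congr rfl fun k _ => ?_
  have := dir_clm (hχ.pd k) (ContinuousLinearMap.toSpanSingleton ℝ (Pi.single (iH k) 1 : Idx → ℝ)) w x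
  refine Eq.trans this ?_
  rw [ContinuousLinearMap.toSpanSingleton_apply]
  congr 1
  exact dir_comm hχ w (Pi.single k 1) x

end OneSided
end
end RMHD

/-- The functional `(a, b) ↦ ⟪x, a⟫ - ⟪y, b⟫`. -/
noncomputable def innerDiff {H K : Type*} [NormedAddCommGroup H] [InnerProductSpace ℝ H]
    [NormedAddCommGroup K] [InnerProductSpace ℝ K] (x : H) (y : K) : (H × K) →L[ℝ] ℝ :=
  (innerSL ℝ x).comp (ContinuousLinearMap.fst ℝ H K)
    - (innerSL ℝ y).comp (ContinuousLinearMap.snd ℝ H K)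

theorem ContinuousOn.innerDiff {H K : Type*} [NormedAddCommGroup H] [InnerProductSpace ℝ H]
    [NormedAddCommGroup K] [InnerProductSpace ℝ K] {I : Set ℝ} {x : ℝ → H} {y : ℝ → K}
    (hx : ContinuousOn x I) (hy : ContinuousOn y I) :
    ContinuousOn (fun s => _root_.innerDiff (x s) (y s)) I :=
  (((innerSL ℝ).continuous.comp_continuousOn hx).clm_comp continuousOn_const).sub
    (((innerSL ℝ).continuous.comp_continuousOn hy).clm_comp continuousOn_const)

/-! ### Momentum and flux of test functions; the constraint functionals. -/

namespace RMHD
noncomputable section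

variable {e : ℝ → ℝ → ℝ} {U : Bool → State} {lam : Bool → ℝ}

/-- The pairing of a perturbation `(W, φ)` with a test vector. -/
def ev (W : HS) (φ : L2Front) : (HS × L2Front) →L[ℝ] ℝ := innerDiff W φ

theorem ev_apply (W : HS) (φ : L2Front) (p : HS × L2Front) :
    ev W φ p = inner ℝ W p.1 - inner ℝ φ p.2 := rfl

/-- The tangential velocity of a state. -/
def velT (U : State) : Fin 2 → ℝ := ![U.v 1, U.v 2]

/-- The tangential magnetic field of a state. -/
def magT (U : State) : Fin 2 → ℝ := ![U.H 1, U.H 2]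

section Vectors

variable {V : State}

/-- The matrix of `indVec`. -/
def indMat (V : State) : Matrix Idx Idx ℝ :=
  block 0 0 0 0 (V.Gam • (1 - vecMulVec V.v V.v)) 0

theorem indMat_mulVec (x : Fin 3 → ℝ) : indMat V *ᵥ magVec x = indVec V x := by
  funext i
  rcases i with _ | k | k | _ <;>
    simp [mulVec, dotProduct, indMat, block, magVec, indVec, Matrix.sub_apply, Matrix.smul_apply,
      vecMulVec_apply, Fin.sum_univ_three, Matrix.one_apply]
  fin_cases k <;> simp <;> ring

/-- The test function whose momentum is `∇χ`. -/
def indH (V : State) (χ : Space → ℝ) (x : Space) : Idx → ℝ := indMat V *ᵥ gradH χ x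

variable {χ : Space → ℝ}

theorem indH_eq (V : State) (χ : Space → ℝ) (x : Space) :
    indH V χ x = indVec V fun k => pd k χ x := indMat_mulVec _

theorem Nice.indH (hχ : Nice χ) : Nice (RMHD.indH V χ) := hχ.gradH.mulVec _

theorem dir_indH (hχ : Nice χ) (w x : Space) : dir w (indH V χ) x = indH V (dir w χ) x := by
  refine (dir_mulVec hχ.gradH _ w x).trans ?_
  rw [dir_gradH hχ]; rfl

theorem dot_grad (hH : V.H 0 = 0) (x : Space) :
    (V.H ⬝ᵥ fun k => pd k χ x) = dir (bd (magT V)) χ x := by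
  rw [dir_bd]; simp [dotProduct, Fin.sum_univ_three, hH, magT]

theorem q_indH (hH : V.H 0 = 0) (x : Space) :
    (V.Gam • qVec V) ⬝ᵥ indH V χ x = dir (bd (magT V)) χ x := by
  have hG := (Gam_pos V).ne'
  rw [indH_eq, smul_dotProduct, q_indVec, dot_grad hH, smul_eq_mul]
  field_simp

theorem A0_indH (x : Space) : A0 e V *ᵥ indH V χ x = gradH χ x := by
  funext i
  rw [indH_eq, A0_indVec]; rfl

/-- The velocity components contract H with second derivatives of χ in two ways and cancel, because
partial derivatives commute. Only convection of ∇χ by v is left. -/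
theorem spatialOp_indH (hu : V.u 0 = 0) (hχ : Nice χ) (x : Space) :
    spatialOp e V (indH V χ) x = gradH (dir (bd (velT V)) χ) x := by
  have hv : V.v 0 = 0 := by simp [State.v, hu]
  have h1 : ∀ j, pd j (indH V χ) x = indVec V fun k => pd k (pd j χ) x := fun j => by
    rw [← indH_eq]; exact dir_indH hχ _ x
  have hs : ∀ j k, pd k (pd j χ) x = pd j (pd k χ) x := fun j k => dir_comm hχ _ _ x
  have h2 : ∀ k, pd k (dir (bd (velT V)) χ) x = V.v 1 * pd 1 (pd k χ) x + V.v 2 * pd 2 (pd k χ) x :=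
    fun k => by
      have := dir_comm hχ (Pi.single k 1) (bd (velT V)) x
      refine this.trans ?_
      rw [dir_bd]; rfl
  funext i
  simp only [spatialOp, h1, Finset.sum_apply, A_indVec]
  rcases i with _ | k | k | _
  · simp [gradH, magVec]
  · simp only [gradH, magVec, dotProduct, Fin.sum_univ_three]
    fin_cases k <;> simp [ej, hv, hs 1 0, hs 2 0, hs 2 1] <;> ring
  · simp only [gradH, magVec, Fin.sum_univ_three, h2, hv, hs _ k]
    ring
  · simp [gradH, magVec]

end Vectors

section Original

variable (e U)

/-- The coefficients of `Γ q`. -/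
def rO (σ : Bool) : Idx → ℝ := (U σ).Gam • qVec (U σ)

/-- The momentum of a test function. -/
def oMom (Ψ : Bool → Space → Idx → ℝ) : HS × L2Front :=
  (glueH fun σ x => A0 e (U σ) *ᵥ Ψ σ x, jump (rO U) Ψ)

/-- The flux of a test function. -/
def oFlux (Ψ : Bool → Space → Idx → ℝ) : HS × L2Front :=
  (glueH fun σ => spatialOp e (U σ) (Ψ σ), jump (rO U) fun σ => dir (bd (velT (U σ))) (Ψ σ))

/-- The test vector of the constraints on the side `σ`. -/
def conVec (σ : Bool) (χ : Space → ℝ) : HS × L2Front :=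
  (glueH (onSide σ (gradH χ)), sgn σ • toL fun y => dir (bd (magT (U σ))) χ (bd y))

variable {e U}

theorem oFlux_snd (Ψ : Bool → Space → Idx → ℝ) : (oFlux e U Ψ).2
    = jump (rO U) fun σ => dir (bd (velT (U σ))) (Ψ σ) := rfl

theorem conVec_snd (σ : Bool) (χ : Space → ℝ) : (conVec U σ χ).2
    = sgn σ • toL fun y => dir (bd (magT (U σ))) χ (bd y) := rfl

theorem inner_toL {n : ℕ} (φ : Lp ℝ 2 (volume : Measure (Fin n → ℝ))) {f : (Fin n → ℝ) → ℝ}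
    (hf : MemLp f 2 volume) : inner ℝ φ (toL f) = ∫ y, φ y * f y := by
  rw [L2.inner_def]
  refine integral_congr_ae ?_
  filter_upwards [toL_coeFn hf] with y hy
  rw [hy]; simp [mul_comm]

theorem Nice.spatialOp {Ψ : Space → Idx → ℝ} (hΨ : Nice Ψ) (V : State) :
    Nice (RMHD.spatialOp e V Ψ) := Nice.sum _ fun j => (hΨ.pd j).mulVec _

variable {Ψ : Bool → Space → Idx → ℝ}

theorem momentum_eq (hΨ : ∀ σ, Nice (Ψ σ)) (f : L2 Rpos) (g : L2 Rneg) (φ : L2Front) :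
    momentum e (U true) (U false) (Ψ true) (Ψ false) f g φ
      = ev (join f g) φ (oMom e U Ψ) := by
  rw [ev_apply, momentum, oMom]
  dsimp only
  rw [← pair_add_pair f g (fun σ => (hΨ σ).mulVec _), jump,
    inner_toL φ (nice_jump (rO U) hΨ).memLp]
  simp only [rO, smul_dotProduct, smul_eq_mul]

theorem flux_eq (hΨ : ∀ σ, Nice (Ψ σ)) (f : L2 Rpos) (g : L2 Rneg) (φ : L2Front) :
    flux e (U true) (U false) (Ψ true) (Ψ false) f g φ
      = ev (join f g) φ (oFlux e U Ψ) := by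
  rw [ev_apply, flux, oFlux]
  dsimp only
  rw [← pair_add_pair f g (fun σ => (hΨ σ).spatialOp _), jump,
    inner_toL φ (nice_jump (rO U) (Θ := fun σ => dir (bd (velT (U σ))) (Ψ σ))
      fun σ => (hΨ σ).dir _).memLp]
  simp only [rO, smul_dotProduct, smul_eq_mul, dir_bd]
  rfl

variable {χ : Space → ℝ}

theorem onSide_self {E : Type*} [NormedAddCommGroup E] (σ : Bool) (f : Space → E) :
    onSide σ f σ = f := if_pos rfl

theorem onSide_ne {E : Type*} [NormedAddCommGroup E] {σ τ : Bool} (h : τ ≠ σ) (f : Space → E) :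
    onSide σ f τ = fun _ => 0 := if_neg h

theorem dir_onSide (w : Space) (σ τ : Bool) (f : Space → Idx → ℝ) :
    dir w (onSide σ f τ) = onSide σ (dir w f) τ := by
  unfold onSide
  split_ifs
  · rfl
  · funext x; simp [dir]

theorem mulVec_onSide (M : Bool → Matrix Idx Idx ℝ) (σ τ : Bool) (f : Space → Idx → ℝ) (x : Space) :
    M τ *ᵥ onSide σ f τ x = onSide σ (fun x => M σ *ᵥ f x) τ x := by
  unfold onSide
  split_ifs with h
  · rw [h]
  · simp

/-- The constraints, interior and boundary together, are themselves momenta of test functions; with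
`oFlux_indH` the weak equations imply that they are transported by v. -/
theorem oMom_indH (hH : ∀ σ, (U σ).H 0 = 0) (hχ : Nice χ) (σ : Bool) :
    oMom e U (onSide σ (indH (U σ) χ)) = conVec U σ χ := by
  refine Prod.ext ?_ ?_
  · change glueH _ = glueH _
    simp only [mulVec_onSide (fun τ => A0 e (U τ)), A0_indH]
  · change jump _ _ = _
    rw [jump_onSide _ _ hχ.indH]
    simp only [rO, q_indH (hH σ)]
    rfl

theorem oFlux_indH (hu : ∀ σ, (U σ).u 0 = 0) (hH : ∀ σ, (U σ).H 0 = 0) (hχ : Nice χ) (σ : Bool) :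
    oFlux e U (onSide σ (indH (U σ) χ)) = conVec U σ (dir (bd (velT (U σ))) χ) := by
  refine Prod.ext ?_ ?_
  · change glueH _ = glueH _
    congr 1; funext τ x
    by_cases hτ : τ = σ
    · subst hτ
      rw [onSide_self, onSide_self]
      exact spatialOp_indH (hu τ) hχ x
    · rw [onSide_ne hτ, onSide_ne hτ]
      simp [spatialOp, pd]
  · rw [oFlux_snd, conVec_snd]
    have h : (fun τ => dir (bd (velT (U τ))) (onSide σ (indH (U σ) χ) τ))
        = onSide σ (indH (U σ) (dir (bd (velT (U σ))) χ)) := by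
      funext τ
      rw [dir_onSide]
      unfold onSide
      split_ifs with hτ
      · rw [hτ]; funext x; exact dir_indH hχ _ x
      · rfl
    rw [h, jump_onSide _ _ (hχ.dir (bd (velT (U σ)))).indH]
    simp only [rO, q_indH (hH σ)]

theorem conVec_add_smul {χ' : Space → ℝ} (hχ : Nice χ) (hχ' : Nice χ') (σ : Bool) (c : ℝ) :
    conVec U σ (fun x => χ x + c * χ' x) = conVec U σ χ + c • conVec U σ χ' := by
  have hd : ∀ w x : Space, dir w (fun x => χ x + c * χ' x) x = dir w χ x + c * dir w χ' x :=
    fun w x => by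
      have := dir_clm hχ' (c • ContinuousLinearMap.id ℝ ℝ) w x
      exact (dir_add hχ (hχ'.clm (c • ContinuousLinearMap.id ℝ ℝ)) w x).trans (congrArg _ this)
  refine Prod.ext ?_ ?_
  · change glueH _ = glueH _ + c • glueH _
    rw [← glueH_smul (fun τ => hχ'.gradH.onSide _ τ), ← glueH_add (fun τ => hχ.gradH.onSide _ τ)
      (fun τ => (hχ'.gradH.onSide _ τ).smul c)]
    congr 1; funext τ x i
    unfold onSide
    split_ifs
    · change gradH (fun x => χ x + c * χ' x) x i = gradH χ x i + c * gradH χ' x i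
      have hp : ∀ k, pd k (fun x => χ x + c * χ' x) x = pd k χ x + c * pd k χ' x := fun k =>
        hd (Pi.single k 1) x
      rcases i with _ | _ | k | _ <;> simp [gradH, magVec, hp]
    · simp
  · change sgn σ • toL (fun y => dir (bd (magT (U σ))) (fun x => χ x + c * χ' x) (bd y))
      = sgn σ • _ + c • sgn σ • _
    rw [smul_comm c, ← smul_add, ← toL_smul (hχ'.dir _).bd.memLp,
      ← toL_add (hχ.dir _).bd.memLp ((hχ'.dir _).bd.smul c).memLp]
    simp only [hd]; rfl

theorem conVec_zero (σ : Bool) : conVec U σ (fun _ => 0) = 0 := by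
  have h := conVec_add_smul (U := U) (χ := fun _ => 0) (χ' := fun _ => 0) Nice.zero Nice.zero σ 1
  simpa using h

end Original

/-! ### Passage from the original to the symmetrized weak form. -/

section Reduced

theorem SymSys.op_eq (S : SymSys) {Θ : Bool → Space → Idx → ℝ} (hΘ : ∀ σ, Nice (Θ σ)) :
    S.op Θ = glueH fun σ x => ∑ j, S.D j σ *ᵥ pd j (Θ σ) x := by
  rw [glueH_sum Finset.univ fun j σ => ((hΘ σ).pd j).mulVec _]
  exact Finset.sum_congr rfl fun j _ => mul_glueH _ fun σ => (hΘ σ).pd j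

variable (h : Symmetrizable e U lam)

namespace Symmetrizable

/-- The common convective velocity. -/
def vel (_ : Symmetrizable e U lam) : Fin 2 → ℝ :=
  ![(U true).v 1 - lam true * (U true).H 1, (U true).v 2 - lam true * (U true).H 2]

theorem velT_eq (σ : Bool) : velT (U σ) = h.vel + lam σ • magT (U σ) := by
  cases σ
  · funext i; fin_cases i
    · simp [velT, magT, vel, h.vel_one]
    · simp [velT, magT, vel, h.vel_two]
  · funext i; fin_cases i <;> simp [velT, magT, vel]

theorem dir_velT {E : Type*} [NormedAddCommGroup E] [NormedSpace ℝ E] (σ : Bool) (f : Space → E)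
    (x : Space) : dir (bd (velT (U σ))) f x
      = dir (bd h.vel) f x + lam σ • dir (bd (magT (U σ))) f x := by
  have : bd (velT (U σ)) = bd h.vel + lam σ • bd (magT (U σ)) := by
    rw [h.velT_eq, bd_linear]
  rw [dir, this, map_add, map_smul]; rfl

/-- The momentum of a test function for the symmetrized system. -/
def mom (Θ : Bool → Space → Idx → ℝ) : HS × L2Front :=
  (mul h.sys.B (glueH Θ), jump h.sys.q Θ)

/-- The flux of a test function for the symmetrized system. -/
def flx (Θ : Bool → Space → Idx → ℝ) : HS × L2Front :=
  (h.sys.op Θ, jump h.sys.q fun σ => dir (bd h.vel) (Θ σ))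

/-- Multiplication by the symmetrizer. -/
def sym (_ : Symmetrizable e U lam) (Θ : Bool → Space → Idx → ℝ) : Bool → Space → Idx → ℝ :=
  fun σ x => symK e (U σ) (lam σ) *ᵥ Θ σ x

variable {Θ : Bool → Space → Idx → ℝ}

theorem nice_sym (hΘ : ∀ σ, Nice (Θ σ)) (σ : Bool) : Nice (h.sym Θ σ) := (hΘ σ).mulVec _

theorem rO_symK (σ : Bool) (X : Idx → ℝ) :
    rO U σ ⬝ᵥ (symK e (U σ) (lam σ) *ᵥ X) = h.sys.q σ ⬝ᵥ X := by
  have hG := (Gam_pos (U σ)).ne'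
  rw [rO, smul_dotProduct, q_symK (h.u_zero σ) (h.H_zero σ), smul_eq_mul]
  change _ = qVec (U σ) ⬝ᵥ X
  field_simp

theorem oMom_sym (hΘ : ∀ σ, Nice (Θ σ)) : oMom e U (h.sym Θ) = h.mom Θ := by
  refine Prod.ext ?_ ?_
  · change glueH _ = mul h.sys.B (glueH Θ)
    rw [mul_glueH _ hΘ]
    congr 1; funext σ x
    exact mulVec_mulVec _ _ _
  · change toL _ = toL _
    simp only [sym, h.rO_symK]

theorem spatialOp_symK (hΘ : ∀ σ, Nice (Θ σ)) (σ : Bool) (x : Space) :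
    spatialOp e (U σ) (h.sym Θ σ) x = (∑ j, h.sys.D j σ *ᵥ pd j (Θ σ) x)
      + lam σ • gradH (fun x => h.sys.q σ ⬝ᵥ Θ σ x) x := by
  have h1 : ∀ j, pd j (h.sym Θ σ) x = symK e (U σ) (lam σ) *ᵥ pd j (Θ σ) x := fun j =>
    dir_mulVec (hΘ σ) _ _ x
  have h2 : ∀ j, A e (U σ) j * symK e (U σ) (lam σ)
      = Bj e (U σ) (lam σ) j + lam σ • magQ (U σ) j := fun j => by rw [Bj]; abel
  have h3 : ∀ k, pd k (fun x => h.sys.q σ ⬝ᵥ Θ σ x) x = h.sys.q σ ⬝ᵥ pd k (Θ σ) x := fun k =>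
    dir_dot (hΘ σ) _ _ x
  simp only [spatialOp, h1, mulVec_mulVec, h2, add_mulVec, Finset.sum_add_distrib, smul_mulVec,
    ← Finset.smul_sum]
  congr 2
  funext i
  rw [Finset.sum_apply]
  simp only [magQ_mulVec, gradH, h3]
  rcases i with _ | _ | k | _ <;> simp [magVec, iH]
  rfl

theorem jump_sides (r : Bool → Idx → ℝ) {F : Bool → Space → Idx → ℝ} (hF : ∀ σ, Nice (F σ))
    (c : Bool → ℝ) : jump r (fun σ x => c σ • F σ x)
      = ∑ σ, c σ • sgn σ • toL fun y => r σ ⬝ᵥ F σ (bd y) := by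
  rw [Fintype.sum_bool, jump]
  have : ∀ σ, c σ • toL (fun y => r σ ⬝ᵥ F σ (bd y)) = toL fun y => r σ ⬝ᵥ (c σ • F σ (bd y)) :=
    fun σ => by
      rw [← toL_smul ((hF σ).bd.dot _).memLp]
      simp only [dotProduct_smul]
  rw [toL_sub (((hF true).bd.smul _).dot _).memLp (((hF false).bd.smul _).dot _).memLp, ← this,
    ← this]
  simp [sgn, sub_eq_add_neg]

/-- In the interior the difference comes from the term λ `magQ`, which is λ∇q(Θ) in the magnetic
components. At the front it comes from v = (v - λH) + λH. The two contributions fit together to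
constraint functionals and vanish on constrained fields. -/
theorem oFlux_sym (hΘ : ∀ σ, Nice (Θ σ)) : oFlux e U (h.sym Θ)
    = h.flx Θ + ∑ σ, lam σ • conVec U σ fun x => h.sys.q σ ⬝ᵥ Θ σ x := by
  have hq : ∀ σ, Nice fun x => h.sys.q σ ⬝ᵥ Θ σ x := fun σ => (hΘ σ).dot _
  refine Prod.ext ?_ ?_
  · rw [Prod.fst_add, Prod.fst_sum]
    change glueH _ = h.sys.op Θ + ∑ σ, lam σ • glueH (onSide σ (gradH _))
    rw [← glueH_sides (fun σ => (hq σ).gradH), h.sys.op_eq hΘ,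
      ← glueH_add (fun σ => Nice.sum _ fun j => ((hΘ σ).pd j).mulVec _)
        (fun σ => (hq σ).gradH.smul _)]
    congr 1; funext σ x
    exact h.spatialOp_symK hΘ σ x
  · rw [Prod.snd_add, Prod.snd_sum]
    simp only [Prod.smul_snd, conVec_snd, oFlux_snd, flx]
    have e1 : jump (rO U) (fun σ => dir (bd (velT (U σ))) (h.sym Θ σ))
        = jump h.sys.q fun σ x => dir (bd h.vel) (Θ σ) x
          + lam σ • dir (bd (magT (U σ))) (Θ σ) x := by
      have : ∀ σ x, rO U σ ⬝ᵥ dir (bd (velT (U σ))) (h.sym Θ σ) x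
          = h.sys.q σ ⬝ᵥ (dir (bd h.vel) (Θ σ) x + lam σ • dir (bd (magT (U σ))) (Θ σ) x) :=
        fun σ x => by
          rw [← h.dir_velT, ← h.rO_symK]
          exact congrArg _ (dir_mulVec (hΘ σ) _ _ x)
      simp only [jump, this]
    rw [e1, jump_add (fun σ => (hΘ σ).dir _) (fun σ => ((hΘ σ).dir _).smul _),
      jump_sides _ fun σ => (hΘ σ).dir _]
    congr 1
    refine Finset.sum_congr rfl fun σ _ => ?_
    congr 3; funext y
    exact (dir_dot (hΘ σ) _ _ _).symm

/-- The test function for the symmetrized system that yields the constraints. -/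
def conTest (σ : Bool) (χ : Space → ℝ) : Bool → Space → Idx → ℝ :=
  onSide σ fun x => h.invK σ *ᵥ indH (U σ) χ x

variable {χ : Space → ℝ}

theorem nice_conTest (hχ : Nice χ) (σ τ : Bool) : Nice (h.conTest σ χ τ) :=
  Nice.onSide (hχ.indH.mulVec _) _ _

theorem sym_conTest (σ : Bool) (χ : Space → ℝ) :
    h.sym (h.conTest σ χ) = onSide σ (indH (U σ) χ) := by
  funext τ x
  rw [sym, conTest, mulVec_onSide fun τ => symK e (U τ) (lam τ)]
  simp only [h.symK_invK]

theorem mom_conTest (hχ : Nice χ) (σ : Bool) : h.mom (h.conTest σ χ) = conVec U σ χ := by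
  rw [← h.oMom_sym (h.nice_conTest hχ σ), h.sym_conTest, oMom_indH h.H_zero hχ]

/-- For this test function q(Θ) is H·∇χ, so the correction in `oFlux_sym` changes the transport
velocity from v to v - λH. Hence the symmetrized problem also propagates the constraints, although
with another velocity. -/
theorem flx_conTest (hχ : Nice χ) (σ : Bool) :
    h.flx (h.conTest σ χ) = conVec U σ (dir (bd h.vel) χ) := by
  have h1 := h.oFlux_sym (h.nice_conTest hχ σ)
  rw [h.sym_conTest, oFlux_indH h.u_zero h.H_zero hχ] at h1
  have h2 : ∀ τ, (fun x => h.sys.q τ ⬝ᵥ h.conTest σ χ τ x)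
      = if τ = σ then dir (bd (magT (U σ))) χ else fun _ => 0 := fun τ => by
    funext x
    unfold conTest onSide
    split_ifs with hτ
    · rw [hτ, ← h.rO_symK, h.symK_invK]
      exact q_indH (h.H_zero σ) x
    · simp
  have h3 : (∑ τ, lam τ • conVec U τ fun x => h.sys.q τ ⬝ᵥ h.conTest σ χ τ x)
      = lam σ • conVec U σ (dir (bd (magT (U σ))) χ) := by
    simp only [h2]
    cases σ <;> simp [conVec_zero]
  have h4 : dir (bd (velT (U σ))) χ
      = fun x => dir (bd h.vel) χ x + lam σ * dir (bd (magT (U σ))) χ x := by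
    funext x; exact h.dir_velT σ χ x
  rw [h3, h4, conVec_add_smul (hχ.dir _) (hχ.dir _)] at h1
  exact (add_right_cancel h1).symm

/-- Test functions for the symmetrized system. -/
structure RedTest (Θ : Bool → Space → Idx → ℝ) : Prop where
  nice : ∀ σ, Nice (Θ σ)
  w_eq : ∀ y, h.sys.w true ⬝ᵥ Θ true (bd y) = h.sys.w false ⬝ᵥ Θ false (bd y)

theorem sym_u_zero (σ : Bool) (x : Space) : h.sym Θ σ x (iU 0) = h.sys.w σ ⬝ᵥ Θ σ x :=
  symK_u_zero (h.u_zero σ) (h.H_zero σ) _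

variable {h}

theorem RedTest.isTest (hΘ : h.RedTest Θ) : IsTest (h.sym Θ true) (h.sym Θ false) where
  smooth_p := (h.nice_sym hΘ.nice true).1
  smooth_m := (h.nice_sym hΘ.nice false).1
  supp_p := (h.nice_sym hΘ.nice true).2
  supp_m := (h.nice_sym hΘ.nice false).2
  match_bd y := by rw [sym_u_zero, sym_u_zero, hΘ.w_eq]

variable (h)

theorem isTest_indH (hχ : Nice χ) (σ : Bool) :
    IsTest (onSide σ (indH (U σ) χ) true) (onSide σ (indH (U σ) χ) false) where
  smooth_p := (hχ.indH.onSide _ _).1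
  smooth_m := (hχ.indH.onSide _ _).1
  supp_p := (hχ.indH.onSide _ _).2
  supp_m := (hχ.indH.onSide _ _).2
  match_bd y := by
    have : ∀ x, indH (U σ) χ x (iU 0) = 0 := fun x => by rw [indH_eq]; rfl
    unfold onSide
    split_ifs <;> simp [this]

theorem redTest_conTest (hχ : Nice χ) (σ : Bool) : h.RedTest (h.conTest σ χ) where
  nice := h.nice_conTest hχ σ
  w_eq y := by
    rw [← h.sym_u_zero, ← h.sym_u_zero, h.sym_conTest]
    exact (isTest_indH hχ σ).match_bd y

/-- Every test function is in the range of the symmetrizer. -/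
theorem exists_redTest {Ψ : Bool → Space → Idx → ℝ} (hΨ : IsTest (Ψ true) (Ψ false)) :
    ∃ Θ, h.RedTest Θ ∧ h.sym Θ = Ψ := by
  have hn : ∀ σ, Nice (Ψ σ) := fun σ => by
    cases σ
    · exact ⟨hΨ.smooth_m, hΨ.supp_m⟩
    · exact ⟨hΨ.smooth_p, hΨ.supp_p⟩
  have hs : h.sym (fun σ x => h.invK σ *ᵥ Ψ σ x) = Ψ := by
    funext σ x; exact h.symK_invK σ _
  have hw : ∀ σ x, h.sys.w σ ⬝ᵥ (h.invK σ *ᵥ Ψ σ x) = Ψ σ x (iU 0) := fun σ x => by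
    rw [← h.sym_u_zero (Θ := fun σ x => h.invK σ *ᵥ Ψ σ x), hs]
  exact ⟨_, ⟨fun σ => (hn σ).mulVec _, fun y => by rw [hw, hw, hΨ.match_bd]⟩, hs⟩

end Symmetrizable
end Reduced
end
end RMHD

/-! ### Propagation of the constraints and equivalence of the two weak problems. -/

/-- Differentiation of a time-dependent functional along a moving vector. -/
theorem hasDerivWithinAt_moving {X : Type*} [NormedAddCommGroup X] [NormedSpace ℝ X] {I : Set ℝ}
    {t : ℝ} {z : ℝ → X →L[ℝ] ℝ} (hz : ContinuousWithinAt z I t) {a : ℝ → X} {a' : X} {d : ℝ}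
    (hd : HasDerivWithinAt (fun s => z s (a t)) d I t) (ha : HasDerivWithinAt a a' I t) :
    HasDerivWithinAt (fun s => z s (a s)) (d + z t a') I t := by
  have h : HasDerivWithinAt (fun s => z s (a s - a t)) (z t a') I t := by
    rw [hasDerivWithinAt_iff_tendsto_slope] at ha ⊢
    have hz' : Tendsto z (𝓝[I \ {t}] t) (𝓝 (z t)) := hz.mono_left (nhdsWithin_mono _ Set.sdiff_subset)
    refine ((isBoundedBilinearMap_apply.continuous.tendsto (z t, a')).comp
      (hz'.prodMk_nhds ha)).congr fun s => ?_
    simp [slope, sub_self]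
  refine (hd.add h).congr_of_eventuallyEq (.of_forall fun s => ?_) ?_
  · simp
  · simp

theorem eq_of_hasDerivWithinAt_zero {f : ℝ → ℝ} {T : ℝ}
    (h : ∀ t ∈ Set.Icc 0 T, HasDerivWithinAt f 0 (Set.Icc 0 T) t) : ∀ t ∈ Set.Icc 0 T, f t = f 0 := by
  intro t ht
  have hT : 0 ≤ T := ht.1.trans ht.2
  rcases hT.eq_or_lt with h0 | h0
  · rw [le_antisymm (ht.2.trans h0.symm.le) ht.1]
  refine constant_of_derivWithin_zero (fun s hs => (h s hs).differentiableWithinAt)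
    (fun s hs => ?_) t ht
  exact (h s ⟨hs.1, hs.2.le⟩).derivWithin (uniqueDiffOn_Icc h0 s ⟨hs.1, hs.2.le⟩)

/-- A functional that evolves dually to a moving vector takes a constant value at it. -/
theorem apply_moving_eq {X : Type*} [NormedAddCommGroup X] [NormedSpace ℝ X] {T : ℝ}
    {z : ℝ → X →L[ℝ] ℝ} (hz : ContinuousOn z (Set.Icc 0 T)) {a b : ℝ → X}
    (ha : ∀ s, HasDerivAt a (-b s) s)
    (hd : ∀ s ∈ Set.Icc 0 T, HasDerivWithinAt (fun r => z r (a s)) (z s (b s)) (Set.Icc 0 T) s) :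
    ∀ t ∈ Set.Icc 0 T, z t (a t) = z 0 (a 0) :=
  eq_of_hasDerivWithinAt_zero fun s hs =>
    (hasDerivWithinAt_moving (hz s hs) (hd s hs) (ha s).hasDerivWithinAt).congr_deriv
      (by rw [map_neg, add_neg_cancel])

namespace RMHD
noncomputable section

variable {e : ℝ → ℝ → ℝ} {U : Bool → State} {lam : Bool → ℝ}

theorem continuousOn_ev {I : Set ℝ} {W : ℝ → HS} {φ : ℝ → L2Front} (hW : ContinuousOn W I)
    (hφ : ContinuousOn φ I) : ContinuousOn (fun s => ev (W s) (φ s)) I := hW.innerDiff hφ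

/-- The weak form of the evolution equation for a pair of test vectors. -/
def Evol (I : Set ℝ) (W : ℝ → HS) (φ : ℝ → L2Front) (p q : HS × L2Front) : Prop :=
  ∀ t ∈ I, HasDerivWithinAt (fun s => ev (W s) (φ s) p) (ev (W t) (φ t) q) I t

/-- The constraints. -/
def Con (U : Bool → State) (W : HS) (φ : L2Front) : Prop :=
  ∀ σ χ, Nice χ → ev W φ (conVec U σ χ) = 0

theorem transFlow_conVec_fst (σ : Bool) {χ : Space → ℝ} (hχ : Nice χ) (ω : Fin 2 → ℝ) (r : ℝ) :
    (transFlow (bd ω)).τ r (conVec U σ χ).1 = (conVec U σ fun x => χ (x + r • bd ω)).1 := by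
  refine (transFlow_glueH (fun τ => hχ.gradH.onSide _ τ) (bd_zero_apply ω) r).trans ?_
  change glueH _ = glueH _
  congr 1; funext τ x
  have hp : ∀ k, pd k (fun x => χ (x + r • bd ω)) x = pd k χ (x + r • bd ω) := fun k =>
    dir_translate _ _ _
  unfold onSide
  split_ifs
  · simp only [gradH, hp]
  · rfl

theorem transFlow_conVec_snd (σ : Bool) {χ : Space → ℝ} (hχ : Nice χ) (ω : Fin 2 → ℝ) (r : ℝ) :
    (transFlow ω).τ r (conVec U σ χ).2 = (conVec U σ fun x => χ (x + r • bd ω)).2 := by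
  rw [conVec_snd, conVec_snd, map_smul, transFlow_toL (hχ.dir _).bd.memLp]
  congr 2; funext y
  rw [dir_translate, bd_linear]

theorem hasDerivAt_conVec (σ : Bool) {χ : Space → ℝ} (hχ : Nice χ) (ω : Fin 2 → ℝ) (r : ℝ) :
    HasDerivAt (fun r => conVec U σ fun x => χ (x + r • bd ω))
      (conVec U σ (dir (bd ω) fun x => χ (x + r • bd ω))) r := by
  have d1 := (transFlow (bd ω)).hasDerivAt_of_zero
    (glueH_hasDerivAt (fun τ => hχ.gradH.onSide σ τ) (Or.inl (bd_zero_apply ω))) r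
  have d2 := ((transFlow ω).hasDerivAt_of_zero
    ((hχ.dir (bd (magT (U σ)))).bd.hasDerivAt_transFlow ω) r).const_smul (sgn σ)
  have e1 : (fun τ => dir (bd ω) (onSide σ (gradH χ) τ)) = onSide σ (gradH (dir (bd ω) χ)) := by
    funext τ x
    rw [dir_onSide]
    unfold onSide
    split_ifs
    · exact dir_gradH hχ _ x
    · rfl
  have e2 : (dir ω fun y => dir (bd (magT (U σ))) χ (bd y))
      = fun y => dir (bd (magT (U σ))) (dir (bd ω) χ) (bd y) := by
    funext y
    rw [dir_comp_bd (hχ.dir _)]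
    exact dir_comm hχ _ _ _
  have e3 : (dir (bd ω) fun x => χ (x + r • bd ω)) = fun x => dir (bd ω) χ (x + r • bd ω) := by
    funext x; exact dir_translate _ _ _
  rw [e1] at d1
  rw [e2, ← map_smul] at d2
  rw [e3]
  refine ((d1.congr_deriv (transFlow_conVec_fst (U := U) σ (hχ.dir _) ω r)).congr_of_eventuallyEq
    (.of_forall fun s => (transFlow_conVec_fst (U := U) σ hχ ω s).symm)).prodMk
    ((d2.congr_deriv (transFlow_conVec_snd (U := U) σ (hχ.dir _) ω r)).congr_of_eventuallyEq
    (.of_forall fun s => ?_))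
  refine (transFlow_conVec_snd (U := U) σ hχ ω s).symm.trans ?_
  rw [conVec_snd, map_smul]; rfl

section Transport

variable {T : ℝ} {W : ℝ → HS} {φ : ℝ → L2Front}

/-- The constraint is transported along a tangential velocity. -/
theorem con_transport (hW : ContinuousOn W (Set.Icc 0 T)) (hφ : ContinuousOn φ (Set.Icc 0 T))
    (σ : Bool) (ω : Fin 2 → ℝ)
    (h : ∀ χ, Nice χ → Evol (Set.Icc 0 T) W φ (conVec U σ χ) (conVec U σ (dir (bd ω) χ)))
    (h0 : ∀ χ, Nice χ → ev (W 0) (φ 0) (conVec U σ χ) = 0) {t : ℝ} (ht : t ∈ Set.Icc 0 T)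
    {χ : Space → ℝ} (hχ : Nice χ) : ev (W t) (φ t) (conVec U σ χ) = 0 := by
  -- The test function is moved along the characteristics so as to equal χ at s = t; the pairing is
  -- then independent of s and vanishes at s = 0.
  let χs : ℝ → Space → ℝ := fun s x => χ (x + (t - s) • bd ω)
  have hχs : ∀ s, Nice (χs s) := fun s => hχ.translate _
  have hconst := apply_moving_eq (continuousOn_ev hW hφ) (a := fun s => conVec U σ (χs s))
    (fun s => HasDerivAt.comp_const_sub t s (hasDerivAt_conVec (U := U) σ hχ ω (t - s)))
    (fun s hs => h _ (hχs s) s hs) t ht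
  have h1 : χs t = χ := by funext x; simp [χs]
  simp only [h1] at hconst
  rw [hconst, h0 _ (hχs 0)]

end Transport

variable (h : Symmetrizable e U lam) (I : Set ℝ) (W : ℝ → HS) (φ : ℝ → L2Front)

/-- Weak solutions of the original problem. -/
def OrigSol (e : ℝ → ℝ → ℝ) (U : Bool → State) : Prop :=
  ∀ Ψ : Bool → Space → Idx → ℝ, IsTest (Ψ true) (Ψ false) →
    Evol I W φ (oMom e U Ψ) (oFlux e U Ψ)

/-- Weak solutions of the symmetrized problem. -/
def Symmetrizable.RedSol : Prop :=
  ∀ Θ, h.RedTest Θ → Evol I W φ (h.mom Θ) (h.flx Θ)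

variable {h I W φ}

theorem OrigSol.con {T : ℝ} (hs : Symmetrizable e U lam) (hW : ContinuousOn W (Set.Icc 0 T))
    (hφ : ContinuousOn φ (Set.Icc 0 T)) (ho : OrigSol (Set.Icc 0 T) W φ e U)
    (h0 : Con U (W 0) (φ 0)) {t : ℝ} (ht : t ∈ Set.Icc 0 T) : Con U (W t) (φ t) :=
  fun σ χ hχ => con_transport hW hφ σ (velT (U σ)) (fun χ hχ => by
    rw [← oMom_indH (e := e) hs.H_zero hχ, ← oFlux_indH (e := e) hs.u_zero hs.H_zero hχ]
    exact ho _ (Symmetrizable.isTest_indH hχ σ)) (h0 σ) ht hχ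

namespace Symmetrizable

theorem RedSol.con {T : ℝ} (hW : ContinuousOn W (Set.Icc 0 T))
    (hφ : ContinuousOn φ (Set.Icc 0 T)) (hr : h.RedSol (Set.Icc 0 T) W φ)
    (h0 : Con U (W 0) (φ 0)) {t : ℝ} (ht : t ∈ Set.Icc 0 T) : Con U (W t) (φ t) :=
  fun σ χ hχ => con_transport hW hφ σ h.vel (fun χ hχ => by
    rw [← h.mom_conTest hχ, ← h.flx_conTest hχ]
    exact hr _ (h.redTest_conTest hχ σ)) (h0 σ) ht hχ

theorem ev_oFlux_sym {W : HS} {φ : L2Front} (hc : Con U W φ) {Θ : Bool → Space → Idx → ℝ}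
    (hΘ : ∀ σ, Nice (Θ σ)) : ev W φ (oFlux e U (h.sym Θ)) = ev W φ (h.flx Θ) := by
  rw [h.oFlux_sym hΘ, map_add, map_sum]
  simp only [map_smul]
  rw [Finset.sum_eq_zero fun σ _ => by rw [hc σ _ ((hΘ σ).dot _), smul_zero], add_zero]

/-- The symmetrizer maps the test functions of one problem onto those of the other. Momenta agree,
and fluxes differ only by constraint functionals. -/
theorem origSol_iff (hc : ∀ t ∈ I, Con U (W t) (φ t)) :
    OrigSol I W φ e U ↔ h.RedSol I W φ := by
  constructor
  · intro ho Θ hΘ t ht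
    have := ho _ hΘ.isTest t ht
    rwa [h.oMom_sym hΘ.nice, ev_oFlux_sym (hc t ht) hΘ.nice] at this
  · intro hr Ψ hΨ t ht
    obtain ⟨Θ, hΘ, rfl⟩ := h.exists_redTest hΨ
    have := hr Θ hΘ t ht
    rwa [← h.oMom_sym hΘ.nice, ← ev_oFlux_sym (hc t ht) hΘ.nice] at this

theorem jump_eq_zero {r : Bool → Idx → ℝ} {Θ : Bool → Space → Idx → ℝ}
    (hq : ∀ y, r true ⬝ᵥ Θ true (bd y) = r false ⬝ᵥ Θ false (bd y)) : jump r Θ = 0 := by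
  rw [jump]
  simp only [hq, sub_self]
  have := toL_smul (f := fun _ : Fin 2 → ℝ => (0 : ℝ)) Nice.zero.memLp 0
  simpa using this

theorem jump_dir_eq_zero {r : Bool → Idx → ℝ} {Θ : Bool → Space → Idx → ℝ}
    (hΘ : ∀ σ, Nice (Θ σ)) (hq : ∀ y, r true ⬝ᵥ Θ true (bd y) = r false ⬝ᵥ Θ false (bd y))
    (w : Fin 2 → ℝ) : jump r (fun σ => dir (bd w) (Θ σ)) = 0 := by
  rw [jump_dir hΘ]
  simp only [hq, sub_self]
  have : (dir w fun _ : Fin 2 → ℝ => (0 : ℝ)) = fun _ => 0 := by funext y; simp [dir]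
  rw [this]
  have := toL_smul (f := fun _ : Fin 2 → ℝ => (0 : ℝ)) Nice.zero.memLp 0
  simpa using this

theorem mom_core {Θ : Bool → Space → Idx → ℝ} (hΘ : CoreTest h.sys Θ) :
    h.mom Θ = (mul h.sys.B (glueH Θ), 0) := by rw [mom, jump_eq_zero hΘ.q_eq]

theorem flx_core {Θ : Bool → Space → Idx → ℝ} (hΘ : CoreTest h.sys Θ) :
    h.flx Θ = (h.sys.op Θ, 0) := by rw [flx, jump_dir_eq_zero hΘ.nice hΘ.q_eq]

/-- The front enters only through the jump of q(Θ). For test functions without such a jump it drops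
out, and the interior perturbation evolves independently of φ. -/
theorem RedSol.coreSol (hr : h.RedSol I W φ) : h.sys.CoreSol I W := fun Θ hΘ t ht => by
  have := hr Θ ⟨hΘ.nice, hΘ.w_eq⟩ t ht
  simpa only [mom_core hΘ, flx_core hΘ, ev_apply, inner_zero_right, sub_zero] using this

end Symmetrizable

section Interface

theorem isSolution_iff {T : ℝ} {U0p : L2 Rpos} {U0m : L2 Rneg} {φ0 : L2Front} {Up : ℝ → L2 Rpos}
    {Um : ℝ → L2 Rneg} : IsSolution e (U true) (U false) T U0p U0m φ0 Up Um φ ↔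
      ContinuousOn Up (Set.Icc 0 T) ∧ ContinuousOn Um (Set.Icc 0 T) ∧ ContinuousOn φ (Set.Icc 0 T) ∧
      Up 0 = U0p ∧ Um 0 = U0m ∧ φ 0 = φ0 ∧
      OrigSol (Set.Icc 0 T) (fun t => join (Up t) (Um t)) φ e U := by
  have hn : ∀ {Ψ : Bool → Space → Idx → ℝ}, IsTest (Ψ true) (Ψ false) → ∀ σ, Nice (Ψ σ) :=
    fun {Ψ} hΨ σ => by
      cases σ
      · exact ⟨hΨ.smooth_m, hΨ.supp_m⟩
      · exact ⟨hΨ.smooth_p, hΨ.supp_p⟩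
  constructor
  · rintro ⟨h1, h2, h3, h4, h5, h6, h7⟩
    refine ⟨h1, h2, h3, h4, h5, h6, fun Ψ hΨ t ht => ?_⟩
    simpa only [momentum_eq (hn hΨ), flux_eq (hn hΨ)] using h7 _ _ hΨ t ht
  · rintro ⟨h1, h2, h3, h4, h5, h6, h7⟩
    refine ⟨h1, h2, h3, h4, h5, h6, fun Ψp Ψm hΨ t ht => ?_⟩
    let Ψ : Bool → Space → Idx → ℝ := fun σ => if σ then Ψp else Ψm
    have hΨ' : IsTest (Ψ true) (Ψ false) := hΨ
    have := h7 Ψ hΨ' t ht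
    exact (this.congr_deriv (flux_eq (hn hΨ') _ _ _).symm).congr_of_eventuallyEq
      (.of_forall fun s => momentum_eq (hn hΨ') _ _ _) (momentum_eq (hn hΨ') _ _ _)

theorem pair_zero {D : Set Space} (f : L2 D) : pair f (fun _ => 0) = 0 := by simp [pair]

theorem divPair_eq {D : Set Space} (f : L2 D) (χ : Space → ℝ) : divPair f χ = pair f (gradH χ) := by
  refine integral_congr_ae (.of_forall fun x => ?_)
  simp [dotProduct, gradH, magVec, iH]

theorem frontPair_eq (σ : Bool) (φ : L2Front) {χ : Space → ℝ} (hχ : Nice χ) :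
    frontPair (U σ) φ χ = inner ℝ φ (toL fun y => dir (bd (magT (U σ))) χ (bd y)) := by
  rw [inner_toL φ (hχ.dir _).bd.memLp, frontPair]
  simp only [dir_bd, smul_eq_mul]; rfl

theorem admissible_iff {U0p : L2 Rpos} {U0m : L2 Rneg} {φ0 : L2Front} :
    Admissible (U true) (U false) U0p U0m φ0 ↔ Con U (join U0p U0m) φ0 := by
  have key : ∀ σ χ, Nice χ → ev (join U0p U0m) φ0 (conVec U σ χ)
      = (pair U0p (onSide σ (gradH χ) true) + pair U0m (onSide σ (gradH χ) false))
        - sgn σ * frontPair (U σ) φ0 χ := fun σ χ hχ => by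
    rw [ev_apply, pair_add_pair _ _ fun τ => hχ.gradH.onSide σ τ, frontPair_eq σ φ0 hχ, conVec_snd,
      inner_smul_right]
    rfl
  constructor
  · intro ha σ χ hχ
    rw [key σ χ hχ]
    obtain ⟨h1, h2⟩ := ha χ hχ.1 hχ.2
    rw [divPair_eq] at h1 h2
    cases σ
    · rw [onSide_self, onSide_ne (by simp), pair_zero, h2]; simp [sgn]
    · rw [onSide_self, onSide_ne (by simp), pair_zero, h1]; simp [sgn]
  · intro hc χ h1 h2
    have hχ : Nice χ := ⟨h1, h2⟩
    have ht := hc true χ hχ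
    have hf := hc false χ hχ
    rw [key _ χ hχ, onSide_self, onSide_ne (by simp), pair_zero] at ht hf
    simp only [sgn, if_true] at ht
    simp only [sgn, Bool.false_eq_true, if_false] at hf
    rw [divPair_eq, divPair_eq]
    constructor <;> linarith

end Interface
end
end RMHD

/-! ### Multiscale control of a vector by its averaged difference quotients. -/

namespace IsometryFlow

variable {H : Type*} [NormedAddCommGroup H] [InnerProductSpace ℝ H] [CompleteSpace H]
variable (G : IsometryFlow H)

theorem hasDerivAt_avg {δ : ℝ} (x : H) (s : ℝ) :
    HasDerivAt (fun s => G.τ s (G.avg δ x)) (G.τ s (G.diff δ x)) s := by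
  refine G.hasDerivAt_of_zero ?_ s
  let F : ℝ → H := fun u => ∫ r in (0 : ℝ)..u, G.τ r x
  have hF : ∀ u, HasDerivAt F (G.τ u x) u := fun u =>
    intervalIntegral.integral_hasDerivAt_right (G.intervalIntegrable x 0 u)
      (G.continuous' x).stronglyMeasurable.stronglyMeasurableAtFilter (G.continuous' x).continuousAt
  have e : ∀ s, G.τ s (G.avg δ x) = (2 * δ)⁻¹ • (F (s + δ) - F (s + -δ)) := fun s => by
    have h := clm_avg (G := G) (G.τ s).toContinuousLinearMap δ x
    simp only [LinearIsometry.coe_toContinuousLinearMap] at h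
    have h1 : ∀ r, G.τ s (G.τ r x) = G.τ (s + r) x := fun r => (G.map_add' s r x).symm
    simp only [h1] at h
    rw [h, intervalIntegral.integral_comp_add_left (fun r => G.τ r x) s,
      ← intervalIntegral.integral_interval_sub_left (G.intervalIntegrable x 0 (s + δ))
        (G.intervalIntegrable x 0 (s + -δ))]
  simp only [e]
  have h1 : HasDerivAt (fun s => F (s + δ)) (G.τ δ x) 0 := by
    have := hF (0 + δ)
    simpa using this.comp_add_const 0 δ
  have h2 : HasDerivAt (fun s => F (s + -δ)) (G.τ (-δ) x) 0 := by
    have := hF (0 + -δ)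
    simpa using this.comp_add_const 0 (-δ)
  exact (h1.sub h2).const_smul (2 * δ)⁻¹

variable {G}

theorem norm_translate_sub_le {δ : ℝ} (x : H) (s : ℝ) :
    ‖G.τ s (G.avg δ x) - G.avg δ x‖ ≤ ‖G.diff δ x‖ * |s| := by
  have := Convex.norm_image_sub_le_of_norm_hasDerivWithin_le (s := Set.univ) (x := 0) (y := s)
    (f := fun s => G.τ s (G.avg δ x)) (C := ‖G.diff δ x‖)
    (fun s _ => (G.hasDerivAt_avg x s).hasDerivWithinAt)
    (fun s _ => by rw [LinearIsometry.norm_map]) convex_univ (Set.mem_univ _) (Set.mem_univ _)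
  simpa [G.map_zero'] using this

theorem norm_avg_sub_le {y : H} {C : ℝ} (hC : ∀ s, ‖G.τ s y - y‖ ≤ C * |s|) {r : ℝ} (hr : 0 < r) :
    ‖G.avg r y - y‖ ≤ C * r := by
  have hC0 : 0 ≤ C := by simpa using (norm_nonneg _).trans (hC 1)
  have e : G.avg r y - y = (2 * r)⁻¹ • ∫ s in -r..r, (G.τ s y - y) := by
    rw [intervalIntegral.integral_sub (G.intervalIntegrable _ _ _)
      intervalIntegrable_const, intervalIntegral.integral_const, smul_sub, smul_smul, avg_apply]
    have : (2 * r)⁻¹ * (r - -r) = 1 := by field_simp; ring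
    rw [this, one_smul]
  have hb : ‖∫ s in -r..r, (G.τ s y - y)‖ ≤ C * r * |r - -r| := by
    refine intervalIntegral.norm_integral_le_of_norm_le_const fun s hs => ?_
    rw [Set.uIoc_of_le (by linarith)] at hs
    refine (hC s).trans (mul_le_mul_of_nonneg_left ?_ hC0)
    rw [abs_le]; exact ⟨hs.1.le, hs.2⟩
  rw [e, norm_smul, Real.norm_eq_abs, abs_of_pos (by positivity)]
  rw [abs_of_pos (by linarith)] at hb
  calc (2 * r)⁻¹ * ‖∫ s in -r..r, (G.τ s y - y)‖ ≤ (2 * r)⁻¹ * (C * r * (r - -r)) := by gcongr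
    _ = C * r := by field_simp; ring

theorem τ_avg (δ s : ℝ) (x : H) : G.τ s (G.avg δ x) = G.avg δ (G.τ s x) :=
  avg_comm (G := G) (M := (G.τ s).toContinuousLinearMap)
    (fun t z => by
      simp only [LinearIsometry.coe_toContinuousLinearMap, ← G.map_add', add_comm]) δ x

section Pair

variable {Ga Gb : IsometryFlow H} (hab : ∀ s t x, Ga.τ s (Gb.τ t x) = Gb.τ t (Ga.τ s x))
include hab

theorem comm_τ_avg (s δ : ℝ) (x : H) : Ga.τ s (Gb.avg δ x) = Gb.avg δ (Ga.τ s x) :=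
  avg_comm (G := Gb) (M := (Ga.τ s).toContinuousLinearMap) (fun t z => hab s t z) δ x

theorem comm_avg_τ (δ s : ℝ) (x : H) : Ga.avg δ (Gb.τ s x) = Gb.τ s (Ga.avg δ x) :=
  (comm_τ_avg (fun s t x => (hab t s x).symm) s δ x).symm

theorem comm_avg_avg (δ η : ℝ) (x : H) : Ga.avg δ (Gb.avg η x) = Gb.avg η (Ga.avg δ x) :=
  avg_comm (G := Gb) (M := Ga.avg δ) (fun s y => comm_avg_τ hab δ s y) η x

theorem comm_avg_diff (δ η : ℝ) (x : H) : Ga.avg δ (Gb.diff η x) = Gb.diff η (Ga.avg δ x) :=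
  diff_comm (G := Gb) (M := Ga.avg δ) (fun s y => comm_avg_τ hab δ s y) η x

theorem comm_diff_avg (δ η : ℝ) (x : H) : Ga.diff δ (Gb.avg η x) = Gb.avg η (Ga.diff δ x) :=
  (comm_avg_diff (fun s t x => (hab t s x).symm) η δ x).symm

end Pair

/-- The average over a parallelogram. -/
noncomputable def box (Ga Gb : IsometryFlow H) (δ : ℝ) : H →L[ℝ] H := (Ga.avg δ).comp (Gb.avg δ)

omit [CompleteSpace H] in
theorem box_apply (Ga Gb : IsometryFlow H) (δ : ℝ) (x : H) :
    box Ga Gb δ x = Ga.avg δ (Gb.avg δ x) := rfl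

omit [CompleteSpace H] in
theorem norm_box_le (Ga Gb : IsometryFlow H) (δ : ℝ) (x : H) : ‖box Ga Gb δ x‖ ≤ ‖x‖ :=
  (Ga.norm_avg_le _ _).trans (Gb.norm_avg_le _ _)

theorem box_tendsto (Ga Gb : IsometryFlow H) {δ : ℕ → ℝ} (hδ : ∀ n, 0 < δ n)
    (hlim : Tendsto δ atTop (𝓝 0)) (x : H) :
    Tendsto (fun n => box Ga Gb (δ n) x) atTop (𝓝 x) := by
  have h1 := avg_tendsto (G := Ga) hδ hlim x
  have h2 := avg_tendsto (G := Gb) hδ hlim x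
  have h3 : Tendsto (fun n => Ga.avg (δ n) (Gb.avg (δ n) x - x)) atTop (𝓝 0) := by
    refine squeeze_zero_norm (fun n => Ga.norm_avg_le (δ n) _) ?_
    simpa using (h2.sub_const x).norm
  simpa [box_apply] using h3.add h1

theorem inner_box {Ga Gb : IsometryFlow H} (hab : ∀ s t x, Ga.τ s (Gb.τ t x) = Gb.τ t (Ga.τ s x))
    (δ : ℝ) (x y : H) : inner ℝ (box Ga Gb δ x) y = inner ℝ x (box Ga Gb δ y) := by
  rw [box_apply, inner_avg, inner_avg, box_apply, comm_avg_avg hab]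

variable {Ga Gb : IsometryFlow H} (hab : ∀ s t x, Ga.τ s (Gb.τ t x) = Gb.τ t (Ga.τ s x))
include hab

theorem norm_box_sub_le {δ r D : ℝ} (hr : 0 < r) {x : H}
    (ha : ‖Ga.diff δ (Gb.avg δ x)‖ ≤ D) (hb : ‖Gb.diff δ (Ga.avg δ x)‖ ≤ D) :
    ‖box Ga Gb r (box Ga Gb δ x) - box Ga Gb δ x‖ ≤ 2 * (D * r) := by
  set y := box Ga Gb δ x with hy
  have hya : ‖Ga.avg r y - y‖ ≤ D * r := by
    refine norm_avg_sub_le (fun s => ?_) hr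
    exact (norm_translate_sub_le (Gb.avg δ x) s).trans (by gcongr)
  have hyb : ‖Gb.avg r y - y‖ ≤ D * r := by
    refine norm_avg_sub_le (fun s => ?_) hr
    rw [hy, box_apply, comm_avg_avg hab]
    exact (norm_translate_sub_le (Ga.avg δ x) s).trans (by gcongr)
  have e : box Ga Gb r y - y = Ga.avg r (Gb.avg r y - y) + (Ga.avg r y - y) := by
    rw [map_sub, box_apply]; abel
  rw [e]
  refine (norm_add_le _ _).trans ?_
  have := (Ga.norm_avg_le r (Gb.avg r y - y)).trans hyb
  linarith

theorem box_comm (δ η : ℝ) (x : H) :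
    box Ga Gb δ (box Ga Gb η x) = box Ga Gb η (box Ga Gb δ x) := by
  have haa : ∀ (G : IsometryFlow H) (x : H), G.avg δ (G.avg η x) = G.avg η (G.avg δ x) :=
    fun G x => avg_comm (G := G) (M := G.avg δ) (fun s y => (τ_avg δ s y).symm) η x
  simp only [box_apply]
  rw [← comm_avg_avg hab, haa, haa Gb, comm_avg_avg hab δ η (Gb.avg δ x)]

/-- A vector is controlled by its average on the unit scale if its averages on small scales have
suitably bounded difference quotients. -/
theorem norm_le_of_norm_diff_le {x : H} {N : ℝ}
    (ha : ∀ n : ℕ, ‖Ga.diff ((1 / 4) ^ n) (Gb.avg ((1 / 4) ^ n) x)‖ ≤ N * 2 ^ n)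
    (hb : ∀ n : ℕ, ‖Gb.diff ((1 / 4) ^ n) (Ga.avg ((1 / 4) ^ n) x)‖ ≤ N * 2 ^ n) :
    ‖x‖ ≤ ‖box Ga Gb 1 x‖ + 10 * N := by
  have hN : 0 ≤ N := by simpa using (norm_nonneg _).trans (ha 0)
  let y : ℕ → H := fun n => box Ga Gb ((1 / 4) ^ n) x
  have h1 : ∀ m n : ℕ, ‖box Ga Gb ((1 / 4) ^ m) (y n) - y n‖ ≤ 2 * (N * 2 ^ n * (1 / 4) ^ m) :=
    fun m n => norm_box_sub_le hab (by positivity) (ha n) (hb n)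
  have h2 : ∀ n : ℕ, ‖y (n + 1) - y n‖ ≤ 5 * N * (1 / 2) ^ n := by
    intro n
    -- The averages on two scales commute. Each bracket is at most a constant times difference
    -- quotient times scale, that is N·2ⁿ·4⁻ⁿ = N·2⁻ⁿ, which is summable; this is where growth
    -- slower than 4ⁿ is used.
    have e : y (n + 1) - y n = (box Ga Gb ((1 / 4) ^ (n + 1)) (y n) - y n)
        - (box Ga Gb ((1 / 4) ^ n) (y (n + 1)) - y (n + 1)) := by
      simp only [y]
      rw [box_comm hab ((1 / 4) ^ (n + 1))]; abel
    rw [e]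
    refine (norm_sub_le _ _).trans ?_
    have a1 := h1 (n + 1) n
    have a2 := h1 n (n + 1)
    have p : (2 : ℝ) ^ n * (1 / 4) ^ n = (1 / 2) ^ n := by rw [← mul_pow]; norm_num
    have q : 0 ≤ N * (1 / 2) ^ n := by positivity
    calc _ ≤ 2 * (N * 2 ^ n * (1 / 4) ^ (n + 1)) + 2 * (N * 2 ^ (n + 1) * (1 / 4) ^ n) :=
          add_le_add a1 a2
      _ = 9 / 2 * (N * (2 ^ n * (1 / 4) ^ n)) := by rw [pow_succ, pow_succ]; ring
      _ ≤ 5 * N * (1 / 2) ^ n := by rw [p]; linarith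
  -- The geometric series 5N(1 + 1/2 + 1/4 + …) = 10N.
  have h3 : ∀ n : ℕ, ‖y n‖ ≤ ‖y 0‖ + 10 * N * (1 - (1 / 2) ^ n) := by
    intro n
    induction n with
    | zero => simp
    | succ n ih =>
      have := norm_le_norm_add_norm_sub' (y (n + 1)) (y n)
      have h := h2 n
      rw [pow_succ]
      linarith
  have h4 : ∀ n : ℕ, ‖y n‖ ≤ ‖box Ga Gb 1 x‖ + 10 * N := fun n => by
    have := h3 n
    have h0 : y 0 = box Ga Gb 1 x := by simp [y]
    have q : 0 ≤ N * (1 / 2) ^ n := by positivity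
    rw [h0] at this
    linarith
  have hlim := (box_tendsto Ga Gb (δ := fun n => (1 / 4) ^ n) (fun n => by positivity)
    (tendsto_pow_atTop_nhds_zero_of_lt_one (by norm_num) (by norm_num)) x).norm
  exact le_of_tendsto' hlim h4

omit hab

theorem sum_avg_eq_zero (G : IsometryFlow H) {ι : Type*} (s : Finset ι) (x : ι → H →L[ℝ] ℝ)
    (y : ι → H) (h : ∀ r, ∑ i ∈ s, x i (G.τ r (y i)) = 0) (δ : ℝ) :
    ∑ i ∈ s, x i (G.avg δ (y i)) = 0 := by
  simp only [clm_avg]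
  have hint : ∀ i ∈ s, IntervalIntegrable (fun r => x i (G.τ r (y i))) volume (-δ) δ := fun i _ =>
    ((x i).continuous.comp (G.continuous' (y i))).intervalIntegrable _ _
  rw [← Finset.smul_sum, ← intervalIntegral.integral_finsetSum hint]
  simp [h]

theorem sum_box_eq_zero (Ga Gb : IsometryFlow H) {ι : Type*} (s : Finset ι) (x : ι → H →L[ℝ] ℝ)
    (y : ι → H) (h : ∀ r t, ∑ i ∈ s, x i (Ga.τ r (Gb.τ t (y i))) = 0) (δ : ℝ) :
    ∑ i ∈ s, x i (box Ga Gb δ (y i)) = 0 := by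
  refine sum_avg_eq_zero Ga s x _ (fun r => ?_) δ
  exact sum_avg_eq_zero Gb s (fun i => (x i).comp (Ga.τ r).toContinuousLinearMap) y (h r) δ

end IsometryFlow

theorem norm_le_of_inner_le {H : Type*} [NormedAddCommGroup H] [InnerProductSpace ℝ H] {x : H}
    {C : ℝ} (hC : 0 ≤ C) {S : Set H} (hS : Dense S) (h : ∀ y ∈ S, inner ℝ x y ≤ C * ‖y‖) :
    ‖x‖ ≤ C := by
  have := hS.induction (P := fun y => inner ℝ x y ≤ C * ‖y‖) h
    (isClosed_le (by fun_prop) (by fun_prop)) x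
  rw [real_inner_self_eq_norm_sq] at this
  by_contra hne
  push Not at hne
  nlinarith

/-! ### Averages over parallelograms in the front. -/

namespace RMHD
noncomputable section
open IsometryFlow

section FrontBox

variable (a b : Fin 2 → ℝ)

/-- The determinant of two tangential directions. -/
def det2 : ℝ := a 0 * b 1 - a 1 * b 0

/-- The coefficients of `w` with respect to `a`, `b`. -/
def coef (w : Fin 2 → ℝ) : ℝ × ℝ :=
  ((w 0 * b 1 - w 1 * b 0) / det2 a b, (a 0 * w 1 - a 1 * w 0) / det2 a b)

variable {a b}

theorem eq_coef (h : det2 a b ≠ 0) (w : Fin 2 → ℝ) :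
    w = (coef a b w).1 • a + (coef a b w).2 • b := by
  funext i
  simp only [coef, Pi.add_apply, Pi.smul_apply, smul_eq_mul]
  rw [div_mul_eq_mul_div, div_mul_eq_mul_div, ← add_div, eq_div_iff h, det2]
  fin_cases i <;> simp <;> ring

theorem coef_left (h : det2 a b ≠ 0) : coef a b a = (1, 0) := by
  refine Prod.ext (div_self h) ?_
  simp only [coef]
  rw [mul_comm (a 0), sub_self, zero_div]

theorem coef_right (h : det2 a b ≠ 0) : coef a b b = (0, 1) := by
  refine Prod.ext ?_ (div_self h)
  simp only [coef]
  rw [mul_comm (b 0), sub_self, zero_div]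

variable (a b)

/-- The average over a parallelogram in the front. -/
def fbox (δ : ℝ) : L2Front →L[ℝ] L2Front := box (transFlow a) (transFlow b) δ

/-- The averaged derivative in the direction `w`. -/
def fboxD (δ : ℝ) (w : Fin 2 → ℝ) : L2Front →L[ℝ] L2Front :=
  (coef a b w).1 • ((transFlow a).diff δ).comp ((transFlow b).avg δ)
    + (coef a b w).2 • ((transFlow b).diff δ).comp ((transFlow a).avg δ)

theorem fboxD_apply (δ : ℝ) (w : Fin 2 → ℝ) (x : L2Front) : fboxD a b δ w x
    = (coef a b w).1 • (transFlow a).diff δ ((transFlow b).avg δ x)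
      + (coef a b w).2 • (transFlow b).diff δ ((transFlow a).avg δ x) := rfl

variable {a b}

theorem front_comm (s t : ℝ) (x : L2Front) : (transFlow a).τ s ((transFlow b).τ t x)
    = (transFlow b).τ t ((transFlow a).τ s x) := transFlow_comm a b s t x

theorem norm_fbox_le (δ : ℝ) (x : L2Front) : ‖fbox a b δ x‖ ≤ ‖x‖ := norm_box_le _ _ δ x

theorem inner_fbox (δ : ℝ) (x y : L2Front) :
    inner ℝ (fbox a b δ x) y = inner ℝ x (fbox a b δ y) := inner_box front_comm δ x y

theorem norm_fboxD_le {δ : ℝ} (hδ : 0 < δ) (w : Fin 2 → ℝ) (x : L2Front) :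
    ‖fboxD a b δ w x‖ ≤ (|(coef a b w).1| + |(coef a b w).2|) * (δ⁻¹ * ‖x‖) := by
  rw [fboxD_apply, add_mul]
  refine (norm_add_le _ _).trans (add_le_add ?_ ?_) <;>
  · rw [norm_smul, Real.norm_eq_abs]
    refine mul_le_mul_of_nonneg_left ((norm_diff_le _ hδ _).trans ?_) (abs_nonneg _)
    gcongr
    exact norm_avg_le _ _ _

theorem dir_comb {g : (Fin 2 → ℝ) → ℝ} (hg : Nice g) (c d : ℝ) (v w : Fin 2 → ℝ) :
    toL (dir (c • v + d • w) g) = c • toL (dir v g) + d • toL (dir w g) := by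
  rw [← toL_smul (hg.dir v).memLp, ← toL_smul (hg.dir w).memLp,
    ← toL_add ((hg.dir v).smul c).memLp ((hg.dir w).smul d).memLp]
  congr 1; funext x
  simp [dir]

/-- After w is expanded in the basis a, b, each directional derivative is absorbed by the average
along the same direction. -/
theorem fbox_dir (h : det2 a b ≠ 0) (δ : ℝ) (w : Fin 2 → ℝ) {g : (Fin 2 → ℝ) → ℝ} (hg : Nice g) :
    fbox a b δ (toL (dir w g)) = fboxD a b δ w (toL g) := by
  conv_lhs => rw [eq_coef h w]
  rw [dir_comb hg, map_add, map_smul, map_smul, fboxD_apply]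
  congr 2
  · rw [fbox, box_apply, comm_avg_avg front_comm, avg_deriv (hg.hasDerivAt_transFlow a),
      comm_avg_diff front_comm]
  · rw [fbox, box_apply, avg_deriv (hg.hasDerivAt_transFlow b), comm_avg_diff front_comm]

/-- An identity between the derivatives of all test functions extends to the averaged derivatives
of all square integrable functions. -/
theorem sum_fboxD_eq_zero (h : det2 a b ≠ 0) {ι : Type*} [Fintype ι] (x₀ : L2Front →L[ℝ] ℝ)
    (x : ι → L2Front →L[ℝ] ℝ) (w : ι → Fin 2 → ℝ)
    (hx : ∀ g, Nice g → x₀ (toL g) + ∑ i, x i (toL (dir (w i) g)) = 0) (δ : ℝ) (y : L2Front) :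
    x₀ (fbox a b δ y) + ∑ i, x i (fboxD a b δ (w i) y) = 0 := by
  refine dense_nice.induction (P := fun y => x₀ (fbox a b δ y)
    + ∑ i, x i (fboxD a b δ (w i) y) = 0) ?_ (isClosed_eq (by fun_prop) continuous_const) y
  rintro _ ⟨g, hg, rfl⟩
  have h1 := sum_box_eq_zero (transFlow a) (transFlow b) Finset.univ
    (fun i : Option ι => i.elim x₀ x)
    (fun i => i.elim (toL g) fun i => toL (dir (w i) g)) (fun r t => ?_) δ
  · rw [Fintype.sum_option] at h1
    simp only [Option.elim] at h1
    rw [← h1]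
    congr 1
    exact Finset.sum_congr rfl fun i _ => by rw [← fbox_dir h δ (w i) hg]; rfl
  · have ht : ∀ k : (Fin 2 → ℝ) → ℝ, Nice k → (transFlow a).τ r ((transFlow b).τ t (toL k))
        = toL fun y => k (y + (r • a + t • b)) := fun k hk => by
      rw [transFlow_toL hk.memLp, transFlow_toL (hk.translate _).memLp]
      congr 1; funext y; rw [add_assoc]
    rw [Fintype.sum_option]
    simp only [Option.elim, ht g hg, ht _ (hg.dir _)]
    have := hx _ (hg.translate (r • a + t • b))
    rw [← this]
    congr 1
    refine Finset.sum_congr rfl fun i _ => ?_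
    congr 2; funext y
    exact (dir_translate _ _ _).symm

end FrontBox

/-! ### Compressed normal cut-off functions. -/

section Cutoff

theorem exists_cutoff : ∃ θ : ℝ → ℝ, ContDiff ℝ (⊤ : ℕ∞) θ ∧ HasCompactSupport θ ∧ θ 0 = 1 := by
  let f : ContDiffBump (0 : ℝ) := default
  exact ⟨f, f.contDiff, f.hasCompactSupport, f.one_of_mem_closedBall (by simp [f.rIn_pos.le])⟩

variable {z : ℝ → ℝ}

theorem memLp_cutoff (hz : ContDiff ℝ (⊤ : ℕ∞) z) (hs : HasCompactSupport z) : MemLp z 2 volume :=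
  hz.continuous.memLp_of_hasCompactSupport hs

theorem memLp_deriv_cutoff (hz : ContDiff ℝ (⊤ : ℕ∞) z) (hs : HasCompactSupport z) :
    MemLp (deriv z) 2 volume :=
  (hz.continuous_deriv (by simp)).memLp_of_hasCompactSupport hs.deriv

/-- The cut-off function compressed by the factor `4 ^ n`. -/
def compress (z : ℝ → ℝ) (n : ℕ) (x : ℝ) : ℝ := z (4 ^ n * x)

theorem contDiff_compress (hz : ContDiff ℝ (⊤ : ℕ∞) z) (n : ℕ) :
    ContDiff ℝ (⊤ : ℕ∞) (compress z n) := hz.comp (contDiff_const.mul contDiff_id)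

theorem hasCompactSupport_compress (hs : HasCompactSupport z) (n : ℕ) :
    HasCompactSupport (compress z n) :=
  hs.comp_homeomorph (Homeomorph.mulLeft₀ ((4 : ℝ) ^ n) (by positivity))

theorem sqrt_integral_compress (z : ℝ → ℝ) (n : ℕ) :
    Real.sqrt (∫ x, compress z n x ^ 2) = (1 / 2) ^ n * Real.sqrt (∫ x, z x ^ 2) := by
  have h := Measure.integral_comp_mul_left (fun x => z x ^ 2) ((4 : ℝ) ^ n)
  have e : |((4 : ℝ) ^ n)⁻¹| = ((1 / 2) ^ n) ^ 2 := by
    rw [abs_of_pos (by positivity), ← pow_mul, mul_comm, pow_mul, ← inv_pow]; norm_num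
  simp only [compress]
  rw [h, e, smul_eq_mul, Real.sqrt_mul (by positivity), Real.sqrt_sq (by positivity)]

theorem deriv_compress (hz : ContDiff ℝ (⊤ : ℕ∞) z) (n : ℕ) :
    deriv (compress z n) = fun x => 4 ^ n * compress (deriv z) n x := by
  funext x
  have h1 : HasDerivAt (fun x : ℝ => 4 ^ n * x) (4 ^ n) x := by
    simpa using (hasDerivAt_id x).const_mul ((4 : ℝ) ^ n)
  have h2 := ((hz.differentiable (by simp)) (4 ^ n * x)).hasDerivAt.comp x h1
  rw [show compress z n = z ∘ fun x => 4 ^ n * x from rfl, h2.deriv, compress, mul_comm]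

theorem sqrt_integral_deriv_compress (hz : ContDiff ℝ (⊤ : ℕ∞) z) (n : ℕ) :
    Real.sqrt (∫ x, deriv (compress z n) x ^ 2) = 2 ^ n * Real.sqrt (∫ x, deriv z x ^ 2) := by
  rw [deriv_compress hz]
  simp only [mul_pow]
  rw [integral_const_mul, Real.sqrt_mul (by positivity), Real.sqrt_sq (by positivity),
    sqrt_integral_compress, ← mul_assoc, ← mul_pow]
  norm_num

end Cutoff

/-! ### Half a derivative for the front from the constraints. -/

section High

theorem single_succ_eq (j : Fin 2) : (Pi.single j.succ 1 : Space) = bd (Pi.single j 1) := by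
  funext i; fin_cases j <;> fin_cases i <;> simp [bd]

variable {z : ℝ → ℝ} {g : (Fin 2 → ℝ) → ℝ}

theorem Nice.tensFun (hg : Nice g) (hz : ContDiff ℝ (⊤ : ℕ∞) z) (hs : HasCompactSupport z)
    (c : Idx → ℝ) : Nice (RMHD.tensFun g z c) :=
  (hg.tensor hz hs).clm (ContinuousLinearMap.toSpanSingleton ℝ c)

/-- The vector with magnetic component `k` on the side `σ`. -/
def sideH (σ : Bool) (k : Fin 3) : Bool → Idx → ℝ := fun τ => if τ = σ then Pi.single (iH k) 1 else 0

theorem glueH_gradH_tensor (hg : Nice g) (hz : ContDiff ℝ (⊤ : ℕ∞) z) (hs : HasCompactSupport z)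
    (σ : Bool) : glueH (onSide σ (gradH fun x => g (tl x) * z (x 0)))
      = lift (memLp_deriv_cutoff hz hs) (sideH σ 0) (toL g)
        + ∑ j : Fin 2, lift (memLp_cutoff hz hs) (sideH σ j.succ)
          (toL (dir (Pi.single j 1) g)) := by
  have hz' : ContDiff ℝ (⊤ : ℕ∞) (deriv z) := hz.deriv'
  rw [lift_toL _ _ hg.memLp]
  simp only [lift_toL _ _ (hg.dir _).memLp]
  rw [← glueH_sum Finset.univ fun j τ => (hg.dir _).tensFun hz hs _,
    ← glueH_add (fun τ => hg.tensFun hz' hs.deriv _)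
      fun τ => Nice.sum _ fun j => (hg.dir _).tensFun hz hs _]
  congr 1; funext τ x
  have h0 : pd 0 (fun x => g (tl x) * z (x 0)) x = g (tl x) * deriv z (x 0) :=
    dir_tensor_zero hg hz hs x
  have h1 : ∀ j : Fin 2, pd j.succ (fun x => g (tl x) * z (x 0)) x
      = dir (Pi.single j 1) g (tl x) * z (x 0) := fun j => by
    rw [← dir_tensor_bd hg hz hs, ← single_succ_eq]; rfl
  unfold onSide sideH tensFun
  split_ifs
  · rw [gradH, magVec_eq, Fin.sum_univ_succ, h0]
    simp only [h1]
  · simp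

theorem con_tensor {U : Bool → State} {W : HS} {φ : L2Front} (hc : Con U W φ) (hg : Nice g)
    (hz : ContDiff ℝ (⊤ : ℕ∞) z) (hs : HasCompactSupport z) (hz0 : z 0 = 1) (σ : Bool) :
    inner ℝ W (lift (memLp_deriv_cutoff hz hs) (sideH σ 0) (toL g))
      + ∑ j : Fin 2, inner ℝ W (lift (memLp_cutoff hz hs) (sideH σ j.succ)
        (toL (dir (Pi.single j 1) g))) - sgn σ * inner ℝ φ (toL (dir (magT (U σ)) g)) = 0 := by
  have h := hc σ _ (hg.tensor hz hs)
  rw [ev_apply, conVec_snd, conVec, glueH_gradH_tensor hg hz hs, inner_add_right, inner_sum,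
    inner_smul_right] at h
  rw [← h]
  congr 4; funext y
  rw [dir_tensor_bd hg hz hs, tl_bd]
  simp [bd, hz0]

/-- A trace estimate for H₁ = H·∇φ. The constraint is tested with a tangential function times a
cut-off in a layer of width 4⁻ⁿ. The normal derivative costs 4ⁿ and a tangential derivative averaged
on the scale 4⁻ⁿ costs 4ⁿ as well, while the thin layer gains 2⁻ⁿ in L²; the total is 2ⁿ, half a
derivative. -/
theorem exists_con_box_le {U : Bool → State} {a b : Fin 2 → ℝ} (hdet : det2 a b ≠ 0) (σ : Bool) :
    ∃ C : ℝ, 0 ≤ C ∧ ∀ W φ, Con U W φ → ∀ (n : ℕ) (G : L2Front),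
      |inner ℝ φ (fboxD a b ((1 / 4) ^ n) (magT (U σ)) G)| ≤ C * ‖W‖ * 2 ^ n * ‖G‖ := by
  obtain ⟨θ, hθ, hθs, hθ0⟩ := exists_cutoff
  choose C hC hCl using fun k : Fin 3 => exists_norm_lift_le (sideH σ k)
  let m : Fin 2 → ℝ := fun j =>
    |(coef a b (Pi.single j 1)).1| + |(coef a b (Pi.single j 1)).2|
  have hm : ∀ j, 0 ≤ m j := fun j => by positivity
  set I0 := Real.sqrt (∫ x, θ x ^ 2) with hI0
  set I1 := Real.sqrt (∫ x, deriv θ x ^ 2) with hI1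
  refine ⟨C 0 * I1 + ∑ j : Fin 2, C j.succ * I0 * m j, ?_, fun W φ hc n G => ?_⟩
  · have : ∀ j : Fin 2, 0 ≤ C j.succ * I0 * m j := fun j =>
      mul_nonneg (mul_nonneg (hC _) (Real.sqrt_nonneg _)) (hm j)
    exact add_nonneg (mul_nonneg (hC _) (Real.sqrt_nonneg _)) (Finset.sum_nonneg fun j _ => this j)
  set δ : ℝ := (1 / 4) ^ n with hδ
  have hδ0 : 0 < δ := by positivity
  have hz := contDiff_compress hθ n
  have hs := hasCompactSupport_compress hθs n
  have hz0 : compress θ n 0 = 1 := by simp [compress, hθ0]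
  -- The index `none` stands for the front term, differentiated along the magnetic field; `some j`
  -- stands for the tangential gradient in the bulk.
  have key := sum_fboxD_eq_zero hdet (ι := Option (Fin 2))
    ((innerSL ℝ W).comp (lift (memLp_deriv_cutoff hz hs) (sideH σ 0)))
    (fun i => i.elim (-(sgn σ • innerSL ℝ φ)) fun j =>
      (innerSL ℝ W).comp (lift (memLp_cutoff hz hs) (sideH σ j.succ)))
    (fun i => i.elim (magT (U σ)) fun j => Pi.single j 1) (fun g hg => by
      rw [Fintype.sum_option]
      have := con_tensor hc hg hz hs hz0 σ
      rw [← this]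
      change inner ℝ W (lift (memLp_deriv_cutoff hz hs) (sideH σ 0) (toL g))
        + (-(sgn σ * inner ℝ φ (toL (dir (magT (U σ)) g)))
          + ∑ j : Fin 2, inner ℝ W (lift (memLp_cutoff hz hs) (sideH σ j.succ)
            (toL (dir (Pi.single j 1) g)))) = _
      ring) δ G
  rw [Fintype.sum_option] at key
  simp only [Option.elim] at key
  change inner ℝ W (lift _ _ (fbox a b δ G)) + (-(sgn σ * inner ℝ φ (fboxD a b δ (magT (U σ)) G))
    + ∑ j : Fin 2, inner ℝ W (lift _ _ (fboxD a b δ (Pi.single j 1) G))) = 0 at key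
  have hsgn : |sgn σ| = 1 := by cases σ <;> simp [sgn]
  have e : |inner ℝ φ (fboxD a b δ (magT (U σ)) G)|
      = |sgn σ * inner ℝ φ (fboxD a b δ (magT (U σ)) G)| := by rw [abs_mul, hsgn, one_mul]
  have e2 : sgn σ * inner ℝ φ (fboxD a b δ (magT (U σ)) G)
      = inner ℝ W (lift (memLp_deriv_cutoff hz hs) (sideH σ 0) (fbox a b δ G))
        + ∑ j : Fin 2, inner ℝ W (lift (memLp_cutoff hz hs) (sideH σ j.succ)
          (fboxD a b δ (Pi.single j 1) G)) := by linarith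
  rw [e, e2]
  have p : ((1 / 2 : ℝ) ^ n) * δ⁻¹ = 2 ^ n := by
    rw [hδ, ← inv_pow, ← mul_pow]; norm_num
  have b0 : |inner ℝ W (lift (memLp_deriv_cutoff hz hs) (sideH σ 0) (fbox a b δ G))|
      ≤ C 0 * I1 * (‖W‖ * 2 ^ n * ‖G‖) := by
    refine (abs_real_inner_le_norm _ _).trans ?_
    have h1 := hCl 0 _ (memLp_deriv_cutoff hz hs) (fbox a b δ G)
    rw [sqrt_integral_deriv_compress hθ] at h1
    have h2 := norm_fbox_le (a := a) (b := b) δ G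
    have h3 : C 0 * (2 ^ n * I1) * ‖fbox a b δ G‖ ≤ C 0 * (2 ^ n * I1) * ‖G‖ :=
      mul_le_mul_of_nonneg_left h2 (mul_nonneg (hC 0) (by positivity))
    calc ‖W‖ * _ ≤ ‖W‖ * (C 0 * (2 ^ n * I1) * ‖G‖) := by gcongr; exact h1.trans h3
      _ = _ := by ring
  have bj : ∀ j : Fin 2, |inner ℝ W (lift (memLp_cutoff hz hs) (sideH σ j.succ)
      (fboxD a b δ (Pi.single j 1) G))| ≤ C j.succ * I0 * m j * (‖W‖ * 2 ^ n * ‖G‖) := by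
    intro j
    refine (abs_real_inner_le_norm _ _).trans ?_
    have h1 := hCl j.succ _ (memLp_cutoff hz hs) (fboxD a b δ (Pi.single j 1) G)
    rw [sqrt_integral_compress] at h1
    have h2 : ‖fboxD a b δ (Pi.single j 1) G‖ ≤ m j * (δ⁻¹ * ‖G‖) := norm_fboxD_le hδ0 _ G
    have h3 := mul_le_mul_of_nonneg_left h2
      (show 0 ≤ C j.succ * ((1 / 2) ^ n * I0) from mul_nonneg (hC _) (by positivity))
    calc ‖W‖ * _ ≤ ‖W‖ * (C j.succ * ((1 / 2) ^ n * I0) * (m j * (δ⁻¹ * ‖G‖))) := by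
          gcongr; exact h1.trans h3
      _ = C j.succ * I0 * m j * (‖W‖ * ((1 / 2) ^ n * δ⁻¹) * ‖G‖) := by ring
      _ = _ := by rw [p]
  refine (abs_add_le _ _).trans ((add_le_add b0 ((Finset.abs_sum_le_sum_abs _ _).trans
    (Finset.sum_le_sum fun j _ => bj j))).trans (le_of_eq ?_))
  rw [← Finset.sum_mul]; ring

/-- The front is controlled by its average on the unit scale and by the magnetic field. -/
theorem exists_front_norm_le {U : Bool → State} (hdet : det2 (magT (U true)) (magT (U false)) ≠ 0) :
    ∃ C : ℝ, 0 ≤ C ∧ ∀ W φ, Con U W φ →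
      ‖φ‖ ≤ ‖fbox (magT (U true)) (magT (U false)) 1 φ‖ + C * ‖W‖ := by
  set a := magT (U true)
  set b := magT (U false)
  obtain ⟨Ca, hCa, ha⟩ := exists_con_box_le (U := U) hdet true
  obtain ⟨Cb, hCb, hb⟩ := exists_con_box_le (U := U) hdet false
  refine ⟨10 * (Ca + Cb), by positivity, fun W φ hc => ?_⟩
  have := norm_le_of_norm_diff_le (Ga := transFlow a) (Gb := transFlow b) front_comm (x := φ)
    (N := (Ca + Cb) * ‖W‖) (fun n => ?_) (fun n => ?_)
  · refine this.trans (le_of_eq ?_)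
    rw [fbox]; ring
  -- The basis consists of the two magnetic fields themselves, so each constraint bounds the
  -- difference quotient along one basis vector.
  · refine norm_le_of_inner_le (by positivity) dense_univ fun y _ => ?_
    have h1 := ha W φ hc n y
    rw [fboxD_apply, coef_left hdet, one_smul, zero_smul, add_zero] at h1
    rw [inner_diff, inner_avg, ← comm_diff_avg front_comm]
    refine (neg_le_abs _).trans (h1.trans ?_)
    have : 0 ≤ Cb * ‖W‖ * 2 ^ n * ‖y‖ := by positivity
    linarith
  · refine norm_le_of_inner_le (by positivity) dense_univ fun y _ => ?_
    have h1 := hb W φ hc n y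
    rw [fboxD_apply, coef_right hdet, one_smul, zero_smul, zero_add] at h1
    rw [inner_diff, inner_avg, ← comm_diff_avg front_comm]
    refine (neg_le_abs _).trans (h1.trans ?_)
    have : 0 ≤ Ca * ‖W‖ * 2 ^ n * ‖y‖ := by positivity
    linarith

end High
end
end RMHD

/-- The integrated form of a weak evolution equation. -/
theorem forall_hasDerivWithinAt_iff {X : Type*} [NormedAddCommGroup X] [NormedSpace ℝ X] {T : ℝ}
    {z : ℝ → X →L[ℝ] ℝ} (hz : ContinuousOn z (Set.Icc 0 T)) (p q : X) :
    (∀ t ∈ Set.Icc 0 T, HasDerivWithinAt (fun s => z s p) (z t q) (Set.Icc 0 T) t) ↔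
      ∀ t ∈ Set.Icc 0 T, z t p - z 0 p = (∫ s in (0 : ℝ)..t, z s) q := by
  have hzv : ∀ v : X, ContinuousOn (fun s => z s v) (Set.Icc 0 T) := fun v =>
    hz.clm_apply continuousOn_const
  have hsub : ∀ {t}, t ∈ Set.Icc 0 T → Set.uIcc 0 t ⊆ Set.Icc 0 T := fun {t} ht => by
    rw [Set.uIcc_of_le ht.1]; exact Set.Icc_subset_Icc_right ht.2
  have hq : ∀ t ∈ Set.Icc 0 T, (∫ s in (0 : ℝ)..t, z s) q = ∫ s in (0 : ℝ)..t, z s q :=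
    fun t ht => ContinuousLinearMap.intervalIntegral_apply (hz.mono (hsub ht)).intervalIntegrable q
  constructor
  · intro h t ht
    rw [hq t ht]
    have hI : Set.Icc 0 t ⊆ Set.Icc 0 T := Set.Icc_subset_Icc_right ht.2
    refine (intervalIntegral.integral_eq_sub_of_hasDerivAt_of_le (f := fun s => z s p) ht.1
      ((hzv p).mono hI) (fun s hs => ?_) ((hzv q).mono (hsub ht)).intervalIntegrable).symm
    exact (h s (hI ⟨hs.1.le, hs.2.le⟩)).hasDerivAt (Icc_mem_nhds hs.1 (hs.2.trans_le ht.2))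
  · intro h t ht
    have hT : 0 ≤ T := ht.1.trans ht.2
    let g : ℝ → ℝ := Set.IccExtend hT ((Set.Icc 0 T).domRestrict fun s => z s q)
    have hg : Continuous g := (continuousOn_iff_continuous_domRestrict.1 (hzv q)).Icc_extend'
    have hgz : ∀ s ∈ Set.Icc 0 T, g s = z s q := fun s hs => Set.IccExtend_of_mem hT _ hs
    have e : ∀ s ∈ Set.Icc 0 T, z s p = z 0 p + ∫ r in (0 : ℝ)..s, g r := fun s hs => by
      have h1 := h s hs
      rw [hq s hs, ← intervalIntegral.integral_congr fun r hr => hgz r (hsub hs hr)] at h1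
      linarith
    have hd : HasDerivAt (fun s => z 0 p + ∫ r in (0 : ℝ)..s, g r) (z t q) t := by
      rw [← hgz t ht]
      exact ((hg.integral_hasStrictDerivAt 0 t).hasDerivAt).const_add _
    exact hd.hasDerivWithinAt.congr e (e t ht)

namespace IsometryFlow

variable {H K : Type*} [NormedAddCommGroup H] [InnerProductSpace ℝ H] [CompleteSpace H]
  [NormedAddCommGroup K] [InnerProductSpace ℝ K] [CompleteSpace K]

theorem box_map {Ga Gb : IsometryFlow H} {Fa Fb : IsometryFlow K} {M : H →L[ℝ] K}
    (ha : ∀ s x, M (Ga.τ s x) = Fa.τ s (M x)) (hb : ∀ s x, M (Gb.τ s x) = Fb.τ s (M x)) (δ : ℝ)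
    (x : H) : box Fa Fb δ (M x) = M (box Ga Gb δ x) := by
  have h : M (Gb.avg δ x) = Fb.avg δ (M x) := by
    rw [clm_avg (G := Gb) M, avg_apply]; simp only [hb]
  rw [box_apply, box_apply, clm_avg (G := Ga) M, ← h, avg_apply]
  simp only [ha]

theorem inner_box_congr (Ga Gb : IsometryFlow H) (Fa Fb : IsometryFlow K) {x y : H} {z w : K}
    (h : ∀ r t, inner ℝ x (Ga.τ r (Gb.τ t y)) = inner ℝ z (Fa.τ r (Fb.τ t w))) (δ : ℝ) :
    inner ℝ x (box Ga Gb δ y) = inner ℝ z (box Fa Fb δ w) := by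
  rw [box_apply, box_apply, inner_avg_right, inner_avg_right]
  congr 2; funext r
  have h1 := clm_avg (G := Gb) ((innerSL ℝ x).comp (Ga.τ r).toContinuousLinearMap) δ y
  have h2 := clm_avg (G := Fb) ((innerSL ℝ z).comp (Fa.τ r).toContinuousLinearMap) δ w
  refine h1.trans (Eq.trans ?_ h2.symm)
  congr 2; funext t
  exact h r t

omit [CompleteSpace H] in
theorem continuous_τ (G : IsometryFlow H) {f : ℝ → H} (hf : Continuous f) :
    Continuous fun s => G.τ s (f s) := by
  refine continuous_iff_continuousAt.2 fun t => ?_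
  have h1 : Tendsto (fun s => G.τ s (f s - f t)) (𝓝 t) (𝓝 0) := by
    refine squeeze_zero_norm (a := fun s => ‖f s - f t‖) (fun s => by rw [LinearIsometry.norm_map]) ?_
    simpa using ((hf.tendsto t).sub_const (f t)).norm
  have h2 := h1.add ((G.continuous' (f t)).tendsto t)
  simpa [ContinuousAt] using h2

end IsometryFlow

/-! ### Transport equations in the front. -/

namespace RMHD
noncomputable section

section Transport

variable {vel : Fin 2 → ℝ}

/-- `∂_t y + ∂_vel y = f` in the weak sense. -/
def TransportEq (vel : Fin 2 → ℝ) (T : ℝ) (y f : ℝ → L2Front) : Prop :=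
  ∀ g, Nice g → ∀ t ∈ Set.Icc 0 T, HasDerivWithinAt (fun s => inner ℝ (y s) (toL g))
    (inner ℝ (f t) (toL g) + inner ℝ (y t) (toL (dir vel g))) (Set.Icc 0 T) t

theorem hasDerivAt_transFlow_toL {g : (Fin 2 → ℝ) → ℝ} (hg : Nice g) (s : ℝ) :
    HasDerivAt (fun s => (transFlow vel).τ s (toL g)) ((transFlow vel).τ s (toL (dir vel g))) s :=
  (transFlow vel).hasDerivAt_of_zero (hg.hasDerivAt_transFlow vel) s

/-- By duality: paired with a smooth function carried along by the flow, y changes only through the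
source, and translations preserve the norm of the test function. -/
theorem TransportEq.norm_le {T N : ℝ} {y f : ℝ → L2Front} (h : TransportEq vel T y f)
    (hy : ContinuousOn y (Set.Icc 0 T)) (hf : ∀ s ∈ Set.Icc 0 T, ‖f s‖ ≤ N) {t : ℝ}
    (ht : t ∈ Set.Icc 0 T) : ‖y t‖ ≤ ‖y 0‖ + N * t := by
  have hN : 0 ≤ N := (norm_nonneg _).trans (hf t ht)
  refine norm_le_of_inner_le (add_nonneg (norm_nonneg _) (mul_nonneg hN ht.1)) dense_nice ?_
  rintro _ ⟨g, hg, rfl⟩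
  have hd : ∀ s ∈ Set.Icc 0 T, HasDerivWithinAt
      (fun s => inner ℝ (y s) ((transFlow vel).τ (t - s) (toL g)))
      (inner ℝ (f s) ((transFlow vel).τ (t - s) (toL g))) (Set.Icc 0 T) s := by
    intro s hs
    have h1 := h _ (hg.translate ((t - s) • vel)) s hs
    have h2 : (dir vel fun x => g (x + (t - s) • vel)) = fun x => dir vel g (x + (t - s) • vel) := by
      funext x; exact dir_translate _ _ _
    rw [h2, ← transFlow_toL hg.memLp, ← transFlow_toL (hg.dir vel).memLp] at h1
    have h3 := HasDerivAt.comp_const_sub t s (hasDerivAt_transFlow_toL (vel := vel) hg (t - s))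
    have hz : ContinuousWithinAt (fun s => innerSL ℝ (y s)) (Set.Icc 0 T) s :=
      (innerSL ℝ).continuous.continuousAt.comp_continuousWithinAt (hy s hs)
    refine (hasDerivWithinAt_moving hz h1 h3.hasDerivWithinAt).congr_deriv ?_
    rw [map_neg, innerSL_apply_apply]; ring
  have hb := Convex.norm_image_sub_le_of_norm_hasDerivWithin_le (C := N * ‖toL g‖) hd
    (fun s hs => (norm_inner_le_norm _ _).trans (by
      rw [LinearIsometry.norm_map]; gcongr; exact hf s hs)) (convex_Icc 0 T)
    (⟨le_rfl, ht.1.trans ht.2⟩ : (0 : ℝ) ∈ Set.Icc 0 T) ht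
  simp only [sub_self, sub_zero, (transFlow vel).map_zero'] at hb
  rw [Real.norm_eq_abs, Real.norm_eq_abs, abs_of_nonneg ht.1] at hb
  have h4 : inner ℝ (y 0) ((transFlow vel).τ t (toL g)) ≤ ‖y 0‖ * ‖toL g‖ :=
    (real_inner_le_norm _ _).trans (by rw [LinearIsometry.norm_map])
  have h5 := (abs_le.1 hb).2
  nlinarith

theorem exists_transportEq (vel : Fin 2 → ℝ) (y0 : L2Front) {f : ℝ → L2Front} (hf : Continuous f) :
    ∃ y : ℝ → L2Front, Continuous y ∧ y 0 = y0 ∧ ∀ T, TransportEq vel T y f := by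
  have hc := (transFlow vel).continuous_τ hf
  let F : ℝ → L2Front := fun t => y0 + ∫ s in (0 : ℝ)..t, (transFlow vel).τ s (f s)
  have hF : ∀ t, HasDerivAt F ((transFlow vel).τ t (f t)) t := fun t =>
    ((hc.integral_hasStrictDerivAt 0 t).hasDerivAt).const_add _
  have hFc : Continuous F := continuous_iff_continuousAt.2 fun t => (hF t).continuousAt
  refine ⟨fun t => (transFlow vel).τ (-t) (F t), ?_, ?_, fun T g hg t _ => ?_⟩
  · have := ((transFlow vel).continuous_τ (f := fun t => F (-t)) (by fun_prop)).comp continuous_neg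
    simpa [Function.comp_def] using this
  · simp [F, (transFlow vel).map_zero']
  · have h := (hF t).inner ℝ (hasDerivAt_transFlow_toL (vel := vel) hg t)
    simp only [(transFlow vel).inner_τ, neg_neg] at h ⊢
    refine (h.congr_deriv ?_).hasDerivWithinAt
    rw [← (transFlow vel).map_add']
    simp [(transFlow vel).map_zero']
    ring

end Transport
end
end RMHD

/-! ### Test functions with a prescribed pressure jump. -/

namespace RMHD
noncomputable section
open IsometryFlow

variable {e : ℝ → ℝ → ℝ} {U : Bool → State} {lam : Bool → ℝ} (h : Symmetrizable e U lam)

/-- A cut-off function in the normal variable. -/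
def cutoff : ℝ → ℝ := exists_cutoff.choose

theorem contDiff_cutoff : ContDiff ℝ (⊤ : ℕ∞) cutoff := exists_cutoff.choose_spec.1

theorem hasCompactSupport_cutoff : HasCompactSupport cutoff := exists_cutoff.choose_spec.2.1

theorem cutoff_zero : cutoff 0 = 1 := exists_cutoff.choose_spec.2.2

/-- The unit pressure on the plus side. -/
def presVec (σ : Bool) : Idx → ℝ := if σ then Pi.single iP 1 else 0

/-- The test function with the pressure jump `g`. -/
def frontTest (g : (Fin 2 → ℝ) → ℝ) (σ : Bool) : Space → Idx → ℝ := tensFun g cutoff (presVec σ)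

/-- The normal extension `f ↦ f(x') cutoff(x¹) presVec`. -/
def presLift : L2Front →L[ℝ] HS :=
  lift (memLp_cutoff contDiff_cutoff hasCompactSupport_cutoff) presVec

/-- The normal derivative of `presLift`. -/
def presLiftD : L2Front →L[ℝ] HS :=
  lift (memLp_deriv_cutoff contDiff_cutoff hasCompactSupport_cutoff) presVec

variable {g : (Fin 2 → ℝ) → ℝ}

theorem nice_frontTest (hg : Nice g) (σ : Bool) : Nice (frontTest g σ) :=
  hg.tensFun contDiff_cutoff hasCompactSupport_cutoff _

theorem frontTest_bd (σ : Bool) (y : Fin 2 → ℝ) : frontTest g σ (bd y) = g y • presVec σ := by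
  have : (bd y) 0 = 0 := rfl
  rw [frontTest, tensFun, tl_bd, this, cutoff_zero, mul_one]

theorem dir_frontTest (hg : Nice g) (w x : Space) (σ : Bool) : dir w (frontTest g σ) x
    = dir w (fun x => g (tl x) * cutoff (x 0)) x • presVec σ :=
  dir_clm (hg.tensor contDiff_cutoff hasCompactSupport_cutoff)
    (ContinuousLinearMap.toSpanSingleton ℝ (presVec σ)) w x

theorem glueH_frontTest (hg : Nice g) : glueH (frontTest g) = presLift (toL g) :=
  (lift_toL _ _ hg.memLp).symm

theorem glueH_pd_zero_frontTest (hg : Nice g) :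
    (glueH fun σ => pd 0 (frontTest g σ)) = presLiftD (toL g) := by
  rw [presLiftD, lift_toL _ _ hg.memLp]
  congr 1; funext σ x
  refine (dir_frontTest hg _ x σ).trans ?_
  rw [dir_tensor_zero hg contDiff_cutoff hasCompactSupport_cutoff]; rfl

theorem glueH_pd_succ_frontTest (hg : Nice g) (j : Fin 2) :
    (glueH fun σ => pd j.succ (frontTest g σ)) = presLift (toL (dir (Pi.single j 1) g)) := by
  rw [presLift, lift_toL _ _ (hg.dir _).memLp]
  congr 1; funext σ x
  refine (dir_frontTest hg _ x σ).trans ?_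
  rw [single_succ_eq, dir_tensor_bd hg contDiff_cutoff hasCompactSupport_cutoff]; rfl

namespace Symmetrizable

/-- The interior momentum of the front test functions. -/
def frontMom : L2Front →L[ℝ] HS := (mul h.sys.B).comp presLift

/-- The interior flux of the front test functions, without tangential derivatives. -/
def frontFlx : L2Front →L[ℝ] HS := (mul (h.sys.D 0)).comp presLiftD

/-- The coefficients of the tangential derivatives in the flux of the front test functions. -/
def frontFlxD (j : Fin 2) : L2Front →L[ℝ] HS := (mul (h.sys.D j.succ)).comp presLift

theorem q_presVec (σ : Bool) : h.sys.q σ ⬝ᵥ presVec σ = if σ then 1 else 0 := by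
  unfold presVec
  split_ifs
  · change qVec (U σ) ⬝ᵥ _ = 1
    rw [dotProduct_single, mul_one]; rfl
  · simp

theorem w_presVec (σ : Bool) : h.sys.w σ ⬝ᵥ presVec σ = 0 := by
  unfold presVec
  split_ifs
  · change wVec (U σ) (lam σ) ⬝ᵥ _ = 0
    rw [dotProduct_single, mul_one]; rfl
  · simp

theorem redTest_frontTest (hg : Nice g) : h.RedTest (frontTest g) where
  nice := nice_frontTest hg
  w_eq y := by simp only [frontTest_bd, dotProduct_smul, w_presVec, smul_zero]

theorem jump_frontTest (g : (Fin 2 → ℝ) → ℝ) : jump h.sys.q (frontTest g) = toL g := by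
  rw [jump]
  simp only [frontTest_bd, dotProduct_smul, q_presVec]
  simp

theorem mom_frontTest (hg : Nice g) :
    h.mom (frontTest g) = (h.frontMom (toL g), toL g) := by
  rw [mom, jump_frontTest, glueH_frontTest hg]; rfl

theorem flx_frontTest (hg : Nice g) : h.flx (frontTest g)
    = (h.frontFlx (toL g) + ∑ j, h.frontFlxD j (toL (dir (Pi.single j 1) g)),
        toL (dir h.vel g)) := by
  have h1 : jump h.sys.q (fun σ => dir (bd h.vel) (frontTest g σ)) = toL (dir h.vel g) := by
    rw [jump_dir (nice_frontTest hg)]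
    simp only [frontTest_bd, dotProduct_smul, q_presVec]
    simp
  rw [flx, h1, SymSys.op, Fin.sum_univ_succ, glueH_pd_zero_frontTest hg]
  simp only [glueH_pd_succ_frontTest hg]
  rfl

variable {Θ Φ : Bool → Space → Idx → ℝ}

theorem mom_add (hΘ : ∀ σ, Nice (Θ σ)) (hΦ : ∀ σ, Nice (Φ σ)) :
    h.mom (fun σ x => Θ σ x + Φ σ x) = h.mom Θ + h.mom Φ := by
  refine Prod.ext ?_ ?_
  · change mul h.sys.B (glueH _) = mul h.sys.B (glueH _) + mul h.sys.B (glueH _)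
    rw [glueH_add hΘ hΦ, map_add]
  · exact jump_add hΘ hΦ

theorem flx_add (hΘ : ∀ σ, Nice (Θ σ)) (hΦ : ∀ σ, Nice (Φ σ)) :
    h.flx (fun σ x => Θ σ x + Φ σ x) = h.flx Θ + h.flx Φ := by
  refine Prod.ext ?_ ?_
  · exact h.sys.op_add hΘ hΦ
  · have : ∀ σ, dir (bd h.vel) (fun x => Θ σ x + Φ σ x)
        = fun x => dir (bd h.vel) (Θ σ) x + dir (bd h.vel) (Φ σ) x := fun σ => by
      funext x; exact dir_add (hΘ σ) (hΦ σ) _ x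
    change jump h.sys.q (fun σ => dir (bd h.vel) (fun x => Θ σ x + Φ σ x)) = _
    simp only [this]
    exact jump_add (fun σ => (hΘ σ).dir _) fun σ => (hΦ σ).dir _

variable {h} in
/-- Every test function is the sum of a front test function and of a test function for the
interior problem. -/
theorem RedTest.exists_coreTest (hΘ : h.RedTest Θ) : ∃ g, Nice g ∧ ∃ Φ, CoreTest h.sys Φ ∧
    h.mom Θ = h.mom Φ + h.mom (frontTest g) ∧ h.flx Θ = h.flx Φ + h.flx (frontTest g) := by
  let g : (Fin 2 → ℝ) → ℝ := fun y =>
    h.sys.q true ⬝ᵥ Θ true (bd y) - h.sys.q false ⬝ᵥ Θ false (bd y)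
  have hg : Nice g := nice_jump h.sys.q hΘ.nice
  let Φ : Bool → Space → Idx → ℝ := fun σ x => Θ σ x - frontTest g σ x
  have hΦ : ∀ σ, Nice (Φ σ) := fun σ => (hΘ.nice σ).sub (nice_frontTest hg σ)
  have e : Θ = fun σ x => Φ σ x + frontTest g σ x := by
    funext σ x; exact (sub_add_cancel _ _).symm
  refine ⟨g, hg, Φ, ⟨hΦ, fun y => ?_, fun y => ?_⟩, ?_, ?_⟩
  · simp only [Φ, dotProduct_sub, frontTest_bd, dotProduct_smul, q_presVec]
    simp [g]
  · simp only [Φ, dotProduct_sub, frontTest_bd, dotProduct_smul, w_presVec, smul_zero, sub_zero]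
    exact hΘ.w_eq y
  · conv_lhs => rw [e]
    exact h.mom_add hΦ (nice_frontTest hg)
  · conv_lhs => rw [e]
    exact h.flx_add hΦ (nice_frontTest hg)

end Symmetrizable
end
end RMHD

/-! ### The transport equation for the pressure impulse. -/

namespace RMHD
noncomputable section
open IsometryFlow

variable {e : ℝ → ℝ → ℝ} {U : Bool → State} {lam : Bool → ℝ} (h : Symmetrizable e U lam)
  {a b : Fin 2 → ℝ} {T : ℝ} {W : ℝ → HS} {φ : ℝ → L2Front} {g : (Fin 2 → ℝ) → ℝ}

/-- The average over a tangential parallelogram. -/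
def hbox (a b : Fin 2 → ℝ) (δ : ℝ) : HS →L[ℝ] HS := box (transFlow (bd a)) (transFlow (bd b)) δ

theorem bulk_comm (s t : ℝ) (x : HS) : (transFlow (bd a)).τ s ((transFlow (bd b)).τ t x)
    = (transFlow (bd b)).τ t ((transFlow (bd a)).τ s x) := transFlow_comm _ _ s t x

theorem hbox_mul_lift {z : ℝ → ℝ} (hz : MemLp z 2 volume) (c : Bool → Idx → ℝ)
    (M : Bool → Matrix Idx Idx ℝ) (δ : ℝ) (x : L2Front) :
    hbox a b δ (mul M (lift hz c x)) = mul M (lift hz c (fbox a b δ x)) := by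
  have hc : ∀ (w : Fin 2 → ℝ) (s : ℝ) (x : L2Front), ((mul M).comp (lift hz c))
      ((transFlow w).τ s x) = (transFlow (bd w)).τ s (((mul M).comp (lift hz c)) x) :=
    fun w s x => by
      simp only [ContinuousLinearMap.comp_apply]
      rw [transFlow_lift, mul_transFlow _ (Or.inl rfl)]
  exact box_map (M := (mul M).comp (lift hz c)) (hc a) (hc b) δ x

theorem inner_hbox (δ : ℝ) (x y : HS) :
    inner ℝ (hbox a b δ x) y = inner ℝ x (hbox a b δ y) := inner_box bulk_comm δ x y

namespace Symmetrizable

/-- The pressure impulse at the front. -/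
def frontPot (W : HS) (φ : L2Front) : L2Front := ContinuousLinearMap.adjoint h.frontMom W - φ

theorem inner_frontPot (W : HS) (φ x : L2Front) :
    inner ℝ (h.frontPot W φ) x = inner ℝ W (h.frontMom x) - inner ℝ φ x := by
  rw [frontPot, inner_sub_left, ContinuousLinearMap.adjoint_inner_left]

variable (a b)

/-- The averaged source of the pressure impulse, in dual form. -/
def frontDual (δ : ℝ) : L2Front →L[ℝ] HS :=
  h.frontFlx.comp (fbox a b δ) + ∑ j, (h.frontFlxD j).comp (fboxD a b δ (Pi.single j 1))
    - h.frontMom.comp (fboxD a b δ h.vel)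

theorem frontDual_apply (δ : ℝ) (x : L2Front) : h.frontDual a b δ x
    = h.frontFlx (fbox a b δ x) + ∑ j, h.frontFlxD j (fboxD a b δ (Pi.single j 1) x)
      - h.frontMom (fboxD a b δ h.vel x) := by
  simp [frontDual]

/-- The averaged source of the pressure impulse. -/
def frontSource (δ : ℝ) : HS →L[ℝ] L2Front := ContinuousLinearMap.adjoint (h.frontDual a b δ)

variable {a b}

/-- For smooth g the weak equation tested with `frontTest g`, integrated in time, is a linear
identity between g and its tangential derivatives. Averaging makes every term bounded in L², so it
extends to all x. -/
theorem RedSol.evol_fbox (hdet : det2 a b ≠ 0) (hW : ContinuousOn W (Set.Icc 0 T))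
    (hφ : ContinuousOn φ (Set.Icc 0 T)) (hr : h.RedSol (Set.Icc 0 T) W φ) (δ : ℝ) (x : L2Front) :
    Evol (Set.Icc 0 T) W φ (h.frontMom (fbox a b δ x), fbox a b δ x)
      (h.frontFlx (fbox a b δ x) + ∑ j, h.frontFlxD j (fboxD a b δ (Pi.single j 1) x),
        fboxD a b δ h.vel x) := by
  have hz := continuousOn_ev hW hφ
  refine (forall_hasDerivWithinAt_iff hz _ _).2 fun t ht => ?_
  set Z := ∫ s in (0 : ℝ)..t, ev (W s) (φ s)
  have key := sum_fboxD_eq_zero hdet (ι := Option (Fin 2))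
    ((ev (W t) (φ t) - ev (W 0) (φ 0)).comp (h.frontMom.prod (ContinuousLinearMap.id ℝ _))
      - Z.comp (h.frontFlx.prod 0))
    (fun i => i.elim (-Z.comp ((0 : L2Front →L[ℝ] HS).prod (ContinuousLinearMap.id ℝ _)))
      fun j => -Z.comp ((h.frontFlxD j).prod 0))
    (fun i => i.elim h.vel fun j => Pi.single j 1) (fun g hg => ?_) δ x
  · rw [Fintype.sum_option] at key
    have e : ((h.frontFlx (fbox a b δ x) + ∑ j, h.frontFlxD j (fboxD a b δ (Pi.single j 1) x),
        fboxD a b δ h.vel x) : HS × L2Front) = (h.frontFlx (fbox a b δ x), 0)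
          + ((0, fboxD a b δ h.vel x)
            + ∑ j, (h.frontFlxD j (fboxD a b δ (Pi.single j 1) x), (0 : L2Front))) := by
      refine Prod.ext ?_ ?_
      · simp
      · simp
    rw [e, map_add, map_add, map_sum]
    simp only [Option.elim, _root_.sub_apply, _root_.neg_apply,
      ContinuousLinearMap.comp_apply, ContinuousLinearMap.prod_apply,
      ContinuousLinearMap.id_apply, _root_.zero_apply, Finset.sum_neg_distrib] at key
    linarith
  · have h1 := (forall_hasDerivWithinAt_iff hz _ _).1 (hr _ (h.redTest_frontTest hg)) t ht
    have e : h.flx (frontTest g) = (h.frontFlx (toL g), 0)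
          + ((0, toL (dir h.vel g))
            + ∑ j, (h.frontFlxD j (toL (dir (Pi.single j 1) g)), (0 : L2Front))) := by
      rw [h.flx_frontTest hg]
      refine Prod.ext ?_ ?_
      · simp
      · simp
    rw [e, map_add, map_add, map_sum, h.mom_frontTest hg] at h1
    rw [Fintype.sum_option]
    simp only [Option.elim, _root_.sub_apply, _root_.neg_apply,
      ContinuousLinearMap.comp_apply, ContinuousLinearMap.prod_apply,
      ContinuousLinearMap.id_apply, _root_.zero_apply, Finset.sum_neg_distrib]
    linarith

/-- The combination `frontPot` absorbs the momentum of W. After tangential averaging the remaining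
source is a bounded operator applied to W, and φ occurs only in the transport term. -/
theorem RedSol.transportEq (hdet : det2 a b ≠ 0) (hW : ContinuousOn W (Set.Icc 0 T))
    (hφ : ContinuousOn φ (Set.Icc 0 T)) (hr : h.RedSol (Set.Icc 0 T) W φ) (δ : ℝ) :
    TransportEq h.vel T (fun t => fbox a b δ (h.frontPot (W t) (φ t)))
      (fun t => h.frontSource a b δ (W t)) := by
  intro g hg t ht
  have h1 := hr.evol_fbox h hdet hW hφ δ (toL g) t ht
  have e1 : ∀ s, inner ℝ (fbox a b δ (h.frontPot (W s) (φ s))) (toL g)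
      = ev (W s) (φ s) (h.frontMom (fbox a b δ (toL g)), fbox a b δ (toL g)) := fun s => by
    rw [inner_fbox, inner_frontPot, ev_apply]
  simp only [e1]
  refine h1.congr_deriv ?_
  rw [ev_apply, inner_fbox, inner_frontPot, fbox_dir hdet δ h.vel hg, frontSource,
    ContinuousLinearMap.adjoint_inner_left, frontDual_apply, inner_sub_right]
  ring

/-- The converse for averaged interior fields, used to construct φ: averaging W puts on the test
side precisely the averaged derivatives of which the source consists. -/
theorem evol_frontTest (hdet : det2 a b ≠ 0) (δ : ℝ)
    (ht : TransportEq h.vel T (fun t => h.frontPot (hbox a b δ (W t)) (φ t))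
      (fun t => h.frontSource a b δ (W t))) (hg : Nice g) :
    Evol (Set.Icc 0 T) (fun t => hbox a b δ (W t)) φ (h.mom (frontTest g))
      (h.flx (frontTest g)) := by
  intro t htT
  have h1 := ht g hg t htT
  simp only [inner_frontPot] at h1
  rw [h.mom_frontTest hg, h.flx_frontTest hg]
  refine h1.congr_deriv ?_
  have b1 : ∀ x, hbox a b δ (h.frontMom x) = h.frontMom (fbox a b δ x) := hbox_mul_lift _ _ _ _
  have b2 : ∀ x, hbox a b δ (h.frontFlx x) = h.frontFlx (fbox a b δ x) := hbox_mul_lift _ _ _ _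
  have b3 : ∀ j x, hbox a b δ (h.frontFlxD j x) = h.frontFlxD j (fbox a b δ x) := fun j =>
    hbox_mul_lift _ _ _ _
  rw [frontSource, ContinuousLinearMap.adjoint_inner_left, frontDual_apply, ev_apply, inner_hbox,
    inner_hbox, b1, fbox_dir hdet δ h.vel hg, map_add, map_sum, b2]
  simp only [b3, fbox_dir hdet δ _ hg]
  rw [inner_sub_right]
  ring

end Symmetrizable
end
end RMHD

/-! ### Limits of weak solutions; bound and existence for the front. -/

/-- Weak evolution equations are stable under uniform convergence. -/
theorem hasDerivWithinAt_of_tendstoUniformlyOn {X : Type*} [NormedAddCommGroup X]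
    [NormedSpace ℝ X] {T : ℝ} {z : ℕ → ℝ → X →L[ℝ] ℝ} {Z : ℝ → X →L[ℝ] ℝ}
    (hz : ∀ n, ContinuousOn (z n) (Set.Icc 0 T)) (hZ : ContinuousOn Z (Set.Icc 0 T))
    (hlim : ∀ v, TendstoUniformlyOn (fun n s => z n s v) (fun s => Z s v) atTop (Set.Icc 0 T))
    {p q : X} (h : ∀ n, ∀ t ∈ Set.Icc 0 T,
      HasDerivWithinAt (fun s => z n s p) (z n t q) (Set.Icc 0 T) t) :
    ∀ t ∈ Set.Icc 0 T, HasDerivWithinAt (fun s => Z s p) (Z t q) (Set.Icc 0 T) t := by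
  refine (forall_hasDerivWithinAt_iff hZ p q).2 fun t ht => ?_
  have h0 : (0 : ℝ) ∈ Set.Icc 0 T := ⟨le_rfl, ht.1.trans ht.2⟩
  have hsub : Set.uIcc 0 t ⊆ Set.Icc 0 T := by
    rw [Set.uIcc_of_le ht.1]; exact Set.Icc_subset_Icc_right ht.2
  have l1 := ((hlim p).tendsto_at ht).sub ((hlim p).tendsto_at h0)
  have l2 := TendstoUniformlyOn.tendsto_intervalIntegral_of_continuousOn (μ := volume)
    (.of_forall fun n => ((hz n).clm_apply continuousOn_const).mono hsub) ((hlim q).mono hsub)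
  rw [ContinuousLinearMap.intervalIntegral_apply (hZ.mono hsub).intervalIntegrable]
  refine tendsto_nhds_unique l1 (l2.congr fun n => ?_)
  rw [(forall_hasDerivWithinAt_iff (hz n) p q).1 (h n) t ht,
    ContinuousLinearMap.intervalIntegral_apply ((hz n).mono hsub).intervalIntegrable]

theorem exists_tendstoUniformlyOn {X Y : Type*} [PseudoMetricSpace X] [CompleteSpace X]
    [PseudoMetricSpace Y] {f : ℕ → ℝ → X} {I : Set ℝ} (hf : ∀ n, ContinuousOn (f n) I) {y : ℕ → Y}
    (hy : CauchySeq y) {K : ℝ}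
    (h : ∀ n m, ∀ t ∈ I, dist (f n t) (f m t) ≤ K * dist (y n) (y m)) :
    ∃ F, ContinuousOn F I ∧ TendstoUniformlyOn f F atTop I := by
  have hu : UniformCauchySeqOn f atTop I := by
    refine Metric.uniformCauchySeqOn_iff.2 fun ε hε => ?_
    obtain ⟨N, hN⟩ := Metric.cauchySeq_iff.1 hy (ε / (|K| + 1)) (by positivity)
    refine ⟨N, fun m hm n hn t ht => (h m n t ht).trans_lt ?_⟩
    have h1 := hN m hm n hn
    rw [lt_div_iff₀ (by positivity)] at h1
    have h2 : K * dist (y m) (y n) ≤ |K| * dist (y m) (y n) := by gcongr; exact le_abs_self K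
    have h3 : 0 ≤ dist (y m) (y n) := dist_nonneg
    nlinarith
  have hex : ∀ t, ∃ x, t ∈ I → Tendsto (fun n => f n t) atTop (𝓝 x) := fun t => by
    by_cases ht : t ∈ I
    · obtain ⟨x, hx⟩ := cauchySeq_tendsto_of_complete (hu.cauchySeq ht)
      exact ⟨x, fun _ => hx⟩
    · exact ⟨f 0 t, fun h => absurd h ht⟩
  choose F hF using hex
  have hlim := hu.tendstoUniformlyOn_of_tendsto fun t ht => hF t ht
  exact ⟨F, hlim.continuousOn (Frequently.of_forall hf), hlim⟩

namespace RMHD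
noncomputable section
open IsometryFlow

variable {e : ℝ → ℝ → ℝ} {U : Bool → State} {lam : Bool → ℝ} (h : Symmetrizable e U lam)
  {a b : Fin 2 → ℝ} {T : ℝ} {W W' : ℝ → HS} {φ φ' : ℝ → L2Front}

theorem ev_sub (W W' : HS) (φ φ' : L2Front) (p : HS × L2Front) :
    ev (W - W') (φ - φ') p = ev W φ p - ev W' φ' p := by
  simp only [ev_apply, inner_sub_left]; ring

theorem Con.sub {W W' : HS} {φ φ' : L2Front} (hc : Con U W φ) (hc' : Con U W' φ') :
    Con U (W - W') (φ - φ') := fun σ χ hχ => by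
  rw [ev_sub, hc σ χ hχ, hc' σ χ hχ, sub_zero]

theorem Con.box {W : HS} {φ : L2Front} (hc : Con U W φ) (δ : ℝ) :
    Con U (hbox a b δ W) (fbox a b δ φ) := fun σ χ hχ => by
  rw [ev_apply, inner_hbox, inner_fbox, sub_eq_zero]
  refine inner_box_congr _ _ _ _ (fun r t => ?_) δ
  rw [transFlow_conVec_fst σ hχ, transFlow_conVec_fst σ (hχ.translate _), transFlow_conVec_snd σ hχ,
    transFlow_conVec_snd σ (hχ.translate _), ← sub_eq_zero]
  exact hc σ _ ((hχ.translate _).translate _)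

section Core

variable {S : SymSys} {Θ : Bool → Space → Idx → ℝ}

theorem CoreTest.translate (hΘ : CoreTest S Θ) (c : Fin 2 → ℝ) (s : ℝ) :
    CoreTest S fun σ x => Θ σ (x + s • bd c) where
  nice σ := (hΘ.nice σ).translate _
  q_eq y := by simp only [← bd_linear, hΘ.q_eq]
  w_eq y := by simp only [← bd_linear, hΘ.w_eq]

theorem SymSys.transFlow_mom (S : SymSys) (hΘ : ∀ σ, Nice (Θ σ)) (c : Fin 2 → ℝ) (s : ℝ) :
    (transFlow (bd c)).τ s (mul S.B (glueH Θ))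
      = mul S.B (glueH fun σ x => Θ σ (x + s • bd c)) := by
  rw [← mul_transFlow _ (Or.inl (bd_zero_apply c)), transFlow_glueH hΘ (bd_zero_apply c)]

theorem SymSys.transFlow_op (S : SymSys) (hΘ : ∀ σ, Nice (Θ σ)) (c : Fin 2 → ℝ) (s : ℝ) :
    (transFlow (bd c)).τ s (S.op Θ) = S.op fun σ x => Θ σ (x + s • bd c) := by
  rw [SymSys.op, map_sum, SymSys.op]
  refine Finset.sum_congr rfl fun j _ => ?_
  rw [← mul_transFlow _ (Or.inl (bd_zero_apply c)),
    transFlow_glueH (fun σ => (hΘ σ).pd j) (bd_zero_apply c)]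
  congr 2; funext σ x
  exact (dir_translate _ _ _).symm

theorem SymSys.CoreSol.box (hW : ContinuousOn W (Set.Icc 0 T)) (hs : S.CoreSol (Set.Icc 0 T) W)
    (δ : ℝ) : S.CoreSol (Set.Icc 0 T) fun t => hbox a b δ (W t) := by
  have hz : ContinuousOn (fun t => innerSL ℝ (W t)) (Set.Icc 0 T) :=
    (innerSL ℝ).continuous.comp_continuousOn hW
  intro Θ hΘ
  simp only [inner_hbox]
  refine (forall_hasDerivWithinAt_iff hz _ _).2 fun t ht => ?_
  have key := sum_box_eq_zero (transFlow (bd a)) (transFlow (bd b)) Finset.univ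
    (fun i : Bool => if i then innerSL ℝ (W t) - innerSL ℝ (W 0)
      else -∫ s in (0 : ℝ)..t, innerSL ℝ (W s))
    (fun i => if i then mul S.B (glueH Θ) else S.op Θ) (fun r s => ?_) δ
  · rw [Fintype.sum_bool] at key
    simp only [if_true, Bool.false_eq_true, if_false, _root_.sub_apply, _root_.neg_apply] at key
    change _ + -(∫ s in (0 : ℝ)..t, innerSL ℝ (W s)) (hbox a b δ (S.op Θ)) = 0 at key
    exact eq_of_sub_eq_zero key
  · rw [Fintype.sum_bool]
    simp only [if_true, Bool.false_eq_true, if_false, _root_.sub_apply, _root_.neg_apply]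
    have hb := hΘ.translate b s
    rw [S.transFlow_mom hΘ.nice, S.transFlow_mom hb.nice, S.transFlow_op hΘ.nice,
      S.transFlow_op hb.nice]
    have := (forall_hasDerivWithinAt_iff hz _ _).1 (hs _ (hb.translate a r)) t ht
    exact sub_eq_zero.2 this

theorem SymSys.CoreSol.sub {I : Set ℝ} (hs : S.CoreSol I W) (hs' : S.CoreSol I W') :
    S.CoreSol I fun t => W t - W' t := fun Θ hΘ t ht => by
  simp only [inner_sub_left]
  exact (hs Θ hΘ t ht).sub (hs' Θ hΘ t ht)

end Core

namespace Symmetrizable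

variable {h}

theorem RedSol.sub {I : Set ℝ} (hr : h.RedSol I W φ) (hr' : h.RedSol I W' φ') :
    h.RedSol I (fun t => W t - W' t) fun t => φ t - φ' t := fun Θ hΘ t ht => by
  simp only [ev_sub]
  exact (hr Θ hΘ t ht).sub (hr' Θ hΘ t ht)

theorem redSol_of_coreSol {I : Set ℝ} (hs : h.sys.CoreSol I W)
    (hf : ∀ g, Nice g → Evol I W φ (h.mom (frontTest g)) (h.flx (frontTest g))) :
    h.RedSol I W φ := by
  intro Θ hΘ t ht
  obtain ⟨g, hg, Φ, hΦ, hm, hx⟩ := hΘ.exists_coreTest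
  rw [hm, hx]
  simp only [map_add]
  have h1 := hs Φ hΦ t ht
  refine HasDerivWithinAt.add (f := fun s => ev (W s) (φ s) (h.mom Φ)) ?_ (hf g hg t ht)
  simpa only [mom_core hΦ, flx_core hΦ, ev_apply, inner_zero_right, sub_zero] using h1

variable (h)

/-- The front of a constrained solution is controlled by the initial data. -/
theorem exists_norm_front_le (hdet : det2 (magT (U true)) (magT (U false)) ≠ 0) :
    ∃ C : ℝ, 1 ≤ C ∧ ∀ (W : ℝ → HS) (φ : ℝ → L2Front) (T : ℝ), ContinuousOn W (Set.Icc 0 T) →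
      ContinuousOn φ (Set.Icc 0 T) → h.RedSol (Set.Icc 0 T) W φ → Con U (W 0) (φ 0) →
      ∀ t ∈ Set.Icc 0 T, ‖φ t‖ ≤ C * (1 + T) * (‖W 0‖ + ‖φ 0‖) := by
  obtain ⟨C₀, hC₀, hW₀⟩ := h.sys.exists_norm_le_of_coreSol
  obtain ⟨C₁, hC₁, hφ₁⟩ := exists_front_norm_le hdet
  set a := magT (U true)
  set b := magT (U false)
  set F := ContinuousLinearMap.adjoint h.frontMom with hF
  set J := h.frontSource a b 1
  refine ⟨1 + C₁ * C₀ + ‖F‖ * C₀ + ‖F‖ + ‖J‖ * C₀, ?_, fun W φ T hW hφ hr hc t ht => ?_⟩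
  · have : 0 ≤ C₁ * C₀ + ‖F‖ * C₀ + ‖F‖ + ‖J‖ * C₀ := by positivity
    linarith
  have hT : 0 ≤ T := ht.1.trans ht.2
  have hWt := hW₀ W T hW hr.coreSol
  have h1 := hφ₁ _ _ (hr.con hW hφ hc ht)
  have hψ : ContinuousOn (fun t => fbox a b 1 (h.frontPot (W t) (φ t))) (Set.Icc 0 T) :=
    (fbox a b 1).continuous.comp_continuousOn ((F.continuous.comp_continuousOn hW).sub hφ)
  have h2 := (hr.transportEq h hdet hW hφ 1).norm_le hψ (N := ‖J‖ * (C₀ * ‖W 0‖))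
    (fun s hs => (J.le_opNorm _).trans (by gcongr; exact hWt s hs)) ht
  have h3 : ‖fbox a b 1 (h.frontPot (W 0) (φ 0))‖ ≤ ‖F‖ * ‖W 0‖ + ‖φ 0‖ :=
    (norm_fbox_le _ _).trans ((norm_sub_le _ _).trans (by gcongr; exact F.le_opNorm _))
  have h4 : ‖fbox a b 1 (φ t)‖ ≤ ‖F‖ * (C₀ * ‖W 0‖)
      + ‖fbox a b 1 (h.frontPot (W t) (φ t))‖ := by
    -- The transport equation is needed only for the average of φ on the unit scale; finer scales
    -- are covered by the constraints.
    have e : φ t = F (W t) - h.frontPot (W t) (φ t) := (sub_sub_cancel _ _).symm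
    conv_lhs => rw [e, map_sub]
    refine (norm_sub_le _ _).trans ?_
    gcongr
    refine (norm_fbox_le _ _).trans ((F.le_opNorm _).trans ?_)
    gcongr
    exact hWt t ht
  have h5 : C₁ * ‖W t‖ ≤ C₁ * (C₀ * ‖W 0‖) := by gcongr; exact hWt t ht
  have h6 : ‖J‖ * (C₀ * ‖W 0‖) * t ≤ ‖J‖ * (C₀ * ‖W 0‖) * T := by gcongr; exact ht.2
  have p1 : 0 ≤ C₁ * C₀ + ‖F‖ * C₀ + ‖F‖ := by positivity
  have p2 : 0 ≤ ‖J‖ * C₀ := by positivity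
  have n1 := norm_nonneg (W 0)
  have n2 := norm_nonneg (φ 0)
  set A := C₁ * C₀ + ‖F‖ * C₀ + ‖F‖ with hA
  set B := ‖J‖ * C₀ with hB
  have h7 : ‖φ t‖ ≤ A * ‖W 0‖ + ‖φ 0‖ + B * T * ‖W 0‖ := by
    rw [hA, hB]; nlinarith
  have h8 : 1 + C₁ * C₀ + ‖F‖ * C₀ + ‖F‖ + B = 1 + A + B := by rw [hA]; ring
  rw [h8]
  have q1 : 0 ≤ A * T * ‖W 0‖ := by positivity
  have q2 : 0 ≤ (A + B) * ‖φ 0‖ := by positivity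
  have q3 : 0 ≤ (A + B) * T * ‖φ 0‖ := by positivity
  have q4 : 0 ≤ T * (‖W 0‖ + ‖φ 0‖) := by positivity
  have q5 : 0 ≤ B * ‖W 0‖ := by positivity
  nlinarith

/-- The interior problem provides W. The equation for φ contains tangential derivatives of W, so it
is first solved for tangential averages of W. The bound of `exists_norm_front_le`, applied to
differences of these solutions, does not depend on the scale of averaging and makes the fronts a
uniform Cauchy sequence. -/
theorem exists_redSol (hdet : det2 (magT (U true)) (magT (U false)) ≠ 0) (T : ℝ) {W₀ : HS}
    {φ₀ : L2Front} (hc : Con U W₀ φ₀) : ∃ (W : ℝ → HS) (φ : ℝ → L2Front),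
      ContinuousOn W (Set.Icc 0 T) ∧ ContinuousOn φ (Set.Icc 0 T) ∧ W 0 = W₀ ∧ φ 0 = φ₀ ∧
      h.RedSol (Set.Icc 0 T) W φ := by
  rcases lt_or_ge T 0 with hT | hT
  · refine ⟨fun _ => W₀, fun _ => φ₀, continuousOn_const, continuousOn_const, rfl, rfl,
      fun Θ _ t ht => absurd (ht.1.trans ht.2) (not_le.2 hT)⟩
  have h0T : (0 : ℝ) ∈ Set.Icc 0 T := ⟨le_rfl, hT⟩
  set a := magT (U true)
  set b := magT (U false)
  obtain ⟨C₀, hC₀, hW₀⟩ := h.sys.exists_norm_le_of_coreSol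
  obtain ⟨C, hC, hφC⟩ := h.exists_norm_front_le hdet
  obtain ⟨W, hWc, hW0, hWs⟩ := h.sys.exists_coreSol W₀
  have hWs' : h.sys.CoreSol (Set.Icc 0 T) W := fun Θ hΘ t _ =>
    (hWs Θ hΘ t (Set.mem_univ t)).mono (Set.subset_univ _)
  let δ : ℕ → ℝ := fun n => (1 / 4) ^ n
  have hδ : ∀ n, 0 < δ n := fun n => by positivity
  have hδ0 : Tendsto δ atTop (𝓝 0) :=
    tendsto_pow_atTop_nhds_zero_of_lt_one (by norm_num) (by norm_num)
  set F := ContinuousLinearMap.adjoint h.frontMom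
  -- The initial value makes `φn n 0` the average of φ₀. The averaged data then satisfy the
  -- constraints again, by `Con.box`.
  choose y hyc hy0 hy using fun n => exists_transportEq h.vel
    (F (hbox a b (δ n) W₀) - fbox a b (δ n) φ₀) (f := fun t => h.frontSource a b (δ n) (W t))
    ((h.frontSource a b (δ n)).continuous.comp hWc)
  let Wn : ℕ → ℝ → HS := fun n t => hbox a b (δ n) (W t)
  let φn : ℕ → ℝ → L2Front := fun n t => F (Wn n t) - y n t
  have hWn : ∀ n, ContinuousOn (Wn n) (Set.Icc 0 T) := fun n =>
    ((hbox a b (δ n)).continuous.comp hWc).continuousOn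
  have hφn : ∀ n, ContinuousOn (φn n) (Set.Icc 0 T) := fun n =>
    (F.continuous.comp_continuousOn (hWn n)).sub (hyc n).continuousOn
  have hφn0 : ∀ n, φn n 0 = fbox a b (δ n) φ₀ := fun n => by
    simp only [φn, Wn, hy0, hW0, sub_sub_cancel]
  have hWn0 : ∀ n, Wn n 0 = hbox a b (δ n) W₀ := fun n => by simp only [Wn, hW0]
  have hrn : ∀ n, h.RedSol (Set.Icc 0 T) (Wn n) (φn n) := fun n => by
    refine redSol_of_coreSol (hWs'.box hWc.continuousOn (δ n)) fun g hg =>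
      h.evol_frontTest hdet (δ n) ?_ hg
    have : (fun t => h.frontPot (hbox a b (δ n) (W t)) (φn n t)) = y n := by
      funext t; exact sub_sub_cancel _ _
    rw [this]
    exact hy n T
  have hcn : ∀ n, Con U (Wn n 0) (φn n 0) := fun n => by
    rw [hWn0, hφn0]; exact hc.box (δ n)
  have hlim : Tendsto (fun n => (hbox a b (δ n) W₀, fbox a b (δ n) φ₀)) atTop (𝓝 (W₀, φ₀)) :=
    (box_tendsto _ _ hδ hδ0 W₀).prodMk_nhds (box_tendsto _ _ hδ hδ0 φ₀)
  have hdist : ∀ n m, ∀ t ∈ Set.Icc 0 T, dist (φn n t) (φn m t) ≤ C * (1 + T) * 2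
      * dist (hbox a b (δ n) W₀, fbox a b (δ n) φ₀) (hbox a b (δ m) W₀, fbox a b (δ m) φ₀) := by
    intro n m t ht
    have h1 := hφC _ _ T ((hWn n).sub (hWn m)) ((hφn n).sub (hφn m)) ((hrn n).sub (hrn m))
      ((hcn n).sub (hcn m)) t ht
    rw [dist_eq_norm, mul_assoc]
    refine h1.trans ?_
    simp only [Pi.sub_apply, hWn0, hφn0]
    rw [← dist_eq_norm, ← dist_eq_norm, Prod.dist_eq]
    gcongr
    have := le_max_left (dist (hbox a b (δ n) W₀) (hbox a b (δ m) W₀))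
      (dist (fbox a b (δ n) φ₀) (fbox a b (δ m) φ₀))
    have := le_max_right (dist (hbox a b (δ n) W₀) (hbox a b (δ m) W₀))
      (dist (fbox a b (δ n) φ₀) (fbox a b (δ m) φ₀))
    dsimp only
    linarith
  obtain ⟨φ, hφ, hφu⟩ := exists_tendstoUniformlyOn hφn hlim.cauchySeq hdist
  have hWu : TendstoUniformlyOn Wn W atTop (Set.Icc 0 T) := by
    have hl : Tendsto (fun n => hbox a b (δ n) W₀) atTop (𝓝 W₀) := box_tendsto _ _ hδ hδ0 W₀
    have hl' : Tendsto (fun n => C₀ * ‖W₀ - hbox a b (δ n) W₀‖) atTop (𝓝 0) := by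
      have := ((tendsto_const_nhds (x := W₀)).sub hl).norm.const_mul C₀
      simpa using this
    refine Metric.tendstoUniformlyOn_iff.2 fun ε hε => ?_
    filter_upwards [hl'.eventually_lt_const hε] with n hn t ht
    rw [dist_eq_norm]
    refine (hW₀ _ T (hWc.continuousOn.sub (hWn n)) (hWs'.sub (hWs'.box hWc.continuousOn (δ n))) t
      ht).trans_lt ?_
    simpa only [Pi.sub_apply, hWn0, hW0] using hn
  refine ⟨W, φ, hWc.continuousOn, hφ, hW0, ?_, fun Θ hΘ => ?_⟩
  · refine tendsto_nhds_unique (hφu.tendsto_at h0T) ?_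
    simp only [hφn0]
    exact box_tendsto _ _ hδ hδ0 φ₀
  · refine hasDerivWithinAt_of_tendstoUniformlyOn (fun n => continuousOn_ev (hWn n) (hφn n))
      (continuousOn_ev hWc.continuousOn hφ) (fun v => ?_) fun n => hrn n Θ hΘ
    have hu : TendstoUniformlyOn (fun n s => (Wn n s, φn n s)) (fun s => (W s, φ s)) atTop
        (Set.Icc 0 T) := fun u hu => tendsto_diag.eventually (hWu.prodMk hφu u hu)
    have hv : UniformContinuous fun x : HS × L2Front => innerDiff v.1 v.2 x :=
      (innerDiff v.1 v.2).uniformContinuous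
    have e : ∀ (x : HS) (y : L2Front), ev x y v = innerDiff v.1 v.2 (x, y) := fun x y => by
      rw [ev_apply, real_inner_comm, real_inner_comm v.2]; rfl
    simp only [e]
    exact hv.comp_tendstoUniformlyOn hu

end Symmetrizable
end
end RMHD

/-! ### Well-posedness and conclusion. -/

namespace RMHD
noncomputable section

variable {e : ℝ → ℝ → ℝ} {U : Bool → State} {lam : Bool → ℝ}

theorem norm_join_le (f : L2 Rpos) (g : L2 Rneg) : ‖join f g‖ ≤ ‖f‖ + ‖g‖ := by
  have := norm_join f g
  have h1 := norm_nonneg f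
  have h2 := norm_nonneg g
  refine le_of_sq_le_sq ?_ (by positivity)
  nlinarith

/-- For constrained data the original and the symmetrized problem coincide, so existence, uniqueness
and bounds are those of the latter. The bound for (U⁺, U⁻) is uniform in time because it comes from
a conserved energy; that for the front grows linearly in T. -/
theorem Symmetrizable.wellPosed (h : Symmetrizable e U lam)
    (hdet : det2 (magT (U true)) (magT (U false)) ≠ 0) : WellPosed e (U true) (U false) := by
  obtain ⟨C₀, hC₀, hW₀⟩ := h.sys.exists_norm_le_of_coreSol
  obtain ⟨C, hC, hφC⟩ := h.exists_norm_front_le hdet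
  refine ⟨C₀ ^ 2, by positivity, fun T hT => ⟨C * (1 + T), by positivity,
    fun U0p U0m φ0 hadm => ?_⟩⟩
  have h0T : (0 : ℝ) ∈ Set.Icc 0 T := ⟨le_rfl, hT.le⟩
  have hc := admissible_iff.1 hadm
  have hred : ∀ Up Um φ, IsSolution e (U true) (U false) T U0p U0m φ0 Up Um φ →
      ContinuousOn (fun t => join (Up t) (Um t)) (Set.Icc 0 T) ∧ ContinuousOn φ (Set.Icc 0 T) ∧
      join (Up 0) (Um 0) = join U0p U0m ∧ φ 0 = φ0 ∧
      h.RedSol (Set.Icc 0 T) (fun t => join (Up t) (Um t)) φ := by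
    intro Up Um φ hs
    obtain ⟨h1, h2, h3, h4, h5, h6, h7⟩ := isSolution_iff.1 hs
    have hj := continuousOn_join h1 h2
    refine ⟨hj, h3, by rw [h4, h5], h6, (origSol_iff fun t ht => ?_).1 h7⟩
    exact h7.con h hj h3 (by simp only [h4, h5, h6]; exact hc) ht
  obtain ⟨W, φ, hW, hφ, hW0, hφ0, hr⟩ := h.exists_redSol hdet T hc
  have hcon : Con U (W 0) (φ 0) := by rw [hW0, hφ0]; exact hc
  have hjoin : (fun t => join (rest Rpos (W t)) (rest Rneg (W t))) = W := by
    funext t; exact join_rest _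
  have hbd := hW₀ W T hW hr.coreSol
  refine ⟨fun t => rest Rpos (W t), fun t => rest Rneg (W t), φ, isSolution_iff.2
    ⟨(rest Rpos).continuous.comp_continuousOn hW, (rest Rneg).continuous.comp_continuousOn hW, hφ,
      ?_, ?_, hφ0, ?_⟩, fun Up' Um' φ' hs' t ht => ?_, fun t ht => ⟨?_, ?_⟩⟩
  · exact (join_eq_iff.1 ((join_rest (W 0)).trans hW0)).1
  · exact (join_eq_iff.1 ((join_rest (W 0)).trans hW0)).2
  · rw [hjoin]
    exact (origSol_iff fun t ht => hr.con hW hφ hcon ht).2 hr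
  · obtain ⟨h1, h2, h3, h4, h5⟩ := hred _ _ _ hs'
    have hrd := h5.sub hr
    have hz : join (Up' 0) (Um' 0) - W 0 = 0 := by rw [h3, hW0, sub_self]
    have hzφ : φ' 0 - φ 0 = 0 := by rw [h4, hφ0, sub_self]
    have e1 := hW₀ _ T (h1.sub hW) hrd.coreSol t ht
    have e2 := hφC _ _ T (h1.sub hW) (h2.sub hφ) hrd (by
      simp only [Pi.sub_apply]
      rw [h3, h4]
      exact hc.sub hcon) t ht
    simp only [Pi.sub_apply, hz, hzφ, norm_zero, mul_zero, add_zero] at e1 e2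
    have e3 := sub_eq_zero.1 (norm_le_zero_iff.1 e1)
    rw [← join_rest (W t)] at e3
    exact ⟨(join_eq_iff.1 e3).1, (join_eq_iff.1 e3).2, sub_eq_zero.1 (norm_le_zero_iff.1 e2)⟩
  · rw [← norm_join, ← norm_join, join_rest, ← mul_pow, ← hW0]
    gcongr
    exact hbd t ht
  · refine (hφC W φ T hW hφ hr hcon t ht).trans ?_
    rw [hW0, hφ0]
    have := norm_join_le U0p U0m
    exact mul_le_mul_of_nonneg_left (by linarith) (by positivity)

end
end RMHD

theorem theorem3 (e : ℝ → ℝ → ℝ) (Up Um : RMHD.State)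
    (hp : RMHD.Hyperbolic e Up) (hm : RMHD.Hyperbolic e Um)
    (hsheet : RMHD.IsCurrentVortexSheet e Up Um)
    (hH : Up.H 1 * Um.H 2 - Up.H 2 * Um.H 1 ≠ 0)
    (hG : 0 < RMHD.G e Up Um) :
    RMHD.LinearlyStable e Up Um := by
  obtain ⟨lp, lm, hlp, hlm, h1, h2⟩ := RMHD.exists_lam hp hm hH hG
  have hBp := RMHD.B0_pos hp hsheet.u_p hsheet.H_p hlp
  have hBm := RMHD.B0_pos hm hsheet.u_m hsheet.H_m hlm
  refine ⟨?_, RMHD.noUnstableModes hsheet hBp hBm h1 h2⟩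
  let U : Bool → RMHD.State := fun σ => if σ then Up else Um
  let lam : Bool → ℝ := fun σ => if σ then lp else lm
  have h : RMHD.Symmetrizable e U lam :=
    { u_zero := fun σ => by cases σ; exacts [hsheet.u_m, hsheet.u_p]
      H_zero := fun σ => by cases σ; exacts [hsheet.H_m, hsheet.H_p]
      pos := fun σ => by cases σ; exacts [hBm, hBp]
      vel_one := h1
      vel_two := h2 }
  -- Nonparallel fields are used a second time: their determinant lets the constraints control the
  -- whole gradient of φ.
  exact h.wellPosed hH
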